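/- Let $T>0$, let $\mathbb{T}^3=\mathbb{R}^3/\mathbb{Z}^3$, and let $(u,\omega)$ be a functional vorticity solution of the 3D Euler equations on $\mathbb{T}^3\times(0,T)$: $u\in L^\infty((0,T);H^{1/2+}(\mathbb{T}^3))$, $\omega=\nabla\times u$ and $\nabla\cdot u=\nabla\cdot\omega=0$ in the sense of distributions, and for all $\psi\in\mathcal{D}(\mathbb{T}^3\times(0,T);\mathbb{R}^3)$ $$\int_0^T\langle\omega,\partial_t\psi\rangle\,dt+\int_0^T\langle u\otimes\omega-\omega\otimes u,\nabla\psi\rangle\,dt=0 ,$$ where, for a.e. $t$, the brackets are duality brackets in $x$ and the products act by $\langle u_i\omega_j,\chi\rangle=\langle\omega_j,u_i\chi\rangle_{H^{-1/2}\times H^{1/2}}$. Here $X^{s+}$ means $X^{s+\theta}$ for some $\theta>0$. Assume that the spatial mean $\int_{\mathbb{T}^3}u\,dx$ does not depend on time (for instance, that $u$ is mean-free), and that $u\in L^3((0,T);W^{1/2+,3}(\mathbb{T}^3))$. Then there is a pressure $p$, that is, an integrable function with $\nabla p=-\partial_tu-\nabla\cdot(u\otimes u)$ in $\mathcal{D}'(\mathbb{T}^3\times(0,T))$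 and $\int_{\mathbb{T}^3}p\,dx=0$ for a.e. $t$. The products $u\cdot\omega$, $p\,\omega$ and $2(u\cdot\omega)u-|u|^2\omega$, given at a.e. time by the $W^{-1/2,3}\times W^{1/2,3/2}$ duality bracket ($\langle g\,\omega_j,\chi\rangle=\langle\omega_j,g\chi\rangle$), are well-defined distributions on $\mathbb{T}^3\times(0,T)$ for every such $p$. Write $\delta u(\xi;x,t)=u(x+\xi,t)-u(x,t)$, define $\delta\omega$ by $\langle\delta\omega(\xi;\cdot,t),\Psi\rangle=\langle\omega(\cdot,t),\Psi(\cdot-\xi)-\Psi\rangle$, and set $\phi_\epsilon(x)=\epsilon^{-3}\phi(x/\epsilon)$ for a radial $\phi\in C_c^\infty(\mathbb{R}^3)$ with $\int\phi\,dx=1$. Then the distributional limit $$D_1(u,\omega)-\tfrac12D_2(u,\omega):=\lim_{\epsilon\to0}\Big[\int_{\mathbb{R}^3}\nabla\phi_\epsilon(\xi)\cdot\delta u(\xi;x,t)\,\big(\delta\omega(\xi;x,t)\cdot\delta u(\xi;x,t)\big)\,d\xi-\tfrac12\int_{\mathbb{R}^3}\nabla\phi_\epsilon(\xi)\cdot\delta\omega(\xi;x,t)\,|\delta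 u(\xi;x,t)|^2\,d\xi\Big]$$ exists in $\mathcal{D}'(\mathbb{T}^3\times(0,T))$ and does not depend on the choice of $\phi$; for each $\epsilon>0$ the bracket of the integrals with a test function is the integral over $\xi$ and then $t$ of the spatial duality brackets. For every such pressure $p$ the local helicity balance holds: $$2\partial_t(u\cdot\omega)+2\nabla\cdot(p\,\omega)+\nabla\cdot\big[2(u\cdot\omega)u-|u|^2\omega\big]+\Big[D_1(u,\omega)-\tfrac12D_2(u,\omega)\Big]=0\quad\text{in }\mathcal{D}'(\mathbb{T}^3\times(0,T)).$$ -/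

import Mathlib

open Real Set Filter Topology MeasureTheory
open scoped NNReal ENNReal InnerProductSpace

noncomputable section

namespace HelicityBalance

/-- Three-dimensional Euclidean space. Functions on the torus `𝕋³ = ℝ³ / ℤ³` are
represented by `ℤ³`-periodic functions on it. -/
abbrev E3 : Type := EuclideanSpace ℝ (Fin 3)

/-- The `i`-th standard basis vector. -/
def e (i : Fin 3) : E3 := EuclideanSpace.single i 1

/-- `ℤ³`-periodicity. -/
def IsPeriodic {F : Type*} (f : E3 → F) : Prop :=
  ∀ (x : E3) (i : Fin 3), f (x + e i) = f x

/-- The fundamental cell `[0,1)³`. -/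
def cell : Set E3 := {x | ∀ i, x i ∈ Ico (0 : ℝ) 1}

/-- The centred cell `[-1/2,1/2]³`. For `h` in it, `‖h‖` is the distance on `𝕋³` between
`x` and `x + h`. -/
def centredCell : Set E3 := {h | ∀ i, |h i| ≤ 1 / 2}

/-! ### Test functions -/

section TestFunctions

variable (F : Type*) [NormedAddCommGroup F] [NormedSpace ℝ F]

/-- Smooth `F`-valued functions on `𝕋³`. -/
def PeriodicTest : Submodule ℝ (E3 → F) where
  carrier := {f | ContDiff ℝ (⊤ : ℕ∞) f ∧ IsPeriodic f}
  add_mem' := by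
    rintro f g ⟨hf, hf'⟩ ⟨hg, hg'⟩
    exact ⟨hf.add hg, fun x i => by simp [hf' x i, hg' x i]⟩
  zero_mem' := ⟨contDiff_const, fun _ _ => rfl⟩
  smul_mem' := by
    rintro c f ⟨hf, hf'⟩
    exact ⟨contDiff_const.smul hf, fun x i => by simp [hf' x i]⟩

/-- The space `𝓓(𝕋³ × (0,T); F)`: smooth functions of `(t,x)`, periodic in `x`, whose support
in time lies in a compact subinterval of `(0,T)`. -/
def SpaceTimeTest (T : ℝ) : Submodule ℝ (ℝ × E3 → F) where
  carrier := {f | ContDiff ℝ (⊤ : ℕ∞) f ∧ (∀ t, IsPeriodic fun x => f (t, x)) ∧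
    ∃ a b : ℝ, 0 < a ∧ b < T ∧ ∀ t, t ∉ Icc a b → ∀ x, f (t, x) = 0}
  add_mem' := by
    rintro f g ⟨hf, hf', a, b, ha, hb, h⟩ ⟨hg, hg', a', b', ha', hb', h'⟩
    refine ⟨hf.add hg, fun t x i => ?_, min a a', max b b', lt_min ha ha', max_lt hb hb',
      fun t ht x => ?_⟩
    · have h1 := hf' t x i
      have h2 := hg' t x i
      simp only [Pi.add_apply] at h1 h2 ⊢
      rw [h1, h2]
    · have h1 : t ∉ Icc a b := fun hh =>
        ht ⟨(min_le_left _ _).trans hh.1, hh.2.trans (le_max_left _ _)⟩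
      have h2 : t ∉ Icc a' b' := fun hh =>
        ht ⟨(min_le_right _ _).trans hh.1, hh.2.trans (le_max_right _ _)⟩
      simp [h t h1 x, h' t h2 x]
  zero_mem' := by
    refine ⟨contDiff_const, fun _ _ _ => rfl, ?_⟩
    rcases le_or_gt T 0 with hT | hT
    · exact ⟨1, T - 1, one_pos, by linarith, fun _ _ _ => rfl⟩
    · exact ⟨T, 0, hT, hT, fun _ _ _ => rfl⟩
  smul_mem' := by
    rintro c f ⟨hf, hf', a, b, ha, hb, h⟩
    refine ⟨contDiff_const.smul hf, fun t x i => ?_, a, b, ha, hb, fun t ht x => ?_⟩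
    · have h1 := hf' t x i
      simp only [Pi.smul_apply] at h1 ⊢
      rw [h1]
    · simp [h t ht x]

variable {F}

/-- A directional space-time derivative of a test function is a test function. -/
theorem fderiv_apply_mem {T : ℝ} {f : ℝ × E3 → F} (hf : f ∈ SpaceTimeTest F T) (v : ℝ × E3) :
    (fun z => fderiv ℝ f z v) ∈ SpaceTimeTest F T := by
  obtain ⟨hf, hp, a, b, ha, hb, h⟩ := hf
  refine ⟨(hf.fderiv_right (m := (⊤ : ℕ∞)) (by simp)).clm_apply contDiff_const, fun t x i => ?_,
    a, b, ha, hb, fun t ht x => ?_⟩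
  · have hshift : (fun z : ℝ × E3 => f (z + (0, e i))) = f := by
      funext z
      obtain ⟨s, y⟩ := z
      simpa using hp s y i
    have h1 := fderiv_comp_add_right (𝕜 := ℝ) (f := f) (x := (t, x)) ((0 : ℝ), e i)
    rw [hshift] at h1
    have h2 : (t, x + e i) = (t, x) + ((0 : ℝ), e i) := by simp
    change fderiv ℝ f (t, x + e i) v = fderiv ℝ f (t, x) v
    rw [h2, ← h1]
  · have hopen : IsOpen ((Prod.fst : ℝ × E3 → ℝ) ⁻¹' (Icc a b)ᶜ) :=
      isClosed_Icc.isOpen_compl.preimage continuous_fst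
    have hev : f =ᶠ[𝓝 (t, x)] fun _ => (0 : F) := by
      filter_upwards [hopen.mem_nhds (show (t, x) ∈ _ from ht)] with z hz
      exact h z.1 hz z.2
    change fderiv ℝ f (t, x) v = 0
    rw [hev.fderiv_eq]
    simp

/-- The time derivative `∂ₜφ`. -/
def dt {T : ℝ} (φ : SpaceTimeTest F T) : SpaceTimeTest F T :=
  ⟨fun z => fderiv ℝ φ.1 z (1, 0), fderiv_apply_mem φ.2 _⟩

/-- The spatial gradient `∇φ` of a scalar test function. -/
def grad {T : ℝ} (φ : SpaceTimeTest ℝ T) : SpaceTimeTest E3 T :=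
  ⟨fun z => ∑ i : Fin 3, fderiv ℝ φ.1 z (0, e i) • e i, by
    have : (fun z => ∑ i : Fin 3, fderiv ℝ φ.1 z (0, e i) • e i) =
        ∑ i : Fin 3, fun z => fderiv ℝ φ.1 z (0, e i) • e i := by
      funext z; simp
    rw [this]
    refine Submodule.sum_mem _ fun i _ => ?_
    obtain ⟨h1, h2, a, b, ha, hb, h3⟩ := fderiv_apply_mem φ.2 ((0 : ℝ), e i)
    refine ⟨h1.smul contDiff_const, fun t x j => ?_, a, b, ha, hb, fun t ht x => ?_⟩
    · have := h2 t x j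
      simp only at this ⊢
      rw [this]
    · have := h3 t ht x
      simp only at this ⊢
      rw [this, zero_smul]⟩

end TestFunctions

/-- The curl of a vector field on `ℝ³`. -/
def curl (ψ : E3 → E3) (x : E3) : E3 :=
  !₂[fderiv ℝ ψ x (e 1) 2 - fderiv ℝ ψ x (e 2) 1,
     fderiv ℝ ψ x (e 2) 0 - fderiv ℝ ψ x (e 0) 2,
     fderiv ℝ ψ x (e 0) 1 - fderiv ℝ ψ x (e 1) 0]

/-- The spatial increment `δf(ξ; x) = f(x + ξ) - f(x)`. -/
def increment {F : Type*} [Sub F] (ξ : E3) (f : E3 → F) (x : E3) : F := f (x + ξ) - f x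

/-! ### Fractional Sobolev spaces on the torus, their duals, and duality brackets -/

section Sobolev

variable {F : Type*} [NormedAddCommGroup F]

/-- The Sobolev–Slobodeckij norm of `W^{s,q}(𝕋³)`, for `0 < s < 1` and `1 ≤ q < ∞`; for `q = 2`
it is the norm of `H^s(𝕋³)`. -/
def sobolevNorm (s q : ℝ) (f : E3 → F) : ℝ≥0∞ :=
  ((∫⁻ x in cell, ‖f x‖ₑ ^ q) +
    ∫⁻ x in cell, ∫⁻ h in centredCell, ‖increment h f x‖ₑ ^ q / ‖h‖ₑ ^ (3 + s * q)) ^ (1 / q)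

/-- Membership in `W^{s,q}(𝕋³)`. -/
def MemSobolev (s q : ℝ) (f : E3 → F) : Prop :=
  IsPeriodic f ∧ AEStronglyMeasurable f volume ∧ sobolevNorm s q f < ⊤

/-- Membership in the Bochner space `L^r((0,T); W^{s,q}(𝕋³))`. -/
def MemBochnerSobolev (T : ℝ) (r : ℝ≥0∞) (s q : ℝ) (f : ℝ → E3 → F) : Prop :=
  (∀ t ∈ Ioo 0 T, IsPeriodic (f t)) ∧
  AEStronglyMeasurable (Function.uncurry f) ((volume.restrict (Ioo 0 T)).prod volume) ∧
  eLpNorm (fun t => sobolevNorm s q (f t)) r (volume.restrict (Ioo 0 T)) < ⊤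

/-- Membership of a functional on smooth vector fields in the dual of `W^{s,q}(𝕋³; ℝ³)`,
that is, in `W^{-s,q'}(𝕋³; ℝ³)` with `1/q + 1/q' = 1`. -/
def MemDual (s q : ℝ) (f : PeriodicTest E3 → ℝ) : Prop :=
  IsLinearMap ℝ f ∧ ∃ C : ℝ≥0, ∀ ψ, ‖f ψ‖ₑ ≤ C * sobolevNorm s q ψ.1

/-- The duality bracket `⟨f, g⟩` between `W^{-s,q'}(𝕋³; ℝ³)` and `W^{s,q}(𝕋³; ℝ³)`: the extension
of `f` by continuity from smooth fields to `g`, i.e. the limit of `f ψ` as the smooth field `ψ`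
tends to `g` in `W^{s,q}`. -/
def bracket (s q : ℝ) (f : PeriodicTest E3 → ℝ) (g : E3 → E3) : ℝ :=
  limUnder (comap (fun ψ : PeriodicTest E3 => sobolevNorm s q fun x => ψ.1 x - g x) (𝓝 0)) f

end Sobolev

/-! ### Functional vorticity solutions and their pressure -/

/-- Functional vorticity solutions of the Euler equations on `𝕋³ × (0,T)`. The vorticity is a
family of distributions `ω t` acting on smooth vector fields. A product of a component of `u` with
a component of `ω` acts on test functions by `⟨u_i ω_j, χ⟩ = ⟨ω_j, u_i χ⟩`, so that
`⟨u ⊗ ω, ∇ψ⟩ = ⟨ω_j, u_i ∂_i ψ_j⟩` and `⟨ω ⊗ u, ∇ψ⟩ = ⟨ω_i, u_j ∂_i ψ_j⟩`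
with the `H^{-1/2} × H^{1/2}` bracket. -/
structure IsFunctionalVorticitySolution (T : ℝ) (u : ℝ → E3 → E3)
    (ω : ℝ → PeriodicTest E3 → ℝ) : Prop where
  /-- `u ∈ L^∞((0,T); H^{1/2+}(𝕋³))` -/
  regularity : ∃ θ : ℝ, 0 < θ ∧ θ < 1 / 2 ∧ MemBochnerSobolev T ⊤ (1 / 2 + θ) 2 u
  /-- `ω = ∇ × u` -/
  vorticity : ∀ᵐ t ∂volume.restrict (Ioo 0 T), ∀ ψ : PeriodicTest E3,
    ω t ψ = ∫ x in cell, ⟪u t x, curl ψ.1 x⟫_ℝ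
  /-- `∇ · u = 0` -/
  div_velocity : ∀ᵐ t ∂volume.restrict (Ioo 0 T), ∀ χ : PeriodicTest ℝ,
    ∫ x in cell, ⟪u t x, gradient χ.1 x⟫_ℝ = 0
  /-- `∇ · ω = 0` -/
  div_vorticity : ∀ᵐ t ∂volume.restrict (Ioo 0 T), ∀ (χ : PeriodicTest ℝ) (ψ : PeriodicTest E3),
    (∀ x, ψ.1 x = gradient χ.1 x) → ω t ψ = 0
  /-- the vorticity equation `∂ₜω + ∇ · (u ⊗ ω - ω ⊗ u) = 0` in weak form -/
  equation : ∀ ψ : SpaceTimeTest E3 T,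
    (∫ t in Ioo 0 T, bracket (1 / 2) 2 (ω t) fun x => (dt ψ).1 (t, x)) +
    (∫ t in Ioo 0 T, bracket (1 / 2) 2 (ω t) fun x =>
      (∑ i, u t x i • fderiv ℝ ψ.1 (t, x) (0, e i)) -
        ∑ i, (∑ j, u t x j * fderiv ℝ ψ.1 (t, x) (0, e i) j) • e i) = 0

/-- `p` is the pressure of the velocity field `u`:
`∇p = -∂ₜu - ∇ · (u ⊗ u)` in the sense of distributions on `𝕋³ × (0,T)`,
normalised by `∫ p dx = 0`. -/
structure IsPressure (T : ℝ) (u : ℝ → E3 → E3) (p : ℝ → E3 → ℝ) : Prop where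
  periodic : ∀ t ∈ Ioo 0 T, IsPeriodic (p t)
  measurable : AEStronglyMeasurable (Function.uncurry p) ((volume.restrict (Ioo 0 T)).prod volume)
  integrable : IntegrableOn (Function.uncurry p) (Ioo 0 T ×ˢ cell)
  mean_zero : ∀ᵐ t ∂volume.restrict (Ioo 0 T), ∫ x in cell, p t x = 0
  momentum : ∀ ζ : SpaceTimeTest E3 T,
    ∫ t in Ioo 0 T, ∫ x in cell,
      (⟪u t x, (dt ζ).1 (t, x)⟫_ℝ +
        (∑ i, ∑ j, u t x i * u t x j * fderiv ℝ ζ.1 (t, x) (0, e i) j) +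
        p t x * ∑ i, fderiv ℝ ζ.1 (t, x) (0, e i) i) = 0

/-! ### Distributions on space-time -/

section Distributions

variable {F : Type*} [NormedAddCommGroup F] [NormedSpace ℝ F] {T : ℝ}

/-- `Λ` is a distribution on `𝕋³ × (0,T)`: it is linear, and on test functions supported in
`[a,b] ⊂ (0,T)` it is bounded by finitely many derivatives. -/
def IsDistribution (Λ : SpaceTimeTest F T → ℝ) : Prop :=
  IsLinearMap ℝ Λ ∧
  ∀ a b : ℝ, 0 < a → b < T → ∃ (C : ℝ) (N : ℕ), ∀ φ : SpaceTimeTest F T,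
    (∀ t, t ∉ Icc a b → ∀ x, φ.1 (t, x) = 0) →
    ∀ M : ℝ, (∀ k ≤ N, ∀ z, ‖iteratedFDeriv ℝ k φ.1 z‖ ≤ M) → |Λ φ| ≤ C * M

/-- The distributional time derivative. -/
def distDt (Λ : SpaceTimeTest ℝ T → ℝ) : SpaceTimeTest ℝ T → ℝ := fun φ => -Λ (dt φ)

/-- The distributional spatial divergence. -/
def distDiv (Λ : SpaceTimeTest E3 T → ℝ) : SpaceTimeTest ℝ T → ℝ := fun φ => -Λ (grad φ)

end Distributions

/-! ### Products with the vorticity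

Below all spatial brackets are those of `W^{-1/2,3}(𝕋³) × W^{1/2,3/2}(𝕋³)`. -/

/-- `∫₀ᵀ ⟨ω(t), G(t)⟩ dt`. -/
def pairing (T : ℝ) (ω : ℝ → PeriodicTest E3 → ℝ) (G : ℝ → E3 → E3) : ℝ :=
  ∫ t in Ioo 0 T, bracket (1 / 2) (3 / 2) (ω t) (G t)

/-- The expression `∫₀ᵀ ⟨ω(t), G(t)⟩ dt` is meaningful. -/
def PairingDefined (T : ℝ) (ω : ℝ → PeriodicTest E3 → ℝ) (G : ℝ → E3 → E3) : Prop :=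
  (∀ᵐ t ∂volume.restrict (Ioo 0 T),
    MemDual (1 / 2) (3 / 2) (ω t) ∧ MemSobolev (1 / 2) (3 / 2) (G t)) ∧
  IntegrableOn (fun t => bracket (1 / 2) (3 / 2) (ω t) (G t)) (Ioo 0 T)

/-- The field paired with `ω` when the helicity density `u · ω` acts on `φ`. -/
def helicityField {T : ℝ} (u : ℝ → E3 → E3) (φ : SpaceTimeTest ℝ T) (t : ℝ) (x : E3) : E3 :=
  φ.1 (t, x) • u t x

/-- The field paired with `ω` when `p ω` acts on `ψ`. -/
def pressureField {T : ℝ} (p : ℝ → E3 → ℝ) (ψ : SpaceTimeTest E3 T) (t : ℝ) (x : E3) : E3 :=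
  p t x • ψ.1 (t, x)

/-- The field paired with `ω` when `2 (u · ω) u - |u|² ω` acts on `ψ`. -/
def fluxField {T : ℝ} (u : ℝ → E3 → E3) (ψ : SpaceTimeTest E3 T) (t : ℝ) (x : E3) : E3 :=
  (2 * ⟪u t x, ψ.1 (t, x)⟫_ℝ) • u t x - (‖u t x‖ ^ 2) • ψ.1 (t, x)

/-- The helicity density `u · ω` on `𝕋³ × (0,T)`. -/
def helicityDensity (T : ℝ) (u : ℝ → E3 → E3) (ω : ℝ → PeriodicTest E3 → ℝ) :
    SpaceTimeTest ℝ T → ℝ :=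
  fun φ => pairing T ω (helicityField u φ)

/-- The vector-valued product `p ω` on `𝕋³ × (0,T)`. -/
def pressureVorticity (T : ℝ) (p : ℝ → E3 → ℝ) (ω : ℝ → PeriodicTest E3 → ℝ) :
    SpaceTimeTest E3 T → ℝ :=
  fun ψ => pairing T ω (pressureField p ψ)

/-- The vector-valued product `2 (u · ω) u - |u|² ω` on `𝕋³ × (0,T)`. -/
def helicityFlux (T : ℝ) (u : ℝ → E3 → E3) (ω : ℝ → PeriodicTest E3 → ℝ) :
    SpaceTimeTest E3 T → ℝ :=
  fun ψ => pairing T ω (fluxField u ψ)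

/-! ### The mollified defect terms -/

/-- Radial mollifiers on `ℝ³`. -/
structure IsMollifier (ϕ : E3 → ℝ) : Prop where
  smooth : ContDiff ℝ (⊤ : ℕ∞) ϕ
  compactSupport : HasCompactSupport ϕ
  radial : ∀ x y, ‖x‖ = ‖y‖ → ϕ x = ϕ y
  integral_eq_one : ∫ x, ϕ x = 1

/-- `ϕ_ε(x) = ε⁻³ ϕ(x / ε)`. -/
def dilate (ϕ : E3 → ℝ) (ε : ℝ) (x : E3) : ℝ := (ε ^ 3)⁻¹ * ϕ (ε⁻¹ • x)

/-- Since `⟨δω(ξ), Ψ⟩ = ⟨ω, δΨ(-ξ)⟩`, the bracket of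
`∇ϕ_ε(ξ) · δu(ξ) (δω(ξ) · δu(ξ))` with `φ` is the bracket of `ω` with this field. -/
def defectField₁ (ϕ : E3 → ℝ) (ε : ℝ) (v : E3 → E3) (φ : E3 → ℝ) (ξ : E3) : E3 → E3 :=
  increment (-ξ) fun x =>
    (⟪gradient (dilate ϕ ε) ξ, increment ξ v x⟫_ℝ * φ x) • increment ξ v x

/-- The bracket of `∇ϕ_ε(ξ) · δω(ξ) |δu(ξ)|²` with `φ` is the bracket of `ω` with this field. -/
def defectField₂ (ϕ : E3 → ℝ) (ε : ℝ) (v : E3 → E3) (φ : E3 → ℝ) (ξ : E3) : E3 → E3 :=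
  increment (-ξ) fun x => (‖increment ξ v x‖ ^ 2 * φ x) • gradient (dilate ϕ ε) ξ

/-- `⟨∫ ∇ϕ_ε(ξ) · δu(ξ) (δω(ξ) · δu(ξ)) dξ, φ⟩` at a fixed time, for velocity `v`
and vorticity `w`. -/
def defect₁ (ϕ : E3 → ℝ) (ε : ℝ) (v : E3 → E3) (w : PeriodicTest E3 → ℝ) (φ : E3 → ℝ) : ℝ :=
  ∫ ξ, bracket (1 / 2) (3 / 2) w (defectField₁ ϕ ε v φ ξ)

/-- `⟨∫ ∇ϕ_ε(ξ) · δω(ξ) |δu(ξ)|² dξ, φ⟩` at a fixed time. -/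
def defect₂ (ϕ : E3 → ℝ) (ε : ℝ) (v : E3 → E3) (w : PeriodicTest E3 → ℝ) (φ : E3 → ℝ) : ℝ :=
  ∫ ξ, bracket (1 / 2) (3 / 2) w (defectField₂ ϕ ε v φ ξ)

/-- `D_{1,ε} - ½ D_{2,ε}` as a functional on `𝓓(𝕋³ × (0,T))`. -/
def mollifiedDefect (T : ℝ) (ϕ : E3 → ℝ) (ε : ℝ) (u : ℝ → E3 → E3)
    (ω : ℝ → PeriodicTest E3 → ℝ) : SpaceTimeTest ℝ T → ℝ :=
  fun φ => ∫ t in Ioo 0 T,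
    (defect₁ ϕ ε (u t) (ω t) (fun x => φ.1 (t, x)) -
      (1 / 2) * defect₂ ϕ ε (u t) (ω t) fun x => φ.1 (t, x))

/-- All brackets and integrals in `mollifiedDefect` are meaningful. -/
def MollifiedDefectDefined (T : ℝ) (ϕ : E3 → ℝ) (ε : ℝ) (u : ℝ → E3 → E3)
    (ω : ℝ → PeriodicTest E3 → ℝ) (φ : SpaceTimeTest ℝ T) : Prop :=
  (∀ᵐ t ∂volume.restrict (Ioo 0 T),
    MemDual (1 / 2) (3 / 2) (ω t) ∧
    (∀ ξ, MemSobolev (1 / 2) (3 / 2) (defectField₁ ϕ ε (u t) (fun x => φ.1 (t, x)) ξ) ∧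
      MemSobolev (1 / 2) (3 / 2) (defectField₂ ϕ ε (u t) (fun x => φ.1 (t, x)) ξ)) ∧
    Integrable (fun ξ =>
      bracket (1 / 2) (3 / 2) (ω t) (defectField₁ ϕ ε (u t) (fun x => φ.1 (t, x)) ξ)) ∧
    Integrable (fun ξ =>
      bracket (1 / 2) (3 / 2) (ω t) (defectField₂ ϕ ε (u t) (fun x => φ.1 (t, x)) ξ))) ∧
  IntegrableOn (fun t => defect₁ ϕ ε (u t) (ω t) fun x => φ.1 (t, x)) (Ioo 0 T) ∧
  IntegrableOn (fun t => defect₂ ϕ ε (u t) (ω t) fun x => φ.1 (t, x)) (Ioo 0 T)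

end HelicityBalance

end

open HelicityBalance

open Real Set Filter Topology MeasureTheory
open scoped NNReal ENNReal InnerProductSpace

set_option linter.unusedSectionVars false

noncomputable section

namespace HelicityBalance

open Function (uncurry)
open Finset (sum_congr mul_sum sum_mul sum_add_distrib sum_sub_distrib sum_le_sum mem_univ sum_comm
  sum_neg_distrib stronglyMeasurable_fun_sum single_le_sum sum_insert sum_eq_single sum_const_zero sum_eq_zero induction_on)
open Metric (ball closedBall)
open Matrix (cons_val_zero cons_val_one cons_val)
open ENNReal (HolderTriple coe_le_coe coe_ne_top mul_lt_top coe_lt_top ofReal_le_ofReal coe_toNNReal rpow_ne_top_of_nonneg ofReal_inv_of_pos ofReal_add mul_ne_top ofReal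
  mul_rpow_of_nonneg rpow_add_of_nonneg coe_rpow_of_nonneg)

local notation "𝔮" => ofReal (3 / 2)
local notation "𝓑" => bracket (1 / 2) (3 / 2)
local notation "𝓛" T:max => volume.restrict (Ioo (0 : ℝ) T)
local notation "JMeas" f:max => StronglyMeasurable (uncurry f)

variable {F : Type*} [NormedAddCommGroup F] [NormedSpace ℝ F] {f : E3 → F} {k : E3 → ℝ} {ε : ℝ}
  {T s κ σ τ : ℝ} {A B C K L M : ℝ≥0} {p q r : ℝ≥0∞} {ϕ : E3 → ℝ} {u : ℝ → E3 → E3}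
  {ω : ℝ → PeriodicTest E3 → ℝ}
/-! ### Integration of periodic functions over the fundamental cell -/

theorem integral_congr_fun {α G : Type*} [MeasurableSpace α] {μ : Measure α} [NormedAddCommGroup G]
    [NormedSpace ℝ G] {f g : α → G} (h : ∀ x, f x = g x) : ∫ x, f x ∂μ = ∫ x, g x ∂μ := by
  simp only [h]

/-- Lebesgue measure on the fundamental cell. -/
abbrev vol : Measure E3 := volume.restrict cell

/-- The standard basis of `E3`. -/
abbrev stdBasis : Module.Basis (Fin 3) ℝ E3 := (EuclideanSpace.basisFun (Fin 3) ℝ).toBasis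

/-- The lattice `ℤ³`. -/
abbrev latticeZ : Submodule ℤ E3 := Submodule.span ℤ (Set.range stdBasis)

theorem stdBasis_apply (i : Fin 3) : stdBasis i = e i := by
  simp [stdBasis, e]

theorem cell_eq_fundamentalDomain : cell = ZSpan.fundamentalDomain stdBasis := by
  ext x
  simp [cell, ZSpan.mem_fundamentalDomain, stdBasis]

instance : VAddInvariantMeasure latticeZ E3 (volume : Measure E3) :=
  inferInstanceAs <| VAddInvariantMeasure latticeZ.toAddSubgroup E3 volume

theorem isAddFundamentalDomain_cell : IsAddFundamentalDomain latticeZ cell (volume : Measure E3) := by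
  rw [cell_eq_fundamentalDomain]
  exact ZSpan.isAddFundamentalDomain stdBasis volume

theorem measurableSet_cell : MeasurableSet cell := by
  rw [cell_eq_fundamentalDomain]
  exact ZSpan.fundamentalDomain_measurableSet stdBasis

theorem volume_cell : volume cell = 1 := by
  have h' := (EuclideanSpace.volume_preserving_symm_measurableEquiv_toLp (Fin 3)).symm.measure_preimage
    (s := cell) measurableSet_cell.nullMeasurableSet
  rw [← h']
  have : (⇑(MeasurableEquiv.toLp 2 (Fin 3 → ℝ)).symm.symm ⁻¹' cell) =
      Set.pi Set.univ fun _ : Fin 3 => Ico (0 : ℝ) 1 := by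
    ext x
    simp [cell]
  rw [this, volume_pi, Measure.pi_pi]
  simp

instance : IsProbabilityMeasure vol := ⟨by simp [volume_cell]⟩

theorem IsPeriodic.vadd_lattice {F : Type*} {f : E3 → F} (hf : IsPeriodic f) (g : latticeZ)
    (x : E3) : f (g +ᵥ x) = f x := by
  obtain ⟨g, hg⟩ := g
  change f (g + x) = f x
  revert x
  induction hg using Submodule.span_induction with
  | mem y hy =>
    obtain ⟨i, rfl⟩ := hy
    intro x
    rw [stdBasis_apply, add_comm, hf]
  | zero => simp
  | add a b _ _ ha hb => intro x; rw [add_assoc, ha, hb]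
  | smul n a _ ha =>
    have hneg : ∀ x, f (-a + x) = f x := fun x => by rw [← ha (-a + x)]; simp
    induction n using Int.induction_on with
    | zero => simp
    | succ k ih => intro x; rw [add_smul, one_smul, add_assoc, ih, ha]
    | pred k ih => intro x; rw [sub_smul, one_smul, sub_eq_add_neg, add_assoc, ih, hneg]

section Translates

open scoped Pointwise

theorem isAddFundamentalDomain_vadd_cell (h : E3) :
    IsAddFundamentalDomain latticeZ (h +ᵥ cell) (volume : Measure E3) := by
  have : VAddCommClass E3 latticeZ E3 := ⟨fun a b c => by
    change a + ((b : E3) + c) = (b : E3) + (a + c)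
    abel⟩
  exact isAddFundamentalDomain_cell.vadd_of_comm h

theorem restrict_vadd_cell (h : E3) :
    (volume : Measure E3).restrict (h +ᵥ cell) = vol.map (fun x => x + h) := by
  have := (measurePreserving_add_right (volume : Measure E3) h).restrict_preimage_emb
    (MeasurableEquiv.addRight h).measurableEmbedding (h +ᵥ cell)
  have h2 : (fun x => x + h) ⁻¹' (h +ᵥ cell) = cell := by
    ext x
    simp [Set.mem_vadd_set_iff_neg_vadd_mem, add_comm x h]
  rw [h2] at this
  exact this.map_eq.symm

theorem IsPeriodic.lintegral_add_right {f : E3 → ℝ≥0∞} (hf : IsPeriodic f) (h : E3) :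
    ∫⁻ x, f (x + h) ∂vol = ∫⁻ x, f x ∂vol := by
  have h1 := isAddFundamentalDomain_cell.setLIntegral_eq (isAddFundamentalDomain_vadd_cell h) f
    (fun g x => hf.vadd_lattice g x)
  rw [h1, restrict_vadd_cell]
  exact ((MeasurableEquiv.addRight h).measurableEmbedding.lintegral_map f).symm

theorem IsPeriodic.integral_add_right {F : Type*} [NormedAddCommGroup F] [NormedSpace ℝ F]
    {f : E3 → F} (hf : IsPeriodic f) (h : E3) : ∫ x, f (x + h) ∂vol = ∫ x, f x ∂vol := by
  have h1 := isAddFundamentalDomain_cell.setIntegral_eq (isAddFundamentalDomain_vadd_cell h)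
    (f := f) (fun g x => hf.vadd_lattice g x)
  rw [h1, restrict_vadd_cell]
  exact ((MeasurableEquiv.addRight h).measurableEmbedding.integral_map f).symm

theorem IsPeriodic.comp {F G : Type*} {f : E3 → F} (hf : IsPeriodic f) (g : F → G) :
    IsPeriodic fun x => g (f x) := fun x i => congrArg g (hf x i)

theorem IsPeriodic.comp₂ {F G H : Type*} {f : E3 → F} {g : E3 → G} (hf : IsPeriodic f)
    (hg : IsPeriodic g) (k : F → G → H) : IsPeriodic fun x => k (f x) (g x) :=
  fun x i => by
  change k (f (x + e i)) (g (x + e i)) = _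
  rw [hf x i, hg x i]

theorem IsPeriodic.shift {F : Type*} {f : E3 → F} (hf : IsPeriodic f) (h : E3) :
    IsPeriodic fun x => f (x + h) := fun x i => by
  change f (x + e i + h) = _
  rw [add_right_comm, hf]

protected theorem IsPeriodic.increment {F : Type*} [Sub F] {f : E3 → F} (hf : IsPeriodic f) (h : E3) :
    IsPeriodic (increment h f) := (hf.shift h).comp₂ hf _

theorem IsPeriodic.eLpNorm_add_right {F : Type*} [NormedAddCommGroup F] {f : E3 → F}
    (hf : IsPeriodic f) (hm : StronglyMeasurable f) (q : ℝ≥0∞) (h : E3) :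
    eLpNorm (fun x => f (x + h)) q vol = eLpNorm f q vol := by
  rcases eq_or_ne q 0 with rfl | h0
  · simp
  rcases eq_or_ne q ⊤ with rfl | ht
  · rw [eLpNorm_exponent_top, eLpNorm_exponent_top]
    have key : ∀ c : ℝ≥0∞, (∀ᵐ x ∂vol, ‖f (x + h)‖ₑ ≤ c) ↔
        (∀ᵐ x ∂vol, ‖f x‖ₑ ≤ c) := by
      intro c
      have hm' : Measurable fun x => ({y : F | ¬ ‖y‖ₑ ≤ c}.indicator (fun _ => (1 : ℝ≥0∞)) (f x)) := by
        have : MeasurableSet (f ⁻¹' {y : F | ¬ ‖y‖ₑ ≤ c}) := by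
          have h2 : Measurable fun x => ‖f x‖ₑ := hm.enorm
          exact (measurableSet_le h2 measurable_const).compl
        exact measurable_const.indicator this
      have h3 := (hf.comp ({y : F | ¬ ‖y‖ₑ ≤ c}.indicator (fun _ => (1 : ℝ≥0∞)))).lintegral_add_right h
      have e1 : (∀ᵐ x ∂vol, ‖f x‖ₑ ≤ c) ↔
          ∫⁻ x, ({y : F | ¬ ‖y‖ₑ ≤ c}.indicator (fun _ => (1 : ℝ≥0∞)) (f x)) ∂vol = 0 := by
        rw [lintegral_eq_zero_iff hm']
        refine Filter.eventually_congr (.of_forall fun x => ?_)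
        simp [Set.indicator_apply]
      have e2 : (∀ᵐ x ∂vol, ‖f (x + h)‖ₑ ≤ c) ↔
          ∫⁻ x, ({y : F | ¬ ‖y‖ₑ ≤ c}.indicator (fun _ => (1 : ℝ≥0∞)) (f (x + h))) ∂vol = 0 := by
        have hm2 := hm'.comp (measurable_id.add_const h)
        simp only [Function.comp_def, id] at hm2
        rw [lintegral_eq_zero_iff hm2]
        refine Filter.eventually_congr (.of_forall fun x => ?_)
        simp [Set.indicator_apply]
      rw [e1, e2, h3]
    refine le_antisymm ?_ ?_
    · exact essSup_le_of_ae_le _ ((key _).2 (ae_le_essSup))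
    · exact essSup_le_of_ae_le _ ((key _).1 (ae_le_essSup (f := fun x => ‖f (x + h)‖ₑ)))
  · rw [eLpNorm_eq_lintegral_rpow_enorm_toReal h0 ht, eLpNorm_eq_lintegral_rpow_enorm_toReal h0 ht,
      (hf.comp fun y => ‖y‖ₑ ^ q.toReal).lintegral_add_right h]

theorem cell_mem_nhds : cell ∈ 𝓝 ((WithLp.toLp 2 fun _ => (1 / 2 : ℝ)) : E3) := by
  have hopen : IsOpen {x : E3 | ∀ i, x i ∈ Ioo (0 : ℝ) 1} := by
    simp only [Set.ofPred_forall]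
    exact isOpen_iInter_of_finite fun i => isOpen_Ioo.preimage (by fun_prop)
  refine Filter.mem_of_superset (hopen.mem_nhds ?_) fun _ hx i => Ioo_subset_Ico_self (hx i)
  intro i
  norm_num

/-- Over a compact set, a periodic function integrates to at most a multiple of its integral
over the cell. -/
theorem exists_setLIntegral_le {K : Set E3} (hK : IsCompact K) :
    ∃ C : ℝ≥0, ∀ f : E3 → ℝ≥0∞, IsPeriodic f → ∀ x : E3,
      ∫⁻ ξ in K, f (x + ξ) ≤ C * ∫⁻ y, f y ∂vol := by
  set c : E3 := WithLp.toLp 2 fun _ => (1 / 2 : ℝ)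
  obtain ⟨s, -, hs⟩ := hK.elim_nhds_subcover (fun x => (x - c) +ᵥ cell) fun x _ => by
    have : (x - c) +ᵥ cell ∈ 𝓝 ((x - c) +ᵥ c) := vadd_mem_nhds_vadd (x - c) cell_mem_nhds
    rwa [vadd_eq_add, sub_add_cancel] at this
  refine ⟨s.card, fun f hf x => ?_⟩
  have hfx : IsPeriodic fun ξ => f (x + ξ) := by simpa [add_comm] using hf.shift x
  have h1 : ∀ h : E3, ∫⁻ ξ in h +ᵥ cell, f (x + ξ) = ∫⁻ y, f y ∂vol := by
    intro h
    rw [← isAddFundamentalDomain_cell.setLIntegral_eq (isAddFundamentalDomain_vadd_cell h)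
      (fun ξ => f (x + ξ)) (fun g y => hfx.vadd_lattice g y), ← hf.lintegral_add_right x]
    simp [add_comm]
  calc ∫⁻ ξ in K, f (x + ξ) ≤ ∫⁻ ξ in ⋃ y ∈ s, (y - c) +ᵥ cell, f (x + ξ) := lintegral_mono_set hs
    _ ≤ ∑ y : s, ∫⁻ ξ in ((y : E3) - c) +ᵥ cell, f (x + ξ) := by
      rw [← Set.iUnion_subtype (fun y => y ∈ s) (fun y => ((y : E3) - c) +ᵥ cell), ← tsum_fintype (L := .unconditional _)]
      exact lintegral_iUnion_le (fun y : s => ((y : E3) - c) +ᵥ cell) _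
    _ = (s.card : ℝ≥0) * ∫⁻ y, f y ∂vol := by simp [h1]

end Translates

theorem IsPeriodic.locallyIntegrable {F : Type*} [NormedAddCommGroup F] {f : E3 → F}
    (hf : IsPeriodic f) (hm : StronglyMeasurable f) (hi : Integrable f vol) :
    LocallyIntegrable f volume := by
  rw [locallyIntegrable_iff]
  intro K hK
  obtain ⟨C, hC⟩ := exists_setLIntegral_le hK
  refine ⟨hm.aestronglyMeasurable, ?_⟩
  have h1 := hC (fun x => ‖f x‖ₑ) (hf.comp _) 0
  simp only [zero_add] at h1
  exact h1.trans_lt (mul_lt_top coe_lt_top hi.2)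

theorem IsPeriodic.ae_volume_of_ae_cell {F : Type*} {f : E3 → F} (hf : IsPeriodic f)
    {p : F → Prop} (h : ∀ᵐ x ∂vol, p (f x)) : ∀ᵐ x, p (f x) := by
  have h1 := (ae_restrict_iff' measurableSet_cell).1 h
  refine isAddFundamentalDomain_cell.measure_zero_of_invariant {x | ¬ p (f x)} ?_ ?_
  · intro g
    ext x
    rw [Set.mem_vadd_set_iff_neg_vadd_mem]
    simp [hf.vadd_lattice (-g) x]
  · have : {x | ¬ p (f x)} ∩ cell = {x | ¬ (x ∈ cell → p (f x))} := by
      ext x; simp [and_comm]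
    rw [this]
    exact h1

/-- Reduction modulo the lattice. -/
def cellFract (x : E3) : E3 := WithLp.toLp 2 fun i => Int.fract (x i)

theorem cellFract_mem (x : E3) : cellFract x ∈ cell := fun _ =>
  ⟨Int.fract_nonneg _, Int.fract_lt_one _⟩

theorem measurable_cellFract : Measurable cellFract := by
  refine (MeasurableEquiv.toLp 2 (Fin 3 → ℝ)).measurable.comp (measurable_pi_lambda _ fun i => ?_)
  exact measurable_fract.comp (by fun_prop)

theorem isPeriodic_cellFract : IsPeriodic cellFract := fun x i => by
  ext j
  by_cases h : j = i
  · subst h; simp [cellFract, e]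
  · simp [cellFract, e, h]

theorem cellFract_of_mem {x : E3} (hx : x ∈ cell) : cellFract x = x := by
  ext i
  exact Int.fract_eq_self.2 (hx i)

/-- A time-dependent periodic function has a jointly measurable version. -/
theorem exists_measurable_version {F : Type*} [NormedAddCommGroup F] {T : ℝ}
    {f : ℝ → E3 → F} (hp : ∀ t ∈ Ioo 0 T, IsPeriodic (f t))
    (hm : AEStronglyMeasurable (uncurry f) ((𝓛 T).prod volume)) :
    ∃ g : ℝ → E3 → F, JMeas g ∧ (∀ t, IsPeriodic (g t)) ∧ ∀ᵐ t ∂𝓛 T, g t =ᵐ[volume] f t := by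
  refine ⟨fun t x => hm.mk _ (t, cellFract x), ?_, ?_, ?_⟩
  · exact hm.stronglyMeasurable_mk.comp_measurable
      (measurable_fst.prodMk (measurable_cellFract.comp measurable_snd))
  · intro t x i
    simp only [isPeriodic_cellFract x i]
  · filter_upwards [Measure.ae_ae_of_ae_prod hm.ae_eq_mk, ae_restrict_mem measurableSet_Ioo]
      with t ht htT
    have hper : IsPeriodic fun x => (hm.mk _ (t, cellFract x), f t x) := fun x i => by
      simp only [isPeriodic_cellFract x i, hp t htT x i]
    have h2 := hper.ae_volume_of_ae_cell (p := fun z => z.1 = z.2) (by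
      rw [ae_restrict_iff' measurableSet_cell]
      filter_upwards [ht] with x hx hxc
      simpa [cellFract_of_mem hxc] using hx.symm)
    exact h2

/-! ### Integrals of families of functions in `L^q` -/

section Minkowski

variable {X Y F : Type*} [MeasurableSpace X] [MeasurableSpace Y] [NormedAddCommGroup F]
  [NormedSpace ℝ F]

/-- Minkowski's integral inequality with a uniform bound on the family. -/
theorem eLpNorm_integral_smul_le {ν : Measure X} [SFinite ν] {μ : Measure Y} [SFinite μ]
    {k : X → ℝ} (hk : Measurable k) {G : X → Y → F} (hG : JMeas G) (hq : 1 ≤ q) {B : ℝ≥0∞}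
    (hB : ∀ ξ, k ξ ≠ 0 → eLpNorm (G ξ) q μ ≤ B) :
    eLpNorm (fun x => ∫ ξ, k ξ • G ξ x ∂ν) q μ ≤ (∫⁻ ξ, ‖k ξ‖ₑ ∂ν) * B := by
  have hGm : Measurable fun z : X × Y => ‖G z.1 z.2‖ₑ := hG.enorm
  have hpt : ∀ x, ‖∫ ξ, k ξ • G ξ x ∂ν‖ₑ ≤ ∫⁻ ξ, ‖k ξ‖ₑ * ‖G ξ x‖ₑ ∂ν := fun x =>
    (enorm_integral_le_lintegral_enorm _).trans (by simp [enorm_smul])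
  rcases eq_or_ne q ⊤ with rfl | ht
  · rw [eLpNorm_exponent_top]
    refine essSup_le_of_ae_le _ ?_
    have hset : MeasurableSet {z : X × Y | ‖k z.1‖ₑ * ‖G z.1 z.2‖ₑ ≤ ‖k z.1‖ₑ * B} :=
      measurableSet_le ((hk.comp measurable_fst).enorm.mul hGm)
        ((hk.comp measurable_fst).enorm.mul_const _)
    have h1 : ∀ᵐ ξ ∂ν, ∀ᵐ x ∂μ, ‖k ξ‖ₑ * ‖G ξ x‖ₑ ≤ ‖k ξ‖ₑ * B := by
      refine Eventually.of_forall fun ξ => ?_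
      by_cases h : k ξ = 0
      · simp [h]
      · filter_upwards [ae_le_eLpNormEssSup (f := G ξ) (μ := μ)] with x hx
        gcongr
        exact hx.trans (by simpa using hB ξ h)
    have h2 := (Measure.ae_ae_comm hset).1 h1
    filter_upwards [h2] with x hx
    refine (hpt x).trans ((lintegral_mono_ae hx).trans ?_)
    rw [lintegral_mul_const _ hk.enorm]
  · have hq0 : q ≠ 0 := (zero_lt_one.trans_le hq).ne'
    have hq1 : 1 ≤ q.toReal := by
      simpa using (ENNReal.toReal_le_toReal ENNReal.one_ne_top ht).2 hq
    have hqpos : 0 < q.toReal := by linarith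
    set p := q.toReal
    set K := ∫⁻ ξ, ‖k ξ‖ₑ ∂ν
    have hJ : ∀ x, (∫⁻ ξ, ‖k ξ‖ₑ * ‖G ξ x‖ₑ ∂ν) ^ p ≤
        K ^ (p - 1) * ∫⁻ ξ, ‖k ξ‖ₑ * ‖G ξ x‖ₑ ^ p ∂ν := by
      intro x
      have hgx : Measurable fun ξ => ‖G ξ x‖ₑ := hGm.comp (measurable_id.prodMk measurable_const)
      have h := eLpNorm'_le_eLpNorm'_mul_rpow_measure_univ (μ := ν.withDensity fun ξ => ‖k ξ‖ₑ)
        (f := fun ξ => ‖G ξ x‖ₑ) zero_lt_one hq1 hgx.aestronglyMeasurable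
      simp only [eLpNorm', enorm_eq_self, ENNReal.rpow_one, div_one,
        withDensity_apply _ MeasurableSet.univ, Measure.restrict_univ] at h
      rw [lintegral_withDensity_eq_lintegral_mul _ hk.enorm hgx,
        lintegral_withDensity_eq_lintegral_mul _ hk.enorm (hgx.pow_const p)] at h
      calc _ ≤ ((∫⁻ ξ, ‖k ξ‖ₑ * ‖G ξ x‖ₑ ^ p ∂ν) ^ (1 / p) * K ^ (1 - 1 / p)) ^ p := by
            gcongr
            exact h
        _ = _ := by
            rw [mul_rpow_of_nonneg _ _ hqpos.le, ← ENNReal.rpow_mul, ← ENNReal.rpow_mul,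
              one_div_mul_cancel hqpos.ne', ENNReal.rpow_one, mul_comm]
            congr 2
            field_simp
    rw [eLpNorm_eq_lintegral_rpow_enorm_toReal hq0 ht]
    calc (∫⁻ x, ‖∫ ξ, k ξ • G ξ x ∂ν‖ₑ ^ p ∂μ) ^ (1 / p)
        ≤ (∫⁻ x, K ^ (p - 1) * ∫⁻ ξ, ‖k ξ‖ₑ * ‖G ξ x‖ₑ ^ p ∂ν ∂μ) ^ (1 / p) := by
          gcongr with x
          exact (ENNReal.rpow_le_rpow (hpt x) hqpos.le).trans (hJ x)
      _ = (K ^ (p - 1) * ∫⁻ ξ, ‖k ξ‖ₑ * ∫⁻ x, ‖G ξ x‖ₑ ^ p ∂μ ∂ν) ^ (1 / p) := by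
          have hm : Measurable fun z : Y × X => ‖k z.2‖ₑ * ‖G z.2 z.1‖ₑ ^ p :=
            (hk.comp measurable_snd).enorm.mul ((hGm.comp measurable_swap).pow_const p)
          rw [lintegral_const_mul _ hm.lintegral_prod_right', lintegral_lintegral_swap hm.aemeasurable]
          congr 2
          refine lintegral_congr fun ξ => ?_
          have := lintegral_const_mul (μ := μ) ‖k ξ‖ₑ
            ((hGm.comp (measurable_prodMk_left (x := ξ))).pow_const p)
          simpa using this
      _ ≤ (K ^ (p - 1) * ∫⁻ ξ, ‖k ξ‖ₑ * B ^ p ∂ν) ^ (1 / p) := by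
          refine ENNReal.rpow_le_rpow ?_ (by positivity)
          refine mul_le_mul_right (lintegral_mono fun ξ => ?_) _
          by_cases h : k ξ = 0
          · simp [h]
          · gcongr
            have := hB ξ h
            rw [eLpNorm_eq_lintegral_rpow_enorm_toReal hq0 ht] at this
            calc _ = ((∫⁻ x, ‖G ξ x‖ₑ ^ p ∂μ) ^ (1 / p)) ^ p := by
                  rw [← ENNReal.rpow_mul, one_div_mul_cancel hqpos.ne', ENNReal.rpow_one]
              _ ≤ _ := by gcongr
      _ = K * B := by
          rw [lintegral_mul_const _ hk.enorm, ← mul_assoc]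
          change (K ^ (p - 1) * K * B ^ p) ^ (1 / p) = _
          have : K ^ (p - 1) * K = K ^ p := by
            conv_lhs => rw [← ENNReal.rpow_one K, ← ENNReal.rpow_mul, one_mul]
            rw [← rpow_add_of_nonneg _ _ (by linarith) zero_le_one]
            simp
          rw [this, ← mul_rpow_of_nonneg _ _ hqpos.le, ← ENNReal.rpow_mul,
            mul_one_div_cancel hqpos.ne', ENNReal.rpow_one]

end Minkowski

/-! ### Correlations with compactly supported kernels -/

section Kernels

/-- The correlation `x ↦ ∫ k(ξ) f(x + ξ) dξ`. -/
def conv (k : E3 → ℝ) (f : E3 → F) (x : E3) : F := ∫ ξ, k ξ • f (x + ξ)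

/-- Integrable periodic functions. -/
structure PerInt (f : E3 → F) : Prop where
  periodic : IsPeriodic f
  meas : StronglyMeasurable f
  integrable : Integrable f vol

/-- Smooth compactly supported kernels. -/
structure IsKernel (k : E3 → ℝ) : Prop where
  smooth : ContDiff ℝ (⊤ : ℕ∞) k
  compact : HasCompactSupport k

theorem IsKernel.continuous (hk : IsKernel k) : Continuous k := hk.smooth.continuous

/-- The `L¹` norm of a kernel. -/
def massOf (k : E3 → ℝ) : ℝ≥0 := (∫⁻ ξ, ‖k ξ‖ₑ).toNNReal

theorem IsKernel.integrable (hk : IsKernel k) : Integrable k :=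
  hk.continuous.integrable_of_hasCompactSupport hk.compact

theorem IsKernel.coe_massOf (hk : IsKernel k) : (massOf k : ℝ≥0∞) = ∫⁻ ξ, ‖k ξ‖ₑ :=
  coe_toNNReal hk.integrable.2.ne

theorem IsKernel.exists_bound (hk : IsKernel k) : ∃ C : ℝ≥0, ∀ ξ, ‖k ξ‖ₑ ≤ C := by
  obtain ⟨C, hC⟩ := hk.compact.exists_bound_of_continuous hk.continuous
  refine ⟨C.toNNReal, fun ξ => ?_⟩
  rw [← ofReal_norm]
  exact ofReal_le_ofReal (hC ξ)

theorem IsKernel.add {k l : E3 → ℝ} (hk : IsKernel k) (hl : IsKernel l) :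
    IsKernel fun ξ => k ξ + l ξ := ⟨hk.1.add hl.1, hk.2.add hl.2⟩

theorem IsKernel.neg (hk : IsKernel k) : IsKernel fun ξ => -k ξ :=
  ⟨hk.1.neg, hk.2.neg⟩

theorem IsKernel.sub {k l : E3 → ℝ} (hk : IsKernel k) (hl : IsKernel l) :
    IsKernel fun ξ => k ξ - l ξ := by
  simpa [sub_eq_add_neg] using hk.add hl.neg

/-- The pointwise bound of a correlation by the `L¹` norm over the cell. -/
theorem IsKernel.exists_lintegral_le (hk : IsKernel k) :
    ∃ C : ℝ≥0, ∀ f : E3 → F, IsPeriodic f → ∀ x,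
      ∫⁻ ξ, ‖k ξ • f (x + ξ)‖ₑ ≤ C * ∫⁻ y, ‖f y‖ₑ ∂vol := by
  obtain ⟨B, hB⟩ := hk.exists_bound
  obtain ⟨C, hC⟩ := exists_setLIntegral_le hk.compact
  refine ⟨B * C, fun f hf x => ?_⟩
  have h0 : (fun ξ => ‖k ξ • f (x + ξ)‖ₑ) =
      (tsupport k).indicator fun ξ => ‖k ξ • f (x + ξ)‖ₑ := by
    symm
    rw [Set.indicator_eq_self]
    intro ξ hξ
    refine subset_tsupport k ?_
    simp only [Function.mem_support] at hξ ⊢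
    rintro h
    simp [h] at hξ
  rw [h0, lintegral_indicator (isClosed_tsupport k).measurableSet]
  calc ∫⁻ ξ in tsupport k, ‖k ξ • f (x + ξ)‖ₑ ≤ ∫⁻ ξ in tsupport k, B * ‖f (x + ξ)‖ₑ := by
        refine lintegral_mono fun ξ => ?_
        rw [enorm_smul]
        gcongr
        exact hB ξ
    _ = B * ∫⁻ ξ in tsupport k, ‖f (x + ξ)‖ₑ := lintegral_const_mul' _ _ coe_ne_top
    _ ≤ B * (C * ∫⁻ y, ‖f y‖ₑ ∂vol) := by
        gcongr
        exact hC (fun y => ‖f y‖ₑ) (hf.comp _) x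
    _ = _ := by push_cast; rw [mul_assoc]

theorem IsKernel.integrable_smul (hk : IsKernel k) (hf : PerInt f) (x : E3) :
    Integrable fun ξ => k ξ • f (x + ξ) := by
  obtain ⟨C, hC⟩ := hk.exists_lintegral_le (F := F)
  exact ⟨hk.continuous.aestronglyMeasurable.smul
    (hf.meas.comp_measurable (measurable_const_add x)).aestronglyMeasurable,
    (hC f hf.periodic x).trans_lt (mul_lt_top coe_lt_top hf.integrable.2)⟩

protected theorem IsPeriodic.conv (hf : IsPeriodic f) (k : E3 → ℝ) :
    IsPeriodic (conv k f) := fun x i => by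
  simp only [conv, add_right_comm x (e i), hf _ i]

theorem stronglyMeasurable_shift (hm : StronglyMeasurable f) (h : E3) :
    StronglyMeasurable fun x => f (x + h) := hm.comp_measurable (measurable_add_const h)

theorem stronglyMeasurable_increment (hm : StronglyMeasurable f) (h : E3) :
    StronglyMeasurable (increment h f) := (stronglyMeasurable_shift hm h).sub hm

theorem stronglyMeasurable_conv (hk : Measurable k) (hm : StronglyMeasurable f) : StronglyMeasurable (conv k f) := by
  have : StronglyMeasurable fun z : E3 × E3 => k z.2 • f (z.1 + z.2) :=
    (hk.comp measurable_snd).stronglyMeasurable.smul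
      (hm.comp_measurable (measurable_fst.add measurable_snd))
  exact this.integral_prod_right

theorem PerInt.shift (hf : PerInt f) (h : E3) : PerInt fun x => f (x + h) := by
  refine ⟨hf.periodic.shift h, stronglyMeasurable_shift hf.meas h,
    (stronglyMeasurable_shift hf.meas h).aestronglyMeasurable, ?_⟩
  have := (hf.periodic.comp fun y => ‖f 0 - f 0‖ₑ + ‖y‖ₑ).lintegral_add_right h
  simp only [sub_self, enorm_zero, zero_add] at this
  rw [HasFiniteIntegral, this]
  exact hf.integrable.2

protected theorem PerInt.increment (hf : PerInt f) (h : E3) : PerInt (increment h f) :=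
  ⟨hf.periodic.increment h, stronglyMeasurable_increment hf.meas h,
    (hf.shift h).integrable.sub hf.integrable⟩

theorem conv_sub_apply (hk : IsKernel k) {f g : E3 → F} (hf : PerInt f) (hg : PerInt g) (x : E3) : conv k (fun y => f y - g y) x = conv k f x - conv k g x := by
  simp only [conv, smul_sub]
  exact integral_sub (hk.integrable_smul hf x) (hk.integrable_smul hg x)

theorem conv_add_apply (hk : IsKernel k) {f g : E3 → F} (hf : PerInt f) (hg : PerInt g) (x : E3) : conv k (fun y => f y + g y) x = conv k f x + conv k g x := by
  simp only [conv, smul_add]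
  exact integral_add (hk.integrable_smul hf x) (hk.integrable_smul hg x)

theorem conv_shift (k : E3 → ℝ) (f : E3 → F) (h x : E3) :
    conv k (fun y => f (y + h)) x = conv k f (x + h) := by
  simp only [conv, add_right_comm x h]

theorem increment_conv (hk : IsKernel k) (hf : PerInt f) (h : E3) :
    increment h (conv k f) = conv k (increment h f) := by
  ext x
  rw [increment, ← conv_shift]
  exact (conv_sub_apply hk (hf.shift h) hf x).symm

/-- The averaged increment `x ↦ ∫ k(ξ) (f(x + ξ) - f(x)) dξ`. -/
def osc (k : E3 → ℝ) (f : E3 → F) (x : E3) : F := ∫ ξ, k ξ • increment ξ f x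

theorem osc_eq [CompleteSpace F] (hk : IsKernel k) (hf : PerInt f) (x : E3) : osc k f x = conv k f x - (∫ ξ, k ξ) • f x := by
  simp only [osc, conv, increment, smul_sub]
  rw [integral_sub (hk.integrable_smul hf x) (hk.integrable.smul_const _), integral_smul_const]

end Kernels

/-! ### Nikolskii classes -/

section Nikolskii

variable {F G H : Type*} [NormedAddCommGroup F] [NormedSpace ℝ F] [NormedAddCommGroup G]
  [NormedSpace ℝ G] [NormedAddCommGroup H] [NormedSpace ℝ H]

/-- Periodic functions in the Nikolskii class of order `s` in `L^q`, with constant `A`. -/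
structure Nik (q : ℝ≥0∞) (s : ℝ) (A : ℝ≥0) (f : E3 → F) : Prop where
  periodic : IsPeriodic f
  meas : StronglyMeasurable f
  norm_le : eLpNorm f q vol ≤ A
  incr_le : ∀ h, eLpNorm (increment h f) q vol ≤ A * ‖h‖ₑ ^ s

variable {q p r : ℝ≥0∞} {s s' : ℝ} {f g : E3 → F}

theorem Nik.memLp (h : Nik q s A f) : MemLp f q vol :=
  ⟨h.meas.aestronglyMeasurable, h.norm_le.trans_lt coe_lt_top⟩

theorem Nik.perInt (h : Nik q s A f) (hq : 1 ≤ q) : PerInt f :=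
  ⟨h.periodic, h.meas, h.memLp.integrable hq⟩

theorem Nik.mono (h : Nik q s A f) (hAB : A ≤ B) : Nik q s B f :=
  ⟨h.periodic, h.meas, h.norm_le.trans (by exact_mod_cast hAB), fun x => (h.incr_le x).trans
    (by gcongr)⟩

theorem Nik.exponent (h : Nik q s A f) (hpq : p ≤ q) : Nik p s A f :=
  ⟨h.periodic, h.meas,
    (eLpNorm_le_eLpNorm_of_exponent_le hpq h.meas.aestronglyMeasurable).trans h.norm_le,
    fun x => (eLpNorm_le_eLpNorm_of_exponent_le hpq
      (stronglyMeasurable_increment h.meas x).aestronglyMeasurable).trans (h.incr_le x)⟩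

theorem Nik.add (hf : Nik q s A f) (hg : Nik q s B g) (hq : 1 ≤ q) :
    Nik q s (A + B) fun x => f x + g x := by
  refine ⟨hf.periodic.comp₂ hg.periodic _, hf.meas.add hg.meas, ?_, fun h => ?_⟩
  · push_cast
    exact (eLpNorm_add_le hf.meas.aestronglyMeasurable hg.meas.aestronglyMeasurable hq).trans
      (add_le_add hf.norm_le hg.norm_le)
  · have : increment h (fun x => f x + g x) = increment h f + increment h g := by
      ext x; simp [increment]; abel
    rw [this]
    push_cast
    rw [add_mul]
    exact (eLpNorm_add_le (stronglyMeasurable_increment hf.meas h).aestronglyMeasurable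
      (stronglyMeasurable_increment hg.meas h).aestronglyMeasurable hq).trans
      (add_le_add (hf.incr_le h) (hg.incr_le h))

theorem Nik.const_smul (hf : Nik q s A f) (c : ℝ) : Nik q s (‖c‖₊ * A) fun x => c • f x := by
  refine ⟨hf.periodic.comp _, hf.meas.const_smul c, ?_, fun h => ?_⟩
  · refine (eLpNorm_const_smul c f q _).trans_le ?_
    push_cast
    exact mul_le_mul' (le_of_eq rfl) hf.norm_le
  · have : increment h (fun x => c • f x) = c • increment h f := by
      ext x; simp [increment, smul_sub]
    rw [this, eLpNorm_const_smul]
    push_cast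
    rw [mul_assoc]
    exact mul_le_mul' (le_of_eq rfl) (hf.incr_le h)

theorem Nik.neg (hf : Nik q s A f) : Nik q s A fun x => -f x := by
  simpa using hf.const_smul (-1)

theorem Nik.sub (hf : Nik q s A f) (hg : Nik q s B g) (hq : 1 ≤ q) :
    Nik q s (A + B) fun x => f x - g x := by
  simpa [sub_eq_add_neg] using hf.add hg.neg hq

theorem Nik.zero : Nik q s 0 fun _ : E3 => (0 : F) :=
  ⟨fun _ _ => rfl, stronglyMeasurable_const, by simp, fun h => by
    have : increment h (fun _ : E3 => (0 : F)) = fun _ => 0 := by ext; simp [increment]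
    simp [this]⟩

theorem Nik.sum {ι : Type*} (t : Finset ι) {f : ι → E3 → F} {A : ι → ℝ≥0}
    (hf : ∀ i ∈ t, Nik q s (A i) (f i)) (hq : 1 ≤ q) :
    Nik q s (∑ i ∈ t, A i) fun x => ∑ i ∈ t, f i x := by
  classical
  induction t using induction_on with
  | empty => simpa using Nik.zero
  | insert a t ha ih =>
    simp only [sum_insert ha]
    exact (hf a (by simp)).add (ih fun i hi => hf i (by simp [hi])) hq

theorem IsPeriodic.eLpNorm_increment_le (hf : IsPeriodic f) (hm : StronglyMeasurable f)
    (hq : 1 ≤ q) (h : E3) : eLpNorm (increment h f) q vol ≤ 2 * eLpNorm f q vol := by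
  refine (eLpNorm_sub_le (stronglyMeasurable_shift hm h).aestronglyMeasurable
    hm.aestronglyMeasurable hq).trans ?_
  rw [hf.eLpNorm_add_right hm, two_mul]

theorem Nik.lower (hf : Nik q s A f) (hq : 1 ≤ q) (hs' : 0 ≤ s') (hs : s' ≤ s) :
    Nik q s' (2 * A) f := by
  refine ⟨hf.periodic, hf.meas, hf.norm_le.trans ?_, fun h => ?_⟩
  · push_cast
    rw [two_mul]
    exact le_self_add
  · rcases le_total ‖h‖ₑ 1 with h1 | h1
    · refine (hf.incr_le h).trans ?_
      push_cast
      gcongr ?_ * ?_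
      · rw [two_mul]; exact le_self_add
      · exact ENNReal.rpow_le_rpow_of_exponent_ge h1 hs
    · refine (hf.periodic.eLpNorm_increment_le hf.meas hq h).trans ?_
      push_cast
      exact (mul_le_mul' le_rfl hf.norm_le).trans (le_mul_of_one_le_right (by positivity) (by
        simpa using ENNReal.rpow_le_rpow h1 hs'))

theorem Nik.shift (hf : Nik q s A f) (h : E3) : Nik q s A fun x => f (x + h) := by
  refine ⟨hf.periodic.shift h, stronglyMeasurable_shift hf.meas h, ?_, fun k => ?_⟩
  · rw [hf.periodic.eLpNorm_add_right hf.meas]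
    exact hf.norm_le
  · have : increment k (fun x => f (x + h)) = fun x => increment k f (x + h) := by
      ext x; simp [increment, add_right_comm]
    rw [this, (hf.periodic.increment k).eLpNorm_add_right (stronglyMeasurable_increment hf.meas k)]
    exact hf.incr_le k

/-- Products of functions in Nikolskii classes. -/
theorem Nik.bilin {g : E3 → G} (hf : Nik p s A f) (hg : Nik q s B g) [HolderTriple p q r]
    (hr : 1 ≤ r) (b : F → G → H) (hb : Continuous fun z : F × G => b z.1 z.2)
    (hadd : ∀ x y z, b (x - y) z = b x z - b y z) (hadd' : ∀ x y z, b x (y - z) = b x y - b x z)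
    (hn : ∀ x y, ‖b x y‖₊ ≤ 1 * ‖x‖₊ * ‖y‖₊) : Nik r s (2 * (A * B)) fun x => b (f x) (g x) := by
  have hbm : ∀ {f : E3 → F} {g : E3 → G}, StronglyMeasurable f → StronglyMeasurable g →
      StronglyMeasurable fun x => b (f x) (g x) := fun h1 h2 =>
    hb.comp_stronglyMeasurable (h1.prodMk h2)
  have key : ∀ {f : E3 → F} {g : E3 → G}, StronglyMeasurable f → StronglyMeasurable g →
      eLpNorm (fun x => b (f x) (g x)) r vol ≤
        eLpNorm f p vol * eLpNorm g q vol := fun h1 h2 => by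
    simpa using eLpNorm_le_eLpNorm_mul_eLpNorm_of_nnnorm (μ := vol) (r := r)
      h1.aestronglyMeasurable h2.aestronglyMeasurable b 1 (.of_forall fun x => hn _ _)
  refine ⟨hf.periodic.comp₂ hg.periodic _, hbm hf.meas hg.meas, ?_, fun h => ?_⟩
  · refine (key hf.meas hg.meas).trans ?_
    calc _ ≤ (A : ℝ≥0∞) * B := mul_le_mul' hf.norm_le hg.norm_le
      _ ≤ _ := by push_cast; rw [two_mul]; exact le_self_add
  · have e1 : increment h (fun x => b (f x) (g x)) =
        (fun x => b (f (x + h)) (increment h g x)) +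
          fun x => b (increment h f x) (g x) := by
      ext x
      simp [increment, hadd, hadd']
    rw [e1]
    have m1 := stronglyMeasurable_shift hf.meas h
    have m2 := stronglyMeasurable_increment hg.meas h
    have m3 := stronglyMeasurable_increment hf.meas h
    refine (eLpNorm_add_le (hbm m1 m2).aestronglyMeasurable (hbm m3 hg.meas).aestronglyMeasurable
      hr).trans ?_
    calc _ ≤ (A : ℝ≥0∞) * (B * ‖h‖ₑ ^ s) + A * ‖h‖ₑ ^ s * B := by
          refine add_le_add ((key m1 m2).trans ?_) ((key m3 hg.meas).trans ?_)
          · rw [hf.periodic.eLpNorm_add_right hf.meas]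
            exact mul_le_mul' hf.norm_le (hg.incr_le h)
          · exact mul_le_mul' (hf.incr_le h) hg.norm_le
      _ = _ := by push_cast; ring

theorem Nik.smul {f : E3 → ℝ} {g : E3 → G} (hf : Nik p s A f) (hg : Nik q s B g)
    [HolderTriple p q r] (hr : 1 ≤ r) : Nik r s (2 * (A * B)) fun x => f x • g x :=
  hf.bilin hg hr (· • ·) continuous_smul (fun _ _ _ => sub_smul _ _ _) (fun _ _ _ => smul_sub _ _ _)
    fun x y => by rw [one_mul]; exact nnnorm_smul_le x y

theorem Nik.inner {f g : E3 → E3} (hf : Nik p s A f) (hg : Nik q s B g)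
    [HolderTriple p q r] (hr : 1 ≤ r) : Nik r s (2 * (A * B)) fun x => ⟪f x, g x⟫_ℝ :=
  hf.bilin hg hr (fun x y => ⟪x, y⟫_ℝ) continuous_inner (fun _ _ _ => inner_sub_left _ _ _)
    (fun _ _ _ => inner_sub_right _ _ _) fun x y => by
      rw [one_mul]; exact nnnorm_inner_le_nnnorm x y

/-- Post-composition with a contractive linear map. -/
theorem Nik.clm (hf : Nik q s A f) (L : F →L[ℝ] G) (hL : ∀ x, ‖L x‖ ≤ ‖x‖) :
    Nik q s A fun x => L (f x) := by
  refine ⟨hf.periodic.comp _, L.continuous.comp_stronglyMeasurable hf.meas,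
    (eLpNorm_mono fun x => hL _).trans hf.norm_le, fun h => ?_⟩
  refine le_trans (eLpNorm_mono fun x => ?_) (hf.incr_le h)
  simp only [increment, ← map_sub]
  exact hL _

theorem Nik.coord {f : E3 → E3} (hf : Nik q s A f) (i : Fin 3) : Nik q s A fun x => f x i :=
  hf.clm (EuclideanSpace.proj i) fun x => by simpa using PiLp.norm_apply_le x i

/-- Bounded Lipschitz periodic functions. -/
theorem Nik.of_lipschitz (hf : IsPeriodic f) (hc : Continuous f) (hM : ∀ x, ‖f x‖ₑ ≤ M)
    (hL : ∀ x h, ‖f (x + h) - f x‖ₑ ≤ M * ‖h‖ₑ) (hs0 : 0 ≤ s) (hs : s ≤ 1) : Nik ⊤ s (2 * M) f := by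
  have : Nik ⊤ 1 M f := by
    refine ⟨hf, hc.stronglyMeasurable, ?_, fun h => ?_⟩
    · rw [eLpNorm_exponent_top]
      exact essSup_le_of_ae_le _ (.of_forall hM)
    · rw [eLpNorm_exponent_top, ENNReal.rpow_one]
      exact essSup_le_of_ae_le _ (.of_forall fun x => hL x h)
  exact this.lower (by simp) hs0 hs

protected theorem Nik.conv (hf : Nik q s A f) (hq : 1 ≤ q) (hk : IsKernel k) :
    Nik q s (massOf k * A) (conv k f) := by
  have hjm : ∀ g : E3 → F, StronglyMeasurable g →
      JMeas fun ξ x : E3 => g (x + ξ) := fun g hg =>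
    hg.comp_measurable (measurable_snd.add measurable_fst)
  refine ⟨hf.periodic.conv k, stronglyMeasurable_conv hk.continuous.measurable hf.meas, ?_,
    fun h => ?_⟩
  · refine (eLpNorm_integral_smul_le hk.continuous.measurable (hjm f hf.meas) hq (B := A)
      fun ξ _ => ?_).trans ?_
    · rw [hf.periodic.eLpNorm_add_right hf.meas]; exact hf.norm_le
    · push_cast; rw [hk.coe_massOf]
  · rw [increment_conv hk (hf.perInt hq)]
    refine (eLpNorm_integral_smul_le hk.continuous.measurable
      (hjm _ (stronglyMeasurable_increment hf.meas h)) hq (B := A * ‖h‖ₑ ^ s) fun ξ _ => ?_).trans ?_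
    · rw [(hf.periodic.increment h).eLpNorm_add_right (stronglyMeasurable_increment hf.meas h)]
      exact hf.incr_le h
    · push_cast; rw [hk.coe_massOf, mul_assoc]

theorem eLpNorm_osc_le (hk : IsKernel k) (hm : StronglyMeasurable f) (hq : 1 ≤ q) {B : ℝ≥0∞}
    (hB : ∀ ξ, k ξ ≠ 0 → eLpNorm (increment ξ f) q vol ≤ B) :
    eLpNorm (osc k f) q vol ≤ massOf k * B := by
  rw [hk.coe_massOf]
  refine eLpNorm_integral_smul_le hk.continuous.measurable (G := fun ξ => increment ξ f) ?_ hq hB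
  exact (hm.comp_measurable (measurable_snd.add measurable_fst)).sub
    (hm.comp_measurable measurable_snd)

protected theorem Nik.eLpNorm_osc_le (hf : Nik q s A f) (hq : 1 ≤ q) (hs : 0 ≤ s)
    (hk : IsKernel k) {ρ : ℝ≥0} (hρ : ∀ ξ, k ξ ≠ 0 → ‖ξ‖ₑ ≤ ρ) :
    eLpNorm (osc k f) q vol ≤ massOf k * (A * (ρ : ℝ≥0∞) ^ s) :=
  eLpNorm_osc_le hk hf.meas hq fun ξ hξ => (hf.incr_le ξ).trans (by
    gcongr
    exact hρ ξ hξ)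

theorem increment_increment (h ξ : E3) (f : E3 → F) :
    increment ξ (increment h f) = increment h (increment ξ f) := by
  ext x
  simp only [increment, add_right_comm x h ξ]
  abel

theorem increment_osc [CompleteSpace F] (hk : IsKernel k) (hf : PerInt f) (h : E3) :
    increment h (osc k f) = osc k (increment h f) := by
  ext x
  rw [osc_eq hk (hf.increment h), ← increment_conv hk hf]
  simp only [increment, osc_eq hk hf, smul_sub]
  abel

/-- Averaged increments at scale `ρ` gain a power of `ρ` in exchange for regularity. -/
protected theorem Nik.osc [CompleteSpace F] (hf : Nik q s A f) (hq : 1 ≤ q) (hκ : 0 ≤ κ)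
    (hκs : κ ≤ s) (hk : IsKernel k) {ρ : ℝ≥0} (hρ1 : ρ ≤ 1) (hρ : ∀ ξ, k ξ ≠ 0 → ‖ξ‖ₑ ≤ ρ) : Nik q (s - κ) (2 * massOf k * A * ρ ^ κ) (osc k f) := by
  have hs : 0 ≤ s := hκ.trans hκs
  have hosc : osc k f = fun x => conv k f x - (∫ ξ, k ξ) • f x := by
    ext x
    exact osc_eq hk (hf.perInt hq) x
  have hρκ : ((ρ ^ κ : ℝ≥0) : ℝ≥0∞) = (ρ : ℝ≥0∞) ^ κ := coe_rpow_of_nonneg _ hκ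
  refine ⟨?_, ?_, ?_, fun h => ?_⟩
  · rw [hosc]
    exact (hf.periodic.conv k).comp₂ hf.periodic fun a b => a - (∫ ξ, k ξ) • b
  · rw [hosc]
    exact (stronglyMeasurable_conv hk.continuous.measurable hf.meas).sub (hf.meas.const_smul _)
  · refine (hf.eLpNorm_osc_le hq hs hk hρ).trans ?_
    push_cast
    rw [hρκ]
    calc (massOf k : ℝ≥0∞) * (A * (ρ : ℝ≥0∞) ^ s) ≤ massOf k * (A * (ρ : ℝ≥0∞) ^ κ) := by
          refine mul_le_mul' le_rfl (mul_le_mul' le_rfl ?_)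
          exact ENNReal.rpow_le_rpow_of_exponent_ge (ENNReal.coe_le_one_iff.2 hρ1) hκs
      _ ≤ 2 * (massOf k * (A * (ρ : ℝ≥0∞) ^ κ)) := by rw [two_mul]; exact le_self_add
      _ = _ := by ring
  · rw [increment_osc hk (hf.perInt hq)]
    have hm := stronglyMeasurable_increment hf.meas h
    have h1 : eLpNorm (osc k (increment h f)) q vol ≤
        massOf k * (2 * (A * (ρ : ℝ≥0∞) ^ κ * ‖h‖ₑ ^ (s - κ))) := by
      refine eLpNorm_osc_le hk hm hq fun ξ hξ => ?_
      rcases le_total ‖h‖ₑ ρ with hle | hle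
      · refine ((hf.periodic.increment h).eLpNorm_increment_le hm hq ξ).trans ?_
        gcongr
        refine (hf.incr_le h).trans ?_
        rw [mul_assoc]
        gcongr
        calc ‖h‖ₑ ^ s = ‖h‖ₑ ^ κ * ‖h‖ₑ ^ (s - κ) := by
              rw [← rpow_add_of_nonneg _ _ hκ (by linarith)]; simp
          _ ≤ _ := by gcongr
      · rw [increment_increment]
        refine ((hf.periodic.increment ξ).eLpNorm_increment_le
          (stronglyMeasurable_increment hf.meas ξ) hq h).trans ?_
        gcongr
        refine (hf.incr_le ξ).trans ?_
        rw [mul_assoc]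
        gcongr
        calc ‖ξ‖ₑ ^ s ≤ (ρ : ℝ≥0∞) ^ s := by gcongr; exact hρ ξ hξ
          _ = (ρ : ℝ≥0∞) ^ κ * (ρ : ℝ≥0∞) ^ (s - κ) := by
              rw [← rpow_add_of_nonneg _ _ hκ (by linarith)]; simp
          _ ≤ _ := by gcongr
    refine h1.trans (le_of_eq ?_)
    push_cast
    rw [hρκ]
    ring

end Nikolskii

/-! ### Comparison of Sobolev–Slobodeckij norms and Nikolskii classes -/

section SobolevNikolskii

theorem eLpNorm_ofReal_eq {q : ℝ} (hq : 1 ≤ q) (f : E3 → F) :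
    eLpNorm f (ofReal q) vol = (∫⁻ x, ‖f x‖ₑ ^ q ∂vol) ^ (1 / q) := by
  have hq0 : 0 < q := by linarith
  rw [eLpNorm_eq_lintegral_rpow_enorm_toReal (by simpa using hq0) ENNReal.ofReal_ne_top,
    ENNReal.toReal_ofReal hq0.le]

theorem lintegral_rpow_le_of_eLpNorm_le {q : ℝ} (hq : 1 ≤ q) {B : ℝ≥0∞}
    (h : eLpNorm f (ofReal q) vol ≤ B) : ∫⁻ x, ‖f x‖ₑ ^ q ∂vol ≤ B ^ q := by
  have hq0 : 0 < q := by linarith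
  rw [eLpNorm_ofReal_eq hq] at h
  calc _ = ((∫⁻ x, ‖f x‖ₑ ^ q ∂vol) ^ (1 / q)) ^ q := by
        rw [← ENNReal.rpow_mul, one_div_mul_cancel hq0.ne', ENNReal.rpow_one]
    _ ≤ _ := by gcongr

theorem measurable_uncurry_increment (hm : StronglyMeasurable f) {q : ℝ} :
    Measurable fun z : E3 × E3 => ‖increment z.2 f z.1‖ₑ ^ q := by
  have : StronglyMeasurable fun z : E3 × E3 => increment z.2 f z.1 :=
    (hm.comp_measurable (measurable_fst.add measurable_snd)).sub (hm.comp_measurable measurable_fst)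
  exact this.enorm.pow_const _

theorem sobolevNorm_eq (hm : StronglyMeasurable f) (s q : ℝ) :
    sobolevNorm s q f = ((∫⁻ x, ‖f x‖ₑ ^ q ∂vol) +
      ∫⁻ h in centredCell, (∫⁻ x, ‖increment h f x‖ₑ ^ q ∂vol) / ‖h‖ₑ ^ (3 + s * q)) ^ (1 / q) := by
  rw [sobolevNorm, lintegral_lintegral_swap]
  · congr 2
    refine lintegral_congr fun h => ?_
    simp only [div_eq_mul_inv]
    exact lintegral_mul_const _ ((measurable_uncurry_increment hm).comp
      (measurable_id.prodMk measurable_const))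
  · exact ((measurable_uncurry_increment hm).div
      ((measurable_enorm.comp measurable_snd).pow_const _)).aemeasurable

theorem ball_subset_centredCell : ball (0 : E3) (1 / 2) ⊆ centredCell := by
  intro x hx i
  have := PiLp.norm_apply_le x i
  rw [norm_eq_abs] at this
  rw [mem_ball_zero_iff] at hx
  linarith

theorem centredCell_subset_ball : centredCell ⊆ ball (0 : E3) 1 := by
  intro x hx
  rw [mem_ball_zero_iff, EuclideanSpace.norm_eq, Real.sqrt_lt' one_pos, Fin.sum_univ_three]
  have h : ∀ i, ‖x i‖ ^ 2 ≤ 1 / 4 := fun i => by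
    have := hx i
    rw [norm_eq_abs]
    nlinarith [abs_nonneg (x i)]
  linarith [h 0, h 1, h 2]

theorem lintegral_centredCell_rpow_lt_top (hκ : 0 < κ) :
    ∫⁻ h in centredCell, ‖h‖ₑ ^ κ / ‖h‖ₑ ^ (3 : ℝ) < ⊤ := by
  have hint : IntegrableOn (fun x : E3 => ‖x‖ ^ (κ - 3)) (ball 0 1) := by
    rw [integrableOn_fun_norm_addHaar volume (f := fun y : ℝ => y ^ (κ - 3))]
    have h2 : IntegrableOn (fun y : ℝ => y ^ (κ - 1)) (Ioo 0 1) := by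
      rw [intervalIntegral.integrableOn_Ioo_rpow_iff one_pos]
      linarith
    refine h2.congr_fun (fun y hy => ?_) measurableSet_Ioo
    simp only [finrank_euclideanSpace, Fintype.card_fin, smul_eq_mul]
    rw [← rpow_natCast, ← rpow_add hy.1]
    congr 1
    push_cast
    ring
  refine lt_of_le_of_lt ?_ hint.2
  refine (lintegral_mono_set centredCell_subset_ball).trans (lintegral_mono fun x => ?_)
  rcases eq_or_ne x 0 with rfl | hx
  · simp [hκ]
  · have hx0 : ‖x‖ₑ ≠ 0 := by simpa using hx
    rw [← ENNReal.rpow_sub _ _ hx0 (by simp), enorm_of_nonneg (by positivity),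
      ← ENNReal.ofReal_rpow_of_pos (norm_pos_iff.2 hx), ofReal_norm]

/-- A Nikolskii class embeds in the Sobolev–Slobodeckij space of lower order. -/
theorem exists_sobolevNorm_le_of_nik {s κ q : ℝ} (hκ : 0 < κ) (hq : 1 ≤ q) :
    ∃ C : ℝ≥0, ∀ (f : E3 → F) (A : ℝ≥0), Nik (ofReal q) (s + κ) A f →
      sobolevNorm s q f ≤ C * A := by
  have hq0 : 0 < q := by linarith
  set Z := ∫⁻ h in centredCell, ‖h‖ₑ ^ (κ * q) / ‖h‖ₑ ^ (3 : ℝ)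
  have hZ : Z < ⊤ := lintegral_centredCell_rpow_lt_top (by positivity)
  refine ⟨((1 + Z) ^ (1 / q)).toNNReal, fun f A hf => ?_⟩
  rw [coe_toNNReal (rpow_ne_top_of_nonneg (by positivity) (by simp [hZ.ne])),
    sobolevNorm_eq hf.meas]
  have h1 := lintegral_rpow_le_of_eLpNorm_le hq hf.norm_le
  have h2 : ∀ h : E3, (∫⁻ x, ‖increment h f x‖ₑ ^ q ∂vol) / ‖h‖ₑ ^ (3 + s * q) ≤
      (A : ℝ≥0∞) ^ q * (‖h‖ₑ ^ (κ * q) / ‖h‖ₑ ^ (3 : ℝ)) := by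
    intro h
    rcases eq_or_ne h 0 with rfl | hh
    · simp [increment, hq0]
    have hx0 : ‖h‖ₑ ≠ 0 := by simpa using hh
    have h3 := lintegral_rpow_le_of_eLpNorm_le hq (hf.incr_le h)
    calc _ ≤ ((A : ℝ≥0∞) * ‖h‖ₑ ^ (s + κ)) ^ q / ‖h‖ₑ ^ (3 + s * q) := by gcongr
      _ = _ := by
        rw [mul_rpow_of_nonneg _ _ hq0.le, mul_div_assoc, ← ENNReal.rpow_mul,
          ← ENNReal.rpow_sub _ _ hx0 (by simp), ← ENNReal.rpow_sub _ _ hx0 (by simp)]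
        congr 2
        ring
  calc _ ≤ ((A : ℝ≥0∞) ^ q + ∫⁻ h in centredCell,
        (A : ℝ≥0∞) ^ q * (‖h‖ₑ ^ (κ * q) / ‖h‖ₑ ^ (3 : ℝ))) ^ (1 / q) := by
        gcongr with h
        exact h2 h
    _ = ((1 + Z) * (A : ℝ≥0∞) ^ q) ^ (1 / q) := by
        rw [lintegral_const_mul' _ _ (rpow_ne_top_of_nonneg hq0.le coe_ne_top)]
        ring_nf
        rfl
    _ = _ := by
        rw [mul_rpow_of_nonneg _ _ (by positivity), ← ENNReal.rpow_mul,
          mul_one_div_cancel hq0.ne', ENNReal.rpow_one]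

/-- The Sobolev–Slobodeckij space embeds in the Nikolskii class of the same order. -/
theorem exists_nik_of_sobolevNorm_le {s q : ℝ} (hs0 : 0 ≤ s) (hs1 : s ≤ 1) (hq : 1 ≤ q) :
    ∃ C : ℝ≥0, ∀ (f : E3 → F) (A : ℝ≥0), IsPeriodic f → StronglyMeasurable f →
      sobolevNorm s q f ≤ A → Nik (ofReal q) s (C * A) f := by
  have hq0 : 0 < q := by linarith
  set v : ℝ≥0∞ := volume (ball (0 : E3) 1)
  have hv0 : v ≠ 0 := (Metric.measure_ball_pos volume _ one_pos).ne'
  have hvt : v ≠ ⊤ := measure_ball_lt_top.ne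
  set a := 3 + s * q
  have ha : 0 ≤ a := by positivity
  set C₀ : ℝ≥0∞ := v⁻¹ * (2 ^ q * 2 ^ a)
  have hC₀ : C₀ ≠ ⊤ := by
    refine mul_ne_top (by simpa) (mul_ne_top ?_ ?_) <;>
    exact rpow_ne_top_of_nonneg (by positivity) (by simp)
  refine ⟨1 + 8 + (C₀ ^ (1 / q)).toNNReal, fun f A hp hm hA => ?_⟩
  set I : E3 → ℝ≥0∞ := fun h => ∫⁻ x, ‖increment h f x‖ₑ ^ q ∂vol with hI
  have hImeas : Measurable I := (measurable_uncurry_increment hm).lintegral_prod_left'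
  have hA' : (∫⁻ x, ‖f x‖ₑ ^ q ∂vol) + ∫⁻ h in centredCell, I h / ‖h‖ₑ ^ a ≤
      (A : ℝ≥0∞) ^ q := by
    rw [sobolevNorm_eq hm] at hA
    calc _ = (((∫⁻ x, ‖f x‖ₑ ^ q ∂vol) +
          ∫⁻ h in centredCell, I h / ‖h‖ₑ ^ a) ^ (1 / q)) ^ q := by
          rw [← ENNReal.rpow_mul, one_div_mul_cancel hq0.ne', ENNReal.rpow_one]
      _ ≤ _ := by gcongr
  have hnorm : eLpNorm f (ofReal q) vol ≤ A := by
    rw [eLpNorm_ofReal_eq hq]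
    calc _ ≤ ((A : ℝ≥0∞) ^ q) ^ (1 / q) := by
          gcongr
          exact le_self_add.trans hA'
      _ = A := by rw [← ENNReal.rpow_mul, mul_one_div_cancel hq0.ne', ENNReal.rpow_one]
  have hq' : 1 ≤ ofReal q := by simpa using hq
  refine ⟨hp, hm, hnorm.trans ?_, fun h => ?_⟩
  · push_cast
    rw [add_assoc, add_mul, one_mul]
    exact le_self_add
  rcases lt_or_ge (1 / 4) ‖h‖ with hh | hh
  · have h1 := eLpNorm_sub_le (stronglyMeasurable_shift hm h).aestronglyMeasurable
      hm.aestronglyMeasurable hq' (μ := vol)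
    refine h1.trans ?_
    rw [hp.eLpNorm_add_right hm, ← two_mul]
    have h4 : (1 : ℝ≥0∞) ≤ 4 * ‖h‖ₑ := by
      rw [← ofReal_norm, ← ENNReal.ofReal_one, show (4 : ℝ≥0∞) = ofReal 4 by simp,
        ← ENNReal.ofReal_mul (by norm_num)]
      exact ofReal_le_ofReal (by linarith)
    have h5 : (1 : ℝ≥0∞) ≤ 4 * ‖h‖ₑ ^ s := by
      calc (1 : ℝ≥0∞) ≤ (4 * ‖h‖ₑ) ^ s := by simpa using ENNReal.rpow_le_rpow h4 hs0
        _ = 4 ^ s * ‖h‖ₑ ^ s := mul_rpow_of_nonneg _ _ hs0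
        _ ≤ 4 ^ (1 : ℝ) * ‖h‖ₑ ^ s := by
            gcongr
            norm_num
        _ = _ := by simp
    calc 2 * eLpNorm f (ofReal q) vol ≤ 2 * A * 1 := by rw [mul_one]; gcongr
      _ ≤ 2 * A * (4 * ‖h‖ₑ ^ s) := by gcongr
      _ = 8 * A * ‖h‖ₑ ^ s := by ring
      _ ≤ _ := by
        push_cast
        gcongr
        rw [add_comm 1 8, add_assoc]
        exact le_self_add
  · rcases eq_or_ne h 0 with rfl | hne
    · have : increment (0 : E3) f = fun _ => 0 := by ext; simp [increment]
      simp [this]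
    set ρ := ‖h‖ₑ with hρ
    have hρ0 : ρ ≠ 0 := by simpa [hρ] using hne
    have hρt : ρ ≠ ⊤ := by simp [hρ]
    have hpos : 0 < ‖h‖ := norm_pos_iff.2 hne
    have hW : ∫⁻ k in ball (0 : E3) (2 * ‖h‖), I k ≤ (2 * ρ) ^ a * (A : ℝ≥0∞) ^ q := by
      calc _ ≤ ∫⁻ k in ball (0 : E3) (2 * ‖h‖), (2 * ρ) ^ a * (I k / ‖k‖ₑ ^ a) := by
            refine setLIntegral_mono' measurableSet_ball fun k hk => ?_
            rcases eq_or_ne k 0 with rfl | hk0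
            · simp [I, increment, hq0]
            have hkρ : ‖k‖ₑ ≤ 2 * ρ := by
              have e2 : 2 * ρ = ofReal (2 * ‖h‖) := by
                rw [ENNReal.ofReal_mul (by norm_num), ofReal_norm]
                simp [hρ]
              rw [e2, ← ofReal_norm]
              exact ofReal_le_ofReal (mem_ball_zero_iff.1 hk).le
            have hk1 : ‖k‖ₑ ^ a ≠ 0 := by simp [hk0]
            have hk2 : ‖k‖ₑ ^ a ≠ ⊤ := rpow_ne_top_of_nonneg ha (by simp)
            calc I k = ‖k‖ₑ ^ a * (I k / ‖k‖ₑ ^ a) := (ENNReal.mul_div_cancel hk1 hk2).symm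
              _ ≤ _ := by gcongr
        _ ≤ ∫⁻ k in centredCell, (2 * ρ) ^ a * (I k / ‖k‖ₑ ^ a) :=
            lintegral_mono_set ((Metric.ball_subset_ball (by linarith)).trans
              ball_subset_centredCell)
        _ = (2 * ρ) ^ a * ∫⁻ k in centredCell, I k / ‖k‖ₑ ^ a :=
            lintegral_const_mul' _ _ (rpow_ne_top_of_nonneg ha
              (mul_ne_top (by simp) hρt))
        _ ≤ _ := by
            gcongr
            exact le_add_self.trans hA'
    have htri : ∀ k, I h ≤ 2 ^ (q - 1) * (I k + I (k - h)) := by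
      intro k
      have hsh : I (k - h) = ∫⁻ x, ‖f (x + k) - f (x + h)‖ₑ ^ q ∂vol := by
        change ∫⁻ x, ‖increment (k - h) f x‖ₑ ^ q ∂vol = _
        rw [← ((hp.increment (k - h)).comp fun y => ‖y‖ₑ ^ q).lintegral_add_right h]
        simp [increment, add_assoc]
      rw [hsh, hI]
      simp only
      rw [← lintegral_add_left' (((stronglyMeasurable_increment hm k).enorm.pow_const q).aemeasurable),
        ← lintegral_const_mul' _ _ (rpow_ne_top_of_nonneg (by linarith) (by simp))]
      refine lintegral_mono fun x => ?_
      calc ‖increment h f x‖ₑ ^ q = ‖increment k f x - (f (x + k) - f (x + h))‖ₑ ^ q := by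
            simp [increment]
        _ ≤ (‖increment k f x‖ₑ + ‖f (x + k) - f (x + h)‖ₑ) ^ q := by
            gcongr
            exact enorm_sub_le
        _ ≤ _ := ENNReal.rpow_add_le_mul_rpow_add_rpow _ _ hq
    have hvol : volume (ball (0 : E3) ‖h‖) = ρ ^ (3 : ℝ) * v := by
      rw [Measure.addHaar_ball _ _ (norm_nonneg h)]
      simp only [finrank_euclideanSpace, Fintype.card_fin]
      rw [ENNReal.ofReal_pow (norm_nonneg h), ofReal_norm]
      norm_cast
    have hmain : ρ ^ (3 : ℝ) * v * I h ≤ 2 ^ q * ((2 * ρ) ^ a * (A : ℝ≥0∞) ^ q) := by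
      calc ρ ^ (3 : ℝ) * v * I h = ∫⁻ k in ball (0 : E3) ‖h‖, I h := by
            rw [setLIntegral_const, hvol, mul_comm]
        _ ≤ ∫⁻ k in ball (0 : E3) ‖h‖, 2 ^ (q - 1) * (I k + I (k - h)) :=
            lintegral_mono fun k => htri k
        _ = 2 ^ (q - 1) * ((∫⁻ k in ball (0 : E3) ‖h‖, I k) +
              ∫⁻ k in ball (0 : E3) ‖h‖, I (k - h)) := by
            rw [lintegral_const_mul' _ _ (rpow_ne_top_of_nonneg (by linarith) (by simp)),
              lintegral_add_left' hImeas.aemeasurable]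
        _ ≤ 2 ^ (q - 1) * ((∫⁻ k in ball (0 : E3) (2 * ‖h‖), I k) +
              ∫⁻ k in ball (0 : E3) (2 * ‖h‖), I k) := by
            refine mul_le_mul' le_rfl (add_le_add ?_ ?_)
            · exact lintegral_mono_set (Metric.ball_subset_ball (by linarith))
            · rw [← lintegral_indicator measurableSet_ball, ← lintegral_indicator measurableSet_ball,
                ← lintegral_sub_right_eq_self
                  ((ball (0 : E3) (2 * ‖h‖)).indicator fun k => I k) h]
              refine lintegral_mono fun k => ?_
              by_cases hk : k ∈ ball (0 : E3) ‖h‖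
              · have : k - h ∈ ball (0 : E3) (2 * ‖h‖) := by
                  rw [mem_ball_zero_iff] at hk ⊢
                  linarith [norm_sub_le k h]
                rw [Set.indicator_of_mem hk, Set.indicator_of_mem this]
              · simp [hk]
        _ ≤ 2 ^ (q - 1) * ((2 * ρ) ^ a * (A : ℝ≥0∞) ^ q + (2 * ρ) ^ a * (A : ℝ≥0∞) ^ q) := by
            gcongr
        _ = (2 ^ (q - 1) * 2 ^ (1 : ℝ)) * ((2 * ρ) ^ a * (A : ℝ≥0∞) ^ q) := by
            rw [← two_mul, ENNReal.rpow_one, mul_assoc]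
        _ = _ := by
            rw [← rpow_add_of_nonneg _ _ (by linarith) zero_le_one, sub_add_cancel]
    have hIh : I h ≤ C₀ * (ρ ^ (s * q) * (A : ℝ≥0∞) ^ q) := by
      have hρ3 : ρ ^ (3 : ℝ) ≠ 0 := by simp [hρ0]
      have hρ3t : ρ ^ (3 : ℝ) ≠ ⊤ := rpow_ne_top_of_nonneg (by norm_num) hρt
      have hc : ρ ^ (3 : ℝ) * v * I h ≤
          (ρ ^ (3 : ℝ) * v) * (C₀ * (ρ ^ (s * q) * (A : ℝ≥0∞) ^ q)) := by
        refine hmain.trans (le_of_eq ?_)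
        rw [mul_rpow_of_nonneg _ _ ha, rpow_add_of_nonneg (x := ρ) 3 (s * q) (by norm_num : (0 : ℝ) ≤ 3)
          (by positivity)]
        calc _ = (v * v⁻¹) * (2 ^ q * (2 ^ a * (ρ ^ (3 : ℝ) * ρ ^ (s * q)) * (A : ℝ≥0∞) ^ q)) := by
              rw [ENNReal.mul_inv_cancel hv0 hvt, one_mul]
          _ = _ := by ring
      exact (ENNReal.mul_le_mul_iff_right (mul_ne_zero hρ3 hv0) (mul_ne_top hρ3t hvt)).1 hc
    rw [eLpNorm_ofReal_eq hq]
    clear_value C₀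
    calc (I h) ^ (1 / q) ≤ (C₀ * (ρ ^ (s * q) * (A : ℝ≥0∞) ^ q)) ^ (1 / q) := by gcongr
      _ = C₀ ^ (1 / q) * (ρ ^ s * A) := by
          rw [mul_rpow_of_nonneg C₀ _ (by positivity),
            mul_rpow_of_nonneg _ _ (by positivity), ← ENNReal.rpow_mul, ← ENNReal.rpow_mul,
            mul_one_div_cancel hq0.ne', ENNReal.rpow_one, mul_assoc, mul_one_div_cancel hq0.ne',
            mul_one]
      _ = C₀ ^ (1 / q) * A * ρ ^ s := by ring
      _ ≤ _ := by
          push_cast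
          rw [coe_toNNReal (rpow_ne_top_of_nonneg (by positivity) hC₀)]
          gcongr
          exact le_add_self

end SobolevNikolskii

/-! ### Smooth kernels and their dilates -/

section SmoothKernels

/-- The `i`-th partial derivative. -/
def pd (i : Fin 3) (f : E3 → F) (x : E3) : F := fderiv ℝ f x (e i)

theorem norm_e (i : Fin 3) : ‖e i‖ = 1 := by simp [e]

theorem contDiff_pd (hf : ContDiff ℝ (⊤ : ℕ∞) f) (i : Fin 3) : ContDiff ℝ (⊤ : ℕ∞) (pd i f) :=
  (hf.fderiv_right (m := (⊤ : ℕ∞)) (by simp)).clm_apply contDiff_const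

protected theorem IsPeriodic.pd (hf : IsPeriodic f) (i : Fin 3) : IsPeriodic (pd i f) := by
  intro x j
  have h1 := fderiv_comp_add_right (𝕜 := ℝ) (f := f) (x := x) (e j)
  rw [show (fun y => f (y + e j)) = f from funext fun y => hf y j] at h1
  change fderiv ℝ f (x + e j) (e i) = fderiv ℝ f x (e i)
  rw [← h1]

protected theorem IsKernel.pd (hk : IsKernel k) (i : Fin 3) : IsKernel (pd i k) :=
  ⟨contDiff_pd hk.smooth i, (hk.compact.fderiv (𝕜 := ℝ)).comp_left (g := fun L : E3 →L[ℝ] ℝ => L (e i))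
    (by simp)⟩

theorem IsKernel.integral_pd (hk : IsKernel k) (i : Fin 3) : ∫ ξ, pd i k ξ = 0 := by
  have h := integral_mul_fderiv_eq_neg_fderiv_mul_of_integrable (μ := (volume : Measure E3))
    (f := fun _ => (1 : ℝ)) (g := k) (v := e i) (by simp)
    (by simp only [one_mul]; exact (hk.pd i).integrable) (by simpa using hk.integrable)
    (fun _ _ => differentiableAt_const _)
    (fun x _ => hk.smooth.differentiable (by simp) x)
  simpa [pd] using h

protected theorem IsKernel.dilate (hk : IsKernel k) (hε : 0 < ε) : IsKernel (dilate k ε) := by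
  refine ⟨contDiff_const.mul (hk.smooth.comp (contDiff_const_smul _)), ?_⟩
  have h1 : HasCompactSupport fun x : E3 => k (ε⁻¹ • x) :=
    hk.compact.comp_homeomorph (Homeomorph.smulOfNeZero ε⁻¹ (inv_ne_zero hε.ne'))
  exact h1.mul_left

theorem pd_dilate (hk : IsKernel k) (i : Fin 3) :
    pd i (dilate k ε) = fun x => ε⁻¹ * dilate (pd i k) ε x := by
  ext x
  have h1 : HasFDerivAt (fun y : E3 => k (ε⁻¹ • y)) ((fderiv ℝ k (ε⁻¹ • x)).comp
      (ε⁻¹ • ContinuousLinearMap.id ℝ E3)) x :=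
    HasFDerivAt.comp x (hk.smooth.differentiable (by simp) _).hasFDerivAt
      ((hasFDerivAt_id x).const_smul ε⁻¹)
  have h2 := h1.const_mul ((ε ^ 3)⁻¹)
  change fderiv ℝ (fun y => (ε ^ 3)⁻¹ * k (ε⁻¹ • y)) x (e i) = _
  rw [h2.fderiv]
  simp [dilate, pd]
  ring

theorem integral_dilate (k : E3 → ℝ) (hε : 0 < ε) : ∫ x, dilate k ε x = ∫ x, k x := by
  simp only [dilate]
  rw [integral_const_mul, Measure.integral_comp_inv_smul_of_nonneg _ _ hε.le]
  simp only [finrank_euclideanSpace, Fintype.card_fin, smul_eq_mul]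
  field_simp

theorem massOf_dilate (hk : IsKernel k) (hε : 0 < ε) : massOf (dilate k ε) = massOf k := by
  have h : ∀ l : E3 → ℝ, IsKernel l → (massOf l : ℝ) = ∫ x, ‖l x‖ := fun l hl => by
    rw [integral_norm_eq_lintegral_enorm hl.integrable.1]
    rfl
  rw [← NNReal.coe_inj, h _ (hk.dilate hε), h _ hk, ← integral_dilate (fun x => ‖k x‖) hε]
  refine integral_congr_fun fun x => ?_
  simp [dilate, abs_of_pos hε]

theorem massOf_const_mul (c : ℝ) : massOf (fun x => c * k x) = ‖c‖₊ * massOf k := by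
  simp only [massOf, enorm_mul]
  rw [lintegral_const_mul' _ _ (by simp)]
  simp

theorem dilate_ne_zero {R : ℝ≥0} (hR : ∀ ξ, k ξ ≠ 0 → ‖ξ‖ₑ ≤ R) (hε : 0 < ε) (ξ : E3)
    (h : dilate k ε ξ ≠ 0) : ‖ξ‖ₑ ≤ (ε.toNNReal * R : ℝ≥0) := by
  have h1 : k (ε⁻¹ • ξ) ≠ 0 := by
    intro h0
    simp [dilate, h0] at h
  have h2 := hR _ h1
  rw [enorm_smul] at h2
  have h3 : ξ = ε • (ε⁻¹ • ξ) := by rw [smul_inv_smul₀ hε.ne']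
  have h4 : ‖ε‖ₑ = (ε.toNNReal : ℝ≥0∞) := by rw [enorm_of_nonneg hε.le]; rfl
  calc ‖ξ‖ₑ = ‖ε‖ₑ * (‖ε⁻¹‖ₑ * ‖ξ‖ₑ) := by
        conv_lhs => rw [h3]
        rw [enorm_smul, enorm_smul]
    _ ≤ ‖ε‖ₑ * R := by gcongr
    _ = _ := by rw [h4]; push_cast; rfl

theorem IsKernel.exists_radius (hk : IsKernel k) : ∃ R : ℝ≥0, ∀ ξ, k ξ ≠ 0 → ‖ξ‖ₑ ≤ R := by
  obtain ⟨R, hR⟩ := hk.compact.isBounded.exists_norm_le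
  refine ⟨R.toNNReal, fun ξ hξ => ?_⟩
  rw [← ofReal_norm]
  exact ofReal_le_ofReal (hR ξ (subset_tsupport k hξ))

theorem pd_ne_zero {R : ℝ≥0} (hR : ∀ ξ, k ξ ≠ 0 → ‖ξ‖ₑ ≤ R) (i : Fin 3) (ξ : E3)
    (h : pd i k ξ ≠ 0) : ‖ξ‖ₑ ≤ R := by
  have h1 : tsupport k ⊆ {ξ | ‖ξ‖ₑ ≤ R} :=
    closure_minimal (fun ξ hξ => hR ξ hξ) (isClosed_le continuous_enorm continuous_const)
  have h2 : ξ ∈ Function.support (fderiv ℝ k) := by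
    intro h0
    exact h (by simp [pd, h0])
  exact h1 (support_fderiv_subset ℝ h2)

/-- Even kernels of integral one. -/
structure IsUnitKernel (k : E3 → ℝ) : Prop extends IsKernel k where
  even : ∀ x, k (-x) = k x
  integral_eq : ∫ x, k x = 1

theorem IsMollifier.isUnitKernel (hk : IsMollifier k) : IsUnitKernel k :=
  ⟨⟨hk.smooth, hk.compactSupport⟩, fun x => hk.radial _ _ (norm_neg x), hk.integral_eq_one⟩

protected theorem IsUnitKernel.dilate (hk : IsUnitKernel k) (hε : 0 < ε) :
    IsUnitKernel (dilate k ε) :=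
  ⟨hk.toIsKernel.dilate hε, fun x => by simp [dilate, hk.even],
    by rw [integral_dilate k hε, hk.integral_eq]⟩

/-- A fixed smooth bump supported in the unit ball. -/
def stdBump : ContDiffBump (0 : E3) := ⟨1 / 2, 1, by norm_num, by norm_num⟩

/-- A fixed even nonnegative unit kernel supported in the unit ball. -/
def stdKernel : E3 → ℝ := stdBump.normed volume

theorem isUnitKernel_stdKernel : IsUnitKernel stdKernel :=
  ⟨⟨stdBump.contDiff_normed, stdBump.hasCompactSupport_normed⟩, stdBump.normed_neg,
    stdBump.integral_normed⟩

theorem stdKernel_radius (ξ : E3) (h : stdKernel ξ ≠ 0) : ‖ξ‖ₑ ≤ (1 : ℝ≥0) := by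
  have h1 : ξ ∈ Function.support (stdBump.normed volume) := h
  rw [stdBump.support_normed_eq, mem_ball_zero_iff] at h1
  rw [← ofReal_norm]
  have : ofReal ‖ξ‖ ≤ ofReal 1 := ofReal_le_ofReal h1.le
  simpa using this

end SmoothKernels

/-! ### Smoothness of correlations -/

section SmoothConv

theorem conv_eq_convolution (k : E3 → ℝ) (f : E3 → F) :
    conv k f = convolution f (fun x => k (-x)) (ContinuousLinearMap.lsmul ℝ ℝ (E := F)).flip
      volume := by
  ext x
  rw [convolution_def, conv, ← integral_sub_right_eq_self _ x]
  simp

theorem IsKernel.comp_neg (hk : IsKernel k) : IsKernel fun x => k (-x) :=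
  ⟨hk.smooth.comp contDiff_neg, hk.compact.comp_homeomorph (Homeomorph.neg E3)⟩

theorem contDiff_conv (hk : IsKernel k) (hf : PerInt f) : ContDiff ℝ (⊤ : ℕ∞) (conv k f) := by
  rw [conv_eq_convolution]
  exact hk.comp_neg.compact.contDiff_convolution_right _
    (hf.periodic.locallyIntegrable hf.meas hf.integrable) hk.comp_neg.smooth

theorem pd_conv (hk : IsKernel k) (hf : PerInt f) (i : Fin 3) (x : E3) : pd i (conv k f) x = -conv (pd i k) f x := by
  have hloc := hf.periodic.locallyIntegrable hf.meas hf.integrable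
  have h1 := hk.comp_neg.compact.hasFDerivAt_convolution_right
    (ContinuousLinearMap.lsmul ℝ ℝ (E := F)).flip hloc (hk.comp_neg.smooth.of_le (by simp)) x
  rw [pd, conv_eq_convolution, h1.fderiv, convolution_precompR_apply _ hloc
    (hk.comp_neg.compact.fderiv (𝕜 := ℝ)) (hk.comp_neg.smooth.continuous_fderiv (by simp)),
    conv_eq_convolution, convolution_def, convolution_def, ← integral_neg]
  refine integral_congr_fun fun t => ?_
  have h2 : HasFDerivAt (fun y : E3 => k (-y)) ((fderiv ℝ k (-(x - t))).comp
      (-ContinuousLinearMap.id ℝ E3)) (x - t) :=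
    HasFDerivAt.comp (x - t) (hk.smooth.differentiable (by simp) _).hasFDerivAt
      ((hasFDerivAt_id (x - t)).neg)
  simp [h2.fderiv, pd]

theorem conv_pd (hk : IsKernel k) {f : E3 → ℝ} (hf : ContDiff ℝ (⊤ : ℕ∞) f) (i : Fin 3) (x : E3) : conv k (pd i f) x = -conv (pd i k) f x := by
  have hfx : ContDiff ℝ (⊤ : ℕ∞) fun ξ => f (x + ξ) := hf.comp (contDiff_const.add contDiff_id)
  have hd : ∀ ξ, fderiv ℝ (fun ξ => f (x + ξ)) ξ = fderiv ℝ f (x + ξ) := fun ξ => by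
    simp [fderiv_comp_add_left]
  have hint : ∀ (a : E3 → ℝ) (b : E3 → ℝ), IsKernel a → Continuous b →
      Integrable fun ξ => a ξ * b ξ := fun a b ha hb =>
    (ha.continuous.mul hb).integrable_of_hasCompactSupport ha.compact.mul_right
  have hb : Continuous fun ξ => pd i f (x + ξ) :=
    (contDiff_pd hf i).continuous.comp (continuous_const.add continuous_id)
  have h := integral_mul_fderiv_eq_neg_fderiv_mul_of_integrable (μ := (volume : Measure E3))
    (f := k) (g := fun ξ => f (x + ξ)) (v := e i)
    (hint _ _ (hk.pd i) hfx.continuous)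
    (by simp only [hd]; exact hint _ _ hk hb)
    (hint _ _ hk hfx.continuous)
    (fun x _ => hk.smooth.differentiable (by simp) x)
    (fun x _ => hfx.differentiable (by simp) x)
  simp only [hd] at h
  exact h

end SmoothConv

/-! ### The algebra of smooth periodic functions -/

section SmoothPeriodic

/-- The algebra `C^∞(𝕋³)`. -/
def smoothPerAlg : Subalgebra ℝ (E3 → ℝ) where
  carrier := {f | ContDiff ℝ (⊤ : ℕ∞) f ∧ IsPeriodic f}
  mul_mem' := fun hf hg => ⟨hf.1.mul hg.1, hf.2.comp₂ hg.2 (· * ·)⟩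
  add_mem' := fun hf hg => ⟨hf.1.add hg.1, hf.2.comp₂ hg.2 (· + ·)⟩
  algebraMap_mem' := fun _ => ⟨contDiff_const, fun _ _ => rfl⟩

/-- Smooth scalar functions on the torus. -/
abbrev SmoothPer : Type := smoothPerAlg

theorem SmoothPer.contDiff (f : SmoothPer) : ContDiff ℝ (⊤ : ℕ∞) f.1 := f.2.1

theorem SmoothPer.periodic (f : SmoothPer) : IsPeriodic f.1 := f.2.2

theorem SmoothPer.continuous (f : SmoothPer) : Continuous f.1 := f.contDiff.continuous

theorem SmoothPer.differentiableAt (f : SmoothPer) (x : E3) : DifferentiableAt ℝ f.1 x :=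
  f.contDiff.differentiable (by simp) x

theorem isBounded_cell : Bornology.IsBounded cell := by
  rw [cell_eq_fundamentalDomain]
  exact ZSpan.fundamentalDomain_isBounded stdBasis

theorem IsPeriodic.apply_cellFract (hf : IsPeriodic f) (x : E3) : f (cellFract x) = f x := by
  have h : x = ((⌊x 0⌋ • stdBasis 0 + (⌊x 1⌋ • stdBasis 1 + ⌊x 2⌋ • stdBasis 2) : E3) +
      cellFract x : E3) := by
    ext i
    simp only [stdBasis_apply]
    fin_cases i <;> simp [e, cellFract]
  have hm : (⌊x 0⌋ • stdBasis 0 + (⌊x 1⌋ • stdBasis 1 + ⌊x 2⌋ • stdBasis 2) : E3) ∈ latticeZ := by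
    have hb : ∀ i, stdBasis i ∈ latticeZ := fun i => Submodule.subset_span ⟨i, rfl⟩
    exact add_mem (Submodule.smul_mem _ _ (hb 0))
      (add_mem (Submodule.smul_mem _ _ (hb 1)) (Submodule.smul_mem _ _ (hb 2)))
  conv_rhs => rw [h]
  exact (hf.vadd_lattice ⟨_, hm⟩ (cellFract x)).symm

theorem IsPeriodic.exists_bound (hf : IsPeriodic f) (hc : Continuous f) : ∃ C : ℝ≥0, ∀ x, ‖f x‖ₑ ≤ C := by
  obtain ⟨C, hC⟩ := (isBounded_cell.isCompact_closure).exists_bound_of_continuousOn hc.continuousOn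
  refine ⟨C.toNNReal, fun x => ?_⟩
  rw [← hf.apply_cellFract x, ← ofReal_norm]
  exact ofReal_le_ofReal (hC _ (subset_closure (cellFract_mem x)))

theorem IsPeriodic.perInt_of_continuous (hf : IsPeriodic f) (hc : Continuous f) : PerInt f := by
  refine ⟨hf, hc.stronglyMeasurable, hc.stronglyMeasurable.aestronglyMeasurable, ?_⟩
  obtain ⟨C, hC⟩ := hf.exists_bound hc
  exact (lintegral_mono hC).trans_lt (by simp)

theorem SmoothPer.perInt (f : SmoothPer) : PerInt f.1 := f.periodic.perInt_of_continuous f.continuous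

theorem SmoothPer.integrable (f : SmoothPer) : Integrable f.1 vol := f.perInt.integrable

/-- Partial derivatives on `C^∞(𝕋³)`. -/
def SmoothPer.D (i : Fin 3) : SmoothPer →ₗ[ℝ] SmoothPer where
  toFun f := ⟨pd i f.1, contDiff_pd f.contDiff i, f.periodic.pd i⟩
  map_add' f g := by
    ext x
    simp only [pd, Subalgebra.coe_add, Pi.add_apply]
    rw [fderiv_add (f.differentiableAt x) (g.differentiableAt x)]
    rfl
  map_smul' c f := by
    ext x
    simp only [pd, Subalgebra.coe_smul, Pi.smul_apply, RingHom.id_apply]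
    rw [fderiv_const_smul (f.differentiableAt x)]
    rfl

/-- Integration over the torus. -/
def cInt : SmoothPer →ₗ[ℝ] ℝ where
  toFun f := ∫ x, f.1 x ∂vol
  map_add' f g := integral_add f.integrable g.integrable
  map_smul' c _ := integral_const_mul c _

theorem cInt_apply (f : SmoothPer) : cInt f = ∫ x, f.1 x ∂vol := rfl

namespace SmoothPer

theorem D_apply (i : Fin 3) (f : SmoothPer) (x : E3) : (D i f).1 x = fderiv ℝ f.1 x (e i) := rfl

theorem D_mul (i : Fin 3) (f g : SmoothPer) : D i (f * g) = D i f * g + f * D i g := by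
  ext x
  change fderiv ℝ (f.1 * g.1) x (e i) = _
  rw [fderiv_mul (f.differentiableAt x) (g.differentiableAt x)]
  simp [D_apply]
  ring

theorem D_comm (i j : Fin 3) (f : SmoothPer) : D i (D j f) = D j (D i f) := by
  ext x
  have hd : Differentiable ℝ (fderiv ℝ f.1) :=
    (f.contDiff.fderiv_right (m := (⊤ : ℕ∞)) (by simp)).differentiable (by simp)
  have h1 : ∀ v w : E3, fderiv ℝ (fun y => fderiv ℝ f.1 y v) x w =
      fderiv ℝ (fderiv ℝ f.1) x w v := fun v w => by
    rw [fderiv_clm_apply (hd x) (differentiableAt_const v)]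
    simp
  change fderiv ℝ (fun y => fderiv ℝ f.1 y (e j)) x (e i) =
    fderiv ℝ (fun y => fderiv ℝ f.1 y (e i)) x (e j)
  rw [h1, h1]
  exact (f.contDiff.contDiffAt.isSymmSndFDerivAt (by
    simp only [minSmoothness_of_isRCLikeNormedField]
    exact WithTop.coe_le_coe.2 (le_top : (2 : ℕ∞) ≤ ⊤))) _ _

theorem cInt_D (i : Fin 3) (f : SmoothPer) : cInt (D i f) = 0 := by
  have h1 : ∀ x, ∫ s in (0 : ℝ)..1, (D i f).1 (x + s • e i) = 0 := by
    intro x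
    have hder : ∀ s : ℝ, HasDerivAt (fun s : ℝ => f.1 (x + s • e i)) ((D i f).1 (x + s • e i)) s := by
      intro s
      have h2 : HasDerivAt (fun s : ℝ => x + s • e i) (e i) s := by
        simpa using ((hasDerivAt_id s).smul_const (e i)).const_add x
      exact (f.differentiableAt _).hasFDerivAt.comp_hasDerivAt s h2
    rw [intervalIntegral.integral_eq_sub_of_hasDerivAt (fun s _ => hder s)]
    · simp [f.periodic x i]
    · exact (Continuous.intervalIntegrable (by
        exact (D i f).continuous.comp (by fun_prop)) _ _)
  have h2 : ∫ x, (∫ s in (0 : ℝ)..1, (D i f).1 (x + s • e i)) ∂vol = 0 := by simp [h1]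
  simp only [intervalIntegral.integral_of_le zero_le_one] at h2
  rw [integral_integral_swap] at h2
  · simp only [(D i f).periodic.integral_add_right] at h2
    simpa [cInt_apply] using h2
  · obtain ⟨C, hC⟩ := (D i f).periodic.exists_bound (D i f).continuous
    refine Integrable.of_bound (C := C) ?_ (.of_forall fun z => ?_)
    · exact ((D i f).continuous.comp (by fun_prop :
        Continuous fun z : E3 × ℝ => z.1 + z.2 • e i)).aestronglyMeasurable
    · have := hC (z.1 + z.2 • e i)
      rw [← ofReal_norm] at this
      exact (ENNReal.ofReal_le_iff_le_toReal coe_ne_top).1 this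

theorem cInt_mul_D (i : Fin 3) (f g : SmoothPer) : cInt (f * D i g) = -cInt (D i f * g) := by
  have h := cInt_D i (f * g)
  rw [D_mul, map_add] at h
  linarith

/-- The mollification of an integrable periodic function. -/
def mol (hk : IsKernel k) {f : E3 → ℝ} (hf : PerInt f) : SmoothPer :=
  ⟨conv k f, contDiff_conv hk hf, hf.periodic.conv k⟩

/-- Correlation with a kernel on `C^∞(𝕋³)`. -/
def J (hk : IsKernel k) : SmoothPer →ₗ[ℝ] SmoothPer where
  toFun f := mol hk f.perInt
  map_add' f g := by
    ext x
    exact conv_add_apply hk f.perInt g.perInt x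
  map_smul' c f := by
    ext x
    simp only [mol, conv, Subalgebra.coe_smul, Pi.smul_apply, RingHom.id_apply, smul_eq_mul]
    rw [← integral_const_mul]
    congr 1
    ext ξ
    ring

theorem J_apply (hk : IsKernel k) (f : SmoothPer) (x : E3) : (J hk f).1 x = conv k f.1 x := rfl

theorem D_J (hk : IsKernel k) (i : Fin 3) (f : SmoothPer) : D i (J hk f) = J hk (D i f) := by
  ext x
  exact (pd_conv hk f.perInt i x).trans (conv_pd hk f.contDiff i x).symm

theorem D_mol (hk : IsKernel k) (i : Fin 3) {f : E3 → ℝ} (hf : PerInt f) :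
    D i (mol hk hf) = -mol (hk.pd i) hf := by
  ext x
  exact pd_conv hk hf i x

theorem J_pd (hk : IsKernel k) (i : Fin 3) (f : SmoothPer) : J (hk.pd i) f = -D i (J hk f) := by
  ext x
  have := pd_conv hk f.perInt i x
  change conv (pd i k) f.1 x = -pd i (conv k f.1) x
  rw [this, neg_neg]

end SmoothPer

/-- Correlation with `k` and correlation with its reflection are adjoint. -/
theorem integral_conv_mul (hk : IsKernel k) {f g : E3 → ℝ} (hf : PerInt f) (hg : IsPeriodic g)
    (hgc : Continuous g) : ∫ x, conv k f x * g x ∂vol =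
      ∫ x, f x * conv (fun ξ => k (-ξ)) g x ∂vol := by
  obtain ⟨C, hC⟩ := hg.exists_bound hgc
  have hm : StronglyMeasurable fun z : E3 × E3 => f (z.1 + z.2) :=
    hf.meas.comp_measurable (measurable_fst.add measurable_snd)
  have hkm : StronglyMeasurable fun z : E3 × E3 => k z.2 :=
    (hk.continuous.comp continuous_snd).stronglyMeasurable
  have hI1 : Integrable (fun z : E3 × E3 => k z.2 * f (z.1 + z.2) * g z.1)
      (vol.prod volume) := by
    have hms : StronglyMeasurable fun z : E3 × E3 => k z.2 * f (z.1 + z.2) * g z.1 :=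
      (hkm.mul hm).mul (hgc.comp continuous_fst).stronglyMeasurable
    refine ⟨hms.aestronglyMeasurable, ?_⟩
    rw [HasFiniteIntegral, lintegral_prod_symm _ hms.enorm.aemeasurable]
    calc ∫⁻ ξ, ∫⁻ x, ‖k ξ * f (x + ξ) * g x‖ₑ ∂vol
        ≤ ∫⁻ ξ, ‖k ξ‖ₑ * ((∫⁻ x, ‖f x‖ₑ ∂vol) * C) := by
          refine lintegral_mono fun ξ => ?_
          rw [← (hf.periodic.comp fun y => ‖y‖ₑ).lintegral_add_right ξ,
            ← lintegral_mul_const' _ _ coe_ne_top, ← lintegral_const_mul' _ _ (by simp)]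
          refine lintegral_mono fun x => ?_
          rw [enorm_mul, enorm_mul, mul_assoc]
          gcongr
          exact hC x
      _ < ⊤ := by
          rw [lintegral_mul_const _ hk.continuous.measurable.enorm]
          exact mul_lt_top hk.integrable.2
            (mul_lt_top hf.integrable.2 coe_lt_top)
  have hI2 : Integrable (fun z : E3 × E3 => k z.2 * f z.1 * g (z.1 - z.2))
      (vol.prod volume) := by
    have hms : StronglyMeasurable fun z : E3 × E3 => k z.2 * f z.1 * g (z.1 - z.2) :=
      (hkm.mul (hf.meas.comp_measurable measurable_fst)).mul
        (hgc.comp continuous_sub).stronglyMeasurable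
    refine ⟨hms.aestronglyMeasurable, ?_⟩
    rw [HasFiniteIntegral, lintegral_prod_symm _ hms.enorm.aemeasurable]
    calc ∫⁻ ξ, ∫⁻ x, ‖k ξ * f x * g (x - ξ)‖ₑ ∂vol
        ≤ ∫⁻ ξ, ‖k ξ‖ₑ * ((∫⁻ x, ‖f x‖ₑ ∂vol) * C) := by
          refine lintegral_mono fun ξ => ?_
          rw [← lintegral_mul_const' _ _ coe_ne_top, ← lintegral_const_mul' _ _ (by simp)]
          refine lintegral_mono fun x => ?_
          rw [enorm_mul, enorm_mul, mul_assoc]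
          gcongr
          exact hC _
      _ < ⊤ := by
          rw [lintegral_mul_const _ hk.continuous.measurable.enorm]
          exact mul_lt_top hk.integrable.2
            (mul_lt_top hf.integrable.2 coe_lt_top)
  calc ∫ x, conv k f x * g x ∂vol
      = ∫ x, (∫ ξ, k ξ * f (x + ξ) * g x) ∂vol := by
        simp only [conv, smul_eq_mul, integral_mul_const]
    _ = ∫ ξ, ∫ x, k ξ * f (x + ξ) * g x ∂vol := integral_integral_swap hI1
    _ = ∫ ξ, ∫ x, k ξ * f x * g (x - ξ) ∂vol := by
        refine integral_congr_fun fun ξ => ?_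
        have hper : IsPeriodic fun x => k ξ * f x * g (x - ξ) := by
          have := (hf.periodic.comp₂ (hg.shift (-ξ)) fun a b => k ξ * a * b)
          simpa [sub_eq_add_neg] using this
        simpa using hper.integral_add_right ξ
    _ = ∫ x, (∫ ξ, k ξ * f x * g (x - ξ)) ∂vol := (integral_integral_swap hI2).symm
    _ = _ := by
        refine integral_congr_fun fun x => ?_
        simp only [conv, smul_eq_mul]
        rw [← integral_const_mul, ← integral_neg_eq_self]
        refine integral_congr_fun fun ξ => ?_
        simp
        ring

theorem integral_conv_mul_of_even (hk : IsKernel k) (he : ∀ x, k (-x) = k x) {f g : E3 → ℝ}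
    (hf : PerInt f) (hg : IsPeriodic g) (hgc : Continuous g) :
    ∫ x, conv k f x * g x ∂vol = ∫ x, f x * conv k g x ∂vol := by
  rw [integral_conv_mul hk hf hg hgc]
  simp only [he]

theorem SmoothPer.cInt_J_mul (hk : IsKernel k) (he : ∀ x, k (-x) = k x) (f g : SmoothPer) : cInt (J hk f * g) = cInt (f * J hk g) :=
  integral_conv_mul_of_even hk he f.perInt g.periodic g.continuous

end SmoothPeriodic

/-! ### Convergence from norm bounds -/

section Convergence

variable {ι : Type*} {l : Filter ι}

theorem tendsto_zero_of_le {a r : ι → ℝ≥0∞} (hr : Tendsto r l (𝓝 0)) (h : ∀ᶠ i in l, a i ≤ r i) :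
    Tendsto a l (𝓝 0) :=
  tendsto_of_tendsto_of_tendsto_of_le_of_le' tendsto_const_nhds hr (.of_forall fun _ => zero_le) h

theorem tendsto_zero_of_le_mul {a : ι → ℝ≥0∞} {r : ι → ℝ≥0} (hr : Tendsto r l (𝓝 0))
    (h : ∀ᶠ i in l, a i ≤ (C * r i : ℝ≥0)) : Tendsto a l (𝓝 0) := by
  refine tendsto_zero_of_le ?_ h
  rw [← ENNReal.coe_zero, ENNReal.tendsto_coe]
  simpa using hr.const_mul C

theorem tendsto_of_enorm_sub {a : ι → ℝ} {b : ℝ} (h : Tendsto (fun i => ‖a i - b‖ₑ) l (𝓝 0)) :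
    Tendsto a l (𝓝 b) := by
  rw [tendsto_iff_edist_tendsto_0]
  simpa only [edist_eq_enorm_sub]

theorem tendsto_enorm_sub_zero {a : ι → ℝ} {b : ℝ} {r : ι → ℝ≥0} (hr : Tendsto r l (𝓝 0))
    (h : ∀ᶠ i in l, ‖a i - b‖ₑ ≤ (C * r i : ℝ≥0)) : Tendsto a l (𝓝 b) :=
  tendsto_of_enorm_sub (tendsto_zero_of_le_mul hr h)

theorem tendsto_half_rpow (hκ : 0 < κ) :
    Tendsto (fun n : ℕ => ((1 / 2 : ℝ≥0) ^ κ) ^ n) atTop (𝓝 0) :=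
  NNReal.tendsto_pow_atTop_nhds_zero_of_lt_one (NNReal.rpow_lt_one (by norm_num) hκ)

theorem half_rpow_pow (κ : ℝ) (n : ℕ) : ((1 / 2 : ℝ≥0) ^ n) ^ κ = ((1 / 2 : ℝ≥0) ^ κ) ^ n := by
  rw [← NNReal.rpow_natCast, ← NNReal.rpow_natCast, ← NNReal.rpow_mul, ← NNReal.rpow_mul, mul_comm]

theorem tendsto_dyadic_rate (hκ : 0 < κ) :
    Tendsto (fun n : ℕ => ((1 / 2 : ℝ≥0) ^ n) ^ κ) atTop (𝓝 0) := by
  simpa only [half_rpow_pow] using tendsto_half_rpow hκ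

theorem tendsto_half_pow : Tendsto (fun n : ℕ => (1 / 2 : ℝ≥0) ^ n) atTop (𝓝 0) := by
  simpa using tendsto_half_rpow one_pos

end Convergence

/-! ### Duality between the curl of a field and Nikolskii classes -/

section Duality

theorem enorm_integral_mul_le [HolderTriple p q 1] {f g : E3 → ℝ} (hf : StronglyMeasurable f)
    (hg : StronglyMeasurable g) : ‖∫ x, f x * g x ∂vol‖ₑ ≤ eLpNorm f p vol * eLpNorm g q vol := by
  refine (enorm_integral_le_lintegral_enorm _).trans ?_
  rw [← eLpNorm_one_eq_lintegral_enorm]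
  simpa using eLpNorm_le_eLpNorm_mul_eLpNorm_of_nnnorm (μ := vol) (r := 1) (p := p) (q := q)
    hf.aestronglyMeasurable hg.aestronglyMeasurable (fun a b => a * b) 1
    (.of_forall fun x => by simp)

theorem eLpNorm_conv_sub_le [CompleteSpace F] (hk : IsUnitKernel k) {ρ : ℝ≥0}
    (hρ : ∀ ξ, k ξ ≠ 0 → ‖ξ‖ₑ ≤ ρ) (hf : Nik q s A f) (hq : 1 ≤ q) (hs : 0 ≤ s) :
    eLpNorm (fun x => conv k f x - f x) q vol ≤ (massOf k * A * ρ ^ s : ℝ≥0) := by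
  have h := hf.eLpNorm_osc_le hq hs hk.toIsKernel hρ
  have h2 : osc k f = fun x => conv k f x - f x := by
    ext x
    rw [osc_eq hk.toIsKernel (hf.perInt hq), hk.integral_eq, one_smul]
  rw [h2] at h
  refine h.trans (le_of_eq ?_)
  push_cast
  rw [coe_rpow_of_nonneg _ hs]
  ring

theorem Nik.conv_sub [CompleteSpace F] (hk : IsUnitKernel k) {ρ : ℝ≥0} (hρ1 : ρ ≤ 1)
    (hρ : ∀ ξ, k ξ ≠ 0 → ‖ξ‖ₑ ≤ ρ) (hf : Nik q s A f) (hq : 1 ≤ q) (hκ : 0 ≤ κ) (hκs : κ ≤ s) :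
    Nik q (s - κ) (2 * massOf k * A * ρ ^ κ) fun x => conv k f x - f x := by
  have h := hf.osc hq hκ hκs hk.toIsKernel hρ1 hρ
  have h2 : osc k f = fun x => conv k f x - f x := by
    ext x
    rw [osc_eq hk.toIsKernel (hf.perInt hq), hk.integral_eq, one_smul]
  rwa [h2] at h

/-- Derivatives of mollifications at scale `ε` lose a factor `ε ^ (s - 1)`. -/
theorem eLpNorm_conv_pd_dilate_le (hk : IsKernel k) {R : ℝ≥0} (hR : ∀ ξ, k ξ ≠ 0 → ‖ξ‖ₑ ≤ R)
    {f : E3 → ℝ} (hf : Nik q s A f) (hq : 1 ≤ q) (hs : 0 ≤ s) (i : Fin 3) (hε : 0 < ε) :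
    eLpNorm (conv (pd i (dilate k ε)) f) q vol ≤
      (ε.toNNReal⁻¹ * massOf (pd i k) * A * (ε.toNNReal * R) ^ s : ℝ≥0) := by
  have hk' := (hk.dilate hε).pd i
  have h := hf.eLpNorm_osc_le hq hs hk' (ρ := ε.toNNReal * R)
    (pd_ne_zero (fun ξ => dilate_ne_zero hR hε ξ) i)
  have h2 : osc (pd i (dilate k ε)) f = conv (pd i (dilate k ε)) f := by
    ext x
    rw [osc_eq hk' (hf.perInt hq), (hk.dilate hε).integral_pd, zero_smul,
      sub_zero]
  rw [h2] at h
  refine h.trans (le_of_eq ?_)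
  have h3 : massOf (pd i (dilate k ε)) = ε.toNNReal⁻¹ * massOf (pd i k) := by
    rw [pd_dilate hk, massOf_const_mul, massOf_dilate (hk.pd i) hε]
    congr 1
    ext
    simp [abs_of_pos hε, hε.le]
  rw [h3, ← coe_rpow_of_nonneg _ hs]
  push_cast
  ring

/-- The kernels `stdKernel` at scale `2^{-n}`. -/
def dyadicKernel (n : ℕ) : E3 → ℝ := dilate stdKernel ((1 / 2) ^ n)

theorem isUnitKernel_dyadicKernel (n : ℕ) : IsUnitKernel (dyadicKernel n) :=
  isUnitKernel_stdKernel.dilate (by positivity)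

theorem isKernel_dyadicKernel (n : ℕ) : IsKernel (dyadicKernel n) :=
  (isUnitKernel_dyadicKernel n).toIsKernel

theorem toNNReal_half_pow (n : ℕ) : ((1 / 2 : ℝ) ^ n).toNNReal = (1 / 2 : ℝ≥0) ^ n := by
  rw [Real.toNNReal_pow (by norm_num)]
  congr 1
  ext
  simp

theorem dyadicKernel_radius (n : ℕ) (ξ : E3) (h : dyadicKernel n ξ ≠ 0) :
    ‖ξ‖ₑ ≤ ((1 / 2) ^ n : ℝ≥0) := by
  have := dilate_ne_zero stdKernel_radius (by positivity) ξ h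
  rwa [toNNReal_half_pow, mul_one] at this

theorem massOf_dyadicKernel (n : ℕ) : massOf (dyadicKernel n) = massOf stdKernel :=
  massOf_dilate isUnitKernel_stdKernel.toIsKernel (by positivity)

open SmoothPer in
theorem integral_mul_D_diff [HolderTriple p q 1] (hp : 1 ≤ p) (hq : 1 ≤ q) (hσ : 1 / 2 < σ)
    (i : Fin 3) {f : E3 → ℝ} {g : SmoothPer} (hf : Nik p σ A f) (hg : Nik q (1 / 2) B g.1) (n : ℕ) :
    ‖cInt ((mol (isKernel_dyadicKernel (n + 1)) (hf.perInt hp) -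
        mol (isKernel_dyadicKernel n) (hf.perInt hp)) * D i g)‖ₑ ≤
      (5 * massOf stdKernel * massOf (pd i stdKernel) * A * B * ((1 / 2) ^ (σ - 1 / 2)) ^ n : ℝ≥0) := by
  set k := fun n => isUnitKernel_dyadicKernel n
  set Fn : ℕ → SmoothPer := fun n => mol (k n).toIsKernel (hf.perInt hp) with hFn
  set Gn : SmoothPer := J (k n).toIsKernel g with hGn
  set m := massOf stdKernel
  set m' := massOf (pd i stdKernel)
  set ε : ℝ≥0 := (1 / 2) ^ n with hε
  have hε0 : ε ≠ 0 := by positivity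
  have hσ0 : 0 ≤ σ := by linarith
  have hid : cInt ((Fn (n + 1) - Fn n) * D i g) =
      cInt ((Fn (n + 1) - Fn n) * D i Gn) - cInt (D i (Fn (n + 1) - Fn n) * (g - Gn)) := by
    have h1 := cInt_mul_D i (Fn (n + 1) - Fn n) (g - Gn)
    rw [map_sub, mul_sub, map_sub] at h1
    linarith
  have hFs : ∀ j, (Fn j).1 = conv (dyadicKernel j) f := fun j => rfl
  have b1 : ∀ j, eLpNorm (fun x => (Fn j).1 x - f x) p vol ≤
      (m * A * ((1 / 2) ^ j) ^ σ : ℝ≥0) := fun j => by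
    have := eLpNorm_conv_sub_le (k j) (dyadicKernel_radius j) hf hp hσ0
    rwa [massOf_dyadicKernel] at this
  have hle : ((1 / 2 : ℝ≥0) ^ (n + 1)) ≤ ε := by
    rw [hε, pow_succ]
    exact mul_le_of_le_one_right (by positivity) (by norm_num)
  have c1 : eLpNorm (Fn (n + 1) - Fn n).1 p vol ≤ (2 * m * A * ε ^ σ : ℝ≥0) := by
    have e1 : (Fn (n + 1) - Fn n).1 =
        (fun x => (Fn (n + 1)).1 x - f x) - fun x => (Fn n).1 x - f x := by
      ext x; simp
    rw [e1]
    refine (eLpNorm_sub_le ((Fn (n + 1)).perInt.meas.sub hf.meas).aestronglyMeasurable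
      ((Fn n).perInt.meas.sub hf.meas).aestronglyMeasurable hp).trans ?_
    refine (add_le_add (b1 (n + 1)) (b1 n)).trans ?_
    rw [← ENNReal.coe_add, coe_le_coe, ← hε]
    calc m * A * ((1 / 2) ^ (n + 1)) ^ σ + m * A * ε ^ σ ≤ m * A * ε ^ σ + m * A * ε ^ σ := by
          gcongr
      _ = _ := by ring
  have d1 : ∀ (r : ℝ≥0∞) (s : ℝ) (E : ℝ≥0) (h : E3 → ℝ) (j : ℕ), 1 ≤ r → 0 ≤ s → Nik r s E h →
      eLpNorm (conv (pd i (dyadicKernel j)) h) r vol ≤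
        (m' * E * ((1 / 2) ^ j) ^ (s - 1) : ℝ≥0) := fun r s E h j hr hs hh => by
    have := eLpNorm_conv_pd_dilate_le isUnitKernel_stdKernel.toIsKernel stdKernel_radius hh hr hs i
      (ε := (1 / 2) ^ j) (by positivity)
    rw [toNNReal_half_pow, mul_one] at this
    refine this.trans (le_of_eq ?_)
    congr 1
    rw [NNReal.rpow_sub_one (by positivity)]
    simp only [m']
    ring
  have hDF : ∀ j, (D i (Fn j)).1 = -conv (pd i (dyadicKernel j)) f := fun j => by
    ext x; exact pd_conv (k j).toIsKernel (hf.perInt hp) i x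
  have c2 : eLpNorm (D i (Fn (n + 1) - Fn n)).1 p vol ≤
      (3 * m' * A * ε ^ (σ - 1) : ℝ≥0) := by
    have e1 : (D i (Fn (n + 1) - Fn n)).1 =
        (-conv (pd i (dyadicKernel (n + 1))) f) - -conv (pd i (dyadicKernel n)) f := by
      rw [← hDF, ← hDF, map_sub]; rfl
    have hm : ∀ j, AEStronglyMeasurable (-conv (pd i (dyadicKernel j)) f) vol := fun j =>
      (stronglyMeasurable_conv ((k j).pd i).continuous.measurable hf.meas).neg.aestronglyMeasurable
    rw [e1]
    refine (eLpNorm_sub_le (hm _) (hm _) hp).trans ?_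
    rw [eLpNorm_neg, eLpNorm_neg]
    refine (add_le_add (d1 p σ A f (n + 1) hp hσ0 hf) (d1 p σ A f n hp hσ0 hf)).trans ?_
    rw [← ENNReal.coe_add, coe_le_coe, ← hε]
    have h2 : ((1 / 2 : ℝ≥0) ^ (n + 1)) ^ (σ - 1) ≤ 2 * ε ^ (σ - 1) := by
      rw [pow_succ, NNReal.mul_rpow, mul_comm]
      gcongr
      rw [one_div, NNReal.inv_rpow, ← NNReal.rpow_neg]
      calc (2 : ℝ≥0) ^ (-(σ - 1)) ≤ 2 ^ (1 : ℝ) :=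
            NNReal.rpow_le_rpow_of_exponent_le (by norm_num) (by linarith)
        _ = 2 := by simp
    calc m' * A * ((1 / 2) ^ (n + 1)) ^ (σ - 1) + m' * A * ε ^ (σ - 1)
        ≤ m' * A * (2 * ε ^ (σ - 1)) + m' * A * ε ^ (σ - 1) := by gcongr
      _ = _ := by ring
  have c3 : eLpNorm (D i Gn).1 q vol ≤ (m' * B * ε ^ ((1 / 2 : ℝ) - 1) : ℝ≥0) := by
    have e1 : (D i Gn).1 = -conv (pd i (dyadicKernel n)) g.1 := by
      ext x; exact pd_conv (k n).toIsKernel g.perInt i x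
    rw [e1, eLpNorm_neg]
    exact d1 q (1 / 2) B g.1 n hq (by norm_num) hg
  have c4 : eLpNorm (g - Gn).1 q vol ≤ (m * B * ε ^ (1 / 2 : ℝ) : ℝ≥0) := by
    have := eLpNorm_conv_sub_le (k n) (dyadicKernel_radius n) hg hq (by norm_num)
    rw [massOf_dyadicKernel] at this
    refine le_trans (le_of_eq ?_) this
    rw [← eLpNorm_neg]
    congr 1
    ext x
    simp [Gn, J_apply]
  change ‖cInt ((Fn (n + 1) - Fn n) * D i g)‖ₑ ≤ _
  rw [hid]
  refine enorm_sub_le.trans ?_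
  have f1 : ‖cInt ((Fn (n + 1) - Fn n) * D i Gn)‖ₑ ≤
      (2 * m * A * ε ^ σ : ℝ≥0) * (m' * B * ε ^ ((1 / 2 : ℝ) - 1) : ℝ≥0) :=
    (enorm_integral_mul_le (p := p) (q := q) (Fn (n + 1) - Fn n).perInt.meas
      (D i Gn).perInt.meas).trans (mul_le_mul' c1 c3)
  have f2 : ‖cInt (D i (Fn (n + 1) - Fn n) * (g - Gn))‖ₑ ≤
      (3 * m' * A * ε ^ (σ - 1) : ℝ≥0) * (m * B * ε ^ (1 / 2 : ℝ) : ℝ≥0) :=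
    (enorm_integral_mul_le (p := p) (q := q) (D i (Fn (n + 1) - Fn n)).perInt.meas
      (g - Gn).perInt.meas).trans (mul_le_mul' c2 c4)
  refine (add_le_add f1 f2).trans ?_
  rw [← ENNReal.coe_mul, ← ENNReal.coe_mul, ← ENNReal.coe_add, coe_le_coe]
  refine le_of_eq ?_
  have g1 : ε ^ σ * ε ^ ((1 / 2 : ℝ) - 1) = ε ^ (σ - 1 / 2) := by
    rw [← NNReal.rpow_add hε0]; congr 1; ring
  have g2 : ε ^ (σ - 1) * ε ^ (1 / 2 : ℝ) = ε ^ (σ - 1 / 2) := by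
    rw [← NNReal.rpow_add hε0]; congr 1; ring
  have g3 : ((1 / 2 : ℝ≥0) ^ (σ - 1 / 2)) ^ n = ε ^ (σ - 1 / 2) := by
    rw [hε, ← NNReal.rpow_natCast, ← NNReal.rpow_natCast, ← NNReal.rpow_mul, ← NNReal.rpow_mul,
      mul_comm]
  rw [g3]
  calc _ = 2 * m * m' * A * B * (ε ^ σ * ε ^ ((1 / 2 : ℝ) - 1)) +
        3 * m * m' * A * B * (ε ^ (σ - 1) * ε ^ (1 / 2 : ℝ)) := by ring
    _ = _ := by rw [g1, g2]; ring

open SmoothPer in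
/-- The pairing of a function with the derivative of a smooth function, bounded through Nikolskii
constants of total order larger than one. -/
theorem exists_integral_mul_D_le [HolderTriple p q 1] (hp : 1 ≤ p) (hq : 1 ≤ q) (hσ : 1 / 2 < σ) :
    ∃ C : ℝ≥0, ∀ (i : Fin 3) (f : E3 → ℝ) (A B : ℝ≥0) (g : SmoothPer), Nik p σ A f →
      Nik q (1 / 2) B g.1 → ‖∫ x, f x * (D i g).1 x ∂vol‖ₑ ≤ C * A * B := by
  set θ : ℝ≥0 := (1 / 2) ^ (σ - 1 / 2)
  have hθ : θ < 1 := NNReal.rpow_lt_one (by norm_num) (by linarith)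
  set S : ℝ≥0 := ∑' n : ℕ, θ ^ n
  have hS : Summable fun n : ℕ => θ ^ n := NNReal.summable_geometric hθ
  set m := massOf stdKernel
  set M : ℝ≥0 := ∑ i, massOf (pd i stdKernel)
  refine ⟨M + 5 * m * M * S, fun i f A B g hf hg => ?_⟩
  have hMi : massOf (pd i stdKernel) ≤ M :=
    single_le_sum (f := fun i => massOf (pd i stdKernel)) (fun _ _ => zero_le) (mem_univ i)
  set k := fun n => isUnitKernel_dyadicKernel n
  set Fn : ℕ → SmoothPer := fun n => mol (k n).toIsKernel (hf.perInt hp) with hFn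
  have hσ0 : 0 ≤ σ := by linarith
  have h0 : ‖cInt (Fn 0 * D i g)‖ₑ ≤ (M * A * B : ℝ≥0) := by
    rw [cInt_mul_D, enorm_neg]
    refine (enorm_integral_mul_le (p := p) (q := q) (D i (Fn 0)).perInt.meas g.perInt.meas).trans ?_
    push_cast
    refine mul_le_mul' ?_ hg.norm_le
    have e1 : (D i (Fn 0)).1 = -conv (pd i (dyadicKernel 0)) f := by
      ext x; exact pd_conv (k 0).toIsKernel (hf.perInt hp) i x
    rw [e1, eLpNorm_neg]
    refine (eLpNorm_conv_pd_dilate_le isUnitKernel_stdKernel.toIsKernel stdKernel_radius hf hp hσ0 i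
      (ε := (1 / 2) ^ 0) (by positivity)).trans ?_
    rw [← ENNReal.coe_mul, coe_le_coe]
    simpa using mul_le_mul' hMi (le_refl A)
  have hn : ∀ n, ‖cInt (Fn n * D i g)‖ₑ ≤
      (M * A * B + 5 * m * M * A * B * ∑ j ∈ Finset.range n, θ ^ j : ℝ≥0) := by
    intro n
    induction n with
    | zero => simpa using h0
    | succ n ih =>
      have hd := integral_mul_D_diff hp hq hσ i hf hg n
      have e1 : cInt (Fn (n + 1) * D i g) = cInt (Fn n * D i g) + cInt ((Fn (n + 1) - Fn n) * D i g) := by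
        rw [← map_add]; congr 1; ring
      rw [e1]
      refine (enorm_add_le _ _).trans ((add_le_add ih hd).trans ?_)
      rw [← ENNReal.coe_add, coe_le_coe, Finset.sum_range_succ, mul_add, add_assoc]
      gcongr
  have hlim : Tendsto (fun n => cInt (Fn n * D i g)) atTop
      (𝓝 (∫ x, f x * (D i g).1 x ∂vol)) := by
    obtain ⟨Bq, hBq⟩ : ∃ Bq : ℝ≥0, eLpNorm (D i g).1 q vol ≤ Bq := by
      obtain ⟨C, hC⟩ := (D i g).periodic.exists_bound (D i g).continuous
      refine ⟨C, (eLpNorm_le_eLpNorm_of_exponent_le le_top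
        (D i g).perInt.meas.aestronglyMeasurable).trans ?_⟩
      rw [eLpNorm_exponent_top]
      exact essSup_le_of_ae_le _ (.of_forall hC)
    refine tendsto_enorm_sub_zero (C := m * A * Bq) (tendsto_dyadic_rate (κ := σ)
      (by linarith)) (.of_forall fun n => ?_)
    have hbd : ∀ h : E3 → ℝ, PerInt h → Integrable (fun x => h x * (D i g).1 x) vol := by
      intro h hh
      obtain ⟨C, hC⟩ := (D i g).periodic.exists_bound (D i g).continuous
      refine hh.integrable.mul_bdd (c := C) (D i g).perInt.meas.aestronglyMeasurable
        (.of_forall fun x => ?_)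
      exact_mod_cast hC x
    have e1 : cInt (Fn n * D i g) - ∫ x, f x * (D i g).1 x ∂vol =
        ∫ x, ((Fn n).1 x - f x) * (D i g).1 x ∂vol := by
      simp only [sub_mul]
      rw [integral_sub (hbd _ (Fn n).perInt) (hbd _ (hf.perInt hp))]
      rfl
    rw [e1]
    refine (enorm_integral_mul_le (p := p) (q := q) ((Fn n).perInt.meas.sub hf.meas)
      (D i g).perInt.meas).trans ?_
    have h1 := eLpNorm_conv_sub_le (k n) (dyadicKernel_radius n) hf hp hσ0
    rw [massOf_dyadicKernel] at h1
    refine (mul_le_mul' h1 hBq).trans ?_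
    rw [← ENNReal.coe_mul, coe_le_coe]
    exact le_of_eq (by simp only [m]; ring)
  refine le_of_tendsto hlim.enorm (.of_forall fun n => (hn n).trans ?_)
  have h3 : ∑ j ∈ Finset.range n, θ ^ j ≤ S := hS.sum_le_tsum _ fun _ _ => zero_le
  rw [← ENNReal.coe_mul, ← ENNReal.coe_mul, coe_le_coe]
  calc M * A * B + 5 * m * M * A * B * ∑ j ∈ Finset.range n, θ ^ j
      ≤ M * A * B + 5 * m * M * A * B * S := by gcongr
    _ = _ := by ring

end Duality

/-! ### The duality bracket with a curl -/

section Bracket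

open SmoothPer

/-- Exponents `p` of a velocity and `q` of a test field, which are conjugate. -/
class ExpPair (p : ℝ≥0∞) (q : ℝ) : Prop extends HolderTriple p (ofReal q) 1 where
  one_le_left : 1 ≤ p
  one_le_right : 1 ≤ q

theorem ExpPair.le (p : ℝ≥0∞) (q : ℝ) [h : ExpPair p q] : 1 ≤ p ∧ 1 ≤ q ∧ 1 ≤ ofReal q :=
  ⟨h.one_le_left, h.one_le_right, by simpa using h.one_le_right⟩

instance expPair_three : ExpPair 3 (3 / 2) where
  inv_add_inv_eq_inv := by
    rw [show (3 : ℝ≥0∞) = ofReal 3 by simp, ← ofReal_inv_of_pos (by norm_num),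
      ← ofReal_inv_of_pos (by norm_num), ← ofReal_add (by norm_num) (by norm_num)]
    norm_num
  one_le_left := by norm_num
  one_le_right := by norm_num

theorem one_le_q : 1 ≤ 𝔮 := (ExpPair.le 3 _).2.2

instance expPair_two : ExpPair 2 2 where
  inv_add_inv_eq_inv := by simpa using ENNReal.inv_two_add_inv_two
  one_le_left := by norm_num
  one_le_right := by norm_num

variable {q : ℝ} [ExpPair p q]

/-- The coordinates of a smooth vector field. -/
def coordT (ψ : PeriodicTest E3) (i : Fin 3) : SmoothPer :=
  ⟨fun x => ψ.1 x i, (EuclideanSpace.proj i : E3 →L[ℝ] ℝ).contDiff.comp ψ.2.1, ψ.2.2.comp fun y => y i⟩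

/-- The curl in coordinates. -/
def curlS (a : Fin 3 → SmoothPer) : Fin 3 → SmoothPer :=
  ![D 1 (a 2) - D 2 (a 1), D 2 (a 0) - D 0 (a 2), D 0 (a 1) - D 1 (a 0)]

theorem fderiv_coord {f : E3 → E3} {x : E3} (hf : DifferentiableAt ℝ f x) (v : E3) (j : Fin 3) :
    fderiv ℝ f x v j = fderiv ℝ (fun y => f y j) x v := by
  have h := (EuclideanSpace.proj j : E3 →L[ℝ] ℝ).hasFDerivAt.comp x hf.hasFDerivAt
  change _ = fderiv ℝ ((EuclideanSpace.proj j : E3 →L[ℝ] ℝ) ∘ f) x v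
  rw [h.fderiv]
  rfl

theorem curl_apply (ψ : PeriodicTest E3) (x : E3) (i : Fin 3) :
    curl ψ.1 x i = (curlS (coordT ψ) i).1 x := by
  have hd : DifferentiableAt ℝ ψ.1 x := ψ.2.1.differentiable (by simp) x
  simp only [curl, curlS]
  fin_cases i <;> simp [fderiv_coord hd, D_apply, coordT]

/-- The distributional curl of `u`, as a functional on smooth fields. -/
def curlFn (u : E3 → E3) (ψ : PeriodicTest E3) : ℝ := ∫ x in cell, ⟪u x, curl ψ.1 x⟫_ℝ

theorem PerInt.coord {u : E3 → E3} (hu : PerInt u) (i : Fin 3) : PerInt fun x => u x i :=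
  ⟨hu.periodic.comp fun y => y i,
    (EuclideanSpace.proj i : E3 →L[ℝ] ℝ).continuous.comp_stronglyMeasurable hu.meas,
    (EuclideanSpace.proj i : E3 →L[ℝ] ℝ).integrable_comp hu.integrable⟩

theorem PerInt.integrable_mul {f : E3 → ℝ} (hf : PerInt f) (g : SmoothPer) :
    Integrable (fun x => f x * g.1 x) vol := by
  obtain ⟨C, hC⟩ := g.periodic.exists_bound g.continuous
  refine hf.integrable.mul_bdd (c := C) g.perInt.meas.aestronglyMeasurable
    (.of_forall fun x => ?_)
  exact_mod_cast hC x

theorem inner_E3 (a b : E3) : ⟪a, b⟫_ℝ = ∑ i, a i * b i := by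
  simp [PiLp.inner_apply, mul_comm]

theorem curlFn_eq {u : E3 → E3} (hu : PerInt u) (ψ : PeriodicTest E3) :
    curlFn u ψ = ∑ i, ∫ x, u x i * (curlS (coordT ψ) i).1 x ∂vol := by
  rw [curlFn, ← integral_finsetSum _ fun i _ => (hu.coord i).integrable_mul _]
  simp only [inner_E3, curl_apply]

theorem curlS_add (a b : Fin 3 → SmoothPer) : curlS (a + b) = curlS a + curlS b := by
  ext i x
  fin_cases i <;> simp [curlS] <;> ring

theorem curlS_smul (c : ℝ) (a : Fin 3 → SmoothPer) : curlS (c • a) = c • curlS a := by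
  ext i x
  fin_cases i <;> simp [curlS] <;> ring

theorem isLinearMap_curlFn {u : E3 → E3} (hu : PerInt u) : IsLinearMap ℝ (curlFn u) := by
  constructor
  · intro ψ φ
    have : coordT (ψ + φ) = coordT ψ + coordT φ := by ext i x; simp [coordT]
    rw [curlFn_eq hu, curlFn_eq hu, curlFn_eq hu, this, curlS_add, ← sum_add_distrib]
    refine sum_congr rfl fun i _ => ?_
    rw [← integral_add ((hu.coord i).integrable_mul _) ((hu.coord i).integrable_mul _)]
    simp [mul_add]
  · intro c ψ
    have : coordT (c • ψ) = c • coordT ψ := by ext i x; simp [coordT]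
    rw [curlFn_eq hu, curlFn_eq hu, this, curlS_smul, smul_eq_mul, mul_sum]
    refine sum_congr rfl fun i _ => ?_
    rw [← integral_const_mul]
    refine integral_congr_fun fun x => ?_
    simp
    ring

theorem exists_curlFn_le (hσ : 1 / 2 < σ) :
    ∃ C : ℝ≥0, ∀ (u : E3 → E3) (A B : ℝ≥0) (ψ : PeriodicTest E3), Nik p σ A u →
      Nik (ofReal q) (1 / 2) B ψ.1 → ‖curlFn u ψ‖ₑ ≤ C * A * B := by
  obtain ⟨hp, hq, hq'⟩ := ExpPair.le p q
  obtain ⟨C, hC⟩ := exists_integral_mul_D_le (p := p) (q := ofReal q) hp hq' hσ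
  refine ⟨6 * C, fun u A B ψ hu hψ => ?_⟩
  have hui := (hu.perInt hp).coord
  have hb : ∀ i j k, ‖∫ x, u x i * (D j (coordT ψ k)).1 x ∂vol‖ₑ ≤ C * A * B :=
    fun i j k => hC j _ A B (coordT ψ k) (hu.coord i) (hψ.coord k)
  have hb2 : ∀ i j k l m, ‖∫ x, u x i * (D j (coordT ψ k) - D l (coordT ψ m)).1 x ∂vol‖ₑ ≤
      2 * (C * A * B) := fun i j k l m => by
    have : ∫ x, u x i * (D j (coordT ψ k) - D l (coordT ψ m)).1 x ∂vol =
        (∫ x, u x i * (D j (coordT ψ k)).1 x ∂vol) -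
          ∫ x, u x i * (D l (coordT ψ m)).1 x ∂vol := by
      rw [← integral_sub ((hui i).integrable_mul _) ((hui i).integrable_mul _)]
      simp [mul_sub]
    rw [this, two_mul]
    exact enorm_sub_le.trans (add_le_add (hb _ _ _) (hb _ _ _))
  rw [curlFn_eq (hu.perInt hp), Fin.sum_univ_three]
  refine (enorm_add_le _ _).trans ?_
  refine (add_le_add_left (enorm_add_le _ _) _).trans ?_
  have h0 := hb2 0 1 2 2 1
  have h1 := hb2 1 2 0 0 2
  have h2 := hb2 2 0 1 1 0
  calc _ ≤ 2 * ((C : ℝ≥0∞) * A * B) + 2 * (C * A * B) + 2 * (C * A * B) :=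
        add_le_add (add_le_add h0 h1) h2
    _ = _ := by push_cast; ring

theorem conv_coord (hk : IsKernel k) {g : E3 → E3} (hg : PerInt g) (x : E3) (i : Fin 3) : conv k g x i = conv k (fun y => g y i) x := by
  have h := (EuclideanSpace.proj i : E3 →L[ℝ] ℝ).integral_comp_comm
    (hk.integrable_smul hg x)
  simpa [conv] using h.symm

/-- The mollification of a field at scale `2^{-n}`. -/
def molTest (n : ℕ) {g : E3 → E3} (hg : PerInt g) : PeriodicTest E3 :=
  ⟨conv (dyadicKernel n) g, contDiff_conv (isKernel_dyadicKernel n) hg,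
    hg.periodic.conv _⟩

theorem sobolevNorm_congr {s r : ℝ} {f g : E3 → F} (h : f =ᵐ[volume] g) : sobolevNorm s r f = sobolevNorm s r g := by
  have hsh : ∀ x : E3, ∀ᵐ ξ, f (x + ξ) = g (x + ξ) := fun x =>
    (measurePreserving_add_left volume x).quasiMeasurePreserving.ae h
  have hc : f =ᵐ[volume.restrict cell] g := ae_restrict_of_ae h
  rw [sobolevNorm, sobolevNorm]
  congr 2
  · exact lintegral_congr_ae (hc.mono fun x hx => by simp only [hx])
  · refine lintegral_congr_ae (hc.mono fun x hx => ?_)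
    refine lintegral_congr_ae (ae_restrict_of_ae ((hsh x).mono fun ξ hξ => ?_))
    simp only [increment, hx, hξ]

theorem bracket_congr {s r : ℝ} {w : PeriodicTest E3 → ℝ} {g g' : E3 → E3}
    (h : g =ᵐ[volume] g') : bracket s r w g = bracket s r w g' := by
  have : (fun ψ : PeriodicTest E3 => sobolevNorm s r fun x => ψ.1 x - g x) =
      fun ψ : PeriodicTest E3 => sobolevNorm s r fun x => ψ.1 x - g' x := by
    ext ψ
    exact sobolevNorm_congr (h.mono fun x hx => by simp only [hx])
  rw [bracket, bracket, this]

theorem curlFn_congr {u u' : E3 → E3} (h : u =ᵐ[volume] u') : curlFn u = curlFn u' := by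
  ext ψ
  exact integral_congr_ae (ae_restrict_of_ae (h.mono fun x hx => by simp only [hx]))

theorem nik_molTest_sub (hr : 1 ≤ r) (hκ : 0 ≤ κ) (hκτ : κ ≤ τ) {g : E3 → E3} (hg : Nik r τ B g)
    (n : ℕ) : Nik r (τ - κ) (2 * massOf stdKernel * B * ((1 / 2) ^ κ) ^ n)
      fun x => (molTest n (hg.perInt hr)).1 x - g x := by
  have := hg.conv_sub (isUnitKernel_dyadicKernel n) (pow_le_one₀ (by positivity) (by norm_num))
    (dyadicKernel_radius n) hr hκ hκτ
  rwa [massOf_dyadicKernel, half_rpow_pow] at this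

/-- The duality bracket of a curl is the limit along mollifications. -/
theorem tendsto_bracket (hσ : 1 / 2 < σ) (hτ : 1 / 2 < τ) {u g : E3 → E3} (hu : Nik p σ A u)
    (hg : Nik (ofReal q) τ B g) (hgi : PerInt g) :
    Tendsto (fun n => curlFn u (molTest n hgi)) atTop (𝓝 (bracket (1 / 2) q (curlFn u) g)) := by
  obtain ⟨hp, hq, hq'⟩ := ExpPair.le p q
  obtain ⟨C, hC⟩ := exists_curlFn_le (p := p) (q := q) hσ
  obtain ⟨C₁, hC₁⟩ := exists_nik_of_sobolevNorm_le (F := E3) (s := 1 / 2) (q := q) (by norm_num)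
    (by norm_num) hq
  have hlin := isLinearMap_curlFn (hu.perInt hp)
  set m := massOf stdKernel
  set κ := τ - 1 / 2 with hκ
  have hκ0 : 0 < κ := by linarith
  set θ : ℝ≥0 := (1 / 2) ^ κ with hθd
  have hθ : θ < 1 := NNReal.rpow_lt_one (by norm_num) hκ0
  have hθ0 : Tendsto (fun n => θ ^ n) atTop (𝓝 0) := tendsto_half_rpow hκ0
  have hdiff : ∀ n, Nik (ofReal q) (1 / 2) (2 * m * B * θ ^ n)
      fun x => (molTest n hgi).1 x - g x := fun n => by
    have := nik_molTest_sub (κ := κ) hq' hκ0.le (by linarith) hg n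
    rwa [show τ - κ = 1 / 2 by rw [hκ]; ring] at this
  set L : ℕ → ℝ := fun n => curlFn u (molTest n hgi) with hL
  have hψL : ∀ (ψ : PeriodicTest E3) (b : ℝ≥0), Nik (ofReal q) (1 / 2) b (fun x => ψ.1 x - g x) →
      ∀ n, ‖curlFn u ψ - L n‖ₑ ≤ (C * A * (b + 2 * m * B * θ ^ n) : ℝ≥0) := by
    intro ψ b hb n
    rw [hL]
    simp only
    rw [← hlin.map_sub]
    push_cast
    have := hC u A (b + 2 * m * B * θ ^ n) (ψ - molTest n hgi) hu (by
      have h := hb.sub (hdiff n) hq'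
      have e : (fun x => ψ.1 x - g x - ((molTest n hgi).1 x - g x)) = (ψ - molTest n hgi).1 := by
        ext1 x
        exact sub_sub_sub_cancel_right _ _ _
      rwa [e] at h)
    simpa using this
  have hCauchy : CauchySeq L := by
    refine cauchySeq_of_le_tendsto_0 (fun N => ((C * A * (2 * (2 * m * B * θ ^ N)) : ℝ≥0) : ℝ)) ?_ ?_
    · intro n k N hn hk
      have h1 := hψL _ _ (hdiff n) k
      rw [← edist_eq_enorm_sub, edist_nndist, coe_le_coe] at h1
      rw [dist_nndist, NNReal.coe_le_coe]
      refine h1.trans (mul_le_mul' le_rfl ?_)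
      rw [two_mul (2 * m * B * θ ^ N)]
      refine add_le_add ?_ ?_
      · exact mul_le_mul' le_rfl (pow_le_pow_of_le_one (by positivity) hθ.le hn)
      · exact mul_le_mul' le_rfl (pow_le_pow_of_le_one (by positivity) hθ.le hk)
    · have h2 := hθ0.const_mul (C * A * (2 * (2 * m * B)))
      rw [mul_zero, ← NNReal.tendsto_coe, NNReal.coe_zero] at h2
      refine h2.congr fun N => ?_
      push_cast
      ring
  obtain ⟨ℓ, hℓ⟩ := cauchySeq_tendsto_of_complete hCauchy
  have hψℓ : ∀ (ψ : PeriodicTest E3) (b : ℝ≥0),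
      Nik (ofReal q) (1 / 2) b (fun x => ψ.1 x - g x) →
      ‖curlFn u ψ - ℓ‖ₑ ≤ (C * A * b : ℝ≥0) := by
    intro ψ b hb
    have h1 : Tendsto (fun n => ‖curlFn u ψ - L n‖ₑ) atTop (𝓝 ‖curlFn u ψ - ℓ‖ₑ) :=
      (tendsto_const_nhds.sub hℓ).enorm
    refine le_of_tendsto_of_tendsto' h1 ?_ (hψL ψ b hb)
    rw [ENNReal.tendsto_coe]
    have h2 := hθ0.const_mul (2 * m * B)
    simpa using (h2.const_add b).const_mul (C * A)
  have hcomap : Tendsto (curlFn u) (comap (fun ψ : PeriodicTest E3 =>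
      sobolevNorm (1 / 2) q fun x => ψ.1 x - g x) (𝓝 0)) (𝓝 ℓ) := by
    have hS : Tendsto (fun ψ : PeriodicTest E3 => sobolevNorm (1 / 2) q fun x => ψ.1 x - g x)
        (comap (fun ψ : PeriodicTest E3 => sobolevNorm (1 / 2) q fun x => ψ.1 x - g x) (𝓝 0))
        (𝓝 0) := tendsto_comap
    have h1 : Tendsto (fun ψ : PeriodicTest E3 => ((C * A * C₁ : ℝ≥0) : ℝ≥0∞) *
        sobolevNorm (1 / 2) q fun x => ψ.1 x - g x)
        (comap (fun ψ : PeriodicTest E3 => sobolevNorm (1 / 2) q fun x => ψ.1 x - g x) (𝓝 0))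
        (𝓝 0) := by
      have := ENNReal.Tendsto.const_mul (a := ((C * A * C₁ : ℝ≥0) : ℝ≥0∞)) hS
        (Or.inr coe_ne_top)
      rwa [mul_zero] at this
    refine tendsto_of_enorm_sub (tendsto_zero_of_le h1 ?_)
    filter_upwards [hS.eventually (gt_mem_nhds (show (0 : ℝ≥0∞) < ⊤ by simp))] with ψ hψ
    have h2 := hC₁ (fun x => ψ.1 x - g x)
      (sobolevNorm (1 / 2) q fun x => ψ.1 x - g x).toNNReal (ψ.2.2.comp₂ hg.periodic _)
      (ψ.2.1.continuous.stronglyMeasurable.sub hg.meas) (coe_toNNReal hψ.ne).ge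
    refine (hψℓ ψ _ h2).trans (le_of_eq ?_)
    push_cast
    rw [coe_toNNReal hψ.ne]
    ring
  have hmol : Tendsto (fun n => molTest n hgi) atTop (comap (fun ψ : PeriodicTest E3 =>
      sobolevNorm (1 / 2) q fun x => ψ.1 x - g x) (𝓝 0)) := by
    rw [tendsto_comap_iff]
    obtain ⟨C₂, hC₂⟩ := exists_sobolevNorm_le_of_nik (F := E3) (s := 1 / 2) (κ := κ / 2) (q := q)
      (by linarith) hq
    refine tendsto_zero_of_le_mul (C := C₂ * (2 * m * B)) (tendsto_half_rpow (half_pos hκ0))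
      (.of_forall fun n => ?_)
    have := nik_molTest_sub (κ := κ / 2) hq' (by linarith) (by linarith) hg n
    rw [show τ - κ / 2 = 1 / 2 + κ / 2 by rw [hκ]; ring] at this
    rw [mul_assoc]
    exact_mod_cast hC₂ _ _ this
  have := hmol.neBot
  rw [bracket, hcomap.limUnder_eq]
  exact hcomap.comp hmol

/-- The basic estimate for the duality bracket. -/
theorem exists_bracket_le (hσ : 1 / 2 < σ) (hτ : 1 / 2 < τ) :
    ∃ C : ℝ≥0, ∀ (u g : E3 → E3) (A B : ℝ≥0), Nik p σ A u → Nik (ofReal q) τ B g →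
      ‖bracket (1 / 2) q (curlFn u) g‖ₑ ≤ C * A * B := by
  obtain ⟨hp, hq, hq'⟩ := ExpPair.le p q
  obtain ⟨C, hC⟩ := exists_curlFn_le (p := p) (q := q) hσ
  refine ⟨C * (2 * massOf stdKernel), fun u g A B hu hg => ?_⟩
  have h := tendsto_bracket hσ hτ hu hg (hg.perInt hq')
  refine le_of_tendsto h.enorm (.of_forall fun n => ?_)
  have h2 := (hg.conv hq' (isKernel_dyadicKernel n)).lower (s' := 1 / 2) hq'
    (by norm_num) hτ.le
  rw [massOf_dyadicKernel] at h2
  refine (hC u A _ (molTest n (hg.perInt hq')) hu h2).trans (le_of_eq ?_)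
  push_cast
  ring

theorem memDual_curlFn (hσ : 1 / 2 < σ) {u : E3 → E3} (hu : Nik p σ A u) : MemDual (1 / 2) q (curlFn u) := by
  obtain ⟨hp, hq, hq'⟩ := ExpPair.le p q
  obtain ⟨C, hC⟩ := exists_curlFn_le (p := p) (q := q) hσ
  obtain ⟨C₁, hC₁⟩ := exists_nik_of_sobolevNorm_le (F := E3) (s := 1 / 2) (q := q) (by norm_num)
    (by norm_num) hq
  refine ⟨isLinearMap_curlFn (hu.perInt hp), C * A * C₁ + 1, fun ψ => ?_⟩
  rcases eq_or_ne (sobolevNorm (1 / 2) q ψ.1) ⊤ with h | h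
  · rw [h, ENNReal.mul_top (by simp)]
    exact le_top
  · have h2 := hC₁ ψ.1 (sobolevNorm (1 / 2) q ψ.1).toNNReal ψ.2.2 ψ.2.1.continuous.stronglyMeasurable
      (coe_toNNReal h).ge
    refine (hC u A _ ψ hu h2).trans ?_
    push_cast
    rw [coe_toNNReal h, add_mul, mul_assoc (C * A : ℝ≥0∞)]
    exact le_self_add

theorem memSobolev_of_nik (hq : 1 ≤ q) (hτ : 1 / 2 < τ) (hf : Nik (ofReal q) τ B f) :
    MemSobolev (1 / 2) q f := by
  obtain ⟨C, hC⟩ := exists_sobolevNorm_le_of_nik (F := F) (s := 1 / 2) (κ := τ - 1 / 2) (q := q)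
      (by linarith) hq
  refine ⟨hf.periodic, hf.meas.aestronglyMeasurable, (hC f B (by simpa using hf)).trans_lt ?_⟩
  exact mul_lt_top coe_lt_top coe_lt_top

theorem memSobolev_congr {s r : ℝ} {f g : E3 → F} (h : f =ᵐ[volume] g) (hf : MemSobolev s r f)
    (hg : IsPeriodic g) : MemSobolev s r g :=
  ⟨hg, hf.2.1.congr h, by rw [← sobolevNorm_congr h]; exact hf.2.2⟩

section Linearity

variable {u u' g g' : E3 → E3} {A' B' : ℝ≥0} (hσ : 1 / 2 < σ) (hτ : 1 / 2 < τ) (hu : Nik p σ A u)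
  (hg : Nik (ofReal q) τ B g)

include hσ hτ hu hg

theorem bracket_add_right (hg' : Nik (ofReal q) τ B' g') :
    bracket (1 / 2) q (curlFn u) (fun x => g x + g' x) =
      bracket (1 / 2) q (curlFn u) g + bracket (1 / 2) q (curlFn u) g' := by
  obtain ⟨hp, hq, hq'⟩ := ExpPair.le p q
  have h1 := tendsto_bracket hσ hτ hu hg (hg.perInt hq')
  have h2 := tendsto_bracket hσ hτ hu hg' (hg'.perInt hq')
  have h3 := tendsto_bracket hσ hτ hu (hg.add hg' hq') ((hg.add hg' hq').perInt hq')
  refine tendsto_nhds_unique h3 ((h1.add h2).congr fun n => ?_)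
  rw [← (isLinearMap_curlFn (hu.perInt hp)).map_add]
  congr 1
  ext1
  funext x
  exact (conv_add_apply (isKernel_dyadicKernel n) (hg.perInt hq') (hg'.perInt hq') x).symm

theorem bracket_smul_right (c : ℝ) :
    bracket (1 / 2) q (curlFn u) (fun x => c • g x) = c * bracket (1 / 2) q (curlFn u) g := by
  obtain ⟨hp, hq, hq'⟩ := ExpPair.le p q
  have h1 := tendsto_bracket hσ hτ hu hg (hg.perInt hq')
  have h3 := tendsto_bracket hσ hτ hu (hg.const_smul c) ((hg.const_smul c).perInt hq')
  refine tendsto_nhds_unique h3 ((h1.const_mul c).congr fun n => ?_)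
  rw [← smul_eq_mul, ← (isLinearMap_curlFn (hu.perInt hp)).map_smul]
  congr 1
  ext1
  funext x
  change c • (∫ ξ, dyadicKernel n ξ • g (x + ξ)) = ∫ ξ, dyadicKernel n ξ • (c • g (x + ξ))
  rw [← integral_smul]
  congr 1
  ext1 ξ
  rw [smul_comm]

theorem bracket_sub_right (hg' : Nik (ofReal q) τ B' g') :
    bracket (1 / 2) q (curlFn u) (fun x => g x - g' x) =
      bracket (1 / 2) q (curlFn u) g - bracket (1 / 2) q (curlFn u) g' := by
  have h1 := bracket_smul_right hσ hτ hu hg' (-1)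
  have h2 := bracket_add_right hσ hτ hu hg (hg'.const_smul (-1))
  simp only [neg_smul, one_smul, ← sub_eq_add_neg, neg_mul, one_mul] at h1 h2
  rw [h2, h1]
  ring

theorem bracket_sub_left (hu' : Nik p σ A' u') :
    bracket (1 / 2) q (curlFn fun x => u x - u' x) g =
      bracket (1 / 2) q (curlFn u) g - bracket (1 / 2) q (curlFn u') g := by
  obtain ⟨hp, hq, hq'⟩ := ExpPair.le p q
  have h1 := tendsto_bracket hσ hτ hu hg (hg.perInt hq')
  have h2 := tendsto_bracket hσ hτ hu' hg (hg.perInt hq')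
  have h3 := tendsto_bracket hσ hτ (hu.sub hu' hp) hg (hg.perInt hq')
  refine tendsto_nhds_unique h3 ((h1.sub h2).congr fun n => ?_)
  rw [curlFn_eq (hu.perInt hp), curlFn_eq (hu'.perInt hp), curlFn_eq ((hu.sub hu' hp).perInt hp),
    ← sum_sub_distrib]
  refine sum_congr rfl fun i _ => ?_
  rw [← integral_sub (((hu.perInt hp).coord i).integrable_mul _)
    (((hu'.perInt hp).coord i).integrable_mul _)]
  refine integral_congr_fun fun x => ?_
  simp
  ring

end Linearity

/-- The vector field with given coordinates. -/
def vecOf (v : Fin 3 → SmoothPer) (x : E3) : E3 := WithLp.toLp 2 fun i => (v i).1 x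

theorem cInt_curlS (v w : Fin 3 → SmoothPer) :
    ∑ i, cInt (v i * curlS w i) = ∑ i, cInt (curlS v i * w i) := by
  simp only [Fin.sum_univ_three, curlS, cons_val_zero, cons_val_one, cons_val,
    mul_sub, sub_mul, map_sub, cInt_mul_D]
  ring

/-- For a smooth field the bracket with its curl is an integral. -/
theorem bracket_vecOf (hσ : 1 / 2 < σ) (hτ : 1 / 2 < τ) {v : Fin 3 → SmoothPer} {g : E3 → E3}
    (hv : Nik p σ A (vecOf v)) (hg : Nik (ofReal q) τ B g) :
    bracket (1 / 2) q (curlFn (vecOf v)) g = ∑ i, ∫ x, (curlS v i).1 x * g x i ∂vol := by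
  obtain ⟨hp, hq, hq'⟩ := ExpPair.le p q
  have hgi := hg.perInt hq'
  refine tendsto_nhds_unique (tendsto_bracket hσ hτ hv hg hgi) ?_
  have h1 : ∀ n, curlFn (vecOf v) (molTest n hgi) =
      ∑ i, ∫ x, (molTest n hgi).1 x i * (curlS v i).1 x ∂vol := fun n => by
    rw [curlFn_eq (hv.perInt hp)]
    refine (cInt_curlS v (coordT (molTest n hgi))).trans (sum_congr rfl fun i _ => ?_)
    rw [mul_comm]
    rfl
  simp only [h1]
  refine tendsto_finsetSum _ fun i _ => ?_
  simp only [mul_comm ((curlS v i).1 _)]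
  obtain ⟨b, hb⟩ := (curlS v i).periodic.exists_bound (curlS v i).continuous
  set κ := τ - 1 / 2 with hκ
  have hκ0 : 0 < κ := by linarith
  refine tendsto_enorm_sub_zero (C := 2 * massOf stdKernel * B * b) (tendsto_half_rpow hκ0)
    (.of_forall fun n => ?_)
  have hd := ((nik_molTest_sub (κ := κ) hq' hκ0.le (by linarith) hg n).coord i)
  have hd1 := (hd.exponent hq').norm_le
  have hm1 : Integrable (fun x => (molTest n hgi).1 x i * (curlS v i).1 x) vol :=
    (coordT (molTest n hgi) i).perInt.integrable_mul _
  rw [mul_right_comm, ← integral_sub hm1 ((hgi.coord i).integrable_mul _)]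
  simp only [← sub_mul]
  refine (enorm_integral_le_lintegral_enorm _).trans ?_
  calc _ ≤ ∫⁻ x, ‖(molTest n hgi).1 x i - g x i‖ₑ * b ∂vol := by
        refine lintegral_mono fun x => ?_
        rw [enorm_mul]
        exact mul_le_mul' le_rfl (hb x)
    _ = (∫⁻ x, ‖(molTest n hgi).1 x i - g x i‖ₑ ∂vol) * b :=
        lintegral_mul_const' _ _ coe_ne_top
    _ ≤ _ := by
        rw [ENNReal.coe_mul]
        refine mul_le_mul' ?_ le_rfl
        rw [eLpNorm_one_eq_lintegral_enorm] at hd1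
        exact hd1

theorem stronglyMeasurable_conv_param {P : Type*} [MeasurableSpace P] (hk : Measurable k)
    {g : P → E3 → F} (hg : JMeas g) : JMeas fun y => conv k (g y) := by
  have : StronglyMeasurable fun z : (P × E3) × E3 => k z.2 • g z.1.1 (z.1.2 + z.2) :=
    (hk.comp measurable_snd).stronglyMeasurable.smul (hg.comp_measurable
      ((measurable_fst.comp measurable_fst).prodMk
        ((measurable_snd.comp measurable_fst).add measurable_snd)))
  exact this.integral_prod_right

theorem curlFn_molTest {u g : E3 → E3} (hu : PerInt u) (hg : PerInt g) (n : ℕ) :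
    curlFn u (molTest n hg) = ∑ i, ∫ x, u x i *
      (![conv (pd 2 (dyadicKernel n)) g x 1 - conv (pd 1 (dyadicKernel n)) g x 2,
        conv (pd 0 (dyadicKernel n)) g x 2 - conv (pd 2 (dyadicKernel n)) g x 0,
        conv (pd 1 (dyadicKernel n)) g x 0 - conv (pd 0 (dyadicKernel n)) g x 1] : Fin 3 → ℝ) i
        ∂vol := by
  have hk := isKernel_dyadicKernel n
  have h : ∀ i j x, (D i (coordT (molTest n hg) j)).1 x = -conv (pd i (dyadicKernel n)) g x j :=
    fun i j x => by
      have e1 : coordT (molTest n hg) j = mol hk (hg.coord j) := by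
        ext y; exact conv_coord hk hg y j
      rw [e1, conv_coord (hk.pd i) hg]
      exact pd_conv hk (hg.coord j) i x
  rw [curlFn_eq hu]
  refine sum_congr rfl fun i _ => integral_congr_fun fun x => ?_
  fin_cases i <;> simp [curlS, h] <;> ring_nf <;> simp

/-- Measurability of the bracket in parameters. -/
theorem stronglyMeasurable_bracket (hσ : 1 / 2 < σ) (hτ : 1 / 2 < τ) {P : Type*} [MeasurableSpace P]
    {u g : P → E3 → E3} {A B : P → ℝ≥0} (hum : JMeas u)
    (hgm : JMeas g) (hu : ∀ y, Nik p σ (A y) (u y)) (hg : ∀ y, Nik (ofReal q) τ (B y) (g y)) :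
    StronglyMeasurable fun y => bracket (1 / 2) q (curlFn (u y)) (g y) := by
  obtain ⟨hp, hq, hq'⟩ := ExpPair.le p q
  refine stronglyMeasurable_of_tendsto atTop (f := fun n y => curlFn (u y)
    (molTest n ((hg y).perInt hq'))) (fun n => ?_) (tendsto_pi_nhds.2 fun y =>
      tendsto_bracket hσ hτ (hu y) (hg y) _)
  simp only [fun y => curlFn_molTest ((hu y).perInt hp) ((hg y).perInt hq') n]
  have hpr : ∀ {f : P × E3 → E3} (i : Fin 3), StronglyMeasurable f →
      StronglyMeasurable fun z => f z i := fun i hf =>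
    (EuclideanSpace.proj i : E3 →L[ℝ] ℝ).continuous.comp_stronglyMeasurable hf
  have hc : ∀ j i, StronglyMeasurable fun z : P × E3 =>
      conv (pd j (dyadicKernel n)) (g z.1) z.2 i := fun j i =>
    hpr i (stronglyMeasurable_conv_param
      ((isKernel_dyadicKernel n).pd j).continuous.measurable hgm)
  refine stronglyMeasurable_fun_sum _ fun i _ => ?_
  refine StronglyMeasurable.integral_prod_right (f := fun (y : P) (x : E3) => u y x i * _)
    ((hpr i hum).mul ?_)
  fin_cases i
  · exact (hc 2 1).sub (hc 1 2)
  · exact (hc 0 2).sub (hc 2 0)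
  · exact (hc 1 0).sub (hc 0 1)

end Bracket

/-! ### A compactly supported potential for differences of dilates -/

section Potential

/-- Minus the derivative of a mollified Newtonian potential, as a function of `|x|²`. -/
def newtonProfile (r : ℝ) : ℝ := r ^ (-(3 / 2) : ℝ) * smoothTransition (2 * r - 1)

theorem newtonProfile_eq_zero {r : ℝ} (h : r ≤ 1 / 2) : newtonProfile r = 0 := by
  rw [newtonProfile, smoothTransition.zero_of_nonpos (by linarith), mul_zero]

theorem newtonProfile_of_one_le {r : ℝ} (h : 1 ≤ r) : newtonProfile r = r ^ (-(3 / 2) : ℝ) := by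
  rw [newtonProfile, smoothTransition.one_of_one_le (by linarith), mul_one]

theorem contDiff_newtonProfile : ContDiff ℝ (⊤ : ℕ∞) newtonProfile := by
  rw [contDiff_iff_contDiffAt]
  intro r
  rcases lt_or_ge r (1 / 2) with h | h
  · have : newtonProfile =ᶠ[𝓝 r] fun _ => 0 := by
      filter_upwards [gt_mem_nhds h] with s hs using newtonProfile_eq_zero hs.le
    exact contDiffAt_const.congr_of_eventuallyEq this
  · exact (Real.contDiffAt_rpow_const_of_ne (by linarith : r ≠ 0)).mul
      (smoothTransition.contDiff.contDiffAt.comp r (by fun_prop))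

theorem newtonProfile_add_deriv {r : ℝ} (hr : 0 < r) :
    6 * newtonProfile r + 4 * r * deriv newtonProfile r =
      8 * r ^ (-(1 / 2) : ℝ) * deriv smoothTransition (2 * r - 1) := by
  have h1 : HasDerivAt (fun s : ℝ => smoothTransition (2 * s - 1))
      (deriv smoothTransition (2 * r - 1) * 2) r := by
    have h2 : HasDerivAt (fun s : ℝ => 2 * s - 1) 2 r := by
      simpa using ((hasDerivAt_id r).const_mul 2).sub_const 1
    exact (((smoothTransition.contDiff (n := 1)).differentiable (by simp)).differentiableAt
      (x := 2 * r - 1)).hasDerivAt.comp r h2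
  have h3 := (Real.hasDerivAt_rpow_const (p := -(3 / 2)) (Or.inl hr.ne')).mul h1
  have h4 : deriv newtonProfile r = _ := h3.deriv
  have e1 : r ^ (-(3 / 2) : ℝ) = r ^ (-(5 / 2) : ℝ) * r := by
    rw [← rpow_add_one hr.ne']; norm_num
  have e2 : r ^ (-(1 / 2) : ℝ) = r ^ (-(5 / 2) : ℝ) * r * r := by
    rw [← rpow_add_one hr.ne', ← rpow_add_one hr.ne']; norm_num
  have e3 : r ^ (-(3 / 2) - 1 : ℝ) = r ^ (-(5 / 2) : ℝ) := by norm_num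
  rw [h4, newtonProfile, e3, e2, e1]
  ring

theorem newtonProfile_dilate {r : ℝ} (hr : 4 ≤ r) : newtonProfile r = newtonProfile (r / 4) / 8 := by
  rw [newtonProfile_of_one_le (by linarith), newtonProfile_of_one_le (by linarith),
    Real.div_rpow (show 0 ≤ r by linarith) (by norm_num), show (4 : ℝ) = 2 ^ (2 : ℝ) by norm_num,
    ← rpow_mul (by norm_num), show (2 : ℝ) * -(3 / 2) = -3 by norm_num,
    rpow_neg (x := 2) (by norm_num)]
  norm_num
  ring

theorem pd_radial {f : ℝ → ℝ} (hf : Differentiable ℝ f) (i : Fin 3) (x : E3) :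
    pd i (fun y : E3 => f (‖y‖ ^ 2)) x = 2 * x i * deriv f (‖x‖ ^ 2) := by
  have h1 := (hasStrictFDerivAt_norm_sq x).hasFDerivAt
  have h2 := (hf (‖x‖ ^ 2)).hasDerivAt.comp_hasFDerivAt x h1
  rw [pd]
  change fderiv ℝ (f ∘ fun y : E3 => ‖y‖ ^ 2) x (e i) = _
  rw [h2.fderiv]
  simp [e, EuclideanSpace.inner_single_right]
  ring

theorem pd_coord_mul_radial {f : ℝ → ℝ} (hf : Differentiable ℝ f) (i : Fin 3) (x : E3) :
    pd i (fun y : E3 => y i * f (‖y‖ ^ 2)) x = f (‖x‖ ^ 2) + 2 * x i ^ 2 * deriv f (‖x‖ ^ 2) := by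
  have h1 : HasFDerivAt (fun y : E3 => y i) (EuclideanSpace.proj i : E3 →L[ℝ] ℝ) x :=
    (EuclideanSpace.proj i : E3 →L[ℝ] ℝ).hasFDerivAt
  have h2 : DifferentiableAt ℝ (fun y : E3 => f (‖y‖ ^ 2)) x :=
    (hf _).comp x (differentiableAt_id.norm_sq ℝ)
  have h3 : HasFDerivAt (fun y : E3 => y i * f (‖y‖ ^ 2)) _ x := h1.mul h2.hasFDerivAt
  have h4 := pd_radial hf i x
  rw [pd] at h4 ⊢
  rw [h3.fderiv]
  simp [h4]
  simp [e]
  ring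

theorem contDiff_radial {f : ℝ → ℝ} (hf : ContDiff ℝ (⊤ : ℕ∞) f) :
    ContDiff ℝ (⊤ : ℕ∞) fun x : E3 => f (‖x‖ ^ 2) := hf.comp (contDiff_norm_sq ℝ)

theorem hasCompactSupport_radial {f : ℝ → ℝ} {R : ℝ} (hR : 0 ≤ R) (hf : ∀ r, R ^ 2 < r → f r = 0) :
    HasCompactSupport fun x : E3 => f (‖x‖ ^ 2) := by
  refine HasCompactSupport.of_support_subset_isCompact (isCompact_closedBall 0 R) fun x hx => ?_
  rw [mem_closedBall_zero_iff]
  by_contra h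
  exact hx (hf _ (by gcongr; exact not_le.1 h))

/-- The mollified point charge. -/
def chargeProfile (r : ℝ) : ℝ := 6 * newtonProfile r + 4 * r * deriv newtonProfile r

theorem contDiff_chargeProfile : ContDiff ℝ (⊤ : ℕ∞) chargeProfile := by
  have h := (contDiff_infty_iff_deriv.1 contDiff_newtonProfile).2
  exact (contDiff_const.mul contDiff_newtonProfile).add ((contDiff_const.mul contDiff_id).mul h)

theorem deriv_smoothTransition_nonneg (x : ℝ) : 0 ≤ deriv smoothTransition x :=
  smoothTransition.monotone.deriv_nonneg

theorem chargeProfile_eq {r : ℝ} (hr : 0 < r) : chargeProfile r =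
    8 * r ^ (-(1 / 2) : ℝ) * deriv smoothTransition (2 * r - 1) := newtonProfile_add_deriv hr

theorem chargeProfile_eq_zero {r : ℝ} (hr : 1 < r) : chargeProfile r = 0 := by
  have h : smoothTransition =ᶠ[𝓝 (2 * r - 1)] fun _ => 1 := by
    filter_upwards [lt_mem_nhds (show 1 < 2 * r - 1 by linarith)] with s hs
      using smoothTransition.one_of_one_le hs.le
  rw [chargeProfile_eq (by linarith), h.deriv_eq]
  simp

theorem chargeProfile_nonneg {r : ℝ} (hr : 0 ≤ r) : 0 ≤ chargeProfile r := by
  rcases hr.eq_or_lt with rfl | hr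
  · rw [chargeProfile, newtonProfile_eq_zero (by norm_num)]
    simp
  · rw [chargeProfile_eq hr]
    have := deriv_smoothTransition_nonneg (2 * r - 1)
    positivity

theorem exists_chargeProfile_ne_zero : ∃ r, 0 < r ∧ chargeProfile r ≠ 0 := by
  obtain ⟨c, hc, h⟩ := exists_deriv_eq_slope smoothTransition (a := 0) (b := 1) one_pos
    smoothTransition.continuous.continuousOn
    ((smoothTransition.contDiff (n := 1)).differentiable (by simp)).differentiableOn
  rw [smoothTransition.one, smoothTransition.zero] at h
  refine ⟨(c + 1) / 2, by linarith [hc.1], ?_⟩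
  rw [chargeProfile_eq (by linarith [hc.1]), show 2 * ((c + 1) / 2) - 1 = c by ring, h]
  have : 0 < (c + 1) / 2 := by linarith [hc.1]
  positivity

theorem integral_charge_pos : 0 < ∫ x : E3, chargeProfile (‖x‖ ^ 2) := by
  obtain ⟨r, hr, h⟩ := exists_chargeProfile_ne_zero
  refine Continuous.integral_pos_of_hasCompactSupport_nonneg_nonzero (x := √r • e 0)
    (contDiff_radial contDiff_chargeProfile).continuous
    (hasCompactSupport_radial zero_le_one fun r hr => chargeProfile_eq_zero (by simpa using hr))
    (fun x => chargeProfile_nonneg (by positivity)) ?_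
  rw [norm_smul, norm_e, mul_one, norm_eq_abs, sq_abs, Real.sq_sqrt hr.le]
  exact h

/-- The difference of two mollified Newtonian potentials. -/
def potentialProfile (s : ℝ) : ℝ :=
  ∫ r in (4 : ℝ)..s, (newtonProfile (r / 4) / 8 - newtonProfile r)

theorem hasDerivAt_potentialProfile (s : ℝ) :
    HasDerivAt potentialProfile (newtonProfile (s / 4) / 8 - newtonProfile s) s := by
  have hc : Continuous fun r => newtonProfile (r / 4) / 8 - newtonProfile r :=
    ((contDiff_newtonProfile.continuous.comp (by fun_prop)).div_const 8).sub
      contDiff_newtonProfile.continuous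
  exact intervalIntegral.integral_hasDerivAt_right (hc.intervalIntegrable _ _)
    (hc.stronglyMeasurableAtFilter _ _) hc.continuousAt

theorem contDiff_potentialProfile : ContDiff ℝ (⊤ : ℕ∞) potentialProfile := by
  rw [contDiff_infty_iff_deriv]
  refine ⟨fun s => (hasDerivAt_potentialProfile s).differentiableAt, ?_⟩
  rw [show deriv potentialProfile = fun s => newtonProfile (s / 4) / 8 - newtonProfile s from
    funext fun s => (hasDerivAt_potentialProfile s).deriv]
  exact ((contDiff_newtonProfile.comp (contDiff_id.div_const 4)).div_const 8).sub
    contDiff_newtonProfile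

theorem potentialProfile_eq_zero (hs : 4 ≤ s) : potentialProfile s = 0 := by
  rw [potentialProfile]
  refine intervalIntegral.integral_zero_ae (.of_forall fun r hr => ?_)
  rw [uIoc_of_le hs] at hr
  rw [← newtonProfile_dilate hr.1.le, sub_self]

theorem sum_pd_pd_potential (x : E3) : ∑ i, pd i (pd i fun y : E3 => potentialProfile (‖y‖ ^ 2)) x =
      dilate (fun y => chargeProfile (‖y‖ ^ 2)) 2 x - chargeProfile (‖x‖ ^ 2) := by
  set k : ℝ → ℝ := fun s => newtonProfile (s / 4) / 8 - newtonProfile s with hk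
  have hkd : ∀ s, HasDerivAt k (deriv newtonProfile (s / 4) / 32 - deriv newtonProfile s) s := by
    intro s
    have h0 : Differentiable ℝ newtonProfile := contDiff_newtonProfile.differentiable (by simp)
    have h1 : HasDerivAt (fun s => newtonProfile (s / 4)) (deriv newtonProfile (s / 4) * (1 / 4)) s :=
      HasDerivAt.comp (h := fun s : ℝ => s / 4) s (h0 (s / 4)).hasDerivAt
        ((hasDerivAt_id s).div_const 4)
    have h2 := (h1.div_const 8).sub (h0 s).hasDerivAt
    have e1 : deriv newtonProfile (s / 4) * (1 / 4) / 8 = deriv newtonProfile (s / 4) / 32 := by ring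
    rw [e1] at h2
    exact h2
  have h1 : ∀ i, pd i (fun y : E3 => potentialProfile (‖y‖ ^ 2)) =
      fun y => y i * (2 * k (‖y‖ ^ 2)) := fun i => by
    ext y
    rw [pd_radial (fun s => (hasDerivAt_potentialProfile s).differentiableAt),
      (hasDerivAt_potentialProfile _).deriv]
    ring
  have h2 : Differentiable ℝ fun s => 2 * k s := fun s => ((hkd s).const_mul 2).differentiableAt
  have h3 : ∀ i, pd i (pd i fun y : E3 => potentialProfile (‖y‖ ^ 2)) x = 2 * k (‖x‖ ^ 2) +
      2 * x i ^ 2 * (2 * (deriv newtonProfile (‖x‖ ^ 2 / 4) / 32 - deriv newtonProfile (‖x‖ ^ 2))) :=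
    fun i => by
      rw [h1, pd_coord_mul_radial h2 i x, ((hkd _).const_mul 2).deriv]
  have h4 : ‖x‖ ^ 2 = x 0 ^ 2 + x 1 ^ 2 + x 2 ^ 2 := by
    rw [EuclideanSpace.norm_sq_eq, Fin.sum_univ_three]
    simp
  have h5 : ‖(2 : ℝ)⁻¹ • x‖ ^ 2 = ‖x‖ ^ 2 / 4 := by
    rw [norm_smul, mul_pow]; norm_num; ring
  simp only [h3, dilate, h5, chargeProfile, Fin.sum_univ_three, hk]
  linear_combination -4 * (deriv newtonProfile (‖x‖ ^ 2 / 4) / 32 - deriv newtonProfile (‖x‖ ^ 2)) * h4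

/-- A kernel whose dilates telescope to the inverse of the Laplacian. -/
theorem exists_potential : ∃ φ Ψ : E3 → ℝ, IsUnitKernel φ ∧ IsKernel Ψ ∧ (∀ x, Ψ (-x) = Ψ x) ∧
    (∀ ξ, Ψ ξ ≠ 0 → ‖ξ‖ₑ ≤ (2 : ℝ≥0)) ∧ ∀ x, ∑ i, pd i (pd i Ψ) x = dilate φ 2 x - φ x := by
  set c := ∫ x : E3, chargeProfile (‖x‖ ^ 2) with hc
  have hc0 : c ≠ 0 := integral_charge_pos.ne'
  refine ⟨fun x => c⁻¹ * chargeProfile (‖x‖ ^ 2), fun x => c⁻¹ * potentialProfile (‖x‖ ^ 2),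
    ⟨⟨contDiff_const.mul (contDiff_radial contDiff_chargeProfile), ?_⟩, fun x => by simp, ?_⟩,
    ⟨contDiff_const.mul (contDiff_radial contDiff_potentialProfile), ?_⟩, fun x => by simp, fun ξ hξ => ?_, ?_⟩
  · have h : HasCompactSupport fun x : E3 => chargeProfile (‖x‖ ^ 2) :=
      hasCompactSupport_radial zero_le_one fun r hr => chargeProfile_eq_zero (by simpa using hr)
    exact h.mul_left
  · rw [integral_const_mul]
    exact inv_mul_cancel₀ hc0
  · have h : HasCompactSupport fun x : E3 => potentialProfile (‖x‖ ^ 2) :=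
      hasCompactSupport_radial zero_le_two fun r hr => potentialProfile_eq_zero (by linarith)
    exact h.mul_left
  · rw [← ofReal_norm, ← ENNReal.ofReal_coe_nnreal]
    refine ofReal_le_ofReal ?_
    by_contra h
    refine hξ (mul_eq_zero_of_right _ (potentialProfile_eq_zero ?_))
    have h2 : (2 : ℝ) < ‖ξ‖ := not_le.1 h
    nlinarith
  · intro x
    have hd : Differentiable ℝ fun y : E3 => potentialProfile (‖y‖ ^ 2) :=
      (contDiff_radial contDiff_potentialProfile).differentiable (by simp)
    have h1 : ∀ (f : E3 → ℝ) (i : Fin 3), Differentiable ℝ f →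
        pd i (fun y => c⁻¹ * f y) = fun y => c⁻¹ * pd i f y := fun f i hf => by
      ext y
      simp only [pd]
      rw [fderiv_const_mul (hf y)]
      simp
    have h2 : ∀ i, pd i (pd i fun x : E3 => c⁻¹ * potentialProfile (‖x‖ ^ 2)) x =
        c⁻¹ * pd i (pd i fun y : E3 => potentialProfile (‖y‖ ^ 2)) x := fun i => by
      rw [h1 _ _ hd, h1 _ _ ((contDiff_pd (contDiff_radial contDiff_potentialProfile) i).differentiable
        (by simp))]
    simp only [h2, ← mul_sum, sum_pd_pd_potential]
    simp only [dilate]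
    ring

end Potential

/-! ### Large scales -/

section LargeScale

theorem dilate_dilate (k : E3 → ℝ) (a b : ℝ) : dilate (dilate k a) b = dilate k (a * b) := by
  ext x
  simp only [dilate, smul_smul, mul_inv, mul_pow]
  ring

theorem pd_const_mul {f : E3 → ℝ} (hf : ContDiff ℝ (⊤ : ℕ∞) f) (c : ℝ) (i : Fin 3) :
    pd i (fun x => c * f x) = fun x => c * pd i f x := by
  ext x
  simp only [pd]
  rw [fderiv_const_mul (hf.differentiable (by simp) x)]
  simp

theorem pd_pd_dilate (hk : IsKernel k) (hε : 0 < ε) (i l : Fin 3) :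
    pd i (pd l (dilate k ε)) = fun x => (ε ^ 2)⁻¹ * dilate (pd i (pd l k)) ε x := by
  rw [pd_dilate hk, pd_const_mul ((hk.pd l).dilate hε).smooth, pd_dilate (hk.pd l)]
  ext x
  field_simp

theorem eLpNorm_conv_le (hk : IsKernel k) (hq : 1 ≤ q) (hf : IsPeriodic f)
    (hm : StronglyMeasurable f) : eLpNorm (conv k f) q vol ≤ massOf k * eLpNorm f q vol := by
  rw [hk.coe_massOf]
  refine eLpNorm_integral_smul_le hk.continuous.measurable (G := fun ξ x => f (x + ξ))
    (hm.comp_measurable (measurable_snd.add measurable_fst)) hq fun ξ _ => ?_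
  rw [hf.eLpNorm_add_right hm]

theorem integral_conv (hk : IsKernel k) {f : E3 → ℝ} (hf : PerInt f) :
    ∫ x, conv k f x ∂vol = (∫ ξ, k ξ) * ∫ x, f x ∂vol := by
  have h := integral_conv_mul hk hf (g := fun _ => 1) (fun _ _ => rfl) continuous_const
  have h2 : ∀ x : E3, conv (fun ξ => k (-ξ)) (fun _ => (1 : ℝ)) x = ∫ ξ, k ξ := fun x => by
    simp only [conv, smul_eq_mul, mul_one]
    exact integral_neg_eq_self k volume
  simp only [mul_one, h2, integral_mul_const] at h
  rw [h, mul_comm]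

theorem exists_massOf_translate_le {m : E3 → ℝ} (hm : IsKernel m) (Y : ℝ) :
    ∃ C : ℝ≥0, ∀ z : E3, ‖z‖ ≤ Y → (massOf fun ξ => m ξ - m (ξ - z) : ℝ≥0∞) ≤ C * ‖z‖ₑ := by
  obtain ⟨L, hL⟩ := ContDiff.lipschitzWith_of_hasCompactSupport (𝕂 := ℝ) hm.compact hm.smooth (by simp)
  obtain ⟨R, hR⟩ := hm.compact.isBounded.exists_norm_le
  have hv : volume (closedBall (0 : E3) (R + Y)) ≠ ⊤ :=
    (isCompact_closedBall _ _).measure_lt_top.ne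
  refine ⟨L * (volume (closedBall (0 : E3) (R + Y))).toNNReal, fun z hz => ?_⟩
  have hk : IsKernel fun ξ => m ξ - m (ξ - z) := by
    have h1 : IsKernel fun ξ => m (ξ - z) :=
      ⟨hm.smooth.comp (contDiff_id.sub contDiff_const),
        hm.compact.comp_homeomorph (Homeomorph.subRight z)⟩
    exact hm.sub h1
  rw [hk.coe_massOf]
  have h0 : ∀ ξ : E3, ‖m ξ - m (ξ - z)‖ₑ ≤
      (closedBall (0 : E3) (R + Y)).indicator (fun _ => L * ‖z‖ₑ) ξ := by
    intro ξ
    by_cases h : ξ ∈ closedBall (0 : E3) (R + Y)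
    · rw [indicator_of_mem h, ← edist_eq_enorm_sub]
      refine (hL ξ (ξ - z)).trans (le_of_eq ?_)
      rw [edist_eq_enorm_sub, sub_sub_cancel]
    · rw [mem_closedBall_zero_iff, not_le] at h
      have hY : 0 ≤ Y := (norm_nonneg z).trans hz
      have e1 : m ξ = 0 := by
        by_contra h1
        exact absurd (hR ξ (subset_tsupport m h1)) (by linarith)
      have e2 : m (ξ - z) = 0 := by
        by_contra h1
        have := hR _ (subset_tsupport m h1)
        have h3 := norm_sub_norm_le ξ z
        linarith
      simp [e1, e2]
  refine (lintegral_mono h0).trans ?_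
  rw [lintegral_indicator measurableSet_closedBall, setLIntegral_const]
  push_cast
  rw [coe_toNNReal hv]
  exact le_of_eq (by ring)

/-- At large scales, correlations of periodic functions are almost constant. -/
theorem exists_eLpNorm_conv_dilate_sub_mean_le {m : E3 → ℝ} (hm : IsKernel m) :
    ∃ C : ℝ≥0, ∀ (q : ℝ≥0∞) (l : ℝ) (f : E3 → ℝ), 1 ≤ q → 1 ≤ l → PerInt f →
      eLpNorm (fun x => conv (dilate m l) f x - (∫ ξ, m ξ) * ∫ y, f y ∂vol) q vol ≤
        C * (l⁻¹).toNNReal * eLpNorm f q vol := by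
  obtain ⟨Y, hY⟩ := isBounded_cell.exists_norm_le
  obtain ⟨C, hC⟩ := exists_massOf_translate_le hm Y
  refine ⟨C * Y.toNNReal, fun q l f hq hl hf => ?_⟩
  have hl0 : 0 < l := by linarith
  have hk := hm.dilate hl0
  set k := dilate m l with hkd
  have hcc := contDiff_conv hk hf
  have hcp : PerInt (conv k f) := (hf.periodic.conv k).perInt_of_continuous hcc.continuous
  have hint : ∀ x, Integrable (fun y => conv k f (x + y)) vol := fun x => by
    simpa only [add_comm x] using (hcp.shift x).integrable
  have h1 : (fun x => conv k f x - (∫ ξ, m ξ) * ∫ y, f y ∂vol) = fun x =>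
      ∫ y, cell.indicator (fun _ => (1 : ℝ)) y • (conv k f x - conv k f (x + y)) := by
    ext x
    have e1 : (fun y => cell.indicator (fun _ => (1 : ℝ)) y • (conv k f x - conv k f (x + y))) =
        cell.indicator fun y => conv k f x - conv k f (x + y) := by
      ext y
      by_cases h : y ∈ cell <;> simp [h]
    rw [e1, integral_indicator measurableSet_cell, integral_sub (integrable_const _) (hint x),
      integral_const]
    simp only [add_comm x]
    rw [hcp.periodic.integral_add_right x, integral_conv hk hf, hkd, integral_dilate m hl0]
    simp
  have h2 : ∀ y, (fun x => conv k f x - conv k f (x + y)) =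
      conv (dilate (fun ξ => m ξ - m (ξ - l⁻¹ • y)) l) f := fun y => by
    ext x
    have e2 : dilate (fun ξ => m ξ - m (ξ - l⁻¹ • y)) l = fun ξ => k ξ - k (ξ - y) := by
      ext ξ
      simp only [hkd, dilate, smul_sub]
      ring
    have hk1 : IsKernel fun ξ => k (ξ - y) :=
      ⟨hk.smooth.comp (contDiff_id.sub contDiff_const),
        hk.compact.comp_homeomorph (Homeomorph.subRight y)⟩
    rw [e2]
    simp only [conv, sub_smul]
    rw [integral_sub (hk.integrable_smul hf x) (hk1.integrable_smul hf x)]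
    congr 1
    rw [← integral_sub_right_eq_self (fun ξ => k ξ • f (x + y + ξ)) y]
    congr 1
    ext ξ
    congr 2
    abel
  rw [h1]
  have hmeas : JMeas fun y x : E3 => conv k f x - conv k f (x + y) :=
    (hcp.meas.comp_measurable measurable_snd).sub
      (hcp.meas.comp_measurable (measurable_snd.add measurable_fst))
  refine (eLpNorm_integral_smul_le (measurable_const.indicator measurableSet_cell) hmeas hq
    (B := C * Y.toNNReal * (l⁻¹).toNNReal * eLpNorm f q vol) fun y hy => ?_).trans ?_
  · have hyc : y ∈ cell := by
      by_contra h
      exact hy (indicator_of_notMem h _)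
    have hk0 : IsKernel fun ξ => m ξ - m (ξ - l⁻¹ • y) := by
      refine hm.sub ⟨hm.smooth.comp (contDiff_id.sub contDiff_const),
        hm.compact.comp_homeomorph (Homeomorph.subRight (l⁻¹ • y))⟩
    change eLpNorm (fun x => conv k f x - conv k f (x + y)) q vol ≤ _
    rw [h2]
    refine (eLpNorm_conv_le (hk0.dilate hl0) hq hf.periodic hf.meas).trans ?_
    rw [massOf_dilate hk0 hl0]
    refine mul_le_mul' ?_ le_rfl
    have hn : ‖l⁻¹ • y‖ ≤ l⁻¹ * Y := by
      rw [norm_smul, norm_eq_abs, abs_of_pos (inv_pos.2 hl0)]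
      exact mul_le_mul_of_nonneg_left (hY y hyc) (inv_pos.2 hl0).le
    have hY0 : 0 ≤ Y := (norm_nonneg y).trans (hY y hyc)
    have hn1 : ‖l⁻¹ • y‖ ≤ Y :=
      hn.trans (mul_le_of_le_one_left hY0 (inv_le_one_of_one_le₀ hl))
    refine (hC _ hn1).trans ?_
    rw [mul_assoc]
    refine mul_le_mul' le_rfl ?_
    rw [← ofReal_norm, mul_comm (Y.toNNReal : ℝ≥0∞), ← ENNReal.coe_mul,
      ← Real.toNNReal_mul (inv_pos.2 hl0).le]
    exact ofReal_le_ofReal hn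
  · simp only [enorm_indicator_eq_indicator_enorm]
    rw [lintegral_indicator measurableSet_cell]
    simp

theorem exists_nik_conv_dilate {m : E3 → ℝ} (hm : IsKernel m) (h0 : ∫ ξ, m ξ = 0) :
    ∃ C : ℝ≥0, ∀ (q : ℝ≥0∞) (s l : ℝ) (A : ℝ≥0) (f : E3 → ℝ), 1 ≤ q → 1 ≤ l → Nik q s A f →
      Nik q s (C * (l⁻¹).toNNReal * A) (conv (dilate m l) f) := by
  obtain ⟨C, hC⟩ := exists_eLpNorm_conv_dilate_sub_mean_le hm
  simp only [h0, zero_mul, sub_zero] at hC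
  refine ⟨C, fun q s l A f hq hl hf => ?_⟩
  have hk := hm.dilate (zero_lt_one.trans_le hl)
  refine ⟨hf.periodic.conv _, stronglyMeasurable_conv hk.continuous.measurable hf.meas, ?_,
    fun h => ?_⟩
  · refine (hC q l f hq hl (hf.perInt hq)).trans ?_
    push_cast
    exact mul_le_mul' le_rfl hf.norm_le
  · rw [increment_conv hk (hf.perInt hq)]
    refine (hC q l _ hq hl ⟨hf.periodic.increment h, stronglyMeasurable_increment hf.meas h,
      ((hf.perInt hq).increment h).integrable⟩).trans ?_
    push_cast
    rw [mul_assoc ((C : ℝ≥0∞) * _)]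
    exact mul_le_mul' le_rfl (hf.incr_le h)

end LargeScale

/-! ### Dyadic series -/

section Dyadic

theorem sum_Ico_geometric_le {θ : ℝ≥0} (hθ : θ < 1) (A : ℝ≥0) (n k : ℕ) :
    ∑ j ∈ Finset.Ico n k, A * θ ^ j ≤ A * θ ^ n / (1 - θ) := by
  have h1 : HasSum (fun j => A * θ ^ n * θ ^ j) (A * θ ^ n * (1 - θ)⁻¹) :=
    (NNReal.hasSum_geometric hθ).mul_left _
  rw [div_eq_mul_inv, Finset.sum_Ico_eq_sum_range]
  simp only [pow_add, ← mul_assoc]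
  exact sum_le_hasSum _ (fun _ _ => zero_le) h1

/-- A geometrically convergent series in a Nikolskii class. -/
theorem nik_limUnder_sum {f : ℕ → E3 → ℝ} {θ : ℝ≥0} (hθ0 : 0 < θ) (hθ : θ < 1) (hq : 1 ≤ q)
    (hf : ∀ j, Nik q s (A * θ ^ j) (f j)) :
    Nik q s (A / (1 - θ)) (fun x => limUnder atTop fun n => ∑ j ∈ Finset.range n, f j x) ∧
    ∀ n, eLpNorm (fun x => ∑ j ∈ Finset.range n, f j x -
      limUnder atTop fun n => ∑ j ∈ Finset.range n, f j x) q vol ≤ (A * θ ^ n / (1 - θ) : ℝ≥0) := by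
  set S : ℕ → E3 → ℝ := fun n x => ∑ j ∈ Finset.range n, f j x with hS
  set L : E3 → ℝ := fun x => limUnder atTop fun n => S n x with hL
  have hSN : ∀ n, Nik q s (A / (1 - θ)) (S n) := fun n => by
    refine (Nik.sum (Finset.range n) (fun j _ => hf j) hq).mono ?_
    simpa using sum_Ico_geometric_le hθ A 0 n
  have hdiff : ∀ n k, n ≤ k → Nik q s (A * θ ^ n / (1 - θ)) fun x => S k x - S n x := fun n k hnk => by
    have h1 : (fun x => S k x - S n x) = fun x => ∑ j ∈ Finset.Ico n k, f j x := by
      ext x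
      rw [Finset.sum_Ico_eq_sub _ hnk]
    rw [h1]
    exact (Nik.sum (Finset.Ico n k) (fun j _ => hf j) hq).mono (sum_Ico_geometric_le hθ A n k)
  have hsm : ∀ n, AEStronglyMeasurable (S n) vol := fun n => (hSN n).meas.aestronglyMeasurable
  have hdiff' : ∀ N n k, N ≤ n → N ≤ k → eLpNorm (S n - S k) q vol ≤
      (A * θ ^ N / (1 - θ) : ℝ≥0) := by
    intro N n k hn hk
    have hmon : ∀ i, N ≤ i → A * θ ^ i / (1 - θ) ≤ A * θ ^ N / (1 - θ) := fun i hi => by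
      rw [div_eq_mul_inv, div_eq_mul_inv]
      exact mul_le_mul' (mul_le_mul' le_rfl (pow_le_pow_of_le_one zero_le hθ.le hi)) le_rfl
    rcases le_total n k with h | h
    · rw [eLpNorm_sub_comm]
      exact (hdiff n k h).norm_le.trans (ENNReal.coe_le_coe.2 (hmon n hn))
    · exact (hdiff k n h).norm_le.trans (ENNReal.coe_le_coe.2 (hmon k hk))
  have hae : ∀ᵐ x ∂vol, ∃ l, Tendsto (fun n => S n x) atTop (𝓝 l) := by
    refine Lp.ae_tendsto_of_cauchy_eLpNorm (p := q) hsm hq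
      (B := fun N => ((A + 1) * θ ^ N / (1 - θ) : ℝ≥0)) ?_ fun N n k hn hk => ?_
    · have h1 : Summable fun N : ℕ => (A + 1) * θ ^ N / (1 - θ) :=
        ((NNReal.hasSum_geometric hθ).summable.mul_left _).div_const _
      exact ENNReal.tsum_coe_ne_top_iff_summable.2 h1
    · refine (hdiff' N n k hn hk).trans_lt (ENNReal.coe_lt_coe.2 ?_)
      have h1 : 0 < 1 - θ := tsub_pos_of_lt hθ
      have h2 : A * θ ^ N < (A + 1) * θ ^ N :=
        mul_lt_mul_of_pos_right (lt_add_one A) (pow_pos hθ0 N)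
      rw [div_eq_mul_inv, div_eq_mul_inv]
      exact mul_lt_mul_of_pos_right h2 (inv_pos.2 h1)
  have hSp : IsPeriodic fun x => fun n => S n x := fun x i => by
    ext n
    exact (hSN n).periodic x i
  have hlim : ∀ᵐ x, Tendsto (fun n => S n x) atTop (𝓝 (L x)) := by
    have := hSp.ae_volume_of_ae_cell (p := fun a => ∃ l, Tendsto a atTop (𝓝 l)) hae
    filter_upwards [this] with x hx using tendsto_nhds_limUnder hx
  have hlimc : ∀ᵐ x ∂vol, Tendsto (fun n => S n x) atTop (𝓝 (L x)) :=
    ae_restrict_of_ae hlim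
  refine ⟨⟨hSp.comp fun a => limUnder atTop a, ?_, ?_, fun h => ?_⟩, fun n => ?_⟩
  · exact StronglyMeasurable.limUnder fun n => (hSN n).meas
  · exact Lp.eLpNorm_le_of_ae_tendsto (.of_forall fun n => (hSN n).norm_le) hsm hlimc
  · have hsh : ∀ᵐ x, Tendsto (fun n => S n (x + h)) atTop (𝓝 (L (x + h))) :=
      (measurePreserving_add_right volume h).quasiMeasurePreserving.ae hlim
    refine Lp.eLpNorm_le_of_ae_tendsto (f := fun n => increment h (S n)) (u := atTop)
      (.of_forall fun n => (hSN n).incr_le h)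
      (fun n => (stronglyMeasurable_increment (hSN n).meas h).aestronglyMeasurable) ?_
    filter_upwards [hlimc, ae_restrict_of_ae hsh] with x hx hx2 using hx2.sub hx
  · refine Lp.eLpNorm_le_of_ae_tendsto (f := fun k x => S n x - S k x) (u := atTop) ?_
      (fun k => (hsm n).sub (hsm k)) ?_
    · filter_upwards [eventually_ge_atTop n] with k hk using hdiff' n n k le_rfl hk
    · filter_upwards [hlimc] with x hx using tendsto_const_nhds.sub hx

end Dyadic

/-! ### The pressure operator -/

section PressureOperator

open SmoothPer

/-- The unit kernel whose dilates are resolved by `potKernel`. -/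
def massKernel : E3 → ℝ := exists_potential.choose

/-- A kernel with `Δ potKernel = dilate massKernel 2 - massKernel`. -/
def potKernel : E3 → ℝ := exists_potential.choose_spec.choose

theorem isUnitKernel_massKernel : IsUnitKernel massKernel :=
  exists_potential.choose_spec.choose_spec.1

theorem isKernel_potKernel : IsKernel potKernel := exists_potential.choose_spec.choose_spec.2.1

theorem potKernel_neg (x : E3) : potKernel (-x) = potKernel x :=
  exists_potential.choose_spec.choose_spec.2.2.1 x

theorem potKernel_radius (ξ : E3) (h : potKernel ξ ≠ 0) : ‖ξ‖ₑ ≤ (2 : ℝ≥0) :=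
  exists_potential.choose_spec.choose_spec.2.2.2.1 ξ h

theorem sum_pd_pd_potKernel (x : E3) :
    ∑ i, pd i (pd i potKernel) x = dilate massKernel 2 x - massKernel x :=
  exists_potential.choose_spec.choose_spec.2.2.2.2 x

/-- The contribution of the `j`-th small and large dyadic scales to the inverse Laplacian. -/
def potStep (j : ℕ) (ξ : E3) : ℝ :=
  ((1 / 2 : ℝ) ^ (j + 1)) ^ 2 * dilate potKernel ((1 / 2) ^ (j + 1)) ξ +
    ((2 : ℝ) ^ j) ^ 2 * dilate potKernel (2 ^ j) ξ

/-- A truncation of the kernel of the inverse Laplacian. -/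
def potSum (n : ℕ) (ξ : E3) : ℝ := ∑ j ∈ Finset.range n, potStep j ξ

theorem IsKernel.const_mul (hk : IsKernel k) (c : ℝ) : IsKernel fun ξ => c * k ξ :=
  ⟨contDiff_const.mul hk.smooth, hk.compact.mul_left⟩

theorem isKernel_zero : IsKernel fun _ => 0 := ⟨contDiff_const, HasCompactSupport.zero⟩

theorem isKernel_sum {ι : Type*} (t : Finset ι) {k : ι → E3 → ℝ} (hk : ∀ i, IsKernel (k i)) :
    IsKernel fun ξ => ∑ i ∈ t, k i ξ := by
  classical
  induction t using induction_on with
  | empty => simpa using isKernel_zero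
  | insert a t ha ih => simpa only [sum_insert ha] using (hk a).add ih

theorem isKernel_potStep (j : ℕ) : IsKernel (potStep j) :=
  ((isKernel_potKernel.dilate (by positivity)).const_mul _).add
    ((isKernel_potKernel.dilate (by positivity)).const_mul _)

theorem isKernel_potSum (n : ℕ) : IsKernel (potSum n) := isKernel_sum _ isKernel_potStep

theorem potSum_neg (n : ℕ) (x : E3) : potSum n (-x) = potSum n x := by
  simp [potSum, potStep, dilate, potKernel_neg]

theorem pd_add {f g : E3 → ℝ} (hf : ContDiff ℝ (⊤ : ℕ∞) f) (hg : ContDiff ℝ (⊤ : ℕ∞) g)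
    (i : Fin 3) : pd i (fun x => f x + g x) = fun x => pd i f x + pd i g x := by
  ext x
  simp only [pd]
  rw [fderiv_fun_add (hf.differentiable (by simp) x) (hg.differentiable (by simp) x)]
  simp

theorem pd_sum {ι : Type*} (t : Finset ι) {f : ι → E3 → ℝ} (hf : ∀ j, ContDiff ℝ (⊤ : ℕ∞) (f j))
    (i : Fin 3) : pd i (fun x => ∑ j ∈ t, f j x) = fun x => ∑ j ∈ t, pd i (f j) x := by
  ext x
  simp only [pd]
  rw [fderiv_fun_sum fun j _ => (hf j).differentiable (by simp) x]
  simp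

theorem pd_comp_neg (hk : ContDiff ℝ (⊤ : ℕ∞) k) (i : Fin 3) (x : E3) :
    pd i (fun y => k (-y)) x = -pd i k (-x) := by
  have h : HasFDerivAt (fun y : E3 => k (-y)) ((fderiv ℝ k (-x)).comp
      (-ContinuousLinearMap.id ℝ E3)) x :=
    HasFDerivAt.comp x (hk.differentiable (by simp) _).hasFDerivAt (hasFDerivAt_id x).neg
  rw [pd, h.fderiv]
  simp [pd]

theorem pd_pd_neg_of_even (hk : ContDiff ℝ (⊤ : ℕ∞) k) (he : ∀ x, k (-x) = k x) (i l : Fin 3)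
    (x : E3) : pd i (pd l k) (-x) = pd i (pd l k) x := by
  have h1 : (fun y => pd l k (-y)) = fun y => (-1) * pd l k y := by
    ext y
    have := pd_comp_neg hk l y
    rw [show (fun y => k (-y)) = k from funext he] at this
    rw [this]
    ring
  have h2 := pd_comp_neg (contDiff_pd hk l) i x
  rw [h1, pd_const_mul (contDiff_pd hk l)] at h2
  linarith

theorem pd_pd_potStep (j : ℕ) (i l : Fin 3) : pd i (pd l (potStep j)) = fun ξ =>
    dilate (pd i (pd l potKernel)) ((1 / 2) ^ (j + 1)) ξ + dilate (pd i (pd l potKernel)) (2 ^ j) ξ := by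
  have h1 : ∀ ε : ℝ, 0 < ε → pd i (pd l fun ξ => ε ^ 2 * dilate potKernel ε ξ) =
      dilate (pd i (pd l potKernel)) ε := fun ε hε => by
    have hk := isKernel_potKernel.dilate hε
    rw [pd_const_mul hk.smooth, pd_const_mul (hk.pd l).smooth, pd_pd_dilate isKernel_potKernel hε]
    ext x
    field_simp
  have hk : ∀ ε : ℝ, 0 < ε → IsKernel fun ξ => ε ^ 2 * dilate potKernel ε ξ := fun ε hε =>
    (isKernel_potKernel.dilate hε).const_mul _
  have ha : (0 : ℝ) < (1 / 2) ^ (j + 1) := by positivity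
  have hb : (0 : ℝ) < 2 ^ j := by positivity
  rw [← h1 _ ha, ← h1 _ hb, ← pd_add ((hk _ ha).pd l).smooth ((hk _ hb).pd l).smooth,
    ← pd_add (hk _ ha).smooth (hk _ hb).smooth]
  rfl

theorem pd_pd_potSum (n : ℕ) (i l : Fin 3) :
    pd i (pd l (potSum n)) = fun ξ => ∑ j ∈ Finset.range n, pd i (pd l (potStep j)) ξ := by
  rw [← pd_sum _ fun j => ((isKernel_potStep j).pd l).smooth,
    ← pd_sum _ fun j => (isKernel_potStep j).smooth]
  rfl

/-- The truncated inverse Laplacian is an inverse up to the smallest and largest scales. -/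
theorem sum_pd_pd_potSum (n : ℕ) (x : E3) : ∑ i, pd i (pd i (potSum n)) x =
    dilate massKernel (2 ^ n) x - dilate massKernel ((1 / 2) ^ n) x := by
  have h1 : ∀ ε : ℝ, ∑ i, dilate (pd i (pd i potKernel)) ε x =
      dilate massKernel (2 * ε) x - dilate massKernel ε x := fun ε => by
    rw [← dilate_dilate]
    simp only [dilate, ← mul_sum, sum_pd_pd_potKernel]
    ring
  simp only [pd_pd_potSum]
  rw [sum_comm]
  simp only [pd_pd_potStep, sum_add_distrib, h1]
  have h2 : ∀ j : ℕ, 2 * (1 / 2 : ℝ) ^ (j + 1) = (1 / 2) ^ j := fun j => by rw [pow_succ]; ring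
  have h3 : ∀ j : ℕ, 2 * (2 : ℝ) ^ j = 2 ^ (j + 1) := fun j => by rw [pow_succ]; ring
  simp only [h2, h3]
  rw [Finset.sum_range_sub' fun j => dilate massKernel ((1 / 2) ^ j) x,
    Finset.sum_range_sub fun j => dilate massKernel (2 ^ j) x]
  simp

/-- The contribution of the `j`-th scales to the pressure with stress tensor `R`. -/
def pressureStep (j : ℕ) (R : Fin 3 → Fin 3 → E3 → ℝ) (x : E3) : ℝ :=
  ∑ i, ∑ l, conv (pd i (pd l (potStep j))) (R i l) x

/-- The pressure with stress tensor `R`. -/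
def pressureOf (R : Fin 3 → Fin 3 → E3 → ℝ) (x : E3) : ℝ :=
  limUnder atTop fun n => ∑ j ∈ Finset.range n, pressureStep j R x

theorem exists_nik_conv_potStep (hκ : 0 ≤ κ) (hκ1 : κ ≤ 1) (i l : Fin 3) :
    ∃ C : ℝ≥0, ∀ (q : ℝ≥0∞) (s : ℝ) (A : ℝ≥0) (f : E3 → ℝ) (j : ℕ), 1 ≤ q → κ ≤ s → Nik q s A f →
      Nik q (s - κ) (C * A * ((1 / 2) ^ κ) ^ j) (conv (pd i (pd l (potStep j))) f) := by
  set m := pd i (pd l potKernel) with hm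
  have hk : IsKernel m := (isKernel_potKernel.pd l).pd i
  have h0 : ∫ ξ, m ξ = 0 := (isKernel_potKernel.pd l).integral_pd i
  obtain ⟨C, hC⟩ := exists_nik_conv_dilate hk h0
  refine ⟨2 * massOf m + 2 * C, fun q s A f j hq hκs hf => ?_⟩
  have ha : (0 : ℝ) < (1 / 2) ^ (j + 1) := by positivity
  have hb : (0 : ℝ) < 2 ^ j := by positivity
  have hs0 : 0 ≤ s := hκ.trans hκs
  have hR : ∀ ξ, dilate m ((1 / 2) ^ (j + 1)) ξ ≠ 0 → ‖ξ‖ₑ ≤ ((1 / 2) ^ j : ℝ≥0) := fun ξ hξ => by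
    have := dilate_ne_zero (pd_ne_zero (pd_ne_zero potKernel_radius l) i) ha ξ hξ
    rwa [toNNReal_half_pow, pow_succ, mul_assoc, one_div, inv_mul_cancel₀ two_ne_zero, mul_one,
      ← one_div] at this
  have h1 : Nik q (s - κ) (2 * massOf m * A * ((1 / 2) ^ κ) ^ j)
      (conv (dilate m ((1 / 2) ^ (j + 1))) f) := by
    have h2 := hf.osc hq hκ hκs (hk.dilate ha) (pow_le_one₀ zero_le (by norm_num)) hR
    rw [massOf_dilate hk ha, half_rpow_pow] at h2
    have h3 : osc (dilate m ((1 / 2) ^ (j + 1))) f = conv (dilate m ((1 / 2) ^ (j + 1))) f := by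
      ext x
      rw [osc_eq (hk.dilate ha) (hf.perInt hq), integral_dilate m ha, h0,
        zero_smul, sub_zero]
    rwa [h3] at h2
  have h4 : Nik q (s - κ) (2 * C * A * ((1 / 2) ^ κ) ^ j) (conv (dilate m (2 ^ j)) f) := by
    refine ((hC q s (2 ^ j) A f hq (one_le_pow₀ (by norm_num)) hf).lower hq (s' := s - κ)
      (by linarith) (by linarith)).mono ?_
    have h5 : (((2 : ℝ) ^ j)⁻¹).toNNReal = (1 / 2) ^ j := by
      rw [← toNNReal_half_pow, one_div, inv_pow]
    have h6 : (1 / 2 : ℝ≥0) ^ j ≤ ((1 / 2) ^ κ) ^ j := by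
      refine pow_le_pow_left₀ zero_le ?_ j
      conv_lhs => rw [← NNReal.rpow_one (1 / 2)]
      exact NNReal.rpow_le_rpow_of_exponent_ge (by norm_num) (by norm_num) hκ1
    rw [h5]
    calc 2 * (C * (1 / 2) ^ j * A) = 2 * C * A * (1 / 2) ^ j := by ring
      _ ≤ _ := mul_le_mul' le_rfl h6
  have h7 : conv (pd i (pd l (potStep j))) f = fun x =>
      conv (dilate m ((1 / 2) ^ (j + 1))) f x + conv (dilate m (2 ^ j)) f x := by
    ext x
    rw [pd_pd_potStep]
    simp only [conv, add_smul]
    exact integral_add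
      ((hk.dilate ha).integrable_smul (hf.perInt hq) x)
      ((hk.dilate hb).integrable_smul (hf.perInt hq) x)
  rw [h7]
  refine (h1.add h4 hq).mono (le_of_eq (by ring))

theorem exists_nik_pressureOf (hκ : 0 < κ) (hκ1 : κ ≤ 1) :
    ∃ C : ℝ≥0, ∀ (q : ℝ≥0∞) (s : ℝ) (A : ℝ≥0) (R : Fin 3 → Fin 3 → E3 → ℝ), 1 ≤ q → κ ≤ s →
      (∀ i l, Nik q s A (R i l)) → Nik q (s - κ) (C * A) (pressureOf R) ∧
        ∀ n, eLpNorm (fun x => ∑ j ∈ Finset.range n, pressureStep j R x - pressureOf R x) q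
          vol ≤ (C * A * ((1 / 2) ^ κ) ^ n : ℝ≥0) := by
  choose C hC using fun i l => exists_nik_conv_potStep hκ.le hκ1 i l
  set θ : ℝ≥0 := (1 / 2) ^ κ with hθd
  have hθ : θ < 1 := NNReal.rpow_lt_one (by norm_num) hκ
  have hθ0 : 0 < θ := NNReal.rpow_pos (by norm_num)
  refine ⟨(∑ i, ∑ l, C i l) / (1 - θ), fun q s A R hq hs hR => ?_⟩
  have h1 : ∀ j, Nik q (s - κ) ((∑ i, ∑ l, C i l) * A * θ ^ j) (pressureStep j R) := fun j => by
    have h2 := Nik.sum Finset.univ (fun i _ => Nik.sum Finset.univ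
      (fun l _ => hC i l q s A (R i l) j hq hs (hR i l)) hq) hq
    refine Nik.mono h2 (le_of_eq ?_)
    simp only [sum_mul]
  obtain ⟨h3, h4⟩ := nik_limUnder_sum hθ0 hθ hq h1
  refine ⟨?_, fun n => (h4 n).trans (ENNReal.coe_le_coe.2 (le_of_eq ?_))⟩
  · convert h3 using 1
    · rw [div_mul_eq_mul_div]
    · rfl
  · ring

theorem stronglyMeasurable_pressureOf {P : Type*} [MeasurableSpace P]
    {R : P → Fin 3 → Fin 3 → E3 → ℝ} (hR : ∀ i l, JMeas fun y => R y i l) :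
    JMeas fun y => pressureOf (R y) := by
  refine StronglyMeasurable.limUnder (f := fun n (z : P × E3) =>
    ∑ j ∈ Finset.range n, pressureStep j (R z.1) z.2) fun n => ?_
  refine stronglyMeasurable_fun_sum _ fun j _ => stronglyMeasurable_fun_sum _
    fun i _ => stronglyMeasurable_fun_sum _ fun l _ => ?_
  exact stronglyMeasurable_conv_param
    (((isKernel_potStep j).pd l).pd i).continuous.measurable (hR i l)

theorem conv_sum_kernel {ι : Type*} (t : Finset ι) {k : ι → E3 → ℝ} (hk : ∀ i, IsKernel (k i))
    {f : E3 → ℝ} (hf : PerInt f) (x : E3) :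
    conv (fun ξ => ∑ i ∈ t, k i ξ) f x = ∑ i ∈ t, conv (k i) f x := by
  simp only [conv, Finset.sum_smul]
  exact integral_finsetSum _ fun i _ => (hk i).integrable_smul hf x

/-- Partial sums of the pressure against a smooth function. -/
theorem integral_pressureStep_mul (n : ℕ) {R : Fin 3 → Fin 3 → E3 → ℝ} (hR : ∀ i l, PerInt (R i l))
    (f : SmoothPer) : ∫ x, (∑ j ∈ Finset.range n, pressureStep j R x) * f.1 x ∂vol =
      ∑ i, ∑ l, ∫ x, R i l x * (D i (D l (J (isKernel_potSum n) f))).1 x ∂vol := by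
  have hk : ∀ i l, IsKernel (pd i (pd l (potSum n))) := fun i l => ((isKernel_potSum n).pd l).pd i
  have h1 : ∀ x, ∑ j ∈ Finset.range n, pressureStep j R x =
      ∑ i, ∑ l, conv (pd i (pd l (potSum n))) (R i l) x := fun x => by
    simp only [pressureStep]
    rw [sum_comm]
    refine sum_congr rfl fun i _ => ?_
    rw [sum_comm]
    refine sum_congr rfl fun l _ => ?_
    rw [pd_pd_potSum, conv_sum_kernel _ (fun j => ((isKernel_potStep j).pd l).pd i) (hR i l)]
  simp only [h1, sum_mul]
  have hi : ∀ i l, Integrable (fun x => conv (pd i (pd l (potSum n))) (R i l) x * f.1 x)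
      vol := fun i l => (mol (hk i l) (hR i l)).perInt.integrable_mul f
  rw [integral_finsetSum _ fun i _ => integrable_finsetSum _ fun l _ => hi i l]
  refine sum_congr rfl fun i _ => ?_
  rw [integral_finsetSum _ fun l _ => hi i l]
  refine sum_congr rfl fun l _ => ?_
  rw [integral_conv_mul_of_even (hk i l) (pd_pd_neg_of_even (isKernel_potSum n).smooth (potSum_neg n) i l)
    (hR i l) f.periodic f.continuous]
  refine integral_congr_fun fun x => ?_
  have h2 : J (hk i l) f = D i (D l (J (isKernel_potSum n) f)) := by
    rw [J_pd ((isKernel_potSum n).pd l) i, J_pd (isKernel_potSum n) l, map_neg, neg_neg]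
  simp only [← h2]
  rfl

/-- The Laplacian of the truncated Newtonian potential. -/
theorem sum_D_D_J_potSum (n : ℕ) (f : SmoothPer) : ∑ i, D i (D i (J (isKernel_potSum n) f)) =
      J (isUnitKernel_massKernel.toIsKernel.dilate (show (0 : ℝ) < 2 ^ n by positivity)) f -
      J (isUnitKernel_massKernel.toIsKernel.dilate (show (0 : ℝ) < (1 / 2) ^ n by positivity)) f := by
  have hk : ∀ i, IsKernel (pd i (pd i (potSum n))) := fun i => ((isKernel_potSum n).pd i).pd i
  have h2 : ∀ i, D i (D i (J (isKernel_potSum n) f)) = J (hk i) f := fun i => by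
    rw [J_pd ((isKernel_potSum n).pd i) i, J_pd (isKernel_potSum n) i, map_neg, neg_neg]
  simp only [h2]
  ext x
  have h3 := conv_sum_kernel Finset.univ hk f.perInt x
  simp only [sum_pd_pd_potSum] at h3
  have h4 : (∑ i, J (hk i) f).1 x = ∑ i, conv (pd i (pd i (potSum n))) f.1 x := by
    simp [J_apply]
  rw [h4, ← h3]
  simp only [conv, sub_smul]
  exact integral_sub ((isUnitKernel_massKernel.toIsKernel.dilate (by positivity)).integrable_smul
    f.perInt x) ((isUnitKernel_massKernel.toIsKernel.dilate (by positivity)).integrable_smul f.perInt x)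

end PressureOperator

/-! ### The helicity identity for smooth fields at a fixed time -/

section Identity

open SmoothPer

variable (hk : IsKernel k) (he : ∀ x, k (-x) = k x)

/-- The expansion of `∫ ∂ₗk(ξ) δw δa δb dξ`. -/
def tripleDefect (l : Fin 3) (w a b : SmoothPer) : SmoothPer :=
  J (hk.pd l) (w * a * b) - w * J (hk.pd l) (a * b) - a * J (hk.pd l) (w * b) -
    b * J (hk.pd l) (w * a) + w * a * J (hk.pd l) b + w * b * J (hk.pd l) a + a * b * J (hk.pd l) w

include he in
theorem cInt_mul_J (f g : SmoothPer) : cInt (f * J hk g) = cInt (J hk f * g) :=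
  (cInt_J_mul hk he f g).symm

include he in
theorem cInt_mul_tripleDefect (l : Fin 3) (f w a b : SmoothPer) :
    cInt (f * tripleDefect hk l w a b) =
      cInt (w * (a * b * J hk (D l f) - a * J hk (b * D l f) + J hk (a * b * D l f) +
        J hk a * b * D l f)) + cInt (f * D l (a * b) * J hk w) + cInt (f * J hk (D l (a * b)) * w) +
      cInt (f * a * J hk (D l (w * b))) + cInt (f * J hk a * D l (w * b)) -
      cInt (f * D l b * J hk (w * a)) - cInt (f * w * a * J hk (D l b)) := by
  have h1 : f * tripleDefect hk l w a b =
      w * (a * b * J hk (D l f) - a * J hk (b * D l f) + J hk (a * b * D l f) +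
        J hk a * b * D l f) + f * D l (a * b) * J hk w + f * J hk (D l (a * b)) * w +
      f * a * J hk (D l (w * b)) + f * J hk a * D l (w * b) -
      f * D l b * J hk (w * a) - f * w * a * J hk (D l b) +
      D l (-(f * J hk (w * a * b)) + f * b * J hk (w * a) - f * w * b * J hk a -
        f * a * b * J hk w) +
      ((D l f * J hk (w * a * b) - J hk (D l f) * (w * a * b)) -
      (b * D l f * J hk (w * a) - J hk (b * D l f) * (w * a)) +
      (a * b * D l f * J hk w - J hk (a * b * D l f) * w)) := by
    simp only [tripleDefect, J_pd hk, D_J, map_add, map_sub, map_neg, D_mul]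
    ring
  rw [h1]
  simp only [map_add, map_sub, map_neg, cInt_D, cInt_mul_J hk he]
  simp only [sub_self, neg_zero, add_zero]

include he in
theorem cInt_mul_tripleDefect_self (l : Fin 3) (f z a : SmoothPer) :
    cInt (f * tripleDefect hk l z a a) =
      cInt (z * (a * a * J hk (D l f) - D l f * J hk (a * a) + 2 * (D l f * J hk a * a))) +
      2 * cInt (f * a * J hk (D l (z * a))) + 2 * cInt (f * J hk a * D l (z * a)) -
      cInt (f * D l z * J hk (a * a)) - cInt (f * a * a * J hk (D l z)) := by
  have h1 : f * tripleDefect hk l z a a =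
      z * (a * a * J hk (D l f) - D l f * J hk (a * a) + 2 * (D l f * J hk a * a)) +
      (2 : ℝ) • (f * a * J hk (D l (z * a))) + (2 : ℝ) • (f * J hk a * D l (z * a)) -
      f * D l z * J hk (a * a) - f * a * a * J hk (D l z) +
      D l (-(f * J hk (z * a * a)) + f * z * J hk (a * a) - (2 : ℝ) • (f * z * a * J hk a)) +
      (D l f * J hk (z * a * a) - J hk (D l f) * (z * a * a)) := by
    simp only [tripleDefect, J_pd hk, D_J, map_add, map_sub, map_neg, D_mul, two_smul]
    ring
  rw [h1]
  simp only [map_add, map_sub, map_neg, map_smul, cInt_D, cInt_mul_J hk he, smul_eq_mul]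
  ring

theorem sum_D_curlS (v : Fin 3 → SmoothPer) : ∑ i, D i (curlS v i) = 0 := by
  simp only [Fin.sum_univ_three, curlS, cons_val_zero, cons_val_one, cons_val,
    map_sub, D_comm 1 0, D_comm 2 0, D_comm 2 1]
  ring

theorem curlS_grad (q : SmoothPer) : curlS (fun i => D i q) = 0 := by
  funext i
  fin_cases i <;> simp [curlS, D_comm 1 0, D_comm 2 0, D_comm 2 1]

/-- The curl of the convection term of a divergence-free field. -/
theorem curlS_convection {v : Fin 3 → SmoothPer} (hv : ∑ i, D i (v i) = 0) (i : Fin 3) :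
    curlS (fun i => ∑ l, D l (v i * v l)) i =
      ∑ l, (D l (curlS v i * v l) - D l (curlS v l * v i)) := by
  simp only [Fin.sum_univ_three] at hv ⊢
  have hv' : ∀ j, D j (D 0 (v 0)) + D j (D 1 (v 1)) + D j (D 2 (v 2)) = 0 := fun j => by
    rw [← map_add, ← map_add, hv, map_zero]
  have h0 := hv' 0
  have h1 := hv' 1
  have h2 := hv' 2
  rw [D_comm 1 0] at h1
  rw [D_comm 2 0, D_comm 2 1] at h2
  fin_cases i <;>
  simp only [curlS, cons_val_zero, cons_val_one, cons_val, Fin.zero_eta,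
    Fin.mk_one, Fin.reduceFinMk, map_sub, map_add, D_mul, D_comm 1 0, D_comm 2 0, D_comm 2 1]
  · linear_combination v 2 * h1 - v 1 * h2 + (D 1 (v 2) - D 2 (v 1)) * hv
  · linear_combination v 0 * h2 - v 2 * h0 + (D 2 (v 0) - D 0 (v 2)) * hv
  · linear_combination v 1 * h0 - v 0 * h1 + (D 0 (v 1) - D 1 (v 0)) * hv

/-- The symmetrised mollified helicity of `a` with the curl of `b`, localised by `f`. -/
def helForm (f : SmoothPer) (a b : Fin 3 → SmoothPer) : ℝ :=
  ∑ i, (cInt (f * a i * J hk (curlS b i)) + cInt (f * J hk (a i) * curlS b i))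

theorem curlS_sub (a b : Fin 3 → SmoothPer) :
    curlS (fun i => a i - b i) = fun i => curlS a i - curlS b i := by
  funext i
  fin_cases i <;> simp [curlS] <;> ring

theorem curlS_add' (a b : Fin 3 → SmoothPer) :
    curlS (fun i => a i + b i) = fun i => curlS a i + curlS b i := by
  funext i
  fin_cases i <;> simp [curlS] <;> ring

theorem helForm_add_right (f : SmoothPer) (a b c : Fin 3 → SmoothPer) :
    helForm hk f a (fun i => b i + c i) = helForm hk f a b + helForm hk f a c := by
  simp only [helForm, curlS_add', map_add, mul_add, ← sum_add_distrib]
  exact sum_congr rfl fun i _ => by ring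

theorem helForm_sub_right (f : SmoothPer) (a b c : Fin 3 → SmoothPer) :
    helForm hk f a (fun i => b i - c i) = helForm hk f a b - helForm hk f a c := by
  simp only [helForm, curlS_sub, map_sub, mul_sub, ← sum_sub_distrib]
  exact sum_congr rfl fun i _ => by ring

theorem helForm_add_left (f : SmoothPer) (a b c : Fin 3 → SmoothPer) :
    helForm hk f (fun i => b i + c i) a = helForm hk f b a + helForm hk f c a := by
  simp only [helForm, map_add, mul_add, add_mul, ← sum_add_distrib]
  exact sum_congr rfl fun i _ => by ring

theorem helForm_sub_left (f : SmoothPer) (a b c : Fin 3 → SmoothPer) :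
    helForm hk f (fun i => b i - c i) a = helForm hk f b a - helForm hk f c a := by
  simp only [helForm, map_sub, mul_sub, sub_mul, ← sum_sub_distrib]
  exact sum_congr rfl fun i _ => by ring

theorem helForm_grad_right (f q : SmoothPer) (a : Fin 3 → SmoothPer) :
    helForm hk f a (fun i => D i q) = 0 := by
  simp [helForm, curlS_grad]

include he in
theorem helForm_grad_left (f q : SmoothPer) (v : Fin 3 → SmoothPer) :
    helForm hk f (fun i => D i q) v =
      -∑ i, cInt (curlS v i * (J hk (q * D i f) + J hk q * D i f)) := by
  have h1 : ∀ i, cInt (f * D i q * J hk (curlS v i)) + cInt (f * J hk (D i q) * curlS v i) =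
      -cInt (curlS v i * (J hk (q * D i f) + J hk q * D i f)) -
        (cInt (f * q * J hk (D i (curlS v i))) + cInt (f * J hk q * D i (curlS v i))) := fun i => by
    have h2 : f * D i q * J hk (curlS v i) + f * J hk (D i q) * curlS v i =
        D i (f * q * J hk (curlS v i)) + D i (f * J hk q * curlS v i) -
        curlS v i * (J hk (q * D i f) + J hk q * D i f) -
        (f * q * J hk (D i (curlS v i)) + f * J hk q * D i (curlS v i)) -
        (q * D i f * J hk (curlS v i) - J hk (q * D i f) * curlS v i) := by
      simp only [D_mul, ← D_J]
      ring
    rw [← map_add, h2]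
    simp only [map_add, map_sub, cInt_D, cInt_mul_J hk he]
    ring
  have h3 : ∑ i, (cInt (f * q * J hk (D i (curlS v i))) + cInt (f * J hk q * D i (curlS v i))) = 0 := by
    rw [sum_add_distrib, ← map_sum, ← map_sum, ← mul_sum, ← mul_sum, ← map_sum,
      sum_D_curlS]
    simp
  rw [helForm, sum_congr rfl fun i _ => h1 i, sum_sub_distrib, h3, sub_zero,
    sum_neg_distrib]

include he in
theorem helForm_eq_left (f : SmoothPer) (a b : Fin 3 → SmoothPer) :
    helForm hk f a b = ∑ i, cInt (curlS (fun i => J hk (f * a i) + f * J hk (a i)) i * b i) := by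
  rw [← cInt_curlS, helForm]
  refine sum_congr rfl fun i _ => ?_
  rw [add_mul, map_add, cInt_mul_J hk he]

include he in
theorem helForm_eq_right (f : SmoothPer) (a b : Fin 3 → SmoothPer) :
    helForm hk f a b = ∑ i, cInt ((f * J hk (curlS b i) + J hk (f * curlS b i)) * a i) := by
  refine sum_congr rfl fun i _ => ?_
  rw [add_mul, map_add, ← cInt_mul_J hk he]
  congr 2 <;> ring

/-- The flux of the mollified helicity. -/
def mollifiedFlux (f : SmoothPer) (v : Fin 3 → SmoothPer) (i : Fin 3) : SmoothPer :=
  ∑ l, (v i * v l * J hk (D l f) - v i * J hk (v l * D l f) + J hk (v i * v l * D l f) +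
    J hk (v i) * v l * D l f) -
  (1 / 2 : ℝ) • ∑ l, (v l * v l * J hk (D i f) - D i f * J hk (v l * v l) +
    2 * (D i f * J hk (v l) * v l))

include he in
/-- The helicity identity. -/
theorem cInt_defect_eq (f : SmoothPer) {v : Fin 3 → SmoothPer} (hv : ∑ i, D i (v i) = 0) :
    ∑ i, ∑ l, (cInt (f * tripleDefect hk l (curlS v i) (v i) (v l)) -
      1 / 2 * cInt (f * tripleDefect hk l (curlS v l) (v i) (v i))) =
    ∑ i, cInt (curlS v i * mollifiedFlux hk f v i) +
      helForm hk f v (fun i => ∑ l, D l (v i * v l)) +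
      helForm hk f (fun i => ∑ l, D l (v i * v l)) v := by
  have hW := sum_D_curlS v
  have z1 : ∀ i, ∑ l, cInt (f * D l (v l) * J hk (curlS v i * v i)) = 0 := fun i => by
    rw [← map_sum, ← sum_mul, ← mul_sum, hv]; simp
  have z2 : ∀ i, ∑ l, cInt (f * curlS v i * v i * J hk (D l (v l))) = 0 := fun i => by
    rw [← map_sum, ← mul_sum, ← map_sum, hv]; simp
  have z3 : ∀ i, ∑ l, cInt (f * D l (curlS v l) * J hk (v i * v i)) = 0 := fun i => by
    rw [← map_sum, ← sum_mul, ← mul_sum, hW]; simp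
  have z4 : ∀ i, ∑ l, cInt (f * v i * v i * J hk (D l (curlS v l))) = 0 := fun i => by
    rw [← map_sum, ← mul_sum, ← map_sum, hW]; simp
  have hflux : ∑ i, cInt (curlS v i * mollifiedFlux hk f v i) =
      ∑ i, ∑ l, cInt (curlS v i * (v i * v l * J hk (D l f) - v i * J hk (v l * D l f) +
        J hk (v i * v l * D l f) + J hk (v i) * v l * D l f)) -
      1 / 2 * ∑ i, ∑ l, cInt (curlS v l * (v i * v i * J hk (D l f) - D l f * J hk (v i * v i) +
        2 * (D l f * J hk (v i) * v i))) := by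
    rw [sum_comm (f := fun i l => cInt (curlS v l * (v i * v i * J hk (D l f) -
      D l f * J hk (v i * v i) + 2 * (D l f * J hk (v i) * v i)))), mul_sum,
      ← sum_sub_distrib]
    refine sum_congr rfl fun i _ => ?_
    rw [mollifiedFlux, mul_sub, map_sub, mul_smul_comm, map_smul, mul_sum, mul_sum,
      map_sum, map_sum, smul_eq_mul]
  have hH1 : helForm hk f v (fun i => ∑ l, D l (v i * v l)) =
      ∑ i, ∑ l, (cInt (f * v i * J hk (D l (curlS v i * v l))) -
        cInt (f * v i * J hk (D l (curlS v l * v i))) +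
        cInt (f * J hk (v i) * D l (curlS v i * v l)) -
        cInt (f * J hk (v i) * D l (curlS v l * v i))) := by
    refine sum_congr rfl fun i _ => ?_
    rw [curlS_convection hv, map_sum, mul_sum, mul_sum, map_sum, map_sum,
      ← sum_add_distrib]
    refine sum_congr rfl fun l _ => ?_
    simp only [map_sub, mul_sub]
    ring
  have hH2 : helForm hk f (fun i => ∑ l, D l (v i * v l)) v =
      ∑ i, ∑ l, (cInt (f * D l (v i * v l) * J hk (curlS v i)) +
        cInt (f * J hk (D l (v i * v l)) * curlS v i)) := by
    refine sum_congr rfl fun i _ => ?_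
    rw [map_sum, mul_sum, mul_sum, sum_mul, sum_mul, map_sum, map_sum,
      ← sum_add_distrib]
  have hA := fun i l => cInt_mul_tripleDefect hk he l f (curlS v i) (v i) (v l)
  have hB := fun i l => cInt_mul_tripleDefect_self hk he l f (curlS v l) (v i)
  rw [hflux, hH1, hH2]
  simp only [hA, hB, mul_add, mul_sub, sum_add_distrib,
    sum_sub_distrib, map_add, map_sub, z1, z2, ← mul_sum, z3, z4, sum_const_zero]
  ring

end Identity

/-! ### The defect of smooth fields -/

section SmoothDefect

open SmoothPer

theorem gradient_apply (f : E3 → ℝ) (x : E3) (l : Fin 3) : gradient f x l = pd l f x := by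
  have h : ⟪gradient f x, e l⟫_ℝ = pd l f x := by
    simp [gradient, pd]
  have h2 : ⟪gradient f x, e l⟫_ℝ = gradient f x l := by
    rw [e, EuclideanSpace.inner_single_right]
    simp
  rw [← h2, h]

section Total

variable (hk : IsKernel k) (he : ∀ x, k (-x) = k x)

/-- The field dual to the divergence-form error in the helicity identity. -/
def errorField (f : SmoothPer) (v : Fin 3 → SmoothPer) (i : Fin 3) : SmoothPer :=
  curlS (fun i => J hk (f * v i) + f * J hk (v i)) i +
    (f * J hk (curlS v i) + J hk (f * curlS v i))

include he in
/-- The helicity identity for approximate solutions. -/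
theorem cInt_defect_eq_of_approx (f q : SmoothPer) {v G : Fin 3 → SmoothPer}
    {E : Fin 3 → Fin 3 → SmoothPer} (hv : ∑ i, D i (v i) = 0)
    (hG : ∀ i, ∑ l, D l (v i * v l) = G i - D i q + ∑ l, D l (E i l)) :
    ∑ i, ∑ l, (cInt (f * tripleDefect hk l (curlS v i) (v i) (v l)) -
      1 / 2 * cInt (f * tripleDefect hk l (curlS v l) (v i) (v i))) =
    ∑ i, cInt (curlS v i * (mollifiedFlux hk f v i + (J hk (q * D i f) + J hk q * D i f))) +
      (helForm hk f v G + helForm hk f G v) -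
      ∑ i, ∑ l, cInt (D l (errorField hk f v i) * E i l) := by
  have h1 : ∀ i l, cInt (D l (errorField hk f v i) * E i l) =
      -cInt (errorField hk f v i * D l (E i l)) := fun i l => by rw [cInt_mul_D, neg_neg]
  have h2 : ∑ i, ∑ l, cInt (D l (errorField hk f v i) * E i l) =
      -(helForm hk f v (fun i => ∑ l, D l (E i l)) + helForm hk f (fun i => ∑ l, D l (E i l)) v) := by
    rw [helForm_eq_left hk he, helForm_eq_right hk he, ← sum_add_distrib,
      ← sum_neg_distrib]
    refine sum_congr rfl fun i _ => ?_
    rw [← map_add, ← add_mul, mul_sum, map_sum, ← sum_neg_distrib]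
    exact sum_congr rfl fun l _ => h1 i l
  rw [cInt_defect_eq hk he f hv, h2]
  simp only [hG, helForm_add_right, helForm_sub_right, helForm_add_left, helForm_sub_left,
    helForm_grad_right, helForm_grad_left hk he, mul_add, map_add, sum_add_distrib]
  ring

theorem tripleDefect_apply (l : Fin 3) (w a b : SmoothPer) (x : E3) :
    (tripleDefect hk l w a b).1 x =
      ∫ ξ, pd l k ξ * (increment ξ w.1 x * increment ξ a.1 x * increment ξ b.1 x) := by
  set P : SmoothPer := w * a * b - w.1 x • (a * b) - a.1 x • (w * b) - b.1 x • (w * a) +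
    (w.1 x * a.1 x) • b + (w.1 x * b.1 x) • a + (a.1 x * b.1 x) • w -
    (w.1 x * a.1 x * b.1 x) • 1 with hP
  have h1 : ∀ ξ, increment ξ w.1 x * increment ξ a.1 x * increment ξ b.1 x = P.1 (x + ξ) := fun ξ => by
    simp [hP, increment]
    ring
  have h2 : (J (hk.pd l) (1 : SmoothPer)).1 x = 0 := by
    change conv (pd l k) (fun _ => (1 : ℝ)) x = 0
    simp [conv, hk.integral_pd l]
  have h3 : ∫ ξ, pd l k ξ * (increment ξ w.1 x * increment ξ a.1 x * increment ξ b.1 x) =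
      (J (hk.pd l) P).1 x := by
    simp only [h1]
    rfl
  rw [h3, hP]
  simp only [map_sub, map_add, map_smul, tripleDefect]
  simp [h2]

theorem integral_integral_tripleDefect (l : Fin 3) (f w a b : SmoothPer) :
    Integrable (fun ξ => ∫ x, pd l k ξ * (f.1 x *
      (increment ξ w.1 x * increment ξ a.1 x * increment ξ b.1 x)) ∂vol) ∧
    ∫ ξ, (∫ x, pd l k ξ * (f.1 x * (increment ξ w.1 x * increment ξ a.1 x * increment ξ b.1 x))
      ∂vol) = cInt (f * tripleDefect hk l w a b) := by
  have hI : Integrable (fun z : E3 × E3 => pd l k z.1 * (f.1 z.2 * (increment z.1 w.1 z.2 *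
      increment z.1 a.1 z.2 * increment z.1 b.1 z.2))) (volume.prod vol) := by
    obtain ⟨F, hF⟩ := f.periodic.exists_bound f.continuous
    obtain ⟨W, hW⟩ := w.periodic.exists_bound w.continuous
    obtain ⟨A, hA⟩ := a.periodic.exists_bound a.continuous
    obtain ⟨B, hB⟩ := b.periodic.exists_bound b.continuous
    have hinc : ∀ (g : SmoothPer) (K : ℝ≥0), (∀ x, ‖g.1 x‖ₑ ≤ K) → ∀ ξ x,
        ‖increment ξ g.1 x‖ₑ ≤ 2 * K := fun g K hK ξ x =>
      enorm_sub_le.trans ((add_le_add (hK _) (hK _)).trans (two_mul _).ge)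
    have hc : ∀ g : SmoothPer, Continuous fun z : E3 × E3 => increment z.1 g.1 z.2 := fun g =>
      (g.continuous.comp (continuous_snd.add continuous_fst)).sub (g.continuous.comp continuous_snd)
    have hbd : Integrable (fun z : E3 × E3 => ‖pd l k z.1‖ * (F * (2 * W * (2 * A) * (2 * B)) : ℝ≥0))
        (volume.prod vol) := ((hk.pd l).integrable.norm.mul_const _).comp_fst vol
    refine hbd.mono' ?_ (.of_forall fun z => ?_)
    · exact (((hk.pd l).continuous.comp continuous_fst).mul ((f.continuous.comp continuous_snd).mul
        (((hc w).mul (hc a)).mul (hc b)))).aestronglyMeasurable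
    · rw [norm_mul, norm_mul]
      refine mul_le_mul_of_nonneg_left ?_ (norm_nonneg _)
      rw [← norm_mul, ← coe_nnnorm, NNReal.coe_le_coe, ← coe_le_coe, ← enorm_eq_nnnorm]
      simp only [enorm_mul]
      push_cast
      exact mul_le_mul' (hF _) (mul_le_mul' (mul_le_mul' (hinc w W hW _ _)
        (hinc a A hA _ _)) (hinc b B hB _ _))
  refine ⟨hI.integral_prod_left, ?_⟩
  rw [integral_integral_swap hI, cInt_apply]
  refine integral_congr_fun fun x => ?_
  simp only [MulMemClass.coe_mul, Pi.mul_apply, tripleDefect_apply]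
  rw [← integral_const_mul]
  congr 1
  ext ξ
  ring

end Total

theorem SmoothPer.exists_nik (hs : 0 ≤ s) (hs1 : s ≤ 1) (f : SmoothPer) :
    ∃ A : ℝ≥0, Nik ⊤ s A f.1 := by
  obtain ⟨C, hC⟩ := f.periodic.exists_bound f.continuous
  have hper : IsPeriodic (fderiv ℝ f.1) := fun x i => by
    have h1 := fderiv_comp_add_right (𝕜 := ℝ) (f := f.1) (x := x) (e i)
    rw [show (fun y => f.1 (y + e i)) = f.1 from funext fun y => f.periodic y i] at h1
    exact h1.symm
  obtain ⟨L, hL⟩ := hper.exists_bound (f.contDiff.continuous_fderiv (by simp))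
  have hlip : LipschitzWith L f.1 := lipschitzWith_of_nnnorm_fderiv_le
    (f.contDiff.differentiable (by simp)) fun x => by
      rw [← coe_le_coe, ← enorm_eq_nnnorm]; exact hL x
  refine ⟨_, Nik.of_lipschitz f.periodic f.continuous (M := C + L) (fun x => (hC x).trans ?_)
    (fun x h => ?_) hs hs1⟩
  · push_cast; exact le_self_add
  · rw [← edist_eq_enorm_sub]
    refine (hlip _ _).trans ?_
    rw [edist_eq_enorm_sub, add_sub_cancel_left]
    push_cast
    gcongr
    exact le_add_self

theorem Nik.toLp {f : Fin 3 → E3 → ℝ} (hf : ∀ i, Nik q s A (f i)) (hq : 1 ≤ q) : Nik q s (3 * A) fun x => (WithLp.toLp 2 fun i => f i x : E3) := by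
  have h1 : ∀ i, Nik q s A fun x => f i x • e i := fun i => by
    have hn : ∀ g : E3 → ℝ, ∀ r : ℝ≥0∞, eLpNorm (fun x => g x • e i) r vol =
        eLpNorm g r vol := fun g r =>
      eLpNorm_congr_norm_ae (.of_forall fun x => by simp [norm_smul, norm_e])
    refine ⟨(hf i).periodic.comp fun y => y • e i, (hf i).meas.smul_const _, ?_, fun h => ?_⟩
    · rw [hn]; exact (hf i).norm_le
    · have : increment h (fun x => f i x • e i) =
          fun x => increment h (f i) x • e i := by
        ext1 x; simp only [increment, sub_smul]
      rw [this, hn]; exact (hf i).incr_le h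
  have h2 := Nik.sum Finset.univ (fun i _ => h1 i) hq
  have h3 : (fun x => (WithLp.toLp 2 fun i => f i x : E3)) = fun x => ∑ i, f i x • e i := by
    ext x j
    simp [e, Fin.sum_univ_three]
    fin_cases j <;> simp
  rw [h3]
  refine h2.mono (by simp)

theorem exists_nik_vecOf (hs : 0 ≤ s) (hs1 : s ≤ 1) (v : Fin 3 → SmoothPer) :
    ∃ A : ℝ≥0, Nik ⊤ s A (vecOf v) := by
  choose A hA using fun i => (v i).exists_nik hs hs1
  have : ∀ i, Nik ⊤ s (∑ j, A j) (v i).1 := fun i =>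
    (hA i).mono (single_le_sum (f := A) (fun _ _ => zero_le) (mem_univ i))
  exact ⟨_, Nik.toLp this (by simp)⟩

/-- Brackets of smooth fields are integrals. -/
theorem bracket_vecOf_vecOf (v g : Fin 3 → SmoothPer) :
    𝓑 (curlFn (vecOf v)) (vecOf g) = ∑ i, cInt (curlS v i * g i) := by
  obtain ⟨A, hA⟩ := exists_nik_vecOf zero_le_one le_rfl v
  obtain ⟨B, hB⟩ := exists_nik_vecOf zero_le_one le_rfl g
  rw [bracket_vecOf (p := 3) (σ := 1) (τ := 1) (by norm_num) (by norm_num) (hA.exponent le_top) (hB.exponent le_top)]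
  rfl

theorem SmoothPer.shift_aux (f : SmoothPer) (h : E3) : (fun x => f.1 (x + h)) ∈ smoothPerAlg :=
  ⟨f.contDiff.comp (contDiff_id.add contDiff_const), f.periodic.shift h⟩

/-- The increment of a smooth function. -/
def incS (h : E3) (f : SmoothPer) : SmoothPer := ⟨fun x => f.1 (x + h), f.shift_aux h⟩ - f

theorem incS_apply (h : E3) (f : SmoothPer) (x : E3) : (incS h f).1 x = increment h f.1 x := rfl

theorem cInt_mul_incS_neg (w g : SmoothPer) (ξ : E3) :
    cInt (w * incS (-ξ) g) = cInt (incS ξ w * g) := by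
  have h1 := (IsPeriodic.comp₂ w.periodic (g.periodic.shift (-ξ)) (· * ·)).integral_add_right ξ
  simp only [incS, mul_sub, sub_mul, map_sub]
  congr 1
  simp only [cInt_apply]
  refine h1.symm.trans ?_
  simp

theorem defectField₁_vecOf (v : Fin 3 → SmoothPer) (f : SmoothPer) (ξ : E3) :
    defectField₁ ϕ ε (vecOf v) f.1 ξ = vecOf fun i => incS (-ξ)
      (∑ l, pd l (dilate ϕ ε) ξ • (f * incS ξ (v l) * incS ξ (v i))) := by
  ext x i
  simp only [defectField₁, increment, vecOf, incS_apply, PiLp.sub_apply, PiLp.smul_apply, inner_E3,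
    gradient_apply, AddSubmonoidClass.coe_finsetSum, Finset.sum_apply, smul_eq_mul,
    Subalgebra.coe_smul, Pi.smul_apply, MulMemClass.coe_mul, Pi.mul_apply, sum_mul]
  congr 1 <;> refine sum_congr rfl fun l _ => by ring

theorem defectField₂_vecOf (v : Fin 3 → SmoothPer) (f : SmoothPer) (ξ : E3) :
    defectField₂ ϕ ε (vecOf v) f.1 ξ = vecOf fun l => incS (-ξ)
      (∑ i, pd l (dilate ϕ ε) ξ • (f * incS ξ (v i) * incS ξ (v i))) := by
  ext x i
  simp only [defectField₂, increment, vecOf, incS_apply, PiLp.sub_apply, PiLp.smul_apply,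
    EuclideanSpace.norm_sq_eq, norm_eq_abs, sq_abs,
    gradient_apply, AddSubmonoidClass.coe_finsetSum, Finset.sum_apply, smul_eq_mul,
    Subalgebra.coe_smul, Pi.smul_apply, MulMemClass.coe_mul, Pi.mul_apply, sum_mul]
  congr 1 <;> refine sum_congr rfl fun l _ => by ring

theorem bracket_defectField₁_vecOf (v : Fin 3 → SmoothPer) (f : SmoothPer) (ξ : E3) :
    𝓑 (curlFn (vecOf v)) (defectField₁ ϕ ε (vecOf v) f.1 ξ) =
      ∑ i, ∑ l, ∫ x, pd l (dilate ϕ ε) ξ * (f.1 x * (increment ξ (curlS v i).1 x *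
        increment ξ (v i).1 x * increment ξ (v l).1 x)) ∂vol := by
  rw [defectField₁_vecOf, bracket_vecOf_vecOf]
  refine sum_congr rfl fun i _ => ?_
  rw [cInt_mul_incS_neg, mul_sum, map_sum]
  refine sum_congr rfl fun l _ => integral_congr_fun fun x => ?_
  simp only [incS_apply, smul_eq_mul, Subalgebra.coe_smul, Pi.smul_apply, MulMemClass.coe_mul,
    Pi.mul_apply]
  ring

theorem bracket_defectField₂_vecOf (v : Fin 3 → SmoothPer) (f : SmoothPer) (ξ : E3) :
    𝓑 (curlFn (vecOf v)) (defectField₂ ϕ ε (vecOf v) f.1 ξ) =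
      ∑ i, ∑ l, ∫ x, pd l (dilate ϕ ε) ξ * (f.1 x * (increment ξ (curlS v l).1 x *
        increment ξ (v i).1 x * increment ξ (v i).1 x)) ∂vol := by
  rw [defectField₂_vecOf, bracket_vecOf_vecOf, sum_comm]
  refine sum_congr rfl fun i _ => ?_
  rw [cInt_mul_incS_neg, mul_sum, map_sum]
  refine sum_congr rfl fun l _ => integral_congr_fun fun x => ?_
  simp only [incS_apply, smul_eq_mul, Subalgebra.coe_smul, Pi.smul_apply, MulMemClass.coe_mul,
    Pi.mul_apply]
  ring

theorem defect_vecOf (hk : IsKernel (dilate ϕ ε)) (v : Fin 3 → SmoothPer) (f : SmoothPer) :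
    defect₁ ϕ ε (vecOf v) (curlFn (vecOf v)) f.1 -
      1 / 2 * defect₂ ϕ ε (vecOf v) (curlFn (vecOf v)) f.1 =
    ∑ i, ∑ l, (cInt (f * tripleDefect hk l (curlS v i) (v i) (v l)) -
      1 / 2 * cInt (f * tripleDefect hk l (curlS v l) (v i) (v i))) := by
  have h := integral_integral_tripleDefect hk
  simp only [defect₁, defect₂, bracket_defectField₁_vecOf, bracket_defectField₂_vecOf,
    sum_sub_distrib, ← mul_sum]
  congr 1
  · rw [integral_finsetSum _ fun i _ => integrable_finsetSum _ fun l _ => (h _ _ _ _ _).1]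
    refine sum_congr rfl fun i _ => ?_
    rw [integral_finsetSum _ fun l _ => (h _ _ _ _ _).1]
    exact sum_congr rfl fun l _ => (h _ _ _ _ _).2
  · congr 1
    rw [integral_finsetSum _ fun i _ => integrable_finsetSum _ fun l _ => (h _ _ _ _ _).1]
    refine sum_congr rfl fun i _ => ?_
    rw [integral_finsetSum _ fun l _ => (h _ _ _ _ _).1]
    exact sum_congr rfl fun l _ => (h _ _ _ _ _).2

end SmoothDefect

/-! ### Convergence of multilinear expressions in Nikolskii classes -/

section Graded

/-- The integrability exponent of expressions of degree `d` in the velocity. -/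
def qexp : ℕ → ℝ≥0∞
  | 0 => ⊤
  | 1 => 3
  | _ => 𝔮

theorem one_le_qexp : ∀ d, 1 ≤ qexp d
  | 0 => le_top
  | 1 => by norm_num [qexp]
  | n + 2 => by simp [qexp]; norm_num

instance holderTriple_three_three : HolderTriple 3 3 𝔮 := by
  constructor
  rw [show (3 : ℝ≥0∞) = ofReal 3 by simp, ← ofReal_inv_of_pos (by norm_num),
    ← ofReal_inv_of_pos (by norm_num), ← ofReal_add (by norm_num) (by norm_num)]
  norm_num

instance holderTriple_qexp_zero_left (d : ℕ) : HolderTriple (qexp 0) (qexp d) (qexp d) :=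
  inferInstanceAs (HolderTriple ⊤ (qexp d) (qexp d))

instance holderTriple_qexp_zero_right (d : ℕ) : HolderTriple (qexp d) (qexp 0) (qexp d) :=
  inferInstanceAs (HolderTriple (qexp d) ⊤ (qexp d))

instance holderTriple_qexp_one_one : HolderTriple (qexp 1) (qexp 1) (qexp 2) :=
  holderTriple_three_three

variable {ι : Type*} {r : ι → ℝ≥0} {A K L : ℝ≥0} {d d' d'' : ℕ} {f f' : ι → E3 → ℝ}
  {g g' : E3 → ℝ}

/-- A family of expressions of degree `d` in a field of size `A` which approximates `g` at rate `r`. -/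
structure GrLim (r : ι → ℝ≥0) (s : ℝ) (A : ℝ≥0) (d : ℕ) (K : ℝ≥0) (f : ι → E3 → ℝ)
    (g : E3 → ℝ) : Prop where
  fam : ∀ i, Nik (qexp d) s (K * A ^ d) (f i)
  lim : Nik (qexp d) s (K * A ^ d) g
  rate : ∀ i, Nik (qexp d) s (K * A ^ d * r i) fun x => f i x - g x

namespace GrLim

theorem const (hg : Nik (qexp d) s (K * A ^ d) g) : GrLim r s A d K (fun _ => g) g :=
  ⟨fun _ => hg, hg, fun i => by simpa using (Nik.zero (F := ℝ)).mono zero_le⟩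

theorem mono (h : GrLim r s A d K f g) (hKL : K ≤ L) : GrLim r s A d L f g :=
  ⟨fun i => (h.fam i).mono (mul_le_mul' hKL le_rfl), h.lim.mono (mul_le_mul' hKL le_rfl),
    fun i => (h.rate i).mono (mul_le_mul' (mul_le_mul' hKL le_rfl) le_rfl)⟩

theorem add (h : GrLim r s A d K f g) (h' : GrLim r s A d L f' g') :
    GrLim r s A d (K + L) (fun i x => f i x + f' i x) fun x => g x + g' x := by
  have hq := one_le_qexp d
  refine ⟨fun i => ((h.fam i).add (h'.fam i) hq).mono (by rw [add_mul]),
    (h.lim.add h'.lim hq).mono (by rw [add_mul]), fun i => ?_⟩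
  simp only [add_sub_add_comm]
  exact ((h.rate i).add (h'.rate i) hq).mono (by rw [add_mul, add_mul])

theorem const_mul (h : GrLim r s A d K f g) (c : ℝ) :
    GrLim r s A d (‖c‖₊ * K) (fun i x => c * f i x) fun x => c * g x := by
  refine ⟨fun i => ((h.fam i).const_smul c).mono (by rw [mul_assoc]),
    (h.lim.const_smul c).mono (by rw [mul_assoc]), fun i => ?_⟩
  simp only [← mul_sub]
  exact ((h.rate i).const_smul c).mono (by rw [mul_assoc, mul_assoc, mul_assoc])

theorem neg (h : GrLim r s A d K f g) : GrLim r s A d K (fun i x => -f i x) fun x => -g x := by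
  simpa using h.const_mul (-1)

theorem sub (h : GrLim r s A d K f g) (h' : GrLim r s A d L f' g') :
    GrLim r s A d (K + L) (fun i x => f i x - f' i x) fun x => g x - g' x := by
  simpa only [sub_eq_add_neg] using h.add h'.neg

theorem sum {κ : Type*} (t : Finset κ) {K : κ → ℝ≥0} {f : κ → ι → E3 → ℝ} {g : κ → E3 → ℝ}
    (h : ∀ j, GrLim r s A d (K j) (f j) (g j)) :
    GrLim r s A d (∑ j ∈ t, K j) (fun i x => ∑ j ∈ t, f j i x) fun x => ∑ j ∈ t, g j x := by
  classical
  induction t using induction_on with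
  | empty => simpa using const (r := r) (A := A) (K := 0) (d := d) (by simpa using Nik.zero (F := ℝ))
  | insert a t ha ih => simpa only [sum_insert ha] using (h a).add ih

theorem mul (h : GrLim r s A d K f g) (h' : GrLim r s A d' L f' g')
    [HolderTriple (qexp d) (qexp d') (qexp d'')] (hd : d + d' = d'') :
    GrLim r s A d'' (4 * K * L) (fun i x => f i x * f' i x) fun x => g x * g' x := by
  have hq := one_le_qexp d''
  have e1 : ∀ x y : ℝ≥0, 2 * (K * A ^ d * x * (L * A ^ d' * y)) ≤ 4 * K * L * A ^ d'' * (x * y) := by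
    intro x y
    rw [← hd, pow_add]
    calc 2 * (K * A ^ d * x * (L * A ^ d' * y)) = 2 * (K * L * (A ^ d * A ^ d') * (x * y)) := by ring
      _ ≤ 4 * (K * L * (A ^ d * A ^ d') * (x * y)) := mul_le_mul' (by norm_num) le_rfl
      _ = _ := by ring
  have e2 : ∀ {f f' : E3 → ℝ}, Nik (qexp d) s (K * A ^ d) f → Nik (qexp d') s (L * A ^ d') f' →
      Nik (qexp d'') s (4 * K * L * A ^ d'') fun x => f x * f' x := fun h1 h2 =>
    (h1.smul h2 hq).mono (by simpa using e1 1 1)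
  refine ⟨fun i => e2 (h.fam i) (h'.fam i), e2 h.lim h'.lim, fun i => ?_⟩
  have h1 := ((h.rate i).smul h'.lim hq).add ((h.fam i).smul (h'.rate i) hq) hq
  have e3 : (fun x => f i x * f' i x - g x * g' x) =
      fun x => (f i x - g x) • g' x + f i x • (f' i x - g' x) := by
    ext x; simp only [smul_eq_mul]; ring
  rw [e3]
  refine h1.mono (le_of_eq ?_)
  rw [← hd, pow_add]
  ring

theorem raise (h : GrLim r s A 1 K f g) (hA : 1 ≤ A) : GrLim r s A 2 K f g := by
  have hq : qexp 2 ≤ qexp 1 := by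
    change 𝔮 ≤ 3
    rw [show (3 : ℝ≥0∞) = ofReal 3 by simp]
    exact ofReal_le_ofReal (by norm_num)
  have hK : K * A ^ 1 ≤ K * A ^ 2 := mul_le_mul' le_rfl (pow_le_pow_right₀ hA (by norm_num))
  exact ⟨fun i => ((h.fam i).exponent hq).mono hK, (h.lim.exponent hq).mono hK,
    fun i => ((h.rate i).exponent hq).mono (mul_le_mul' hK le_rfl)⟩

protected theorem conv (h : GrLim r s A d K f g) (hk : IsKernel k) :
    GrLim r s A d (massOf k * K) (fun i => conv k (f i)) (conv k g) := by
  have hq := one_le_qexp d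
  refine ⟨fun i => ((h.fam i).conv hq hk).mono (by rw [mul_assoc]),
    (h.lim.conv hq hk).mono (by rw [mul_assoc]), fun i => ?_⟩
  have h1 := (h.rate i).conv hq hk
  have h2 : conv k (fun x => f i x - g x) =
      fun x => conv k (f i) x - conv k g x := by
    ext x
    exact conv_sub_apply hk ((h.fam i).perInt hq) (h.lim.perInt hq) x
  rw [h2] at h1
  exact h1.mono (by rw [mul_assoc, mul_assoc, mul_assoc])

theorem shift (h : GrLim r s A d K f g) (ξ : E3) :
    GrLim r s A d K (fun i x => f i (x + ξ)) fun x => g (x + ξ) :=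
  ⟨fun i => (h.fam i).shift ξ, h.lim.shift ξ, fun i => (h.rate i).shift ξ⟩

protected theorem increment (h : GrLim r s A d K f g) (ξ : E3) :
    GrLim r s A d (K + K) (fun i => increment ξ (f i)) (increment ξ g) := (h.shift ξ).sub h

/-- Mollification at scales tending to zero. -/
theorem moll {k : ι → E3 → ℝ} (hk : ∀ i, IsUnitKernel (k i)) {m : ℝ≥0} (hm : ∀ i, massOf (k i) ≤ m)
    {ρ : ι → ℝ≥0} (hρ1 : ∀ i, ρ i ≤ 1) (hρ : ∀ i ξ, k i ξ ≠ 0 → ‖ξ‖ₑ ≤ ρ i) {s₁ κ : ℝ}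
    (hκ : 0 ≤ κ) (hs : κ ≤ s₁) (hg : Nik (qexp d) s₁ (K * A ^ d) g) :
    GrLim (fun i => ρ i ^ κ) (s₁ - κ) A d (2 * (m + 1) * K) (fun i => conv (k i) g) g := by
  have hq := one_le_qexp d
  have hlow : ∀ {c : ℝ≥0} {f : E3 → ℝ}, Nik (qexp d) s₁ (c * (K * A ^ d)) f → c ≤ m + 1 →
      Nik (qexp d) (s₁ - κ) (2 * (m + 1) * K * A ^ d) f := fun {c f} hf hc => by
    refine (hf.lower hq (by linarith) (by linarith)).mono ?_
    calc 2 * (c * (K * A ^ d)) ≤ 2 * ((m + 1) * (K * A ^ d)) :=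
          mul_le_mul' le_rfl (mul_le_mul' hc le_rfl)
      _ = _ := by ring
  refine ⟨fun i => hlow (hg.conv hq (hk i).toIsKernel) ((hm i).trans le_self_add),
    hlow (c := 1) (by simpa using hg) le_add_self, fun i => ?_⟩
  refine (hg.conv_sub (hk i) (hρ1 i) (hρ i) hq hκ hs).mono ?_
  calc 2 * massOf (k i) * (K * A ^ d) * ρ i ^ κ ≤ 2 * (m + 1) * (K * A ^ d) * ρ i ^ κ :=
        mul_le_mul' (mul_le_mul' (mul_le_mul' le_rfl ((hm i).trans le_self_add)) le_rfl) le_rfl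
    _ = _ := by ring

end GrLim

/-- The vector field with given coordinates. -/
def vec (f : Fin 3 → E3 → ℝ) (x : E3) : E3 := WithLp.toLp 2 fun i => f i x

/-- Continuity of the duality bracket. -/
theorem exists_bracket_grLim_le (hs : 1 / 2 < s) : ∃ C : ℝ≥0, ∀ {ι : Type} {r : ι → ℝ≥0}
    {A K L : ℝ≥0} {v : ι → Fin 3 → E3 → ℝ} {u : Fin 3 → E3 → ℝ} {f : ι → Fin 3 → E3 → ℝ}
    {g : Fin 3 → E3 → ℝ}, (∀ j, GrLim r s A 1 K (fun i => v i j) (u j)) →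
    (∀ j, GrLim r s A 2 L (fun i => f i j) (g j)) →
    (∀ i, ‖𝓑 (curlFn (vec (v i))) (vec (f i))‖ₑ ≤ (C * K * L * A ^ 3 : ℝ≥0)) ∧
    ‖𝓑 (curlFn (vec u)) (vec g)‖ₑ ≤ (C * K * L * A ^ 3 : ℝ≥0) ∧
    ∀ i, ‖𝓑 (curlFn (vec (v i))) (vec (f i)) -
      𝓑 (curlFn (vec u)) (vec g)‖ₑ ≤ (C * K * L * A ^ 3 * r i : ℝ≥0) := by
  have hp : (1 : ℝ≥0∞) ≤ 3 := by norm_num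
  obtain ⟨C, hC⟩ := exists_bracket_le (p := 3) (q := 3 / 2) hs hs
  refine ⟨18 * C, fun {ι r A K L v u f g} hv hf => ?_⟩
  have hu1 : ∀ {c : ℝ≥0} {w : Fin 3 → E3 → ℝ}, (∀ j, Nik (qexp 1) s (K * A ^ 1 * c) (w j)) →
      Nik 3 s (3 * (K * A ^ 1 * c)) (vec w) := fun hw => Nik.toLp hw hp
  have hg1 : ∀ {c : ℝ≥0} {w : Fin 3 → E3 → ℝ}, (∀ j, Nik (qexp 2) s (L * A ^ 2 * c) (w j)) →
      Nik 𝔮 s (3 * (L * A ^ 2 * c)) (vec w) := fun hw => Nik.toLp hw one_le_q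
  have vfam : ∀ i, Nik 3 s (3 * (K * A ^ 1 * 1)) (vec (v i)) := fun i =>
    hu1 fun j => by simpa using (hv j).fam i
  have vlim : Nik 3 s (3 * (K * A ^ 1 * 1)) (vec u) := hu1 fun j => by simpa using (hv j).lim
  have ffam : ∀ i, Nik 𝔮 s (3 * (L * A ^ 2 * 1)) (vec (f i)) := fun i =>
    hg1 fun j => by simpa using (hf j).fam i
  have flim : Nik 𝔮 s (3 * (L * A ^ 2 * 1)) (vec g) :=
    hg1 fun j => by simpa using (hf j).lim
  have hle : ∀ {c : ℝ≥0∞}, c ≤ C * (3 * (K * A ^ 1 * 1) : ℝ≥0) * (3 * (L * A ^ 2 * 1) : ℝ≥0) →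
      c ≤ (18 * C * K * L * A ^ 3 : ℝ≥0) := fun {c} hc => by
    refine hc.trans ?_
    norm_cast
    calc C * (3 * (K * A ^ 1 * 1)) * (3 * (L * A ^ 2 * 1)) = 9 * (C * K * L * A ^ 3) := by ring
      _ ≤ 18 * (C * K * L * A ^ 3) := mul_le_mul' (by norm_num) le_rfl
      _ = _ := by ring
  refine ⟨fun i => hle (hC _ _ _ _ (vfam i) (ffam i)), hle (hC _ _ _ _ vlim flim), fun i => ?_⟩
  have vr : Nik 3 s (3 * (K * A ^ 1 * r i)) fun x => vec (v i) x - vec u x := by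
    have := hu1 fun j => (hv j).rate i
    exact this
  have fr : Nik 𝔮 s (3 * (L * A ^ 2 * r i)) fun x => vec (f i) x - vec g x := by
    have := hg1 fun j => (hf j).rate i
    exact this
  have e1 := bracket_sub_left hs hs (vfam i) (ffam i) vlim
  have e2 := bracket_sub_right hs hs vlim (ffam i) flim
  have e3 : 𝓑 (curlFn (vec (v i))) (vec (f i)) -
      𝓑 (curlFn (vec u)) (vec g) =
      𝓑 (curlFn fun x => vec (v i) x - vec u x) (vec (f i)) +
      𝓑 (curlFn (vec u)) (fun x => vec (f i) x - vec g x) := by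
    rw [e1, e2]; ring
  rw [e3]
  refine (enorm_add_le _ _).trans ((add_le_add (hC _ _ _ _ vr (ffam i))
    (hC _ _ _ _ vlim fr)).trans (le_of_eq ?_))
  push_cast
  ring

end Graded

/-! ### Test functions on space-time -/

section Tests

/-- Scalar test functions on `𝕋³ × (0,T)`. -/
abbrev TestFn (T : ℝ) : Type := SpaceTimeTest ℝ T

namespace TestFn

theorem contDiff (φ : TestFn T) : ContDiff ℝ (⊤ : ℕ∞) φ.1 := φ.2.1

theorem differentiableAt (φ : TestFn T) (z : ℝ × E3) : DifferentiableAt ℝ φ.1 z :=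
  φ.contDiff.differentiable (by simp) z

/-- The spatial derivatives of a test function. -/
def dx (i : Fin 3) (φ : TestFn T) : TestFn T :=
  ⟨fun z => fderiv ℝ φ.1 z (0, e i), fderiv_apply_mem φ.2 _⟩

/-- A test function at a fixed time. -/
def slice (φ : TestFn T) (t : ℝ) : SmoothPer :=
  ⟨fun x => φ.1 (t, x), φ.contDiff.comp (contDiff_const.prodMk contDiff_id), φ.2.2.1 t⟩

theorem slice_add (φ ψ : TestFn T) (t : ℝ) : slice (φ + ψ) t = slice φ t + slice ψ t := rfl

theorem slice_sum {ι : Type*} (s : Finset ι) (φ : ι → TestFn T) (t : ℝ) :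
    slice (∑ i ∈ s, φ i) t = ∑ i ∈ s, slice (φ i) t := by
  classical
  induction s using induction_on with
  | empty => simp; rfl
  | insert a s ha ih => rw [sum_insert ha, sum_insert ha, slice_add, ih]

theorem ext_slice {φ ψ : TestFn T} (h : ∀ t, slice φ t = slice ψ t) : φ = ψ := by
  ext z
  exact congrArg (fun f : SmoothPer => f.1 z.2) (h z.1)

theorem slice_dx (i : Fin 3) (φ : TestFn T) (t : ℝ) : slice (dx i φ) t = SmoothPer.D i (slice φ t) := by
  ext x
  have h : HasFDerivAt (fun y : E3 => φ.1 (t, y))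
      ((fderiv ℝ φ.1 (t, x)).comp (ContinuousLinearMap.inr ℝ ℝ E3)) x :=
    (φ.differentiableAt (t, x)).hasFDerivAt.comp x (hasFDerivAt_prodMk_right t x)
  change _ = fderiv ℝ (fun y : E3 => φ.1 (t, y)) x (e i)
  rw [h.fderiv]
  rfl

/-- The time derivative of a test function. -/
abbrev ddt (φ : TestFn T) : TestFn T := dt φ

theorem hasDerivAt (φ : TestFn T) (t : ℝ) (x : E3) :
    HasDerivAt (fun s => φ.1 (s, x)) ((ddt φ).1 (t, x)) t := by
  have h : HasFDerivAt (fun s : ℝ => φ.1 (s, x))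
      ((fderiv ℝ φ.1 (t, x)).comp (ContinuousLinearMap.inl ℝ ℝ E3)) t :=
    (φ.differentiableAt (t, x)).hasFDerivAt.comp t (hasFDerivAt_prodMk_left t x)
  exact h.hasDerivAt

theorem slice_dt_dx (i : Fin 3) (φ : TestFn T) (t : ℝ) :
    slice (ddt (dx i φ)) t = SmoothPer.D i (slice (ddt φ) t) := by
  rw [← slice_dx]
  congr 1
  ext z
  have hd : DifferentiableAt ℝ (fderiv ℝ φ.1) z :=
    (φ.contDiff.fderiv_right (m := (⊤ : ℕ∞)) (by simp)).differentiable (by simp) z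
  have hs : IsSymmSndFDerivAt ℝ φ.1 z := φ.contDiff.contDiffAt.isSymmSndFDerivAt (by
    simp only [minSmoothness_of_isRCLikeNormedField]
    exact WithTop.coe_le_coe.2 (le_top : (2 : ℕ∞) ≤ ⊤))
  have h2 : ∀ v w : ℝ × E3, fderiv ℝ (fun y => fderiv ℝ φ.1 y v) z w =
      fderiv ℝ (fderiv ℝ φ.1) z w v := fun v w => by
    rw [fderiv_clm_apply hd (differentiableAt_const v)]
    simp
  change fderiv ℝ (fun y => fderiv ℝ φ.1 y _) z _ = fderiv ℝ (fun y => fderiv ℝ φ.1 y _) z _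
  rw [h2, h2]
  exact hs _ _

theorem exists_bound_aux {g : ℝ × E3 → F} (hc : Continuous g)
    (hp : ∀ t, IsPeriodic fun x => g (t, x)) {a b : ℝ} (h0 : ∀ t, t ∉ Icc a b → ∀ x, g (t, x) = 0) :
    ∃ C : ℝ≥0, ∀ z, ‖g z‖ ≤ C := by
  obtain ⟨C, hC⟩ := (isCompact_Icc.prod isBounded_cell.isCompact_closure).exists_bound_of_continuousOn
    (f := g) (s := Icc a b ×ˢ closure cell) hc.continuousOn
  refine ⟨C.toNNReal, fun z => ?_⟩
  by_cases hz : z.1 ∈ Icc a b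
  · refine le_trans ?_ (le_coe_toNNReal C)
    have h1 : g z = g (z.1, cellFract z.2) := ((hp z.1).apply_cellFract z.2).symm
    rw [h1]
    exact hC _ ⟨hz, subset_closure (cellFract_mem z.2)⟩
  · have : g z = 0 := h0 z.1 hz z.2
    simp [this]

theorem exists_bound (φ : SpaceTimeTest F T) : ∃ C : ℝ≥0, ∀ z, ‖φ.1 z‖ ≤ C := by
  obtain ⟨hf, hp, a, b, -, -, h⟩ := φ.2
  exact exists_bound_aux hf.continuous hp h

theorem exists_bound_fderiv (φ : SpaceTimeTest F T) : ∃ C : ℝ≥0, ∀ z, ‖fderiv ℝ φ.1 z‖ ≤ C := by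
  obtain ⟨hf, hp, a, b, -, -, h⟩ := φ.2
  refine exists_bound_aux (hf.continuous_fderiv (by simp)) (fun t x i => ?_) (a := a) (b := b)
    fun t ht x => ?_
  · exact ContinuousLinearMap.ext fun v => (fderiv_apply_mem φ.2 v).2.1 t x i
  · have hopen : IsOpen ((Prod.fst : ℝ × E3 → ℝ) ⁻¹' (Icc a b)ᶜ) :=
      isClosed_Icc.isOpen_compl.preimage continuous_fst
    have hev : φ.1 =ᶠ[𝓝 (t, x)] fun _ => (0 : F) := by
      filter_upwards [hopen.mem_nhds (show (t, x) ∈ _ from ht)] with z hz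
      exact h z.1 hz z.2
    rw [hev.fderiv_eq]
    simp

theorem nik_slice (φ : SpaceTimeTest F T) (h0 : ∀ z, ‖φ.1 z‖ ≤ M) (h1 : ∀ z, ‖fderiv ℝ φ.1 z‖ ≤ M)
    (hs0 : 0 ≤ s) (hs : s ≤ 1) (t : ℝ) : Nik ⊤ s (2 * M) fun x => φ.1 (t, x) := by
  have hL : LipschitzWith M φ.1 := lipschitzWith_of_nnnorm_fderiv_le
    (φ.2.1.differentiable (by simp)) h1
  refine Nik.of_lipschitz (φ.2.2.1 t) (φ.2.1.continuous.comp (Continuous.prodMk_right t)) (fun x => ?_) (fun x h => ?_)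
    hs0 hs
  · rw [enorm_eq_nnnorm, coe_le_coe]
    exact h0 _
  · rw [← edist_eq_enorm_sub]
    refine (hL _ _).trans (le_of_eq ?_)
    rw [Prod.edist_eq]
    simp [edist_eq_enorm_sub]

theorem exists_nik_slice (φ : SpaceTimeTest F T) : ∃ M : ℝ≥0, ∀ {s : ℝ}, 0 ≤ s → s ≤ 1 → ∀ t,
    Nik ⊤ s M fun x => φ.1 (t, x) := by
  obtain ⟨M, hM⟩ := exists_bound φ
  obtain ⟨L, hL⟩ := exists_bound_fderiv φ
  exact ⟨2 * (M + L), fun h0 h1 t => nik_slice φ (M := M + L)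
    (fun z => (hM z).trans (by exact_mod_cast le_self_add))
    (fun z => (hL z).trans (by exact_mod_cast le_add_self)) h0 h1 t⟩

theorem stronglyMeasurable_slice (φ : TestFn T) : JMeas fun t => (slice φ t).1 :=
  φ.contDiff.continuous.stronglyMeasurable

section Conv

variable (hk : IsKernel k)

include hk in
theorem contDiff_integral_smul (φ : TestFn T) :
    ContDiff ℝ (⊤ : ℕ∞) fun z : ℝ × E3 => ∫ ξ, k ξ • φ.1 (z.1, z.2 + ξ) := by
  have h := contDiffOn_convolution_right_with_param_comp (𝕜 := ℝ) (n := ⊤) (μ := (volume : Measure E3))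
    (ContinuousLinearMap.lsmul ℝ ℝ : ℝ →L[ℝ] ℝ →L[ℝ] ℝ) (s := univ) (v := fun _ : ℝ × E3 => (0 : E3))
    contDiffOn_const (f := fun _ => (1 : ℝ))
    (g := fun (z : ℝ × E3) ξ => k (-ξ) * φ.1 (z.1, z.2 - ξ)) (k := -tsupport k) isOpen_univ
    hk.compact.isCompact.neg (fun z ξ _ hξ => by
      rw [image_eq_zero_of_notMem_tsupport (f := k) (x := -ξ) fun h => hξ (by simpa using h), zero_mul])
    (locallyIntegrable_const 1) ?_
  · rw [contDiffOn_univ] at h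
    have h2 : (fun z : ℝ × E3 => ∫ ξ, k ξ • φ.1 (z.1, z.2 + ξ)) = fun z => convolution (fun _ => (1 : ℝ))
        (fun ξ => k (-ξ) * φ.1 (z.1, z.2 - ξ)) (ContinuousLinearMap.lsmul ℝ ℝ) volume 0 := by
      ext z
      simp [convolution]
    rw [h2]
    exact h
  · refine ContDiff.contDiffOn ?_
    exact (hk.smooth.comp contDiff_snd.neg).mul (φ.contDiff.comp
      ((contDiff_fst.comp contDiff_fst).prodMk ((contDiff_snd.comp contDiff_fst).sub contDiff_snd)))

/-- Spatial correlation of a test function with a kernel. -/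
def convT (φ : TestFn T) : TestFn T := by
  refine ⟨fun z => ∫ ξ, k ξ • φ.1 (z.1, z.2 + ξ), contDiff_integral_smul hk φ, fun t x i => ?_, ?_⟩
  · have h := (slice φ t).periodic.conv k x i
    exact h
  · obtain ⟨-, -, a, b, ha, hb, h⟩ := φ.2
    exact ⟨a, b, ha, hb, fun t ht x => by simp [h t ht]⟩

theorem slice_convT (φ : TestFn T) (t : ℝ) : slice (convT hk φ) t = SmoothPer.J hk (slice φ t) := rfl

theorem slice_dt_convT (φ : TestFn T) (t : ℝ) :
    slice (ddt (convT hk φ)) t = SmoothPer.J hk (slice (ddt φ) t) := by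
  ext x
  obtain ⟨M, hM⟩ := exists_bound (ddt φ)
  have h := hasDerivAt_integral_of_dominated_loc_of_deriv_le (𝕜 := ℝ) (μ := (volume : Measure E3))
    (F := fun s ξ => k ξ • φ.1 (s, x + ξ)) (F' := fun s ξ => k ξ • (ddt φ).1 (s, x + ξ)) (x₀ := t)
    (s := univ) (bound := fun ξ => ‖k ξ‖ * M) univ_mem (.of_forall fun s => ?_) ?_ ?_ ?_
    (hk.integrable.norm.mul_const _) ?_
  · exact ((convT hk φ).hasDerivAt t x).unique h.2
  · exact (hk.continuous.smul (φ.contDiff.continuous.comp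
      (continuous_const.prodMk (continuous_const.add continuous_id)))).aestronglyMeasurable
  · exact (hk.continuous.smul (φ.contDiff.continuous.comp
      (continuous_const.prodMk (continuous_const.add continuous_id)))).integrable_of_hasCompactSupport
      hk.compact.smul_right
  · exact (hk.continuous.smul ((ddt φ).contDiff.continuous.comp
      (continuous_const.prodMk (continuous_const.add continuous_id)))).aestronglyMeasurable
  · refine Eventually.of_forall fun ξ s _ => ?_
    rw [norm_smul]
    exact mul_le_mul_of_nonneg_left (hM _) (norm_nonneg _)
  · exact Eventually.of_forall fun ξ s _ => (φ.hasDerivAt s (x + ξ)).const_mul (k ξ)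

end Conv

end TestFn

/-- Test functions on `(0,T)`. -/
structure IsTimeTest (T : ℝ) (a : ℝ → ℝ) : Prop where
  smooth : ContDiff ℝ (⊤ : ℕ∞) a
  compact : HasCompactSupport a
  support : tsupport a ⊆ Ioo 0 T

namespace IsTimeTest

variable {a : ℝ → ℝ}

theorem deriv (ha : IsTimeTest T a) : IsTimeTest T (deriv a) :=
  ⟨(contDiff_infty_iff_deriv.1 ha.smooth).2, ha.compact.deriv,
    (tsupport_deriv_subset (𝕜 := ℝ) (f := a)).trans ha.support⟩

theorem exists_Icc (ha : IsTimeTest T a) : ∃ c d : ℝ, 0 < c ∧ d < T ∧ ∀ t, t ∉ Icc c d → a t = 0 := by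
  have hK : IsCompact (tsupport a) := ha.compact
  rcases (tsupport a).eq_empty_or_nonempty with h | h
  · exact ⟨1, T - 1, one_pos, by linarith, fun t _ =>
      image_eq_zero_of_notMem_tsupport (by rw [h]; exact notMem_empty t)⟩
  · refine ⟨_, _, (ha.support (hK.sInf_mem h)).1, (ha.support (hK.sSup_mem h)).2, fun t ht =>
      image_eq_zero_of_notMem_tsupport fun h2 =>
        ht ⟨csInf_le hK.bddBelow h2, le_csSup hK.bddAbove h2⟩⟩

theorem exists_bound (ha : IsTimeTest T a) : ∃ C : ℝ≥0, ∀ t, ‖a t‖ ≤ C := by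
  obtain ⟨C, hC⟩ := ha.compact.exists_bound_of_continuous ha.smooth.continuous
  exact ⟨C.toNNReal, fun t => (hC t).trans (le_coe_toNNReal C)⟩

/-- The product of a function of time and a function of space. -/
def sep (ha : IsTimeTest T a) (χ : SmoothPer) : TestFn T :=
  ⟨fun z => a z.1 * χ.1 z.2, (ha.smooth.comp contDiff_fst).mul (χ.contDiff.comp contDiff_snd),
    fun t => χ.periodic.comp fun y => a t * y, by
      obtain ⟨c, d, hc, hd, h⟩ := ha.exists_Icc
      exact ⟨c, d, hc, hd, fun t ht x => by simp [h t ht]⟩⟩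

theorem slice_sep (ha : IsTimeTest T a) (χ : SmoothPer) (t : ℝ) :
    (ha.sep χ).slice t = a t • χ := rfl

theorem slice_dt_sep (ha : IsTimeTest T a) (χ : SmoothPer) (t : ℝ) :
    (ha.sep χ).ddt.slice t = _root_.deriv a t • χ := by
  ext x
  refine ((ha.sep χ).hasDerivAt t x).unique ?_
  have h := ((ha.smooth.differentiable (by simp) t).hasDerivAt).mul_const (χ.1 x)
  exact h

end IsTimeTest

/-- The vector-valued test function with given coordinates. -/
def vecT (ζ : Fin 3 → TestFn T) : SpaceTimeTest E3 T := by
  refine ⟨fun z => WithLp.toLp 2 fun i => (ζ i).1 z, ?_, fun t x j => ?_, ?_⟩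
  · exact contDiff_euclidean.2 fun i => (ζ i).contDiff
  · ext i
    exact (ζ i).2.2.1 t x j
  · choose a b ha hb h using fun i => (ζ i).2.2.2
    refine ⟨min (a 0) (min (a 1) (a 2)), max (b 0) (max (b 1) (b 2)), by simp [ha], by simp [hb],
      fun t ht x => ?_⟩
    ext i
    refine h i t (fun h2 => ht ⟨?_, ?_⟩) x
    · refine le_trans ?_ h2.1
      fin_cases i <;> simp
    · refine h2.2.trans ?_
      fin_cases i <;> simp

/-- The coordinates of a vector-valued test function. -/
def coordST (ζ : SpaceTimeTest E3 T) (i : Fin 3) : TestFn T := by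
  refine ⟨fun z => ζ.1 z i, (EuclideanSpace.proj i : E3 →L[ℝ] ℝ).contDiff.comp ζ.2.1,
    fun t => (ζ.2.2.1 t).comp fun y => y i, ?_⟩
  obtain ⟨-, -, a, b, ha, hb, h⟩ := ζ.2
  exact ⟨a, b, ha, hb, fun t ht x => by simp [h t ht x]⟩

theorem fderiv_coordST (ζ : SpaceTimeTest E3 T) (z v : ℝ × E3) (i : Fin 3) :
    fderiv ℝ ζ.1 z v i = fderiv ℝ (coordST ζ i).1 z v := by
  have h := (EuclideanSpace.proj i : E3 →L[ℝ] ℝ).hasFDerivAt.comp z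
    (ζ.2.1.differentiable (by simp) z).hasFDerivAt
  change _ = fderiv ℝ ((EuclideanSpace.proj i : E3 →L[ℝ] ℝ) ∘ ζ.1) z v
  rw [h.fderiv]
  rfl

theorem coordST_vecT (ζ : Fin 3 → TestFn T) (i : Fin 3) : coordST (vecT ζ) i = ζ i := rfl

theorem coordST_dt (ζ : SpaceTimeTest E3 T) (i : Fin 3) : coordST (dt ζ) i = dt (coordST ζ i) := by
  ext z
  exact fderiv_coordST ζ z _ i

end Tests

/-! ### Integrable functions on space-time tested against test functions -/

section Pairings

open TestFn

/-- Jointly measurable functions of time and space, periodic and integrable in space at each time,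
and integrable on `(0,T) × 𝕋³`. -/
structure STInt (T : ℝ) (f : ℝ → E3 → ℝ) : Prop where
  meas : JMeas f
  perInt : ∀ t, PerInt (f t)
  lintegral_lt : ∫⁻ t in Ioo 0 T, eLpNorm (f t) 1 vol < ⊤

/-- `∫₀ᵀ ∫ f φ dx dt`. -/
def stPair (T : ℝ) (f : ℝ → E3 → ℝ) (φ : TestFn T) : ℝ :=
  ∫ t in Ioo 0 T, ∫ x, f t x * φ.1 (t, x) ∂vol

namespace STInt

variable {f g : ℝ → E3 → ℝ}

theorem measurable_eLpNorm (hf : JMeas f) : Measurable fun t => eLpNorm (f t) 1 vol := by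
  simp only [eLpNorm_one_eq_lintegral_enorm]
  exact Measurable.lintegral_prod_right' (f := fun z : ℝ × E3 => ‖f z.1 z.2‖ₑ) hf.enorm

theorem integrable (hf : STInt T f) : Integrable (uncurry f) ((𝓛 T).prod vol) := by
  refine ⟨hf.meas.aestronglyMeasurable, ?_⟩
  rw [hasFiniteIntegral_iff_enorm, lintegral_prod _ hf.meas.enorm.aemeasurable]
  simpa only [eLpNorm_one_eq_lintegral_enorm] using! hf.lintegral_lt

protected theorem enorm_integral_mul_le (hf : STInt T f) {χ : E3 → ℝ} (hχ : StronglyMeasurable χ)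
    {t : ℝ} (hM : eLpNorm χ ⊤ vol ≤ M) : ‖∫ x, f t x * χ x ∂vol‖ₑ ≤ eLpNorm (f t) 1 vol * M :=
  (enorm_integral_mul_le (p := 1) (q := ⊤) (hf.perInt t).meas hχ).trans
    (mul_le_mul' le_rfl hM)

theorem exists_eLpNorm_slice_le (φ : TestFn T) :
    ∃ M : ℝ≥0, ∀ t, eLpNorm (slice φ t).1 ⊤ vol ≤ M := by
  obtain ⟨M, hM⟩ := exists_nik_slice φ
  exact ⟨M, fun t => (hM zero_le_one le_rfl t).norm_le⟩

theorem stronglyMeasurable_integral_mul (hf : JMeas f) (φ : TestFn T) :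
    StronglyMeasurable fun t => ∫ x, f t x * φ.1 (t, x) ∂vol :=
  StronglyMeasurable.integral_prod_right (f := fun t x => f t x * φ.1 (t, x))
    (hf.mul φ.contDiff.continuous.stronglyMeasurable)

theorem integrable_mul (hf : STInt T f) (φ : TestFn T) :
    IntegrableOn (fun t => ∫ x, f t x * φ.1 (t, x) ∂vol) (Ioo 0 T) := by
  obtain ⟨M, hM⟩ := exists_eLpNorm_slice_le φ
  refine ⟨(stronglyMeasurable_integral_mul hf.meas φ).aestronglyMeasurable, ?_⟩
  rw [hasFiniteIntegral_iff_enorm]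
  refine (lintegral_mono fun t => hf.enorm_integral_mul_le (slice φ t).perInt.meas (hM t)).trans_lt ?_
  rw [lintegral_mul_const _ (measurable_eLpNorm hf.meas)]
  exact mul_lt_top hf.lintegral_lt coe_lt_top

theorem add (hf : STInt T f) (hg : STInt T g) : STInt T fun t x => f t x + g t x := by
  refine ⟨hf.meas.add hg.meas, fun t => ⟨(hf.perInt t).periodic.comp₂ (hg.perInt t).periodic _,
    (hf.perInt t).meas.add (hg.perInt t).meas, (hf.perInt t).integrable.add (hg.perInt t).integrable⟩, ?_⟩
  refine (lintegral_mono fun t => eLpNorm_add_le (hf.perInt t).meas.aestronglyMeasurable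
    (hg.perInt t).meas.aestronglyMeasurable le_rfl).trans_lt ?_
  rw [lintegral_add_left (measurable_eLpNorm hf.meas)]
  exact ENNReal.add_lt_top.2 ⟨hf.lintegral_lt, hg.lintegral_lt⟩

theorem neg (hf : STInt T f) : STInt T fun t x => -f t x := by
  refine ⟨hf.meas.neg, fun t => ⟨(hf.perInt t).periodic.comp _, (hf.perInt t).meas.neg,
    (hf.perInt t).integrable.neg⟩, ?_⟩
  refine lt_of_eq_of_lt (lintegral_congr fun t => ?_) hf.lintegral_lt
  exact eLpNorm_neg (f t) _ _

theorem sub (hf : STInt T f) (hg : STInt T g) : STInt T fun t x => f t x - g t x := by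
  simpa only [sub_eq_add_neg] using hf.add hg.neg

protected theorem conv (hf : STInt T f) (hk : IsKernel k) : STInt T fun t => conv k (f t) := by
  refine ⟨stronglyMeasurable_conv_param hk.continuous.measurable hf.meas,
    fun t => (SmoothPer.perInt (SmoothPer.mol hk (hf.perInt t))), ?_⟩
  refine (lintegral_mono fun t => eLpNorm_conv_le hk le_rfl (hf.perInt t).periodic
    (hf.perInt t).meas).trans_lt ?_
  rw [lintegral_const_mul _ (measurable_eLpNorm hf.meas)]
  exact mul_lt_top coe_lt_top hf.lintegral_lt

end STInt

variable {f g : ℝ → E3 → ℝ}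

theorem enorm_stPair_le (hf : STInt T f) {φ : TestFn T}
    (hM : ∀ t, eLpNorm (slice φ t).1 ⊤ vol ≤ M) :
    ‖stPair T f φ‖ₑ ≤ (∫⁻ t in Ioo 0 T, eLpNorm (f t) 1 vol) * M := by
  refine (enorm_integral_le_lintegral_enorm _).trans ?_
  rw [← lintegral_mul_const _ (STInt.measurable_eLpNorm hf.meas)]
  exact lintegral_mono fun t => hf.enorm_integral_mul_le (slice φ t).perInt.meas (hM t)

theorem stPair_add (hf : STInt T f) (φ ψ : TestFn T) :
    stPair T f (φ + ψ) = stPair T f φ + stPair T f ψ := by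
  rw [stPair, stPair, stPair, ← integral_add (hf.integrable_mul φ) (hf.integrable_mul ψ)]
  refine integral_congr_fun fun t => ?_
  refine Eq.trans (integral_congr_ae (.of_forall fun x => mul_add _ _ _))
    (integral_add ((hf.perInt t).integrable_mul (slice φ t)) ((hf.perInt t).integrable_mul (slice ψ t)))

theorem stPair_smul (c : ℝ) (φ : TestFn T) : stPair T f (c • φ) = c * stPair T f φ := by
  rw [stPair, stPair, ← integral_const_mul]
  refine integral_congr_fun fun t => ?_
  rw [← integral_const_mul]
  exact integral_congr_fun fun x => mul_left_comm _ _ _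

/-- The pairing with an integrable function, as a linear functional. -/
def stPairL (hf : STInt T f) : TestFn T →ₗ[ℝ] ℝ where
  toFun := stPair T f
  map_add' := stPair_add hf
  map_smul' c φ := stPair_smul c φ

theorem stPair_sub_left (hf : STInt T f) (hg : STInt T g) (φ : TestFn T) :
    stPair T (fun t x => f t x - g t x) φ = stPair T f φ - stPair T g φ := by
  rw [stPair, stPair, stPair, ← integral_sub (hf.integrable_mul φ) (hg.integrable_mul φ)]
  refine integral_congr_fun fun t => ?_
  refine Eq.trans (integral_congr_ae (.of_forall fun x => sub_mul _ _ _))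
    (integral_sub ((hf.perInt t).integrable_mul (slice φ t)) ((hg.perInt t).integrable_mul (slice φ t)))

theorem tendsto_stPair_convT (hf : STInt T f) {k : ℕ → E3 → ℝ} (hk : ∀ n, IsUnitKernel (k n))
    {m : ℝ≥0} (hm : ∀ n, massOf (k n) ≤ m) {ρ : ℕ → ℝ≥0} (hρ : ∀ n ξ, k n ξ ≠ 0 → ‖ξ‖ₑ ≤ ρ n)
    (hρ0 : Tendsto ρ atTop (𝓝 0)) (φ : TestFn T) :
    Tendsto (fun n => stPair T f (convT (hk n).toIsKernel φ)) atTop (𝓝 (stPair T f φ)) := by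
  obtain ⟨M, hM⟩ := exists_nik_slice φ
  refine tendsto_enorm_sub_zero (C := (∫⁻ t in Ioo 0 T, eLpNorm (f t) 1 vol).toNNReal * (m * M)) hρ0
    (.of_forall fun n => ?_)
  rw [mul_assoc, ENNReal.coe_mul, coe_toNNReal hf.lintegral_lt.ne]
  change ‖stPairL hf _ - stPairL hf φ‖ₑ ≤ _
  rw [← map_sub]
  refine enorm_stPair_le hf fun t => ?_
  have h3 := eLpNorm_conv_sub_le (hk n) (hρ n) (hM zero_le_one le_rfl t) le_top zero_le_one
  rw [NNReal.rpow_one] at h3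
  refine h3.trans ?_
  exact_mod_cast mul_le_mul' (mul_le_mul' (hm n) le_rfl) le_rfl
theorem tendsto_stPair_convT_dilate (hf : STInt T f) {m : E3 → ℝ} (hm : IsUnitKernel m)
    (hk : ∀ n : ℕ, IsKernel (dilate m (2 ^ n))) (φ : TestFn T) :
    Tendsto (fun n : ℕ => stPair T f (convT (hk n) φ)) atTop
      (𝓝 (∫ t in Ioo 0 T, (∫ x, f t x ∂vol) * cInt (slice φ t))) := by
  obtain ⟨C, hC⟩ := exists_eLpNorm_conv_dilate_sub_mean_le hm.toIsKernel
  obtain ⟨M, hM⟩ := STInt.exists_eLpNorm_slice_le φ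
  have hi : ∀ t, ‖(∫ x, f t x ∂vol) * cInt (slice φ t)‖ₑ ≤ eLpNorm (f t) 1 vol * M := by
    intro t
    rw [enorm_mul]
    refine mul_le_mul' ?_ ?_
    · rw [eLpNorm_one_eq_lintegral_enorm]
      exact enorm_integral_le_lintegral_enorm _
    · refine (enorm_integral_le_lintegral_enorm _).trans ?_
      rw [← eLpNorm_one_eq_lintegral_enorm]
      exact (eLpNorm_le_eLpNorm_of_exponent_le le_top (slice φ t).perInt.meas.aestronglyMeasurable).trans
        (hM t)
  have hint : IntegrableOn (fun t => (∫ x, f t x ∂vol) * cInt (slice φ t)) (Ioo 0 T) := by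
    refine ⟨((StronglyMeasurable.integral_prod_right hf.meas).mul
      (StronglyMeasurable.integral_prod_right φ.stronglyMeasurable_slice)).aestronglyMeasurable, ?_⟩
    rw [hasFiniteIntegral_iff_enorm]
    refine (lintegral_mono hi).trans_lt ?_
    rw [lintegral_mul_const _ (STInt.measurable_eLpNorm hf.meas)]
    exact mul_lt_top hf.lintegral_lt coe_lt_top
  refine tendsto_enorm_sub_zero (C := (∫⁻ t in Ioo 0 T, eLpNorm (f t) 1 vol).toNNReal * (C * M))
    tendsto_half_pow (.of_forall fun n => ?_)
  rw [mul_assoc, ENNReal.coe_mul, coe_toNNReal hf.lintegral_lt.ne, stPair,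
    ← integral_sub (hf.integrable_mul _) hint]
  refine (enorm_integral_le_lintegral_enorm _).trans ?_
  rw [← lintegral_mul_const _ (STInt.measurable_eLpNorm hf.meas)]
  refine lintegral_mono fun t => ?_
  have he : ∀ x, dilate m (2 ^ n) (-x) = dilate m (2 ^ n) x := fun x => by
    simp [dilate, hm.even]
  have e1 : ∫ x, f t x * (convT (hk n) φ).1 (t, x) ∂vol =
      ∫ x, conv (dilate m (2 ^ n)) (f t) x * (slice φ t).1 x ∂vol :=
    (integral_conv_mul_of_even (hk n) he (hf.perInt t) (slice φ t).periodic
      (slice φ t).continuous).symm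
  have hc : PerInt (conv (dilate m (2 ^ n)) (f t)) :=
    (SmoothPer.mol (hk n) (hf.perInt t)).perInt
  have e2 : ∫ x, f t x * (convT (hk n) φ).1 (t, x) ∂vol -
      (∫ x, f t x ∂vol) * cInt (slice φ t) =
      ∫ x, (conv (dilate m (2 ^ n)) (f t) x - ∫ y, f t y ∂vol) *
        (slice φ t).1 x ∂vol := by
    rw [e1, cInt_apply, ← integral_const_mul, ← integral_sub (hc.integrable_mul _)
      ((slice φ t).integrable.const_mul _)]
    simp only [sub_mul]
  rw [e2]
  refine (enorm_integral_mul_le (p := 1) (q := ⊤)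
    (hc.meas.sub stronglyMeasurable_const) (slice φ t).perInt.meas).trans ?_
  have e3 := hC 1 (2 ^ n) (f t) le_rfl (one_le_pow₀ (by norm_num)) (hf.perInt t)
  rw [hm.integral_eq] at e3
  simp only [one_mul] at e3
  refine (mul_le_mul' e3 (hM t)).trans (le_of_eq ?_)
  rw [← inv_pow, show (2 : ℝ)⁻¹ = 1 / 2 by norm_num, toNNReal_half_pow]
  push_cast
  ring

/-- Time derivatives of test functions integrate to zero. -/
theorem integral_cInt_ddt (hT : 0 < T) (φ : TestFn T) :
    ∫ t in Ioo 0 T, cInt (slice (ddt φ) t) = 0 := by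
  obtain ⟨M, hM⟩ := exists_bound (ddt φ)
  have hI : Integrable (uncurry fun t x => (ddt φ).1 (t, x))
      ((𝓛 T).prod vol) := by
    refine Integrable.mono' (integrable_const (M : ℝ))
      (ddt φ).contDiff.continuous.aestronglyMeasurable (.of_forall fun z => hM z)
  simp only [cInt_apply]
  refine (integral_integral_swap hI).trans ?_
  have h0 : ∀ x, ∫ t in Ioo 0 T, (ddt φ).1 (t, x) = 0 := fun x => by
    rw [← integral_Ioc_eq_integral_Ioo, ← intervalIntegral.integral_of_le hT.le,
      intervalIntegral.integral_eq_sub_of_hasDerivAt (f := fun s => φ.1 (s, x))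
        (fun t _ => φ.hasDerivAt t x)]
    · obtain ⟨-, -, a, b, ha, hb, h⟩ := φ.2
      rw [h T (fun h => hb.not_ge h.2), h 0 (fun h => ha.not_ge h.1), sub_zero]
    · exact ((ddt φ).contDiff.continuous.comp
        (continuous_id.prodMk continuous_const)).intervalIntegrable _ _
  simp [h0]

end Pairings

/-! ### The momentum equation -/

section Momentum

open TestFn SmoothPer

/-- Directional derivatives of test functions. -/
def TestFn.dir (v : ℝ × E3) : TestFn T →ₗ[ℝ] TestFn T where
  toFun φ := ⟨fun z => fderiv ℝ φ.1 z v, fderiv_apply_mem φ.2 v⟩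
  map_add' φ ψ := by
    ext z
    change fderiv ℝ (φ.1 + ψ.1) z v = _
    rw [fderiv_add (φ.differentiableAt z) (ψ.differentiableAt z)]
    rfl
  map_smul' c φ := by
    ext z
    change fderiv ℝ (c • φ.1) z v = _
    rw [fderiv_const_smul (φ.differentiableAt z)]
    rfl

/-- The curl of a test field. -/
def curlT (ψ : Fin 3 → TestFn T) : Fin 3 → TestFn T :=
  ![dx 1 (ψ 2) - dx 2 (ψ 1), dx 2 (ψ 0) - dx 0 (ψ 2), dx 0 (ψ 1) - dx 1 (ψ 0)]

theorem TestFn.slice_sub (φ ψ : TestFn T) (t : ℝ) : slice (φ - ψ) t = slice φ t - slice ψ t := rfl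

theorem slice_curlT (ψ : Fin 3 → TestFn T) (i : Fin 3) (t : ℝ) :
    slice (curlT ψ i) t = curlS (fun j => slice (ψ j) t) i := by
  fin_cases i <;> simp only [curlT, curlS, cons_val_zero, cons_val_one,
    cons_val, Fin.zero_eta, Fin.mk_one, Fin.reduceFinMk, slice_sub, slice_dx]

theorem curlS_curlS (Z : Fin 3 → SmoothPer) (l : Fin 3) :
    curlS (curlS Z) l = D l (∑ j, D j (Z j)) - ∑ i, D i (D i (Z l)) := by
  fin_cases l <;>
  simp only [curlS, cons_val_zero, cons_val_one, cons_val, Fin.zero_eta,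
    Fin.mk_one, Fin.reduceFinMk, map_sub, map_add, Fin.sum_univ_three, D_comm 1 0, D_comm 2 0,
    D_comm 2 1] <;> ring

variable {U : Fin 3 → ℝ → E3 → ℝ}

/-- The weak form of `∂ₜU + ∇ · (U ⊗ U)`, with the sign of the test function reversed. -/
def momForm (hU : ∀ i, STInt T (U i)) (hR : ∀ i l, STInt T fun t x => U i t x * U l t x) :
    (Fin 3 → TestFn T) →ₗ[ℝ] ℝ :=
  ∑ i, stPairL (hU i) ∘ₗ dir (1, 0) ∘ₗ LinearMap.proj i +
    ∑ i, ∑ l, stPairL (hR i l) ∘ₗ dir (0, e i) ∘ₗ LinearMap.proj l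

theorem momForm_apply (hU : ∀ i, STInt T (U i)) (hR : ∀ i l, STInt T fun t x => U i t x * U l t x)
    (ζ : Fin 3 → TestFn T) : momForm hU hR ζ = ∑ i, stPair T (U i) (ddt (ζ i)) +
      ∑ i, ∑ l, stPair T (fun t x => U i t x * U l t x) (dx i (ζ l)) := by
  simp only [momForm, LinearMap.add_apply, LinearMap.sum_apply, LinearMap.comp_apply]
  rfl

variable (hU : ∀ i, STInt T (U i)) (hR : ∀ i l, STInt T fun t x => U i t x * U l t x)

/-- The partial sums of the pressure. -/
def pressureSum (n : ℕ) (U : Fin 3 → ℝ → E3 → ℝ) (t : ℝ) (x : E3) : ℝ :=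
  ∑ j ∈ Finset.range n, pressureStep j (fun i l x => U i t x * U l t x) x

theorem momForm_grad (hdiv : ∀ t (χ : SmoothPer), ∑ i, ∫ x, U i t x * (D i χ).1 x ∂vol = 0)
    (n : ℕ) (δ : TestFn T) :
    momForm hU hR (fun l => dx l (convT (isKernel_potSum n) δ)) = stPair T (pressureSum n U) δ := by
  set χ := convT (isKernel_potSum n) δ with hχ
  have h1 : ∑ i, stPair T (U i) (ddt (dx i χ)) = 0 := by
    simp only [stPair]
    rw [← integral_finsetSum _ fun i _ => (hU i).integrable_mul (ddt (dx i χ))]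
    refine (integral_congr_fun fun t => ?_).trans (integral_zero _ _)
    refine Eq.trans (sum_congr rfl fun i _ => ?_) (hdiv t (slice (ddt χ) t))
    rw [← slice_dt_dx]
    rfl
  rw [momForm_apply, h1, zero_add]
  simp only [stPair]
  rw [sum_congr rfl fun i _ =>
    (integral_finsetSum _ fun l _ => (hR i l).integrable_mul (dx i (dx l χ))).symm,
    ← integral_finsetSum _ fun i _ =>
      integrable_finsetSum _ fun l _ => (hR i l).integrable_mul (dx i (dx l χ))]
  refine integral_congr_fun fun t => ?_
  refine Eq.trans ?_ (integral_pressureStep_mul n (fun i l => (hR i l).perInt t) (slice δ t)).symm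
  refine sum_congr rfl fun i _ => sum_congr rfl fun l _ => ?_
  have h2 : slice (dx i (dx l χ)) t = D i (D l (J (isKernel_potSum n) (slice δ t))) := by
    rw [slice_dx, slice_dx, hχ, slice_convT]
  rw [← h2]
  rfl

theorem isKernel_massKernel_two_pow (n : ℕ) : IsKernel (dilate massKernel (2 ^ n)) :=
  isUnitKernel_massKernel.toIsKernel.dilate (by positivity)

theorem isUnitKernel_massKernel_half_pow (n : ℕ) : IsUnitKernel (dilate massKernel ((1 / 2) ^ n)) :=
  isUnitKernel_massKernel.dilate (by positivity)

theorem momForm_truncated (hdiv : ∀ t (χ : SmoothPer), ∑ i, ∫ x, U i t x * (D i χ).1 x ∂vol = 0)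
    (hcurl : ∀ ψ : Fin 3 → TestFn T, momForm hU hR (curlT ψ) = 0) (n : ℕ) (ζ : Fin 3 → TestFn T) :
    momForm hU hR (fun l => convT (isUnitKernel_massKernel_half_pow n).toIsKernel (ζ l)) -
      momForm hU hR (fun l => convT (isKernel_massKernel_two_pow n) (ζ l)) +
      stPair T (pressureSum n U) (∑ j, dx j (ζ j)) = 0 := by
  have h1 : curlT (curlT fun i => convT (isKernel_potSum n) (ζ i)) =
      (fun l => dx l (convT (isKernel_potSum n) (∑ j, dx j (ζ j)))) -
      ((fun l => convT (isKernel_massKernel_two_pow n) (ζ l)) -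
        fun l => convT (isUnitKernel_massKernel_half_pow n).toIsKernel (ζ l)) := by
    funext l
    refine ext_slice fun t => ?_
    rw [slice_curlT, show (fun j => slice (curlT (fun i => convT (isKernel_potSum n) (ζ i)) j) t) =
      curlS (fun i => J (isKernel_potSum n) (slice (ζ i) t)) from funext fun j => slice_curlT _ j t,
      curlS_curlS, sum_D_D_J_potSum]
    simp only [Pi.sub_apply, slice_sub, slice_dx, slice_convT, slice_sum, map_sum, D_J]
  have h2 := hcurl (curlT fun i => convT (isKernel_potSum n) (ζ i))
  rw [h1, map_sub, map_sub, momForm_grad hU hR hdiv] at h2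
  linarith

theorem massKernel_bounded : ∃ ρ : ℝ≥0, ∀ ξ, massKernel ξ ≠ 0 → ‖ξ‖ₑ ≤ ρ := by
  obtain ⟨R, hR⟩ := isUnitKernel_massKernel.compact.isBounded.exists_norm_le
  refine ⟨R.toNNReal, fun ξ h => ?_⟩
  rw [← ofReal_norm]
  exact ofReal_le_ofReal (hR ξ (subset_tsupport _ h))

theorem tendsto_stPair_massKernel_half_pow {r : ℝ → E3 → ℝ} (hr : STInt T r) (φ : TestFn T) :
    Tendsto (fun n => stPair T r (convT (isUnitKernel_massKernel_half_pow n).toIsKernel φ)) atTop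
      (𝓝 (stPair T r φ)) := by
  obtain ⟨ρ, hρ⟩ := massKernel_bounded
  refine tendsto_stPair_convT hr isUnitKernel_massKernel_half_pow (m := massOf massKernel)
    (fun n => (massOf_dilate isUnitKernel_massKernel.toIsKernel (by positivity)).le)
    (ρ := fun n => (1 / 2) ^ n * ρ) (fun n ξ h => ?_) ?_ φ
  · have := dilate_ne_zero hρ (by positivity) ξ h
    rwa [toNNReal_half_pow] at this
  · simpa using tendsto_half_pow.mul_const ρ

/-- The momentum equation follows from its curl. -/
theorem momForm_add_pressure (hT : 0 < T)
    (hdiv : ∀ t (χ : SmoothPer), ∑ i, ∫ x, U i t x * (D i χ).1 x ∂vol = 0)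
    (hcurl : ∀ ψ : Fin 3 → TestFn T, momForm hU hR (curlT ψ) = 0)
    (hmean : ∀ i, ∃ c : ℝ, ∀ᵐ t ∂𝓛 T, ∫ x, U i t x ∂vol = c) {p : ℝ → E3 → ℝ} (hp : STInt T p)
    (he : ∀ n, STInt T fun t x => pressureSum n U t x - p t x)
    (hlim : Tendsto (fun n => ∫⁻ t in Ioo 0 T,
      eLpNorm (fun x => pressureSum n U t x - p t x) 1 vol) atTop (𝓝 0)) (ζ : Fin 3 → TestFn T) :
    momForm hU hR ζ + ∑ i, stPair T p (dx i (ζ i)) = 0 := by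
  have ddt_convT : ∀ {k : E3 → ℝ} (hk : IsKernel k) (φ : TestFn T),
      ddt (convT hk φ) = convT hk (ddt φ) := fun hk φ => ext_slice fun t => slice_dt_convT hk φ t
  have dx_convT : ∀ {k : E3 → ℝ} (hk : IsKernel k) (i : Fin 3) (φ : TestFn T),
      dx i (convT hk φ) = convT hk (dx i φ) := fun hk i φ => ext_slice fun t => by
    rw [slice_dx, slice_convT, slice_convT, slice_dx, D_J]
  have l1 : Tendsto (fun n => momForm hU hR fun l => convT (isUnitKernel_massKernel_half_pow n).toIsKernel (ζ l))
      atTop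
      (𝓝 (momForm hU hR ζ)) := by
    simp only [momForm_apply, ddt_convT, dx_convT]
    exact (tendsto_finsetSum _ fun i _ => tendsto_stPair_massKernel_half_pow (hU i) _).add
      (tendsto_finsetSum _ fun i _ => tendsto_finsetSum _ fun l _ =>
        tendsto_stPair_massKernel_half_pow (hR i l) _)
  have l2 : Tendsto (fun n => momForm hU hR fun l => convT (isKernel_massKernel_two_pow n) (ζ l)) atTop
      (𝓝 0) := by
    have h0 : (∑ i, ∫ t in Ioo 0 T, (∫ x, U i t x ∂vol) * cInt (slice (ddt (ζ i)) t)) +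
        ∑ i, ∑ l, ∫ t in Ioo 0 T, (∫ x, U i t x * U l t x ∂vol) *
          cInt (slice (dx i (ζ l)) t) = 0 := by
      simp only [slice_dx, cInt_D, mul_zero, integral_zero, sum_const_zero, add_zero]
      refine sum_eq_zero fun i _ => ?_
      obtain ⟨c, hc⟩ := hmean i
      rw [integral_congr_ae (hc.mono fun t ht => congrArg (· * cInt (slice (ddt (ζ i)) t)) ht),
        integral_const_mul, integral_cInt_ddt hT, mul_zero]
    rw [← h0]
    simp only [momForm_apply, ddt_convT, dx_convT]
    exact (tendsto_finsetSum _ fun i _ => tendsto_stPair_convT_dilate (hU i)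
        isUnitKernel_massKernel isKernel_massKernel_two_pow _).add
      (tendsto_finsetSum _ fun i _ => tendsto_finsetSum _ fun l _ =>
        tendsto_stPair_convT_dilate (hR i l) isUnitKernel_massKernel isKernel_massKernel_two_pow _)
  have l3 : Tendsto (fun n => stPair T (pressureSum n U) (∑ j, dx j (ζ j))) atTop
      (𝓝 (∑ i, stPair T p (dx i (ζ i)))) := by
    set δ := ∑ j, dx j (ζ j) with hδ
    have e1 : ∑ i, stPair T p (dx i (ζ i)) = stPair T p δ := (map_sum (stPairL hp) _ _).symm
    obtain ⟨M, hM⟩ := STInt.exists_eLpNorm_slice_le δ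
    rw [e1]
    have hs : ∀ n, STInt T (pressureSum n U) := fun n => by simpa using (he n).add hp
    refine tendsto_of_enorm_sub (tendsto_zero_of_le (r := fun n => (∫⁻ t in Ioo 0 T,
      eLpNorm (fun x => pressureSum n U t x - p t x) 1 vol) * M) ?_ (.of_forall fun n => ?_))
    · simpa using ENNReal.Tendsto.mul_const hlim (Or.inr coe_ne_top)
    · rw [← stPair_sub_left (hs n) hp]
      exact enorm_stPair_le (he n) hM
  have l4 := (l1.sub l2).add l3
  simp only [momForm_truncated hU hR hdiv hcurl] at l4
  simpa using tendsto_nhds_unique l4 tendsto_const_nhds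

end Momentum

/-! ### Weak derivatives in time -/

section WeakTime

variable {X X' Y Y' : ℝ → ℝ}

theorem IsTimeTest.of_Icc {a : ℝ → ℝ} (ha : ContDiff ℝ (⊤ : ℕ∞) a) {c d : ℝ} (hc : 0 < c) (hd : d < T)
    (h : ∀ t, t ∉ Icc c d → a t = 0) : IsTimeTest T a :=
  ⟨ha, HasCompactSupport.intro isCompact_Icc h,
    (closure_minimal (fun t (ht : a t ≠ 0) => by_contra fun h2 => ht (h t h2)) isClosed_Icc).trans
      fun _ ht => ⟨hc.trans_le ht.1, ht.2.trans_lt hd⟩⟩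

theorem IsTimeTest.apply_zero {a : ℝ → ℝ} (ha : IsTimeTest T a) : a 0 = 0 :=
  image_eq_zero_of_notMem_tsupport fun h => (ha.support h).1.false

theorem IsTimeTest.apply_end {a : ℝ → ℝ} (ha : IsTimeTest T a) : a T = 0 :=
  image_eq_zero_of_notMem_tsupport fun h => (ha.support h).2.false

theorem exists_isTimeTest_integral_eq_one (hT : 0 < T) :
    ∃ a : ℝ → ℝ, IsTimeTest T a ∧ ∫ t in (0)..T, a t = 1 := by
  let b : ContDiffBump (T / 2) := ⟨T / 8, T / 4, by linarith, by linarith⟩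
  have h0 : ∀ t, t ∉ Icc (T / 4) (3 * T / 4) → b.normed volume t = 0 := fun t ht => by
    by_contra h
    have h2 : t ∈ Function.support (b.normed volume) := h
    rw [b.support_normed_eq, Real.ball_eq_Ioo] at h2
    simp only [b] at h2
    exact ht ⟨by linarith [h2.1], by linarith [h2.2]⟩
  refine ⟨b.normed volume, IsTimeTest.of_Icc b.contDiff_normed (by linarith) (by linarith) h0, ?_⟩
  rw [intervalIntegral.integral_of_le hT.le, ← b.integral_normed (μ := volume)]
  exact setIntegral_eq_integral_of_forall_compl_eq_zero fun t ht => h0 t fun h => ht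
    (⟨by linarith [h.1], by linarith [h.2]⟩)

theorem IsTimeTest.continuous {a : ℝ → ℝ} (ha : IsTimeTest T a) : Continuous a := ha.smooth.continuous

/-- A function whose weak derivative vanishes is constant. -/
theorem ae_const_of_integral_deriv_mul_eq_zero (hT : 0 < T) (hX : IntegrableOn X (Ioo 0 T))
    (h : ∀ a, IsTimeTest T a → ∫ t in Ioo 0 T, deriv a t * X t = 0) : ∃ c, ∀ᵐ t ∂𝓛 T, X t = c := by
  obtain ⟨a₀, ha₀, h1⟩ := exists_isTimeTest_integral_eq_one hT
  have hint : ∀ {g : ℝ → ℝ}, IsTimeTest T g → IntegrableOn (fun t => g t * X t) (Ioo 0 T) := fun hg => by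
    obtain ⟨C, hC⟩ := hg.exists_bound
    exact hX.bdd_mul hg.continuous.aestronglyMeasurable (.of_forall hC)
  refine ⟨∫ t in Ioo 0 T, a₀ t * X t, ?_⟩
  set c := ∫ t in Ioo 0 T, a₀ t * X t
  have key : ∀ g, IsTimeTest T g → ∫ t in Ioo 0 T, g t * X t = (∫ t in (0)..T, g t) * c := by
    intro g hg
    set m := ∫ t in (0)..T, g t with hm
    set w : ℝ → ℝ := fun t => g t - m * a₀ t with hw
    have hwc : Continuous w := hg.continuous.sub (continuous_const.mul ha₀.continuous)
    set G : ℝ → ℝ := fun t => ∫ s in (0)..t, w s with hG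
    have hder : ∀ t, HasDerivAt G (w t) t := fun t => hwc.integral_hasStrictDerivAt 0 t |>.hasDerivAt
    have hdG : deriv G = w := funext fun t => (hder t).deriv
    obtain ⟨c1, d1, hc1, hd1, h01⟩ := hg.exists_Icc
    obtain ⟨c2, d2, hc2, hd2, h02⟩ := ha₀.exists_Icc
    have hw0 : ∀ t, t ∉ Icc (min c1 c2) (max d1 d2) → w t = 0 := fun t ht => by
      rw [hw]
      simp only
      rw [h01 t fun h => ht ⟨(min_le_left _ _).trans h.1, h.2.trans (le_max_left _ _)⟩,
        h02 t fun h => ht ⟨(min_le_right _ _).trans h.1, h.2.trans (le_max_right _ _)⟩]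
      ring
    have hGT : ∫ s in (0)..T, w s = 0 := by
      have i2 : IntervalIntegrable (fun t => m * a₀ t) volume 0 T :=
        (continuous_const.mul ha₀.continuous).intervalIntegrable _ _
      rw [intervalIntegral.integral_sub (hg.continuous.intervalIntegrable _ _) i2,
        intervalIntegral.integral_const_mul, h1, mul_one, sub_self]
    have hGt : IsTimeTest T G := by
      refine IsTimeTest.of_Icc ?_ (lt_min hc1 hc2) (max_lt hd1 hd2) fun t ht => ?_
      · rw [contDiff_infty_iff_deriv, hdG]
        exact ⟨fun t => (hder t).differentiableAt, hg.smooth.sub (contDiff_const.mul ha₀.smooth)⟩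
      · rcases lt_or_ge t (min c1 c2) with h3 | h3
        · refine (intervalIntegral.integral_congr fun s hs => ?_).trans intervalIntegral.integral_zero
          refine hw0 s fun h4 => ?_
          rcases Set.mem_uIcc.1 hs with h5 | h5
          · exact absurd (h5.2.trans_lt h3) h4.1.not_gt
          · exact absurd (h5.2.trans_lt (lt_min hc1 hc2)) h4.1.not_gt
        · have h4 : max d1 d2 < t := lt_of_not_ge fun h4 => ht ⟨h3, h4⟩
          have h5 : ∫ s in t..T, w s = 0 := by
            refine (intervalIntegral.integral_congr fun s hs => ?_).trans intervalIntegral.integral_zero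
            refine hw0 s fun h6 => ?_
            rcases Set.mem_uIcc.1 hs with h5 | h5
            · exact absurd (h4.trans_le h5.1) h6.2.not_gt
            · exact absurd ((max_lt hd1 hd2).trans_le h5.1) h6.2.not_gt
          have h6 := intervalIntegral.integral_add_adjacent_intervals
            (hwc.intervalIntegrable 0 t) (hwc.intervalIntegrable t T) (μ := volume)
          rw [h5, hGT, add_zero] at h6
          exact h6
    have h3 := h G hGt
    rw [hdG, hw] at h3
    simp only [sub_mul, mul_assoc] at h3
    rw [integral_sub (hint hg) ((hint ha₀).const_mul m), integral_const_mul] at h3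
    linarith
  have hae := isOpen_Ioo.ae_eq_zero_of_integral_contDiff_smul_eq_zero (U := Ioo (0 : ℝ) T)
    (f := fun t => X t - c) (μ := volume) ?_ fun g hg hgc hgs => ?_
  · rw [ae_restrict_iff' measurableSet_Ioo]
    exact hae.mono fun t ht htT => sub_eq_zero.1 (ht htT)
  · exact (hX.sub (integrable_const c)).locallyIntegrableOn
  · have hgt : IsTimeTest T g := ⟨hg, hgc, hgs⟩
    have e1 : ∫ t, g t • (X t - c) = ∫ t in Ioo 0 T, g t • (X t - c) :=
      (setIntegral_eq_integral_of_forall_compl_eq_zero fun t ht => by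
        rw [image_eq_zero_of_notMem_tsupport fun h => ht (hgs h), zero_smul]).symm
    have e2 : IntegrableOn (fun t => g t * c) (Ioo 0 T) :=
      ((hg.continuous.integrable_of_hasCompactSupport hgc).mul_const c).integrableOn
    rw [e1]
    simp only [smul_eq_mul, mul_sub]
    rw [integral_sub (hint hgt) e2, key g hgt, integral_mul_const,
      intervalIntegral.integral_of_le hT.le, integral_Ioc_eq_integral_Ioo, sub_self]

/-- `X'` is the weak derivative of `X` on `(0,T)`. -/
structure WeakDeriv (T : ℝ) (X X' : ℝ → ℝ) : Prop where
  integrable : IntegrableOn X (Ioo 0 T)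
  integrable' : IntegrableOn X' (Ioo 0 T)
  weak : ∀ a, IsTimeTest T a → ∫ t in Ioo 0 T, deriv a t * X t = -∫ t in Ioo 0 T, a t * X' t

theorem IsTimeTest.absolutelyContinuous {a : ℝ → ℝ} (ha : IsTimeTest T a) :
    AbsolutelyContinuousOnInterval a 0 T :=
  (ha.smooth.of_le (by exact_mod_cast le_top)).contDiffOn.absolutelyContinuousOnInterval

/-- Weakly differentiable functions have absolutely continuous versions. -/
theorem WeakDeriv.exists_absolutelyContinuous (hT : 0 < T) (h : WeakDeriv T X X') :
    ∃ Z, AbsolutelyContinuousOnInterval Z 0 T ∧ ∀ᵐ t ∂𝓛 T, X t = Z t ∧ deriv Z t = X' t := by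
  have hi : IntervalIntegrable X' volume 0 T :=
    (intervalIntegrable_iff_integrableOn_Ioo_of_le hT.le).2 h.integrable'
  set F : ℝ → ℝ := fun t => ∫ s in (0)..t, X' s with hF
  have hAC : AbsolutelyContinuousOnInterval F 0 T :=
    hi.absolutelyContinuousOnInterval_intervalIntegral (by simp)
  have hder : ∀ᵐ t ∂𝓛 T, HasDerivAt F (X' t) t := by
    rw [ae_restrict_iff' measurableSet_Ioo]
    filter_upwards [hi.ae_hasDerivAt_integral] with t ht htT
    exact ht (by rw [uIcc_of_le hT.le]; exact Ioo_subset_Icc_self htT) 0 (by simp)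
  have hFi : IntegrableOn F (Ioo 0 T) :=
    ((intervalIntegrable_iff_integrableOn_Ioo_of_le hT.le).1 hAC.continuousOn.intervalIntegrable)
  obtain ⟨c, hc⟩ := ae_const_of_integral_deriv_mul_eq_zero hT (h.integrable.sub hFi) fun a ha => by
    have hb : ∀ {g Z : ℝ → ℝ}, IsTimeTest T g → IntegrableOn Z (Ioo 0 T) →
        IntegrableOn (fun t => g t * Z t) (Ioo 0 T) := fun hg hZ => by
      obtain ⟨C, hC⟩ := hg.exists_bound
      exact hZ.bdd_mul hg.continuous.aestronglyMeasurable (.of_forall hC)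
    have h1 := ha.absolutelyContinuous.integral_deriv_mul_eq_sub hAC
    rw [ha.apply_end, ha.apply_zero, zero_mul, zero_mul, sub_zero,
      intervalIntegral.integral_of_le hT.le, integral_Ioc_eq_integral_Ioo,
      integral_congr_ae (g := fun t => deriv a t * F t + a t * X' t)
        (hder.mono fun t ht => by simp only [ht.deriv]),
      integral_add (hb ha.deriv hFi) (hb ha h.integrable')] at h1
    simp only [Pi.sub_apply, mul_sub]
    rw [integral_sub (hb ha.deriv h.integrable) (hb ha.deriv hFi), h.weak a ha]
    linarith
  refine ⟨fun t => F t + c, ?_, ?_⟩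
  · exact hAC.fun_add (LipschitzOnWith.absolutelyContinuousOnInterval (K := 0)
      ((LipschitzWith.const c).lipschitzOnWith))
  · filter_upwards [hc, hder] with t h1 h2
    refine ⟨by simp only [Pi.sub_apply] at h1; linarith, ?_⟩
    exact (h2.add_const c).deriv

/-- The product rule for weak derivatives. -/
theorem WeakDeriv.integral_mul (hT : 0 < T) (hX : WeakDeriv T X X') (hY : WeakDeriv T Y Y')
    {a : ℝ → ℝ} (ha : IsTimeTest T a) :
    ∫ t in Ioo 0 T, (deriv a t * X t * Y t + a t * X' t * Y t + a t * X t * Y' t) = 0 := by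
  obtain ⟨Z, hZ, hXZ⟩ := hX.exists_absolutelyContinuous hT
  obtain ⟨W, hW, hYW⟩ := hY.exists_absolutelyContinuous hT
  have h1 := (ha.absolutelyContinuous.fun_mul hZ).integral_deriv_mul_eq_sub hW
  simp only [ha.apply_end, ha.apply_zero, zero_mul, sub_zero] at h1
  rw [intervalIntegral.integral_of_le hT.le, integral_Ioc_eq_integral_Ioo] at h1
  have hd : ∀ᵐ t ∂𝓛 T, DifferentiableAt ℝ Z t := by
    rw [ae_restrict_iff' measurableSet_Ioo]
    filter_upwards [hZ.ae_differentiableAt] with t ht htT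
    exact ht (by rw [uIcc_of_le hT.le]; exact Ioo_subset_Icc_self htT)
  refine Eq.trans (integral_congr_ae ?_) h1
  filter_upwards [hXZ, hYW, hd] with t h2 h3 h4
  have h5 := ((ha.smooth.differentiable (by simp) t).hasDerivAt).mul h4.hasDerivAt
  rw [h2.2] at h5
  change _ = deriv (a * Z) t * W t + a t * Z t * deriv W t
  rw [h5.deriv, h2.1, h3.1, h3.2]
  ring

end WeakTime

/-! ### Time derivatives of mollified solutions -/

section TimeDerivatives

open TestFn SmoothPer

/-- `∫₀ᵀ a(t) f(t,x) dt`. -/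
def timeAvg (T : ℝ) (a : ℝ → ℝ) (f : ℝ → E3 → ℝ) (x : E3) : ℝ := ∫ t in Ioo 0 T, a t * f t x

section TimeAvg

variable {f : ℝ → E3 → ℝ} (hf : STInt T f) {a : ℝ → ℝ} (ha : IsTimeTest T a)

include hf ha

theorem STInt.timeAvg_swap_integrable (μ : Measure E3) [SFinite μ] {h : E3 → ℝ}
    (hh : Measurable h) {x : E3}
    (hC : ∀ t, ∫⁻ ξ, ‖h ξ * f t (x + ξ)‖ₑ ∂μ ≤ C * eLpNorm (f t) 1 vol) :
    Integrable (uncurry fun ξ t => h ξ * (a t * f t (x + ξ))) (μ.prod (𝓛 T)) := by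
  obtain ⟨M, hM⟩ := ha.exists_bound
  have hm : JMeas fun ξ t => h ξ * (a t * f t (x + ξ)) :=
    (hh.comp measurable_fst).stronglyMeasurable.mul
      ((ha.continuous.measurable.comp measurable_snd).stronglyMeasurable.mul
        (hf.meas.comp_measurable (measurable_snd.prodMk (measurable_const.add measurable_fst))))
  refine ⟨hm.aestronglyMeasurable, ?_⟩
  rw [hasFiniteIntegral_iff_enorm, lintegral_prod_symm _ hm.enorm.aemeasurable]
  have h1 : ∀ t, ∫⁻ ξ, ‖h ξ * (a t * f t (x + ξ))‖ₑ ∂μ ≤ M * (C * eLpNorm (f t) 1 vol) := by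
    intro t
    refine le_trans ?_ (mul_le_mul' le_rfl (hC t))
    rw [← lintegral_const_mul' _ _ coe_ne_top]
    refine lintegral_mono fun ξ => ?_
    rw [mul_left_comm, enorm_mul]
    refine mul_le_mul' ?_ le_rfl
    rw [enorm_eq_nnnorm, coe_le_coe]
    exact hM t
  refine (lintegral_mono h1).trans_lt ?_
  rw [lintegral_const_mul' _ _ coe_ne_top, lintegral_const_mul' _ _ coe_ne_top]
  exact mul_lt_top coe_lt_top (mul_lt_top coe_lt_top hf.lintegral_lt)

theorem perInt_timeAvg : PerInt (timeAvg T a f) := by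
  have h := hf.timeAvg_swap_integrable ha vol (h := fun _ => 1) measurable_const (x := 0)
    (C := 1) fun t => by simp [eLpNorm_one_eq_lintegral_enorm]
  refine ⟨fun x i => ?_, ?_, ?_⟩
  · simp only [timeAvg, (hf.perInt _).periodic x i]
  · exact StronglyMeasurable.integral_prod_right (f := fun x t => a t * f t x)
      ((ha.continuous.measurable.comp measurable_snd).stronglyMeasurable.mul
        (hf.meas.comp_measurable measurable_swap))
  · have h2 : Integrable (fun x => ∫ t in Ioo 0 T, (1 : ℝ) * (a t * f t (0 + x))) vol :=
      h.integral_prod_left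
    simp only [one_mul, zero_add] at h2
    exact h2

theorem conv_timeAvg (hk : IsKernel k) (x : E3) :
    conv k (timeAvg T a f) x = timeAvg T a (fun t => conv k (f t)) x := by
  obtain ⟨C, hC⟩ := hk.exists_lintegral_le (F := ℝ)
  have h := hf.timeAvg_swap_integrable ha volume hk.continuous.measurable (x := x) (C := C) fun t => by
    rw [eLpNorm_one_eq_lintegral_enorm]
    exact hC (f t) (hf.perInt t).periodic x
  have h2 := integral_integral_swap h
  simp only [conv, timeAvg, smul_eq_mul, ← integral_const_mul] at h2 ⊢
  rw [h2]
  refine integral_congr_ae (.of_forall fun t =>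
    integral_congr_ae (.of_forall fun ξ => mul_left_comm _ _ _))

theorem integral_timeAvg_mul (χ : SmoothPer) :
    ∫ x, timeAvg T a f x * χ.1 x ∂vol = stPair T f (ha.sep χ) := by
  obtain ⟨M, hM⟩ := χ.periodic.exists_bound χ.continuous
  have h := hf.timeAvg_swap_integrable ha vol χ.continuous.measurable (x := 0) (C := M)
    fun t => by
      rw [eLpNorm_one_eq_lintegral_enorm, ← lintegral_const_mul' _ _ coe_ne_top]
      refine lintegral_mono fun ξ => ?_
      rw [enorm_mul, zero_add]
      exact mul_le_mul' (hM ξ) le_rfl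
  have h2 := integral_integral_swap h
  simp only [zero_add] at h2
  refine Eq.trans (integral_congr_fun fun x => ?_) (h2.trans
    (integral_congr_ae (.of_forall fun t =>
      integral_congr_fun fun x => ?_)))
  · simp only [timeAvg]
    rw [integral_const_mul, mul_comm]
  · change χ.1 x * (a t * f t x) = f t x * (a t * χ.1 x)
    ring

end TimeAvg

theorem SmoothPer.eq_zero_of_cInt_mul {S : SmoothPer} (h : ∀ χ, cInt (S * χ) = 0) : S = 0 := by
  have h1 := (integral_eq_zero_iff_of_nonneg (f := (S * S).1) (fun x => mul_self_nonneg (S.1 x))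
    (S * S).integrable).1 (h S)
  have h2 : ∀ᵐ x, S.1 x = 0 := S.periodic.ae_volume_of_ae_cell (p := fun y => y = 0)
    (h1.mono fun x hx => mul_self_eq_zero.1 hx)
  ext x
  exact congrFun ((S.continuous.ae_eq_iff_eq (μ := volume) continuous_const).1 h2) x

/-- Weights in time: measurable functions at least one whose cube is integrable on `(0,T)`. -/
structure IsWeight (T : ℝ) (A : ℝ → ℝ≥0) : Prop where
  meas : Measurable A
  one_le : ∀ t, 1 ≤ A t
  lintegral_lt : ∫⁻ t in Ioo 0 T, (A t : ℝ≥0∞) ^ 3 < ⊤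

theorem IsWeight.pow_le {A : ℝ → ℝ≥0} (hA : IsWeight T A) {d : ℕ} (hd : d ≤ 3) (t : ℝ) :
    A t ^ d ≤ A t ^ 3 := pow_le_pow_right₀ (hA.one_le t) hd

theorem IsWeight.lintegral_const_mul_lt {A : ℝ → ℝ≥0} (hA : IsWeight T A) (C : ℝ≥0) :
    ∫⁻ t in Ioo 0 T, ((C * A t ^ 3 : ℝ≥0) : ℝ≥0∞) < ⊤ := by
  push_cast
  rw [lintegral_const_mul' _ _ coe_ne_top]
  exact mul_lt_top coe_lt_top hA.lintegral_lt

theorem IsWeight.integrable {A : ℝ → ℝ≥0} (hA : IsWeight T A) {h : ℝ → ℝ}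
    (hm : AEStronglyMeasurable h (𝓛 T)) (hb : ∀ t, ‖h t‖ₑ ≤ (C * A t ^ 3 : ℝ≥0)) : IntegrableOn h (Ioo 0 T) :=
  ⟨hm, (lintegral_mono hb).trans_lt (hA.lintegral_const_mul_lt C)⟩

/-- At each point of space, `v'` is the weak derivative in time of `v`. -/
structure TDeriv (T : ℝ) (A : ℝ → ℝ≥0) (v v' : ℝ → SmoothPer) : Prop where
  meas : JMeas fun t => (v t).1
  meas' : JMeas fun t => (v' t).1
  bound : ∃ C : ℝ≥0, ∀ t x, ‖(v t).1 x‖ₑ ≤ (C * A t : ℝ≥0)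
  bound' : ∃ C : ℝ≥0, ∀ t x, ‖(v' t).1 x‖ₑ ≤ (C * A t ^ 2 : ℝ≥0)
  weak : ∀ a, IsTimeTest T a → ∀ x,
    timeAvg T (deriv a) (fun t => (v t).1) x = -timeAvg T a (fun t => (v' t).1) x

section

variable {A : ℝ → ℝ≥0} (hA : IsWeight T A)

include hA

theorem stInt_of_bound {v : ℝ → SmoothPer} {d : ℕ} (hd : d ≤ 3) (hm : JMeas fun t => (v t).1)
    (hC : ∀ t x, ‖(v t).1 x‖ₑ ≤ (C * A t ^ d : ℝ≥0)) : STInt T fun t => (v t).1 := by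
  refine ⟨hm, fun t => (v t).perInt, lt_of_le_of_lt (lintegral_mono fun t => ?_)
    (hA.lintegral_const_mul_lt C)⟩
  rw [eLpNorm_one_eq_lintegral_enorm]
  refine (lintegral_mono fun x => (hC t x).trans (ENNReal.coe_le_coe.2
    (mul_le_mul' le_rfl (hA.pow_le hd t)))).trans ?_
  simp

namespace TDeriv

variable {v v' w w' : ℝ → SmoothPer}

omit hA in
theorem bound_pow (h : TDeriv T A v v') : ∃ C : ℝ≥0, ∀ t x, ‖(v t).1 x‖ₑ ≤ (C * A t ^ 1 : ℝ≥0) := by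
  simpa using h.bound

theorem stInt (h : TDeriv T A v v') : STInt T fun t => (v t).1 := by
  obtain ⟨C, hC⟩ := h.bound_pow
  exact stInt_of_bound hA (by norm_num) h.meas hC

theorem stInt' (h : TDeriv T A v v') : STInt T fun t => (v' t).1 := by
  obtain ⟨C, hC⟩ := h.bound'
  exact stInt_of_bound hA (by norm_num) h.meas' hC

theorem weakDeriv (h : TDeriv T A v v') (x : E3) :
    WeakDeriv T (fun t => (v t).1 x) fun t => (v' t).1 x := by
  obtain ⟨C, hC⟩ := h.bound_pow
  obtain ⟨C', hC'⟩ := h.bound'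
  refine ⟨hA.integrable (C := C) ?_ fun t => ?_, hA.integrable (C := C') ?_ fun t => ?_,
    fun a ha => h.weak a ha x⟩
  · exact (h.meas.comp_measurable (measurable_id.prodMk measurable_const)).aestronglyMeasurable
  · exact (hC t x).trans (ENNReal.coe_le_coe.2 (mul_le_mul' le_rfl (hA.pow_le (by norm_num) t)))
  · exact (h.meas'.comp_measurable (measurable_id.prodMk measurable_const)).aestronglyMeasurable
  · exact (hC' t x).trans (ENNReal.coe_le_coe.2 (mul_le_mul' le_rfl (hA.pow_le (by norm_num) t)))

theorem sub (h : TDeriv T A v v') (h' : TDeriv T A w w') :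
    TDeriv T A (fun t => v t - w t) fun t => v' t - w' t := by
  obtain ⟨C, hC⟩ := h.bound
  obtain ⟨C', hC'⟩ := h.bound'
  obtain ⟨L, hL⟩ := h'.bound
  obtain ⟨L', hL'⟩ := h'.bound'
  refine ⟨h.meas.sub h'.meas, h.meas'.sub h'.meas', ⟨C + L, fun t x => ?_⟩, ⟨C' + L', fun t x => ?_⟩,
    fun a ha x => ?_⟩
  · refine enorm_sub_le.trans ((add_le_add (hC t x) (hL t x)).trans (le_of_eq ?_))
    push_cast; ring
  · refine enorm_sub_le.trans ((add_le_add (hC' t x) (hL' t x)).trans (le_of_eq ?_))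
    push_cast; ring
  · have i : ∀ {b : ℝ → ℝ} {X : ℝ → ℝ}, IsTimeTest T b → IntegrableOn X (Ioo 0 T) →
        IntegrableOn (fun t => b t * X t) (Ioo 0 T) := fun hb hX => by
      obtain ⟨C, hC⟩ := hb.exists_bound
      exact hX.bdd_mul hb.continuous.aestronglyMeasurable (.of_forall hC)
    have h1 := h.weakDeriv hA x
    have h2 := h'.weakDeriv hA x
    have e1 := h1.weak a ha
    have e2 := h2.weak a ha
    simp only [timeAvg, AddSubgroupClass.coe_sub, Pi.sub_apply, mul_sub]
    rw [integral_sub (i ha.deriv h1.integrable) (i ha.deriv h2.integrable),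
      integral_sub (i ha h1.integrable') (i ha h2.integrable'), e1, e2]
    ring

omit hA in
theorem neg (h : TDeriv T A v v') : TDeriv T A (fun t => -v t) fun t => -v' t := by
  obtain ⟨C, hC⟩ := h.bound
  obtain ⟨C', hC'⟩ := h.bound'
  refine ⟨h.meas.neg, h.meas'.neg, ⟨C, fun t x => ?_⟩, ⟨C', fun t x => ?_⟩, fun a ha x => ?_⟩
  · simpa using hC t x
  · simpa using hC' t x
  · have e := h.weak a ha x
    simp only [timeAvg] at e
    simp [timeAvg, integral_neg, e]

theorem J (hk : IsKernel k) (h : TDeriv T A v v') :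
    TDeriv T A (fun t => SmoothPer.J hk (v t)) fun t => SmoothPer.J hk (v' t) := by
  have hb : ∀ {f : SmoothPer} {C : ℝ≥0} (x : E3), (∀ x, ‖f.1 x‖ₑ ≤ C) →
      ‖(SmoothPer.J hk f).1 x‖ₑ ≤ (massOf k * C : ℝ≥0) := fun {f C} x hC => by
    refine (enorm_integral_le_lintegral_enorm _).trans ?_
    push_cast
    rw [hk.coe_massOf, ← lintegral_mul_const' _ _ coe_ne_top]
    refine lintegral_mono fun ξ => ?_
    rw [enorm_smul]
    exact mul_le_mul' le_rfl (hC _)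
  obtain ⟨C, hC⟩ := h.bound
  obtain ⟨C', hC'⟩ := h.bound'
  refine ⟨stronglyMeasurable_conv_param hk.continuous.measurable h.meas,
    stronglyMeasurable_conv_param hk.continuous.measurable h.meas',
    ⟨massOf k * C, fun t x => (hb x (hC t)).trans (by rw [mul_assoc])⟩,
    ⟨massOf k * C', fun t x => (hb x (hC' t)).trans (by rw [mul_assoc])⟩, fun a ha x => ?_⟩
  have h1 := conv_timeAvg (h.stInt hA) ha.deriv hk x
  have h2 := conv_timeAvg (h.stInt' hA) ha hk x
  refine h1.symm.trans (Eq.trans ?_ (congrArg Neg.neg h2))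
  rw [show timeAvg T (deriv a) (fun t => (v t).1) = fun x => -timeAvg T a (fun t => (v' t).1) x from
    funext fun x => h.weak a ha x]
  simp only [conv, smul_neg, integral_neg]

/-- The product rule, integrated in space. -/
theorem integral_mul (hT : 0 < T) (h : TDeriv T A v v') (h' : TDeriv T A w w') (φ : TestFn T) :
    IntegrableOn (fun t => cInt (slice (ddt φ) t * v t * w t)) (Ioo 0 T) ∧
    IntegrableOn (fun t => cInt (slice φ t * v' t * w t)) (Ioo 0 T) ∧
    IntegrableOn (fun t => cInt (slice φ t * v t * w' t)) (Ioo 0 T) ∧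
    (∫ t in Ioo 0 T, cInt (slice (ddt φ) t * v t * w t)) +
      (∫ t in Ioo 0 T, cInt (slice φ t * v' t * w t)) +
      ∫ t in Ioo 0 T, cInt (slice φ t * v t * w' t) = 0 := by
  obtain ⟨C, hC⟩ := h.bound_pow
  obtain ⟨C', hC'⟩ := h.bound'
  obtain ⟨L, hL⟩ := h'.bound_pow
  obtain ⟨L', hL'⟩ := h'.bound'
  have hI : ∀ (η : TestFn T) {X Y : ℝ → SmoothPer} {K M : ℝ≥0} {d d' : ℕ}, d + d' ≤ 3 →
      JMeas (fun t => (X t).1) →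
      JMeas (fun t => (Y t).1) →
      (∀ t x, ‖(X t).1 x‖ₑ ≤ (K * A t ^ d : ℝ≥0)) → (∀ t x, ‖(Y t).1 x‖ₑ ≤ (M * A t ^ d' : ℝ≥0)) →
      Integrable (uncurry fun t x => η.1 (t, x) * (X t).1 x * (Y t).1 x)
        ((𝓛 T).prod vol) := by
    intro η X Y K M d d' hd hX hY hK hM
    obtain ⟨N, hN⟩ := TestFn.exists_bound η
    have := stInt_of_bound hA (v := fun t => slice η t * X t * Y t) (C := N * K * M) hd
      ((η.stronglyMeasurable_slice.mul hX).mul hY) fun t x => by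
        change ‖η.1 (t, x) * (X t).1 x * (Y t).1 x‖ₑ ≤ _
        rw [enorm_mul, enorm_mul]
        refine (mul_le_mul' (mul_le_mul' (show _ ≤ (N : ℝ≥0∞) by
          rw [enorm_eq_nnnorm, coe_le_coe]; exact hN _) (hK t x)) (hM t x)).trans
          (le_of_eq ?_)
        push_cast
        ring
    exact this.integrable
  have i1 := hI (ddt φ) (by norm_num) h.meas h'.meas hC hL
  have i2 := hI φ (by norm_num) h.meas' h'.meas hC' hL
  have i3 := hI φ (by norm_num) h.meas h'.meas' hC hL'
  have j1 : IntegrableOn (fun t => cInt (slice (ddt φ) t * v t * w t)) (Ioo 0 T) :=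
    i1.integral_prod_left
  have j2 : IntegrableOn (fun t => cInt (slice φ t * v' t * w t)) (Ioo 0 T) := i2.integral_prod_left
  have j3 : IntegrableOn (fun t => cInt (slice φ t * v t * w' t)) (Ioo 0 T) := i3.integral_prod_left
  refine ⟨j1, j2, j3, ?_⟩
  have e : ∀ x, ∫ t in Ioo 0 T, ((ddt φ).1 (t, x) * (v t).1 x * (w t).1 x +
      φ.1 (t, x) * (v' t).1 x * (w t).1 x + φ.1 (t, x) * (v t).1 x * (w' t).1 x) = 0 := fun x => by
    have ht : IsTimeTest T fun t => φ.1 (t, x) := by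
      obtain ⟨-, -, a, b, ha, hb, h0⟩ := φ.2
      exact IsTimeTest.of_Icc (φ.contDiff.comp (contDiff_id.prodMk contDiff_const)) ha hb
        fun t ht => h0 t ht x
    have := (h.weakDeriv hA x).integral_mul hT (h'.weakDeriv hA x) ht
    rwa [show deriv (fun t => φ.1 (t, x)) = fun t => (ddt φ).1 (t, x) from
      funext fun t => (φ.hasDerivAt t x).deriv] at this
  have s := integral_integral_swap (f := fun t x => (ddt φ).1 (t, x) * (v t).1 x * (w t).1 x +
    φ.1 (t, x) * (v' t).1 x * (w t).1 x + φ.1 (t, x) * (v t).1 x * (w' t).1 x) ((i1.add i2).add i3)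
  have s2 : ∫ t in Ioo 0 T, (∫ x, ((ddt φ).1 (t, x) * (v t).1 x * (w t).1 x +
      φ.1 (t, x) * (v' t).1 x * (w t).1 x + φ.1 (t, x) * (v t).1 x * (w' t).1 x) ∂vol) = 0 := by
    refine s.trans ?_
    simp [e]
  have j12 : IntegrableOn (fun t => cInt (slice (ddt φ) t * v t * w t) +
    cInt (slice φ t * v' t * w t)) (Ioo 0 T) := j1.add j2
  refine Eq.trans ?_ s2
  rw [← integral_add j1 j2, ← integral_add j12 j3]
  refine integral_congr_fun fun t => ?_
  have e1 := map_add cInt (slice (ddt φ) t * v t * w t + slice φ t * v' t * w t) (slice φ t * v t * w' t)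
  have e2 := map_add cInt (slice (ddt φ) t * v t * w t) (slice φ t * v' t * w t)
  exact (e1.trans (congrArg (· + cInt (slice φ t * v t * w' t)) e2)).symm

end TDeriv

end

end TimeDerivatives

/-! ### The mollified momentum equation and the time derivative of the helicity -/

section MollifiedMomentum

open TestFn SmoothPer

variable {A : ℝ → ℝ≥0} {U : Fin 3 → ℝ → E3 → ℝ} {p : ℝ → E3 → ℝ}

/-- Integrable solutions of the momentum equation, with bounds in terms of a weight. -/
structure IsMomentumSolution (T : ℝ) (A : ℝ → ℝ≥0) (U : Fin 3 → ℝ → E3 → ℝ) (p : ℝ → E3 → ℝ) :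
    Prop where
  pos : 0 < T
  weight : IsWeight T A
  vel : ∀ i, STInt T (U i)
  stress : ∀ i l, STInt T fun t x => U i t x * U l t x
  pres : STInt T p
  vel_le : ∀ i, ∃ C : ℝ≥0, ∀ t, eLpNorm (U i t) 1 vol ≤ (C * A t : ℝ≥0)
  stress_le : ∀ i l, ∃ C : ℝ≥0, ∀ t, eLpNorm (fun x => U i t x * U l t x) 1 vol ≤
    (C * A t ^ 2 : ℝ≥0)
  pres_le : ∃ C : ℝ≥0, ∀ t, eLpNorm (p t) 1 vol ≤ (C * A t ^ 2 : ℝ≥0)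
  momentum : ∀ ζ : Fin 3 → TestFn T, momForm vel stress ζ + ∑ i, stPair T p (dx i (ζ i)) = 0

namespace IsMomentumSolution

variable (h : IsMomentumSolution T A U p) (hk : IsKernel k)

/-- The mollified velocity. -/
def molVel (i : Fin 3) (t : ℝ) : SmoothPer := mol hk ((h.vel i).perInt t)

/-- The mollified convection and pressure terms. -/
def molForce (i : Fin 3) (t : ℝ) : SmoothPer :=
  ∑ l, D l (mol hk ((h.stress i l).perInt t)) + D i (mol hk (h.pres.perInt t))

theorem molVel_pd (i j : Fin 3) (t : ℝ) : h.molVel (hk.pd j) i t = -D j (h.molVel hk i t) := by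
  rw [molVel, molVel, D_mol, neg_neg]

theorem molForce_pd (i j : Fin 3) (t : ℝ) : h.molForce (hk.pd j) i t = -D j (h.molForce hk i t) := by
  have e : ∀ {f : E3 → ℝ} (hf : PerInt f), mol (hk.pd j) hf = -D j (mol hk hf) := fun hf => by
    rw [D_mol, neg_neg]
  simp only [molForce, e, map_neg, map_add, map_sum, sum_neg_distrib, D_comm j]
  ring

theorem cInt_mol_mul {f : E3 → ℝ} (hf : PerInt f) (χ : SmoothPer) :
    cInt (mol hk hf * χ) = ∫ x, f x * (SmoothPer.J hk.comp_neg χ).1 x ∂vol :=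
  integral_conv_mul hk hf χ.periodic χ.continuous

theorem cInt_mol_timeAvg {f : ℝ → E3 → ℝ} (hf : STInt T f) {a : ℝ → ℝ} (ha : IsTimeTest T a)
    (χ : SmoothPer) : cInt (mol hk (perInt_timeAvg hf ha) * χ) =
      stPair T f (ha.sep (SmoothPer.J hk.comp_neg χ)) := by
  rw [cInt_mol_mul, integral_timeAvg_mul hf ha]

theorem exists_conv_le (hk : IsKernel k) : ∃ C : ℝ≥0, ∀ f : E3 → ℝ, IsPeriodic f → ∀ x,
    ‖conv k f x‖ₑ ≤ C * eLpNorm f 1 vol := by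
  obtain ⟨C, hC⟩ := hk.exists_lintegral_le (F := ℝ)
  refine ⟨C, fun f hf x => (enorm_integral_le_lintegral_enorm _).trans ?_⟩
  rw [eLpNorm_one_eq_lintegral_enorm]
  exact hC f hf x

/-- The mollified velocity solves the mollified equation at each point. -/
theorem tDeriv_molVel (i : Fin 3) : TDeriv T A (h.molVel hk i) fun t => -h.molForce hk i t := by
  have hF : ∀ t x, (h.molForce hk i t).1 x =
      (∑ l, -conv (pd l k) (fun y => U i t y * U l t y) x) + -conv (pd i k) (p t) x := fun t x => by
    simp only [molForce, D_mol, AddMemClass.coe_add, AddSubmonoidClass.coe_finsetSum, Pi.add_apply,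
      Finset.sum_apply]
    rfl
  have hmc : ∀ {f : ℝ → E3 → ℝ} (j : Fin 3), STInt T f →
      JMeas fun t => conv (pd j k) (f t) := fun j hf =>
    stronglyMeasurable_conv_param (hk.pd j).continuous.measurable hf.meas
  refine ⟨stronglyMeasurable_conv_param hk.continuous.measurable (h.vel i).meas, ?_, ?_, ?_,
    fun a ha x => ?_⟩
  · have : (uncurry fun t => (-h.molForce hk i t).1) = fun z : ℝ × E3 =>
        -((∑ l, -conv (pd l k) (fun y => U i z.1 y * U l z.1 y) z.2) + -conv (pd i k) (p z.1) z.2) := by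
      ext z
      exact congrArg Neg.neg (hF z.1 z.2)
    rw [this]
    exact ((stronglyMeasurable_fun_sum _ fun l _ => (hmc l (h.stress i l)).neg).add
      (hmc i h.pres).neg).neg
  · obtain ⟨C, hC⟩ := exists_conv_le hk
    obtain ⟨K, hK⟩ := h.vel_le i
    refine ⟨C * K, fun t x => (hC _ ((h.vel i).perInt t).periodic x).trans ?_⟩
    refine (mul_le_mul' le_rfl (hK t)).trans (le_of_eq ?_)
    push_cast; ring
  · choose C hC using fun j => exists_conv_le (hk.pd j)
    choose K hK using h.stress_le i
    obtain ⟨L, hL⟩ := h.pres_le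
    refine ⟨∑ l, C l * K l + C i * L, fun t x => ?_⟩
    have e1 : ‖(-h.molForce hk i t).1 x‖ₑ =
        ‖(∑ l, -conv (pd l k) (fun y => U i t y * U l t y) x) + -conv (pd i k) (p t) x‖ₑ := by
      rw [← hF]
      exact enorm_neg _
    rw [e1]
    refine (enorm_add_le _ _).trans ((add_le_add (enorm_sum_le _ _) le_rfl).trans ?_)
    simp only [enorm_neg]
    refine (add_le_add (sum_le_sum fun l _ => (hC l _ ((h.stress i l).perInt t).periodic x).trans
      (mul_le_mul' le_rfl (hK l t))) ((hC i _ (h.pres.perInt t).periodic x).trans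
      (mul_le_mul' le_rfl (hL t)))).trans (le_of_eq ?_)
    push_cast
    rw [add_mul, sum_mul]
    simp only [mul_assoc]
  · have hS : mol hk (perInt_timeAvg (h.vel i) ha.deriv) -
        (∑ l, D l (mol hk (perInt_timeAvg (h.stress i l) ha)) + D i (mol hk (perInt_timeAvg h.pres ha))) = 0 := by
      refine SmoothPer.eq_zero_of_cInt_mul fun χ => ?_
      have h1 := h.momentum (Pi.single i (ha.sep (SmoothPer.J hk.comp_neg χ)))
      have hdx : ∀ j, dx j (ha.sep (SmoothPer.J hk.comp_neg χ)) =
          ha.sep (SmoothPer.J hk.comp_neg (D j χ)) := fun j => ext_slice fun t => by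
        rw [slice_dx, IsTimeTest.slice_sep, map_smul, D_J, IsTimeTest.slice_sep]
      have hdt : ddt (ha.sep (SmoothPer.J hk.comp_neg χ)) =
          ha.deriv.sep (SmoothPer.J hk.comp_neg χ) := ext_slice fun t => ha.slice_dt_sep _ t
      have hz : ∀ {f : ℝ → E3 → ℝ}, stPair T f 0 = 0 := fun {f} => by
        have := stPair_smul (f := f) (T := T) 0 0
        simpa using this
      have z1 : ddt (0 : TestFn T) = 0 := map_zero (dir ((1 : ℝ), (0 : E3)))
      have z2 : ∀ j, dx j (0 : TestFn T) = 0 := fun j => map_zero (dir ((0 : ℝ), e j))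
      rw [momForm_apply, sum_eq_single i (fun j _ hj => by rw [Pi.single_eq_of_ne hj, z1, hz])
        (by simp), sum_eq_single (s := Finset.univ) (f := fun j => stPair T p (dx j _)) i
        (fun j _ hj => by rw [Pi.single_eq_of_ne hj, z2, hz]) (by simp),
        sum_congr rfl fun j _ => sum_eq_single i
        (fun l _ hl => by rw [Pi.single_eq_of_ne hl, z2, hz]) (by simp)] at h1
      simp only [Pi.single_eq_same, hdx, hdt, ← cInt_mol_timeAvg hk (h.vel i),
        ← cInt_mol_timeAvg hk h.pres] at h1
      simp only [mul_comm (U _ _ _) (U i _ _)] at h1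
      rw [sum_congr rfl fun j _ => (cInt_mol_timeAvg hk (h.stress i j) ha (D j χ)).symm] at h1
      simp only [cInt_mul_D] at h1
      rw [sub_mul, add_mul, map_sub, map_add, sum_mul, map_sum]
      rw [sum_neg_distrib] at h1
      linarith
    have hx := congrArg (fun f : SmoothPer => f.1 x) (sub_eq_zero.1 hS)
    simp only [D_mol, AddMemClass.coe_add, AddSubmonoidClass.coe_finsetSum, Pi.add_apply,
      Finset.sum_apply] at hx
    have e1 : (mol hk (perInt_timeAvg (h.vel i) ha.deriv)).1 x =
        timeAvg T (deriv a) (fun t => (h.molVel hk i t).1) x := conv_timeAvg (h.vel i) ha.deriv hk x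
    have e2 : ∀ {f : ℝ → E3 → ℝ} (hf : STInt T f) (j : Fin 3),
        (-mol (hk.pd j) (perInt_timeAvg hf ha)).1 x =
          ∫ t in Ioo 0 T, a t * -conv (pd j k) (f t) x := fun hf j => by
      refine (congrArg Neg.neg (conv_timeAvg hf ha (hk.pd j) x)).trans ?_
      simp only [timeAvg, mul_neg, integral_neg]
    have i2 : ∀ {f : ℝ → E3 → ℝ}, STInt T f → ∀ j : Fin 3,
        IntegrableOn (fun t => a t * -conv (pd j k) (f t) x) (Ioo 0 T) := fun {f} hf j => by
      obtain ⟨C, hC⟩ := exists_conv_le (hk.pd j)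
      obtain ⟨M, hM⟩ := ha.exists_bound
      refine Integrable.bdd_mul (c := M) ?_ ha.continuous.aestronglyMeasurable
        (.of_forall hM)
      refine Integrable.neg ⟨((hmc j hf).comp_measurable
        (measurable_id.prodMk measurable_const)).aestronglyMeasurable, ?_⟩
      rw [hasFiniteIntegral_iff_enorm]
      refine (lintegral_mono fun t => hC (f t) (hf.perInt t).periodic x).trans_lt ?_
      rw [lintegral_const_mul' _ _ coe_ne_top]
      exact mul_lt_top coe_lt_top hf.lintegral_lt
    rw [e1] at hx
    have hsum := congrArg₂ (· + ·) (sum_congr rfl fun l (_ : l ∈ Finset.univ) =>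
      e2 (h.stress i l) l) (e2 h.pres i)
    refine (hx.trans hsum).trans ?_
    rw [← integral_finsetSum _ fun l _ => i2 (h.stress i l) l,
      ← integral_add (integrable_finsetSum _ fun l _ => i2 (h.stress i l) l) (i2 h.pres i),
      timeAvg, ← integral_neg]
    refine integral_congr_fun fun t => ?_
    have e3 : (-h.molForce hk i t).1 x = -(h.molForce hk i t).1 x := rfl
    simp only [e3, hF, mul_neg, neg_neg, mul_add, mul_sum]

theorem tDeriv_D (i j : Fin 3) :
    TDeriv T A (fun t => D j (h.molVel hk i t)) fun t => -D j (h.molForce hk i t) := by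
  simpa [h.molVel_pd hk, h.molForce_pd hk] using (h.tDeriv_molVel (hk.pd j) i).neg

theorem tDeriv_curlS (i : Fin 3) : TDeriv T A (fun t => curlS (fun j => h.molVel hk j t) i)
    fun t => -curlS (fun j => h.molForce hk j t) i := by
  have hd := h.tDeriv_D hk
  have e := fun i j l m => (hd i j).sub h.weight (hd l m)
  fin_cases i <;> simp only [curlS, cons_val_zero, cons_val_one, cons_val,
    Fin.zero_eta, Fin.mk_one, Fin.reduceFinMk, neg_sub]
  · simpa only [sub_neg_eq_add, neg_add_eq_sub] using e 2 1 1 2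
  · simpa only [sub_neg_eq_add, neg_add_eq_sub] using e 0 2 2 0
  · simpa only [sub_neg_eq_add, neg_add_eq_sub] using e 1 0 0 1

omit h in
theorem cInt_mul_neg_mul (a b c : SmoothPer) : cInt (a * -b * c) = -cInt (a * b * c) := by
  rw [show a * -b * c = -(a * b * c) by ring, map_neg]

omit h in
theorem cInt_mul_neg (a b : SmoothPer) : cInt (a * -b) = -cInt (a * b) := by
  rw [show a * -b = -(a * b) by ring, map_neg]

/-- The time derivative of the localised mollified helicity. -/
theorem integral_helForm {m : E3 → ℝ} (hm : IsKernel m) (φ : TestFn T) :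
    IntegrableOn (fun t => helForm hm (slice (ddt φ) t) (fun i => h.molVel hk i t)
      fun i => h.molVel hk i t) (Ioo 0 T) ∧
    IntegrableOn (fun t => helForm hm (slice φ t) (fun i => h.molVel hk i t)
        (fun i => h.molForce hk i t) +
      helForm hm (slice φ t) (fun i => h.molForce hk i t) fun i => h.molVel hk i t) (Ioo 0 T) ∧
    ∫ t in Ioo 0 T, (helForm hm (slice φ t) (fun i => h.molVel hk i t)
        (fun i => h.molForce hk i t) +
      helForm hm (slice φ t) (fun i => h.molForce hk i t) fun i => h.molVel hk i t) =
    ∫ t in Ioo 0 T, helForm hm (slice (ddt φ) t) (fun i => h.molVel hk i t)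
      fun i => h.molVel hk i t := by
  have hv := h.tDeriv_molVel hk
  have hW := h.tDeriv_curlS hk
  have hA := h.weight
  have P := fun i => (hv i).integral_mul hA h.pos ((hW i).J hA hm) φ
  have Q := fun i => ((hv i).J hA hm).integral_mul hA h.pos (hW i) φ
  set v := fun t i => h.molVel hk i t
  set G := fun t i => h.molForce hk i t
  have e1 : ∀ t, helForm hm (slice φ t) (v t) (G t) + helForm hm (slice φ t) (G t) (v t) =
      -∑ i, (cInt (slice φ t * v t i * J hm (-curlS (G t) i)) +
        cInt (slice φ t * -G t i * J hm (curlS (v t) i)) +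
        (cInt (slice φ t * J hm (v t i) * -curlS (G t) i) +
        cInt (slice φ t * J hm (-G t i) * curlS (v t) i))) := fun t => by
    simp only [helForm, map_neg (J hm), cInt_mul_neg, cInt_mul_neg_mul, ← sum_add_distrib, ← sum_neg_distrib]
    exact sum_congr rfl fun i _ => by ring
  have i1 : ∀ i, IntegrableOn (fun t => cInt (slice φ t * v t i * J hm (-curlS (G t) i)) +
        cInt (slice φ t * -G t i * J hm (curlS (v t) i)) +
        (cInt (slice φ t * J hm (v t i) * -curlS (G t) i) +
        cInt (slice φ t * J hm (-G t i) * curlS (v t) i))) (Ioo 0 T) := fun i =>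
    ((P i).2.2.1.add (P i).2.1).add ((Q i).2.2.1.add (Q i).2.1)
  have i2 : ∀ i, IntegrableOn (fun t => cInt (slice (ddt φ) t * v t i * J hm (curlS (v t) i)) +
      cInt (slice (ddt φ) t * J hm (v t i) * curlS (v t) i)) (Ioo 0 T) := fun i =>
    (P i).1.add (Q i).1
  refine ⟨integrable_finsetSum _ fun i _ => i2 i, ?_, ?_⟩
  · change IntegrableOn (fun t => helForm hm (slice φ t) (v t) (G t) +
      helForm hm (slice φ t) (G t) (v t)) _
    simp only [e1]
    exact (integrable_finsetSum _ fun i _ => i1 i).neg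
  · change ∫ t in Ioo 0 T, (helForm hm (slice φ t) (v t) (G t) + helForm hm (slice φ t) (G t) (v t)) =
      ∫ t in Ioo 0 T, helForm hm (slice (ddt φ) t) (v t) (v t)
    simp only [e1]
    rw [integral_neg, integral_finsetSum _ fun i _ => i1 i]
    simp only [helForm]
    rw [integral_finsetSum _ fun i _ => i2 i, ← sum_neg_distrib]
    refine sum_congr rfl fun i _ => ?_
    have p1 : IntegrableOn (fun t => cInt (slice φ t * v t i * J hm (-curlS (G t) i)) +
      cInt (slice φ t * -G t i * J hm (curlS (v t) i))) (Ioo 0 T) := (P i).2.2.1.add (P i).2.1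
    have p2 : IntegrableOn (fun t => cInt (slice φ t * J hm (v t i) * -curlS (G t) i) +
      cInt (slice φ t * J hm (-G t i) * curlS (v t) i)) (Ioo 0 T) := (Q i).2.2.1.add (Q i).2.1
    rw [integral_add p1 p2, integral_add (P i).2.2.1 (P i).2.1, integral_add (Q i).2.2.1 (Q i).2.1,
      integral_add (P i).1 (Q i).1]
    have p3 := (P i).2.2.2
    have p4 := (Q i).2.2.2
    linarith

end IsMomentumSolution

end MollifiedMomentum

/-! ### Integrable functions with vanishing spatial gradient -/

section GradientZero

open TestFn SmoothPer

variable {r : ℝ → E3 → ℝ}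

theorem stPair_eq_zero_of_dx (hr : STInt T r) (h0 : ∀ᵐ t ∂𝓛 T, ∫ x, r t x ∂vol = 0)
    (h : ∀ i φ, stPair T r (dx i φ) = 0) (φ : TestFn T) : stPair T r φ = 0 := by
  have h1 := tendsto_stPair_massKernel_half_pow hr φ
  have h2 := tendsto_stPair_convT_dilate hr isUnitKernel_massKernel isKernel_massKernel_two_pow φ
  have h3 : ∫ t in Ioo 0 T, (∫ x, r t x ∂vol) * cInt (slice φ t) = 0 :=
    integral_eq_zero_of_ae (h0.mono fun t ht => by simp [ht])
  rw [h3] at h2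
  refine tendsto_nhds_unique h1 (h2.congr fun n => ?_)
  have h4 : convT (isKernel_massKernel_two_pow n) φ =
      ∑ i, dx i (dx i (convT (isKernel_potSum n) φ)) +
        convT (isUnitKernel_massKernel_half_pow n).toIsKernel φ := ext_slice fun t => by
    rw [slice_add, slice_sum]
    simp only [slice_dx, slice_convT]
    rw [sum_D_D_J_potSum, sub_add_cancel]
  rw [h4, stPair_add hr]
  have h5 : stPair T r (∑ i, dx i (dx i (convT (isKernel_potSum n) φ))) = 0 :=
    (map_sum (stPairL hr) _ _).trans (sum_eq_zero fun i _ => h i _)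
  rw [h5, zero_add]

theorem ae_conv_eq_zero_of_stPair (hr : STInt T r) (h : ∀ φ, stPair T r φ = 0) (hk : IsKernel k) : ∀ᵐ t ∂𝓛 T, ∀ᵐ x, conv k (r t) x = 0 := by
  have hm : JMeas fun t => conv k (r t) :=
    stronglyMeasurable_conv_param hk.continuous.measurable hr.meas
  have h1 : ∀ x, ∀ᵐ t ∂𝓛 T, conv k (r t) x = 0 := fun x => by
    have hi : IntegrableOn (fun t => conv k (r t) x) (Ioo 0 T) := by
      obtain ⟨C, hC⟩ := IsMomentumSolution.exists_conv_le hk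
      refine ⟨(hm.comp_measurable (measurable_id.prodMk measurable_const)).aestronglyMeasurable, ?_⟩
      rw [hasFiniteIntegral_iff_enorm]
      refine (lintegral_mono fun t => hC (r t) (hr.perInt t).periodic x).trans_lt ?_
      rw [lintegral_const_mul' _ _ coe_ne_top]
      exact mul_lt_top coe_lt_top hr.lintegral_lt
    have hae := isOpen_Ioo.ae_eq_zero_of_integral_contDiff_smul_eq_zero (U := Ioo (0 : ℝ) T)
      (f := fun t => conv k (r t) x) (μ := volume) hi.locallyIntegrableOn fun a h1 h2 h3 => ?_
    · rw [ae_restrict_iff' measurableSet_Ioo]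
      exact hae
    · have ha : IsTimeTest T a := ⟨h1, h2, h3⟩
      have hS : mol hk (perInt_timeAvg hr ha) = 0 := SmoothPer.eq_zero_of_cInt_mul fun χ => by
        rw [IsMomentumSolution.cInt_mol_timeAvg hk hr ha, h]
      have hx : conv k (timeAvg T a r) x = 0 := congrFun (congrArg Subtype.val hS) x
      rw [conv_timeAvg hr ha hk] at hx
      rw [← hx]
      exact (setIntegral_eq_integral_of_forall_compl_eq_zero fun t ht => by
        rw [image_eq_zero_of_notMem_tsupport fun h => ht (h3 h), zero_smul]).symm
  exact (Measure.ae_ae_comm (p := fun t x => conv k (r t) x = 0)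
    (hm.measurable (measurableSet_singleton 0))).2 (.of_forall h1)

/-- A function with vanishing spatial gradient and vanishing spatial means is zero. -/
theorem ae_eq_zero_of_stPair_dx (hr : STInt T r) (h0 : ∀ᵐ t ∂𝓛 T, ∫ x, r t x ∂vol = 0)
    (h : ∀ i φ, stPair T r (dx i φ) = 0) : ∀ᵐ t ∂𝓛 T, ∀ᵐ x, r t x = 0 := by
  let b : ℕ → ContDiffBump (0 : E3) := fun n =>
    ⟨1 / (2 * (n + 1)), 1 / (n + 1), by positivity, by
      rw [one_div_lt_one_div (by positivity) (by positivity)]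
      linarith [n.cast_nonneg (α := ℝ)]⟩
  have hb : ∀ n, IsKernel ((b n).normed volume) := fun n =>
    ⟨(b n).contDiff_normed, (b n).hasCompactSupport_normed⟩
  have h1 := ae_all_iff.2 fun n =>
    ae_conv_eq_zero_of_stPair hr (stPair_eq_zero_of_dx hr h0 h) (hb n)
  filter_upwards [h1] with t ht
  have hl : LocallyIntegrable (r t) volume :=
    (hr.perInt t).periodic.locallyIntegrable (hr.perInt t).meas (hr.perInt t).integrable
  have hlim := ContDiffBump.ae_convolution_tendsto_right_of_locallyIntegrable (φ := b) (l := atTop)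
    (K := 2) tendsto_one_div_add_atTop_nhds_zero_nat (.of_forall fun n => by
      change 1 / ((n : ℝ) + 1) ≤ 2 * (1 / (2 * (n + 1)))
      field_simp
      exact le_rfl) hl
  filter_upwards [hlim, ae_all_iff.2 ht] with x hx h2
  refine tendsto_nhds_unique hx (tendsto_const_nhds.congr fun n => ?_)
  rw [← h2 n, convolution_def, conv, ← integral_neg_eq_self]
  simp [sub_eq_add_neg, (b n).normed_neg]

end GradientZero

/-! ### The curl form of the convection term -/

section CurlForm

open SmoothPer

variable {q : ℝ} [ExpPair p q]

/-- The bracket extends the functional. -/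
theorem bracket_periodicTest (hσ : 1 / 2 < σ) {u : E3 → E3} (hu : Nik p σ A u)
    (ψ : PeriodicTest E3) : bracket (1 / 2) q (curlFn u) ψ.1 = curlFn u ψ := by
  obtain ⟨hp, hq, hq'⟩ := ExpPair.le p q
  obtain ⟨B, hB⟩ := exists_nik_vecOf (s := 1) zero_le_one le_rfl (coordT ψ)
  have hψ : Nik (ofReal q) 1 B ψ.1 := hB.exponent le_top
  obtain ⟨C, hC⟩ := exists_curlFn_le (p := p) (q := q) hσ
  refine tendsto_nhds_unique (tendsto_bracket hσ (by norm_num) hu hψ (hψ.perInt hq')) ?_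
  refine tendsto_enorm_sub_zero (C := C * A * (2 * massOf stdKernel * B)) (tendsto_half_rpow
    (κ := 1 / 2) (by norm_num)) (.of_forall fun n => ?_)
  rw [← (isLinearMap_curlFn (hu.perInt hp)).map_sub, mul_assoc]
  have h2 := nik_molTest_sub (κ := 1 / 2) hq' (by norm_num) (by norm_num) hψ n
  rw [show (1 : ℝ) - 1 / 2 = 1 / 2 by norm_num] at h2
  exact_mod_cast hC u A _ (molTest n (hψ.perInt hq') - ψ) hu h2

theorem bracket_two_eq (hσ : 1 / 2 < σ) (hτ : 1 / 2 < τ) {u g : E3 → E3} (hu : Nik 3 σ A u)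
    (hg : Nik 3 τ B g) : bracket (1 / 2) 2 (curlFn u) g = 𝓑 (curlFn u) g := by
  have h1 : 𝔮 ≤ 3 := by
    rw [show (3 : ℝ≥0∞) = ofReal 3 by simp]
    exact ofReal_le_ofReal (by norm_num)
  have h2 : (2 : ℝ≥0∞) ≤ 3 := by norm_num
  have h3 : ofReal 2 ≤ 3 := by simpa
  exact tendsto_nhds_unique
    (tendsto_bracket (p := 2) hσ hτ (hu.exponent h2) (hg.exponent h3)
      (hg.perInt (by norm_num)))
    (tendsto_bracket (p := 3) hσ hτ hu (hg.exponent h1) _)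

variable {ι : Type} {l : Filter ι} {r : ι → ℝ≥0} {A K L : ℝ≥0} {d : ℕ}

/-- Dyadic mollification. -/
theorem GrLim.dyadic {g : E3 → ℝ} (hs : 0 ≤ s) (hκ : 0 ≤ κ)
    (hg : Nik (qexp d) (s + κ) (K * A ^ d) g) :
    GrLim (fun n : ℕ => ((1 / 2 : ℝ≥0) ^ n) ^ κ) s A d (2 * (massOf stdKernel + 1) * K)
      (fun n => conv (dyadicKernel n) g) g := by
  have := GrLim.moll isUnitKernel_dyadicKernel (fun n => (massOf_dyadicKernel n).le)
    (fun n => pow_le_one₀ (by positivity) (by norm_num)) dyadicKernel_radius hκ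
    (show κ ≤ s + κ by linarith) hg
  rwa [add_sub_cancel_right] at this

theorem GrLim.tendsto_bracket (hs : 1 / 2 < s) (hr : Tendsto r l (𝓝 0))
    {v : ι → Fin 3 → E3 → ℝ} {u : Fin 3 → E3 → ℝ} {f : ι → Fin 3 → E3 → ℝ} {g : Fin 3 → E3 → ℝ}
    (hv : ∀ j, GrLim r s A 1 K (fun i => v i j) (u j))
    (hf : ∀ j, GrLim r s A 2 L (fun i => f i j) (g j)) :
    Tendsto (fun i => 𝓑 (curlFn (vec (v i))) (vec (f i))) l (𝓝 (𝓑 (curlFn (vec u)) (vec g))) := by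
  obtain ⟨C, hC⟩ := exists_bracket_grLim_le hs
  exact tendsto_enorm_sub_zero hr (.of_forall (hC hv hf).2.2)

theorem GrLim.tendsto_integral_mul (hr : Tendsto r l (𝓝 0)) {f : ι → E3 → ℝ} {g : E3 → ℝ}
    (h : GrLim r s A d K f g) (χ : SmoothPer) :
    Tendsto (fun i => ∫ x, f i x * χ.1 x ∂vol) l (𝓝 (∫ x, g x * χ.1 x ∂vol)) := by
  obtain ⟨M, hM⟩ := χ.exists_nik (s := 1) zero_le_one le_rfl
  have hq := one_le_qexp d
  refine tendsto_enorm_sub_zero (C := K * A ^ d * M) hr (.of_forall fun i => ?_)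
  rw [mul_right_comm, ← integral_sub (((h.fam i).perInt hq).integrable_mul χ)
    ((h.lim.perInt hq).integrable_mul χ)]
  simp only [← sub_mul]
  refine (enorm_integral_mul_le (p := 1) (q := ⊤) ((h.rate i).exponent hq).meas hM.meas).trans ?_
  exact_mod_cast mul_le_mul' ((h.rate i).exponent hq).norm_le hM.norm_le

theorem sum_D_mol (hk : IsKernel k) {w : Fin 3 → E3 → ℝ} (hw : ∀ i, PerInt (w i))
    (hdiv : ∀ χ : SmoothPer, ∑ i, ∫ x, w i x * (D i χ).1 x ∂vol = 0) :
    ∑ i, D i (mol hk (hw i)) = 0 := by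
  refine eq_zero_of_cInt_mul fun χ => ?_
  rw [sum_mul, map_sum]
  have h1 : ∀ i, cInt (D i (mol hk (hw i)) * χ) =
      -∫ x, w i x * (D i (J hk.comp_neg χ)).1 x ∂vol := fun i => by
    rw [D_J, ← IsMomentumSolution.cInt_mol_mul hk (hw i), cInt_mul_D, neg_neg]
  rw [sum_congr rfl fun i _ => h1 i, sum_neg_distrib, hdiv, neg_zero]

/-- The convection term in curl form, for smooth fields. -/
theorem sum_cInt_curlS_mul_cross {v : Fin 3 → SmoothPer} (hv : ∑ i, D i (v i) = 0)
    (ψ : Fin 3 → SmoothPer) : ∑ i, cInt (curlS v i * ∑ l, v l * (D l (ψ i) - D i (ψ l))) =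
      ∑ i, ∑ l, cInt (v i * v l * D l (curlS ψ i)) := by
  have h1 := cInt_curlS (fun i => ∑ l, D l (v i * v l)) ψ
  have h2 : ∑ i, cInt (curlS (fun i => ∑ l, D l (v i * v l)) i * ψ i) =
      -∑ i, cInt (curlS v i * ∑ l, v l * (D l (ψ i) - D i (ψ l))) := by
    have h3 : ∀ (a : SmoothPer) i l, cInt (D l a * ψ i) = -cInt (a * D l (ψ i)) := fun a i l => by
      rw [cInt_mul_D, neg_neg]
    have h4 : ∑ i, ∑ l, cInt (curlS v l * v i * D l (ψ i)) =
        ∑ i, ∑ l, cInt (curlS v i * v l * D i (ψ l)) := sum_comm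
    simp only [curlS_convection hv, sum_mul, map_sum, sub_mul, map_sub, h3, mul_sum,
      sum_neg_distrib, mul_sub, sum_sub_distrib, ← mul_assoc]
    linarith
  rw [h2] at h1
  have h5 : ∑ i, cInt ((∑ l, D l (v i * v l)) * curlS ψ i) =
      -∑ i, ∑ l, cInt (v i * v l * D l (curlS ψ i)) := by
    simp only [sum_mul, map_sum, ← sum_neg_distrib, cInt_mul_D, neg_neg]
  linarith

/-- The convection term in curl form. -/
theorem bracket_cross (hs : 1 / 2 < s) (hs1 : s ≤ 1) (hκ : 0 < κ) {w : Fin 3 → E3 → ℝ}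
    (hA : 1 ≤ A) (hw : ∀ i, Nik 3 (s + κ) A (w i))
    (hdiv : ∀ χ : SmoothPer, ∑ i, ∫ x, w i x * (D i χ).1 x ∂vol = 0) (ψ : Fin 3 → SmoothPer) :
    𝓑 (curlFn (vec w)) (vec fun i x => ∑ l, w l x * (D l (ψ i) - D i (ψ l)).1 x) =
      ∑ i, ∑ l, ∫ x, w i x * w l x * (D l (curlS ψ i)).1 x ∂vol := by
  have hp : ∀ i, PerInt (w i) := fun i => (hw i).perInt (by norm_num)
  have hg : ∀ i, GrLim _ s A 1 _ (fun n => conv (dyadicKernel n) (w i)) (w i) := fun i =>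
    GrLim.dyadic (K := 1) (d := 1) (by linarith) hκ.le (by simpa [qexp] using hw i)
  have hr := tendsto_dyadic_rate hκ
  choose M hM using fun i l => (D l (ψ i) - D i (ψ l)).exists_nik (s := s) (by linarith) hs1
  have hc : ∀ i l, GrLim (fun n : ℕ => ((1 / 2 : ℝ≥0) ^ n) ^ κ) s A 0 (∑ i, ∑ l, M i l)
      (fun _ => (D l (ψ i) - D i (ψ l)).1) (D l (ψ i) - D i (ψ l)).1 := fun i l =>
    GrLim.const ((hM i l).mono (by
      rw [pow_zero, mul_one]
      exact (single_le_sum (f := fun l => M i l) (fun _ _ => zero_le) (mem_univ l)).trans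
        (single_le_sum (f := fun i => ∑ l, M i l) (fun _ _ => zero_le) (mem_univ i))))
  have l1 := GrLim.tendsto_bracket hs hr hg fun i => (GrLim.sum Finset.univ fun l =>
    (hg l).mul (hc i l) (d'' := 1) rfl).raise hA
  have l2 := tendsto_finsetSum Finset.univ fun i _ => tendsto_finsetSum Finset.univ fun l _ =>
    ((hg i).mul (hg l) (d'' := 2) rfl).tendsto_integral_mul hr (D l (curlS ψ i))
  refine tendsto_nhds_unique l1 (l2.congr fun n => ?_)
  have hk := isKernel_dyadicKernel n
  have h1 := bracket_vecOf_vecOf (fun i => mol hk (hp i)) fun i =>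
    ∑ l, mol hk (hp l) * (D l (ψ i) - D i (ψ l))
  rw [sum_cInt_curlS_mul_cross (sum_D_mol hk hp hdiv)] at h1
  refine h1.symm.trans (congrArg (𝓑 _) ?_)
  ext x i
  simp only [vecOf, vec, AddSubmonoidClass.coe_finsetSum, Finset.sum_apply]
  rfl

end CurlForm

/-! ### Regular solutions of the vorticity equation -/

section Regular

open TestFn SmoothPer

variable {A : ℝ → ℝ≥0}

/-- Divergence-free velocity fields with Nikolskii bounds in terms of a weight. -/
structure IsRegular (T s κ : ℝ) (A : ℝ → ℝ≥0) (u : ℝ → E3 → E3) : Prop where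
  pos : 0 < T
  weight : IsWeight T A
  half_lt : 1 / 2 < s
  kappa_pos : 0 < κ
  le_one : s + 3 * κ ≤ 1
  meas : JMeas u
  nik : ∀ t, Nik 3 (s + 3 * κ) (A t) (u t)
  div : ∀ t (χ : SmoothPer), ∑ i, ∫ x, u t x i * (D i χ).1 x ∂vol = 0

/-- The pressure of a velocity field. -/
def pres (u : ℝ → E3 → E3) (t : ℝ) : E3 → ℝ := pressureOf fun i l x => u t x i * u t x l

/-- The smooth field `ψ(t, ·)`. -/
def sliceE (ψ : SpaceTimeTest E3 T) (t : ℝ) : PeriodicTest E3 :=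
  ⟨fun x => ψ.1 (t, x), ψ.2.1.comp (contDiff_const.prodMk contDiff_id), ψ.2.2.1 t⟩

theorem ofReal_three_half_le : 𝔮 ≤ 3 := by
  rw [show (3 : ℝ≥0∞) = ofReal 3 by simp]
  exact ofReal_le_ofReal (by norm_num)

theorem stInt_of_nik (hA : IsWeight T A) {f : ℝ → E3 → ℝ} {d : ℕ} (hd : d ≤ 3) (hq : 1 ≤ q)
    (hm : JMeas f) (hf : ∀ t, Nik q τ (C * A t ^ d) (f t)) : STInt T f :=
  ⟨hm, fun t => (hf t).perInt hq, (lintegral_mono fun t => (((hf t).exponent hq).norm_le).trans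
    (ENNReal.coe_le_coe.2 (mul_le_mul' le_rfl (hA.pow_le hd t)))).trans_lt
      (hA.lintegral_const_mul_lt C)⟩

namespace IsRegular

variable (h : IsRegular T s κ A u)

include h

theorem tau_le : s + 2 * κ ≤ 1 := by linarith [h.le_one, h.kappa_pos]

theorem meas_coord (i : Fin 3) : JMeas fun t x => u t x i :=
  (EuclideanSpace.proj i : E3 →L[ℝ] ℝ).continuous.comp_stronglyMeasurable h.meas

theorem nik_coord (t : ℝ) (i : Fin 3) : Nik 3 (s + 3 * κ) (A t) fun x => u t x i := (h.nik t).coord i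

theorem nik_stress (t : ℝ) (i l : Fin 3) :
    Nik 𝔮 (s + 3 * κ) (2 * A t ^ 2) fun x => u t x i * u t x l := by
  rw [pow_two]
  exact (h.nik_coord t i).smul (h.nik_coord t l) one_le_q

theorem stInt_vel (i : Fin 3) : STInt T fun t x => u t x i :=
  stInt_of_nik h.weight (q := 3) (C := 1) (d := 1) (by norm_num) (by norm_num) (h.meas_coord i) fun t => by
    simpa using h.nik_coord t i

theorem stInt_stress (i l : Fin 3) : STInt T fun t x => u t x i * u t x l :=
  stInt_of_nik h.weight (by norm_num) one_le_q ((h.meas_coord i).mul (h.meas_coord l))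
    fun t => h.nik_stress t i l

theorem meas_pres : JMeas (pres u) :=
  stronglyMeasurable_pressureOf fun i l => (h.meas_coord i).mul (h.meas_coord l)

theorem exists_nik_pres : ∃ C : ℝ≥0, ∀ t, Nik 𝔮 (s + 2 * κ) (C * A t ^ 2) (pres u t) ∧
    ∀ n, eLpNorm (fun x => pressureSum n (fun i t x => u t x i) t x - pres u t x) 1 vol ≤
      (C * ((1 / 2) ^ κ) ^ n * A t ^ 2 : ℝ≥0) := by
  obtain ⟨C, hC⟩ := exists_nik_pressureOf h.kappa_pos (by linarith [h.half_lt, h.tau_le])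
  refine ⟨C * 2, fun t => ?_⟩
  obtain ⟨h1, h2⟩ := hC _ _ _ _ one_le_q (by linarith [h.half_lt, h.kappa_pos])
    (h.nik_stress t)
  refine ⟨?_, fun n => ?_⟩
  · rw [show s + 3 * κ - κ = s + 2 * κ by ring, ← mul_assoc] at h1
    exact h1
  · have hm : StronglyMeasurable fun x =>
        pressureSum n (fun i t x => u t x i) t x - pres u t x := by
      refine StronglyMeasurable.sub (stronglyMeasurable_fun_sum _ fun j _ =>
        stronglyMeasurable_fun_sum _ fun i _ => stronglyMeasurable_fun_sum _ fun l _ =>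
          stronglyMeasurable_conv ?_ (h.nik_stress t i l).meas) h1.meas
      exact ((isKernel_potStep j).pd l |>.pd i).continuous.measurable
    refine (eLpNorm_le_eLpNorm_of_exponent_le one_le_q hm.aestronglyMeasurable).trans
      ((h2 n).trans (le_of_eq ?_))
    congr 1
    ring

theorem stInt_pres : STInt T (pres u) := by
  obtain ⟨C, hC⟩ := h.exists_nik_pres
  exact stInt_of_nik h.weight (by norm_num) one_le_q h.meas_pres fun t => (hC t).1

theorem stInt_pressureSum_sub (n : ℕ) :
    STInt T fun t x => pressureSum n (fun i t x => u t x i) t x - pres u t x := by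
  have h1 : ∀ i l j, STInt T fun t => conv (pd i (pd l (potStep j))) fun x => u t x i * u t x l :=
    fun i l j => (h.stInt_stress i l).conv (((isKernel_potStep j).pd l).pd i)
  have hz : STInt T fun _ _ => 0 := ⟨stronglyMeasurable_const, fun _ =>
    ⟨fun _ _ => rfl, stronglyMeasurable_const, integrable_zero _ _ _⟩, by simp⟩
  have hsum : ∀ {ι : Type} (t : Finset ι) {f : ι → ℝ → E3 → ℝ}, (∀ i, STInt T (f i)) →
      STInt T fun τ x => ∑ i ∈ t, f i τ x := fun t f hf => by
    classical
    induction t using induction_on with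
    | empty => simpa using hz
    | insert a t ha ih => simpa [sum_insert ha] using (hf a).add ih
  exact (hsum _ fun j => hsum _ fun i => hsum _ fun l => h1 i l j).sub h.stInt_pres

theorem tendsto_pressureSum : Tendsto (fun n => ∫⁻ t in Ioo 0 T,
    eLpNorm (fun x => pressureSum n (fun i t x => u t x i) t x - pres u t x) 1 vol)
    atTop (𝓝 0) := by
  obtain ⟨C, hC⟩ := h.exists_nik_pres
  refine tendsto_zero_of_le_mul (C := (∫⁻ t in Ioo 0 T, ((C * A t ^ 3 : ℝ≥0) : ℝ≥0∞)).toNNReal)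
    (tendsto_half_rpow h.kappa_pos) (.of_forall fun n => ?_)
  rw [mul_comm, ENNReal.coe_mul, coe_toNNReal (h.weight.lintegral_const_mul_lt C).ne,
    ← lintegral_const_mul' _ _ coe_ne_top]
  refine lintegral_mono fun t => ((hC t).2 n).trans ?_
  rw [← ENNReal.coe_mul, coe_le_coe]
  calc C * ((1 / 2) ^ κ) ^ n * A t ^ 2 = ((1 / 2) ^ κ) ^ n * (C * A t ^ 2) := by ring
    _ ≤ _ := mul_le_mul' le_rfl (mul_le_mul' le_rfl (h.weight.pow_le (by norm_num) t))

theorem integral_pres (t : ℝ) : ∫ x, pres u t x ∂vol = 0 := by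
  obtain ⟨C, hC⟩ := h.exists_nik_pres
  have hp : PerInt (pres u t) := (hC t).1.perInt one_le_q
  have h0 : ∀ n, ∫ x, pressureSum n (fun i t x => u t x i) t x ∂vol = 0 := fun n => by
    have := integral_pressureStep_mul n (fun i l => (h.stInt_stress i l).perInt t) 1
    have h1 : ∀ i l, D i (D l (J (isKernel_potSum n) 1)) = 0 := fun i l => by
      have h2 : D l (1 : SmoothPer) = 0 := by
        ext x
        exact congrArg (· (e l)) (fderiv_const_apply (𝕜 := ℝ) (x := x) (1 : ℝ))
      rw [D_J, D_J, h2, map_zero, map_zero]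
    simpa [h1, pressureSum] using this
  have hi : ∀ n, Integrable (fun x => pressureSum n (fun i t x => u t x i) t x - pres u t x)
    vol := fun n => ((h.stInt_pressureSum_sub n).perInt t).integrable
  have hS : ∀ n, Integrable (pressureSum n (fun i t x => u t x i) t) vol := fun n =>
    ((hi n).add hp.integrable).congr (.of_forall fun x => sub_add_cancel _ _)
  refine tendsto_nhds_unique (tendsto_enorm_sub_zero (C := C * A t ^ 2)
    (tendsto_half_rpow h.kappa_pos) (.of_forall fun n => ?_)) tendsto_const_nhds
  have h2 := integral_sub (hS n) hp.integrable
  rw [h0] at h2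
  rw [← h2, mul_right_comm]
  refine (enorm_integral_le_lintegral_enorm _).trans ?_
  rw [← eLpNorm_one_eq_lintegral_enorm]
  exact (hC t).2 n

/-- The momentum form of a curl, in terms of brackets with the vorticity. -/
theorem momForm_curlT (ψ : Fin 3 → TestFn T) : momForm h.stInt_vel h.stInt_stress (curlT ψ) =
      (∫ t in Ioo 0 T, bracket (1 / 2) 2 (curlFn (u t)) fun x => (dt (vecT ψ)).1 (t, x)) +
      ∫ t in Ioo 0 T, bracket (1 / 2) 2 (curlFn (u t)) fun x =>
        (∑ i, u t x i • fderiv ℝ (vecT ψ).1 (t, x) (0, e i)) -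
          ∑ i, (∑ j, u t x j * fderiv ℝ (vecT ψ).1 (t, x) (0, e i) j) • e i := by
  have hs : 1 / 2 < s + 3 * κ := by linarith [h.half_lt, h.kappa_pos]
  rw [momForm_apply]
  congr 1
  · simp only [stPair]
    rw [← integral_finsetSum _ fun i _ => (h.stInt_vel i).integrable_mul _]
    refine integral_congr_fun fun t => ?_
    have h1 := bracket_periodicTest (p := 2) (q := 2) hs
      ((h.nik t).exponent (show (2 : ℝ≥0∞) ≤ 3 by norm_num)) (sliceE (dt (vecT ψ)) t)
    rw [curlFn_eq ((h.nik t).perInt (by norm_num))] at h1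
    refine Eq.trans (sum_congr rfl fun i _ => ?_) h1.symm
    have h2 : coordT (sliceE (dt (vecT ψ)) t) = fun j => slice (ddt (ψ j)) t := funext fun j => by
      change slice (coordST (dt (vecT ψ)) j) t = _
      rw [coordST_dt]
      rfl
    have h3 : slice (ddt (curlT ψ i)) t = curlS (fun j => slice (ddt (ψ j)) t) i := by
      have h4 : ∀ a b : TestFn T, slice (ddt (a - b)) t = slice (ddt a) t - slice (ddt b) t :=
        fun a b => congrArg (slice · t) (map_sub (dir ((1 : ℝ), (0 : E3))) a b)
      fin_cases i <;> simp [curlT, curlS, h4, slice_dt_dx]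
    rw [h2, ← h3]
    rfl
  · simp only [stPair]
    rw [← sum_congr rfl fun i _ => integral_finsetSum _ fun l _ =>
      (h.stInt_stress i l).integrable_mul _, ← integral_finsetSum _ fun i _ =>
        integrable_finsetSum _ fun l _ => (h.stInt_stress i l).integrable_mul _]
    refine integral_congr_fun fun t => ?_
    obtain ⟨B, hB⟩ : ∃ B : Fin 3 → Fin 3 → ℝ≥0, ∀ i l, Nik ⊤ (s + 3 * κ) (B i l)
        (D l (slice (ψ i) t) - D i (slice (ψ l) t)).1 := by
      choose B hB using fun i l => (D l (slice (ψ i) t) - D i (slice (ψ l) t)).exists_nik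
        (by linarith) h.le_one
      exact ⟨B, hB⟩
    have h1 := bracket_cross h.half_lt (by linarith [h.le_one, h.kappa_pos])
      (show 0 < 3 * κ by linarith [h.kappa_pos]) (h.weight.one_le t) (fun i => h.nik_coord t i)
      (h.div t) fun i => slice (ψ i) t
    have h2 : (fun x => (∑ i, u t x i • fderiv ℝ (vecT ψ).1 (t, x) (0, e i)) -
        ∑ i, (∑ j, u t x j * fderiv ℝ (vecT ψ).1 (t, x) (0, e i) j) • e i) =
        vec fun i x => ∑ l, u t x l * (D l (slice (ψ i) t) - D i (slice (ψ l) t)).1 x := by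
      ext x i
      have h3 : ∀ l i, fderiv ℝ (vecT ψ).1 (t, x) (0, e l) i = (D l (slice (ψ i) t)).1 x :=
        fun l i => by
          rw [fderiv_coordST, coordST_vecT, ← slice_dx]
          rfl
      have h4 : ∀ c : Fin 3 → ℝ, (∑ i, c i • e i : E3) i = c i := fun c => by
        simp [e, Pi.single_apply]
      simp only [PiLp.sub_apply, h4, vec]
      simp only [PiLp.smul_apply, WithLp.ofLp_sum, Finset.sum_apply, smul_eq_mul, h3]
      rw [← sum_sub_distrib]
      refine sum_congr rfl fun l _ => ?_
      rw [← mul_sub]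
      rfl
    have h5 : Nik 3 (s + 3 * κ) _ (vec fun i x => ∑ l, u t x l *
        (D l (slice (ψ i) t) - D i (slice (ψ l) t)).1 x) :=
      Nik.toLp (A := ∑ i, ∑ l, 2 * (A t * B i l)) (fun i => ((Nik.sum _ fun l _ =>
        (h.nik_coord t l).smul (hB i l) (r := 3) (by norm_num)) (by norm_num)).mono
        (single_le_sum (f := fun i => ∑ l, 2 * (A t * B i l)) (fun _ _ => zero_le)
          (mem_univ i))) (by norm_num)
    refine Eq.trans ?_ ((congrArg (bracket (1 / 2) 2 (curlFn (u t))) h2).trans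
      ((bracket_two_eq hs hs (h.nik t) h5).trans h1)).symm
    beta_reduce
    rw [sum_comm]
    refine sum_congr rfl fun i _ => sum_congr rfl fun l _ => ?_
    refine integral_congr_fun fun x => ?_
    have h6 : (dx l (curlT ψ i)).1 (t, x) = (D l (curlS (fun j => slice (ψ j) t) i)).1 x := by
      rw [← slice_curlT, ← slice_dx]
      rfl
    simp only [h6]
    ring

/-- Regular solutions of the vorticity equation with constant mean solve the momentum equation. -/
theorem isMomentumSolution (hmean : ∀ i, ∃ c : ℝ, ∀ᵐ t ∂𝓛 T, ∫ x, u t x i ∂vol = c)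
    (hvort : ∀ ψ : SpaceTimeTest E3 T,
      (∫ t in Ioo 0 T, bracket (1 / 2) 2 (curlFn (u t)) fun x => (dt ψ).1 (t, x)) +
      (∫ t in Ioo 0 T, bracket (1 / 2) 2 (curlFn (u t)) fun x =>
        (∑ i, u t x i • fderiv ℝ ψ.1 (t, x) (0, e i)) -
          ∑ i, (∑ j, u t x j * fderiv ℝ ψ.1 (t, x) (0, e i) j) • e i) = 0) :
    IsMomentumSolution T A (fun i t x => u t x i) (pres u) where
  pos := h.pos
  weight := h.weight
  vel := h.stInt_vel
  stress := h.stInt_stress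
  pres := h.stInt_pres
  vel_le i := ⟨1, fun t => by simpa using ((h.nik_coord t i).exponent (by norm_num)).norm_le⟩
  stress_le i l := ⟨2, fun t => ((h.nik_stress t i l).exponent one_le_q).norm_le⟩
  pres_le := by
    obtain ⟨C, hC⟩ := h.exists_nik_pres
    exact ⟨C, fun t => ((hC t).1.exponent one_le_q).norm_le⟩
  momentum := momForm_add_pressure _ _ h.pos h.div (fun ψ => (h.momForm_curlT ψ).trans (hvort _))
    hmean h.stInt_pres h.stInt_pressureSum_sub h.tendsto_pressureSum

end IsRegular

end Regular

/-! ### Limits of fluxes and defects at a fixed time -/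

section FixedTime

open SmoothPer

variable {ι : Type} {r : ι → ℝ≥0} {d : ℕ}

theorem GrLim.lower {s' : ℝ} {f : ι → E3 → ℝ} {g : E3 → ℝ} (h : GrLim r s' A d K f g) (hs : 0 ≤ s)
    (hss : s ≤ s') : GrLim r s A d (2 * K) f g := by
  have hq := one_le_qexp d
  have e : ∀ {c : ℝ≥0} {f : E3 → ℝ}, Nik (qexp d) s' (K * A ^ d * c) f →
      Nik (qexp d) s (2 * K * A ^ d * c) f := fun h => (h.lower hq hs hss).mono (le_of_eq (by ring))
  exact ⟨fun i => by simpa using e (c := 1) (by simpa using h.fam i),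
    by simpa using e (c := 1) (by simpa using h.lim), fun i => e (h.rate i)⟩

/-- Simultaneous approximation and mollification. -/
theorem GrLim.moll_family {k : ι → E3 → ℝ} (hk : ∀ i, IsUnitKernel (k i)) {m : ℝ≥0}
    (hm : ∀ i, massOf (k i) ≤ m) (hr : ∀ i, r i ≤ 1) (hρ : ∀ i ξ, k i ξ ≠ 0 → ‖ξ‖ₑ ≤ r i)
    (hs : 0 ≤ s) (hκ : 0 ≤ κ) {f : ι → E3 → ℝ} {g : E3 → ℝ}
    (h : GrLim (fun i => r i ^ κ) (s + κ) A d K f g) :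
    GrLim (fun i => r i ^ κ) s A d ((2 * m + 2 * (m + 1)) * K) (fun i => conv (k i) (f i)) g := by
  have hq := one_le_qexp d
  have h1 := GrLim.moll hk hm hr hρ hκ (show κ ≤ s + κ by linarith) h.lim
  rw [add_sub_cancel_right] at h1
  have e : ∀ {c : ℝ≥0} {f : E3 → ℝ} (i : ι), Nik (qexp d) (s + κ) (K * A ^ d * c) f →
      Nik (qexp d) s (2 * m * K * A ^ d * c) (conv (k i) f) := fun i hf =>
    ((hf.conv hq (hk i).toIsKernel).lower hq hs (by linarith)).mono (by
      calc 2 * (massOf (k i) * (K * A ^ d * _)) ≤ 2 * (m * (K * A ^ d * _)) :=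
            mul_le_mul' le_rfl (mul_le_mul' (hm i) le_rfl)
        _ = _ := by ring)
  have hadd : ∀ c, 2 * m * K * A ^ d * c + 2 * (m + 1) * K * A ^ d * c =
      (2 * m + 2 * (m + 1)) * K * A ^ d * c := fun c => by ring
  refine ⟨fun i => ?_, h1.lim.mono ?_, fun i => ?_⟩
  · exact Nik.mono (by simpa using e (c := 1) i (by simpa using h.fam i))
      (mul_le_mul' (mul_le_mul' le_self_add le_rfl) le_rfl)
  · exact mul_le_mul' (mul_le_mul' le_add_self le_rfl) le_rfl
  · have h2 := (e i (h.rate i)).add (h1.rate i) hq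
    rw [hadd] at h2
    refine Eq.mp (congrArg _ (funext fun x => ?_)) h2
    rw [conv_sub_apply (hk i).toIsKernel ((h.fam i).perInt hq) (h.lim.perInt hq)]
    ring

/-- The flux paired with the vorticity, for an averaging operator `J`, a test function with spatial
gradient `g` and time derivative `g'`, a velocity `v` and a pressure `q`. -/
def fluxOf (J : (E3 → ℝ) → E3 → ℝ) (g : Fin 3 → E3 → ℝ) (g' : E3 → ℝ) (v : Fin 3 → E3 → ℝ)
    (q : E3 → ℝ) (i : Fin 3) (x : E3) : ℝ :=
  ∑ l, (v i x * v l x * J (g l) x - v i x * J (fun y => v l y * g l y) x +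
    J (fun y => v i y * v l y * g l y) x + J (v i) x * v l x * g l x) -
  1 / 2 * ∑ l, (v l x * v l x * J (g i) x - g i x * J (fun y => v l y * v l y) x +
    2 * (g i x * J (v l) x * v l x)) +
  (J (fun y => q y * g i y) x + J q x * g i x) + (J (fun y => g' y * v i y) x + g' x * J (v i) x)

theorem exists_grLim_fluxOf (hs : 0 ≤ s) (hκ : 0 ≤ κ) (c K : ℝ≥0) : ∃ L : ℝ≥0, ∀ {ι : Type}
    {r : ι → ℝ≥0} {A : ℝ≥0} {J : ι → (E3 → ℝ) → E3 → ℝ} {J₀ : (E3 → ℝ) → E3 → ℝ}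
    {g : Fin 3 → E3 → ℝ} {g' : E3 → ℝ} {v : ι → Fin 3 → E3 → ℝ} {u : Fin 3 → E3 → ℝ}
    {q : ι → E3 → ℝ} {p : E3 → ℝ}, 1 ≤ A →
    (∀ {d : ℕ} {M : ℝ≥0} {f : ι → E3 → ℝ} {f₀ : E3 → ℝ}, GrLim r (s + κ) A d M f f₀ →
      GrLim r s A d (c * M) (fun i => J i (f i)) (J₀ f₀)) →
    (∀ l, Nik ⊤ (s + κ) K (g l)) → Nik ⊤ (s + κ) K g' →
    (∀ l, GrLim r (s + κ) A 1 K (fun i => v i l) (u l)) → GrLim r (s + κ) A 2 K q p →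
    ∀ j, GrLim r s A 2 L (fun i => fluxOf (J i) g g' (v i) (q i) j) (fluxOf J₀ g g' u p j) := by
  exact ⟨_, fun {ι r A J J₀ g g' v u q p} hA hJ hg hg' hv hq j => by
    have G : ∀ l, GrLim r (s + κ) A 0 K (fun _ => g l) (g l) := fun l =>
      GrLim.const (d := 0) (by rw [pow_zero, mul_one]; exact hg l)
    have G' : GrLim r (s + κ) A 0 K (fun _ => g') g' :=
      GrLim.const (d := 0) (by rw [pow_zero, mul_one]; exact hg')
    have hss : s ≤ s + κ := by linarith
    have g0 := fun l => (G l).lower hs hss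
    have v0 := fun l => (hv l).lower hs hss
    have Jv := fun l => hJ (hv l)
    have Jg := fun l => hJ (G l)
    have Jvg := fun l => hJ ((hv l).mul (G l) (d'' := 1) rfl)
    have Jvvg := fun i l => hJ (((hv i).mul (hv l) (d'' := 2) rfl).mul (G l) (d'' := 2) rfl)
    have Jvv := fun l => hJ ((hv l).mul (hv l) (d'' := 2) rfl)
    have Jqg := hJ (hq.mul (G j) (d'' := 2) rfl)
    have Jg'v := hJ (G'.mul (hv j) (d'' := 1) rfl)
    have t1 := GrLim.sum Finset.univ fun l =>
      (((((v0 j).mul (v0 l) (d'' := 2) rfl).mul (Jg l) (d'' := 2) rfl).sub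
        ((v0 j).mul (Jvg l) (d'' := 2) rfl)).add (Jvvg j l)).add
        (((Jv j).mul (v0 l) (d'' := 2) rfl).mul (g0 l) (d'' := 2) rfl)
    have t2 := (GrLim.sum Finset.univ fun l =>
      ((((v0 l).mul (v0 l) (d'' := 2) rfl).mul (Jg j) (d'' := 2) rfl).sub
        ((g0 j).mul (Jvv l) (d'' := 2) rfl)).add
        ((((g0 j).mul (Jv l) (d'' := 1) rfl).mul (v0 l) (d'' := 2) rfl).const_mul 2)).const_mul (1 / 2)
    have t3 := Jqg.add ((hJ hq).mul (g0 j) (d'' := 2) rfl)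
    have t4 := (Jg'v.add ((G'.lower hs hss).mul (Jv j) (d'' := 1) rfl)).raise hA
    exact ((t1.sub t2).add t3).add t4⟩

/-- The size of the gradient of a dilated kernel. -/
def gradSize (k : E3 → ℝ) (ξ : E3) : ℝ≥0 := ∑ l, ‖pd l k ξ‖₊

theorem lintegral_gradSize (hk : IsKernel k) :
    ∫⁻ ξ, (gradSize k ξ : ℝ≥0∞) = (∑ l, massOf (pd l k) : ℝ≥0) := by
  have : ∀ ξ, (gradSize k ξ : ℝ≥0∞) = ∑ l, ‖pd l k ξ‖ₑ := fun ξ => by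
    rw [gradSize]
    push_cast
    rfl
  simp only [this]
  rw [lintegral_finsetSum _ fun l _ => (hk.pd l).continuous.enorm.measurable]
  push_cast
  exact sum_congr rfl fun l _ => ((hk.pd l).coe_massOf).symm

theorem defectField₁_apply (v : E3 → E3) (f : E3 → ℝ) (ξ : E3) (i : Fin 3) (x : E3) :
    defectField₁ ϕ ε v f ξ x i = increment (-ξ) (fun x => ∑ l, pd l (dilate ϕ ε) ξ *
      (f x * increment ξ (fun y => v y l) x * increment ξ (fun y => v y i) x)) x := by
  have : ∀ x, ((⟪gradient (dilate ϕ ε) ξ, increment ξ v x⟫_ℝ * f x) • increment ξ v x) i =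
      ∑ l, pd l (dilate ϕ ε) ξ *
        (f x * increment ξ (fun y => v y l) x * increment ξ (fun y => v y i) x) := fun x => by
    rw [inner_E3]
    simp only [gradient_apply, PiLp.smul_apply, smul_eq_mul, sum_mul]
    refine sum_congr rfl fun l _ => ?_
    simp only [increment, PiLp.sub_apply]
    ring
  simp only [defectField₁, increment, PiLp.sub_apply] at this ⊢
  rw [this, this]

theorem defectField₂_apply (v : E3 → E3) (f : E3 → ℝ) (ξ : E3) (i : Fin 3) (x : E3) :
    defectField₂ ϕ ε v f ξ x i = increment (-ξ) (fun x => ∑ l, pd i (dilate ϕ ε) ξ *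
      (f x * increment ξ (fun y => v y l) x * increment ξ (fun y => v y l) x)) x := by
  have : ∀ x, ((‖increment ξ v x‖ ^ 2 * f x) • gradient (dilate ϕ ε) ξ) i =
      ∑ l, pd i (dilate ϕ ε) ξ *
        (f x * increment ξ (fun y => v y l) x * increment ξ (fun y => v y l) x) := fun x => by
    rw [← real_inner_self_eq_norm_sq, inner_E3]
    simp only [gradient_apply, PiLp.smul_apply, smul_eq_mul, sum_mul]
    refine sum_congr rfl fun l _ => ?_
    simp only [increment, PiLp.sub_apply]
    ring
  simp only [defectField₂, increment, PiLp.sub_apply] at this ⊢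
  rw [this, this]

theorem grLim_sum_const_mul {ξ : E3} {a : Fin 3 → Fin 3} {f : Fin 3 → ι → E3 → ℝ}
    {g : Fin 3 → E3 → ℝ} (h : ∀ l, GrLim r s A d M (f l) (g l)) :
    GrLim r s A d (3 * (gradSize k ξ * M)) (fun i x => ∑ l, pd (a l) k ξ * f l i x)
      fun x => ∑ l, pd (a l) k ξ * g l x := by
  refine (GrLim.sum Finset.univ fun l => (h l).const_mul (pd (a l) k ξ)).mono ?_
  refine (Finset.sum_le_card_nsmul _ _ (gradSize k ξ * M) fun l _ => mul_le_mul'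
    (single_le_sum (f := fun l => ‖pd l k ξ‖₊) (fun _ _ => zero_le) (mem_univ _))
      le_rfl).trans (le_of_eq ?_)
  simp

/-- Convergence of the defect fields. -/
theorem grLim_defectField {f : E3 → ℝ} {v : ι → Fin 3 → E3 → ℝ} {u : Fin 3 → E3 → ℝ}
    (hf : Nik ⊤ s K f) (hv : ∀ j, GrLim r s A 1 K (fun i => v i j) (u j)) (ξ : E3) (j : Fin 3) :
    GrLim r s A 2 (gradSize (dilate ϕ ε) ξ * (384 * K ^ 3))
        (fun i x => defectField₁ ϕ ε (vec (v i)) f ξ x j) (fun x => defectField₁ ϕ ε (vec u) f ξ x j) ∧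
      GrLim r s A 2 (gradSize (dilate ϕ ε) ξ * (384 * K ^ 3))
        (fun i x => defectField₂ ϕ ε (vec (v i)) f ξ x j) fun x => defectField₂ ϕ ε (vec u) f ξ x j := by
  have F : GrLim r s A 0 K (fun _ => f) f :=
    GrLim.const (d := 0) (by rw [pow_zero, mul_one]; exact hf)
  have T := fun a b => ((F.mul ((hv a).increment ξ) (d'' := 1) rfl).mul ((hv b).increment ξ)
    (d'' := 2) rfl)
  have t1 := (grLim_sum_const_mul (k := dilate ϕ ε) (ξ := ξ) (a := fun l => l)
    fun l => T l j).increment (-ξ)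
  have t2 := (grLim_sum_const_mul (k := dilate ϕ ε) (ξ := ξ) (a := fun _ => j)
    fun l => T l l).increment (-ξ)
  simp only [defectField₁_apply, defectField₂_apply]
  exact ⟨t1.mono (le_of_eq (by ring)), t2.mono (le_of_eq (by ring))⟩

end FixedTime

/-! ### Integrability and convergence of the defects -/

section Defects

open TestFn SmoothPer

variable {A : ℝ → ℝ≥0}

theorem integrable_bracket_family (hA : IsWeight T A) (hs : 1 / 2 < s) {w : ℝ → E3 → E3}
    {g : ℝ → E3 → E3 → E3} {N : E3 → ℝ≥0} (hwm : JMeas w) (hw : ∀ t, Nik 3 s (K * A t) (w t))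
    (hgm : JMeas fun z : ℝ × E3 => g z.1 z.2) (hN : ∫⁻ ξ, (N ξ : ℝ≥0∞) < ⊤)
    (hg : ∀ t ξ, Nik 𝔮 s (L * N ξ * A t ^ 2) (g t ξ)) :
    (∀ t, Integrable fun ξ => 𝓑 (curlFn (w t)) (g t ξ)) ∧
    IntegrableOn (fun t => ∫ ξ, 𝓑 (curlFn (w t)) (g t ξ)) (Ioo 0 T) := by
  obtain ⟨C, hC⟩ := exists_bracket_le (p := 3) (q := 3 / 2) hs hs
  have hm := stronglyMeasurable_bracket (p := 3) (q := 3 / 2) (P := ℝ × E3) hs hs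
    (u := fun z => w z.1) (hwm.comp_measurable (g := fun z : (ℝ × E3) × E3 => (z.1.1, z.2))
      (by fun_prop)) hgm (fun z => hw z.1) fun z => hg z.1 z.2
  have hb : ∀ t ξ, ‖𝓑 (curlFn (w t)) (g t ξ)‖ₑ ≤
      (C * K * L * A t ^ 3 : ℝ≥0) * (N ξ : ℝ≥0∞) := fun t ξ => by
    refine (hC _ _ _ _ (hw t) (hg t ξ)).trans (le_of_eq ?_)
    push_cast
    ring
  refine ⟨fun t => ⟨(hm.comp_measurable (g := fun ξ => (t, ξ)) (by fun_prop)).aestronglyMeasurable,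
    ?_⟩, hA.integrable (C := C * K * L * (∫⁻ ξ, (N ξ : ℝ≥0∞)).toNNReal)
      (hm.integral_prod_right' (ν := volume)).aestronglyMeasurable fun t => ?_⟩
  · rw [hasFiniteIntegral_iff_enorm]
    refine (lintegral_mono (hb t)).trans_lt ?_
    rw [lintegral_const_mul' _ _ coe_ne_top]
    exact mul_lt_top coe_lt_top hN
  · refine (enorm_integral_le_lintegral_enorm _).trans ((lintegral_mono (hb t)).trans (le_of_eq ?_))
    rw [lintegral_const_mul' _ _ coe_ne_top]
    push_cast
    rw [coe_toNNReal hN.ne]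
    ring

theorem stronglyMeasurable_defectField (hk : IsKernel (dilate ϕ ε)) {w : ℝ → E3 → E3}
    (hwm : JMeas w) (φ : TestFn T) :
    JMeas (fun z : ℝ × E3 => defectField₁ ϕ ε (w z.1) (slice φ z.1).1 z.2) ∧
    JMeas fun z : ℝ × E3 => defectField₂ ϕ ε (w z.1) (slice φ z.1).1 z.2 := by
  have hg : Continuous (gradient (dilate ϕ ε)) :=
    (InnerProductSpace.toDual ℝ E3).symm.continuous.comp (hk.smooth.continuous_fderiv (by simp))
  have mg : StronglyMeasurable fun z : (ℝ × E3) × E3 => gradient (dilate ϕ ε) z.1.2 :=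
    hg.stronglyMeasurable.comp_measurable (by fun_prop)
  have mi : ∀ y : (ℝ × E3) × E3 → E3, Measurable y →
      StronglyMeasurable fun z => increment z.1.2 (w z.1.1) (y z) := fun y hy =>
    (hwm.comp_measurable (g := fun z : (ℝ × E3) × E3 => (z.1.1, y z + z.1.2)) (by fun_prop)).sub
      (hwm.comp_measurable (g := fun z : (ℝ × E3) × E3 => (z.1.1, y z)) (by fun_prop))
  have mφ : ∀ y : (ℝ × E3) × E3 → E3, Measurable y →
      StronglyMeasurable fun z => φ.1 (z.1.1, y z) := fun y hy =>
    φ.contDiff.continuous.stronglyMeasurable.comp_measurable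
      (g := fun z : (ℝ × E3) × E3 => (z.1.1, y z)) (by fun_prop)
  have m1 : ∀ y : (ℝ × E3) × E3 → E3, Measurable y → StronglyMeasurable fun z =>
      (⟪gradient (dilate ϕ ε) z.1.2, increment z.1.2 (w z.1.1) (y z)⟫_ℝ * φ.1 (z.1.1, y z)) •
        increment z.1.2 (w z.1.1) (y z) := fun y hy =>
    ((mg.inner (mi y hy)).mul (mφ y hy)).smul (mi y hy)
  have m2 : ∀ y : (ℝ × E3) × E3 → E3, Measurable y → StronglyMeasurable fun z =>
      (‖increment z.1.2 (w z.1.1) (y z)‖ ^ 2 * φ.1 (z.1.1, y z)) • gradient (dilate ϕ ε) z.1.2 :=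
    fun y hy => (((mi y hy).norm.pow 2).mul (mφ y hy)).smul mg
  have my : Measurable fun z : (ℝ × E3) × E3 => z.2 + -z.1.2 := by fun_prop
  exact ⟨(m1 _ my).sub (m1 _ measurable_snd), (m2 _ my).sub (m2 _ measurable_snd)⟩

theorem nik_defectField {A K : ℝ≥0} {w : E3 → E3} {f : E3 → ℝ} (hw : Nik 3 s (K * A) w)
    (hf : Nik ⊤ s K f) (ξ : E3) : Nik 𝔮 s (1152 * K ^ 3 * gradSize (dilate ϕ ε) ξ * A ^ 2)
      (defectField₁ ϕ ε w f ξ) ∧ Nik 𝔮 s (1152 * K ^ 3 * gradSize (dilate ϕ ε) ξ * A ^ 2)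
      (defectField₂ ϕ ε w f ξ) := by
  have hv : ∀ j, GrLim (fun _ : Unit => 0) s A 1 K (fun _ x => w x j) fun x => w x j := fun j =>
    GrLim.const (by rw [pow_one]; exact hw.coord j)
  have e : 3 * (gradSize (dilate ϕ ε) ξ * (384 * K ^ 3) * A ^ 2) =
    1152 * K ^ 3 * gradSize (dilate ϕ ε) ξ * A ^ 2 := by ring
  rw [← e]
  exact ⟨Nik.toLp (fun j => (grLim_defectField hf hv ξ j).1.lim) one_le_q,
    Nik.toLp (fun j => (grLim_defectField hf hv ξ j).2.lim) one_le_q⟩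

theorem lintegral_gradSize_lt (hk : IsKernel k) : ∫⁻ ξ, (gradSize k ξ : ℝ≥0∞) < ⊤ := by
  rw [lintegral_gradSize hk]
  exact coe_lt_top

theorem integrable_defect (hA : IsWeight T A) (hs : 1 / 2 < s) (hs1 : s ≤ 1)
    (hk : IsKernel (dilate ϕ ε)) {w : ℝ → E3 → E3} (hwm : JMeas w)
    (hw : ∀ t, Nik 3 s (K * A t) (w t)) (φ : TestFn T) :
    ((∀ t, Integrable fun ξ => 𝓑 (curlFn (w t)) (defectField₁ ϕ ε (w t) (slice φ t).1 ξ)) ∧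
      IntegrableOn (fun t => defect₁ ϕ ε (w t) (curlFn (w t)) (slice φ t).1) (Ioo 0 T)) ∧
    ((∀ t, Integrable fun ξ => 𝓑 (curlFn (w t)) (defectField₂ ϕ ε (w t) (slice φ t).1 ξ)) ∧
      IntegrableOn (fun t => defect₂ ϕ ε (w t) (curlFn (w t)) (slice φ t).1) (Ioo 0 T)) := by
  obtain ⟨M, hM⟩ := exists_nik_slice φ
  have hw' : ∀ t, Nik 3 s (max K M * A t) (w t) := fun t =>
    (hw t).mono (mul_le_mul' (le_max_left _ _) le_rfl)
  have hf : ∀ t, Nik ⊤ s (max K M) (slice φ t).1 := fun t =>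
    (hM (by linarith) hs1 t).mono (le_max_right _ _)
  obtain ⟨m1, m2⟩ := stronglyMeasurable_defectField hk hwm φ
  exact ⟨integrable_bracket_family hA hs hwm hw' m1 (lintegral_gradSize_lt hk)
      fun t ξ => (nik_defectField (hw' t) (hf t) ξ).1,
    integrable_bracket_family hA hs hwm hw' m2 (lintegral_gradSize_lt hk)
      fun t ξ => (nik_defectField (hw' t) (hf t) ξ).2⟩

/-- The defect at a fixed time. -/
def defect (ϕ : E3 → ℝ) (ε : ℝ) (w : E3 → E3) (f : E3 → ℝ) : ℝ :=
  defect₁ ϕ ε w (curlFn w) f - 1 / 2 * defect₂ ϕ ε w (curlFn w) f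

theorem enorm_integral_sub_le {f g : E3 → ℝ} (hf : Integrable f) (hg : Integrable g) {N : E3 → ℝ≥0∞}
    {c : ℝ≥0} (h : ∀ ξ, ‖f ξ - g ξ‖ₑ ≤ c * N ξ) : ‖(∫ ξ, f ξ) - ∫ ξ, g ξ‖ₑ ≤ c * ∫⁻ ξ, N ξ := by
  rw [← integral_sub hf hg, ← lintegral_const_mul' _ _ coe_ne_top]
  exact (enorm_integral_le_lintegral_enorm _).trans (lintegral_mono h)

/-- The rate of dyadic mollification. -/
def dyadicRate (κ : ℝ) (n : ℕ) : ℝ≥0 := ((1 / 2 : ℝ≥0) ^ n) ^ κ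

/-- The dyadically mollified velocity. -/
def molU (u : ℝ → E3 → E3) (n : ℕ) (t : ℝ) : E3 → E3 :=
  vec fun j => conv (dyadicKernel n) fun x => u t x j

namespace IsRegular

variable (h : IsRegular T s κ A u)

include h

theorem nik_vel_sk (t : ℝ) : Nik 3 (s + 2 * κ) (2 * A t) (u t) :=
  (h.nik t).lower (by norm_num) (by linarith [h.half_lt, h.kappa_pos]) (by linarith [h.kappa_pos])

theorem exists_grLim (φ : TestFn T) : ∃ K : ℝ≥0, (∀ t, Nik ⊤ (s + κ) K (slice φ t).1) ∧
    (∀ t l, Nik ⊤ (s + κ) K (D l (slice φ t)).1) ∧ (∀ t, Nik ⊤ (s + κ) K (slice (ddt φ) t).1) ∧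
    (∀ t j, GrLim (dyadicRate κ) (s + κ) (A t) 1 K
      (fun n => conv (dyadicKernel n) fun x => u t x j) fun x => u t x j) ∧
    ∀ t, GrLim (dyadicRate κ) (s + κ) (A t) 2 K (fun n => conv (dyadicKernel n) (pres u t))
      (pres u t) := by
  have hs := h.half_lt
  have hκ := h.kappa_pos
  have hs1 : s + κ ≤ 1 := by linarith [h.le_one]
  obtain ⟨M, hM⟩ := exists_nik_slice φ
  choose N hN using fun l => exists_nik_slice (dx l φ)
  obtain ⟨P, hP⟩ := exists_nik_slice (ddt φ)
  obtain ⟨C, hC⟩ := h.exists_nik_pres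
  set c := 2 * (massOf stdKernel + 1)
  refine ⟨M + ∑ l, N l + P + c * 2 + c * C, fun t => (hM (by linarith) hs1 t).mono ?_,
    fun t l => ?_, fun t => (hP (by linarith) hs1 t).mono ?_, fun t j => GrLim.mono (K := c * 2) ?_ ?_,
    fun t => GrLim.mono (K := c * C) ?_ ?_⟩
  · rw [add_assoc, add_assoc, add_assoc]; exact le_self_add
  · rw [← slice_dx]
    refine (hN l (by linarith) hs1 t).mono ?_
    refine (single_le_sum (f := N) (fun _ _ => zero_le) (mem_univ l)).trans ?_
    rw [add_assoc, add_assoc, add_assoc]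
    exact le_add_left le_self_add
  · rw [add_assoc, add_assoc]; exact le_add_left le_self_add
  · refine GrLim.dyadic (by linarith) hκ.le ?_
    rw [pow_one, show s + κ + κ = s + 2 * κ by ring]
    exact (h.nik_vel_sk t).coord j
  · rw [add_assoc]; exact le_add_left le_self_add
  · refine GrLim.dyadic (by linarith) hκ.le ?_
    rw [show s + κ + κ = s + 2 * κ by ring]
    exact (hC t).1
  · exact le_add_self

omit h in
theorem meas_molU (hu : JMeas u) (n : ℕ) : JMeas (molU u n) := by
  have h1 : ∀ j, JMeas fun t => conv (dyadicKernel n) fun x => u t x j :=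
    fun j => stronglyMeasurable_conv_param
      (isKernel_dyadicKernel n).continuous.measurable
      ((EuclideanSpace.proj j : E3 →L[ℝ] ℝ).continuous.comp_stronglyMeasurable hu)
  exact (PiLp.continuous_toLp 2 _).comp_stronglyMeasurable
    (measurable_pi_lambda _ fun j => (h1 j).measurable).stronglyMeasurable

theorem exists_nik_molU : ∃ K : ℝ≥0, ∀ n t, Nik 3 (s + κ) (K * A t) (molU u n t) := by
  obtain ⟨K, -, -, -, hv, -⟩ := h.exists_grLim (0 : TestFn T)
  refine ⟨3 * K, fun n t => ?_⟩
  have := Nik.toLp (fun j => (hv t j).fam n) (one_le_qexp 1)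
  rwa [pow_one, ← mul_assoc] at this

theorem nik_vel (t : ℝ) : Nik 3 (s + κ) (2 * A t) (u t) :=
  (h.nik t).lower (by norm_num) (by linarith [h.half_lt, h.kappa_pos]) (by linarith [h.kappa_pos])

/-- Convergence of the defects of the mollified velocities. -/
theorem exists_defect_sub_le (hk : IsKernel (dilate ϕ ε)) (φ : TestFn T) : ∃ C : ℝ≥0, ∀ n t,
    ‖defect ϕ ε (molU u n t) (slice φ t).1 - defect ϕ ε (u t) (slice φ t).1‖ₑ ≤
      (C * A t ^ 3 * dyadicRate κ n : ℝ≥0) := by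
  have hs : 1 / 2 < s + κ := by linarith [h.half_lt, h.kappa_pos]
  have hs1 : s + κ ≤ 1 := by linarith [h.le_one, h.kappa_pos]
  obtain ⟨K, hK, -, -, hv, -⟩ := h.exists_grLim φ
  obtain ⟨K', hK'⟩ := h.exists_nik_molU
  obtain ⟨C, hC⟩ := exists_bracket_grLim_le hs
  set m := ∑ l, massOf (pd l (dilate ϕ ε)) with hm
  set D := C * K * (384 * K ^ 3) with hD
  refine ⟨2 * (D * m), fun n t => ?_⟩
  have iu := integrable_defect h.weight hs hs1 hk h.meas h.nik_vel φ
  have iv := integrable_defect h.weight hs hs1 hk (meas_molU h.meas n) (hK' n) φ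
  have b1 := fun ξ => (hC (hv t) fun j => (grLim_defectField (ϕ := ϕ) (ε := ε) (hK t) (hv t) ξ j).1).2.2 n
  have b2 := fun ξ => (hC (hv t) fun j => (grLim_defectField (ϕ := ϕ) (ε := ε) (hK t) (hv t) ξ j).2).2.2 n
  have e : ∀ ξ, ((C * K * (gradSize (dilate ϕ ε) ξ * (384 * K ^ 3)) * A t ^ 3 * dyadicRate κ n : ℝ≥0) :
      ℝ≥0∞) = ((D * A t ^ 3 * dyadicRate κ n : ℝ≥0) : ℝ≥0∞) * (gradSize (dilate ϕ ε) ξ : ℝ≥0∞) :=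
    fun ξ => by
      rw [← ENNReal.coe_mul, hD]
      congr 1
      ring
  simp only [e] at b1 b2
  have c1 := enorm_integral_sub_le (iv.1.1 t) (iu.1.1 t) b1
  have c2 := enorm_integral_sub_le (iv.2.1 t) (iu.2.1 t) b2
  rw [lintegral_gradSize hk, ← hm] at c1 c2
  have e2 : defect ϕ ε (molU u n t) (slice φ t).1 - defect ϕ ε (u t) (slice φ t).1 =
      (defect₁ ϕ ε (molU u n t) (curlFn (molU u n t)) (slice φ t).1 -
        defect₁ ϕ ε (u t) (curlFn (u t)) (slice φ t).1) -
      1 / 2 * (defect₂ ϕ ε (molU u n t) (curlFn (molU u n t)) (slice φ t).1 -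
        defect₂ ϕ ε (u t) (curlFn (u t)) (slice φ t).1) := by
    simp only [defect]
    ring
  rw [e2]
  have c3 : ‖(1 / 2 : ℝ)‖ₑ ≤ 1 := by
    rw [← ofReal_norm]
    norm_num
  refine enorm_sub_le.trans ((add_le_add c1 ((enorm_mul _ _).le.trans
    ((mul_le_mul' c3 c2).trans (one_mul _).le))).trans (le_of_eq ?_))
  push_cast
  ring

end IsRegular

end Defects

/-! ### The mollification error -/

section MollificationError

open TestFn SmoothPer

variable {A : ℝ → ℝ≥0} (hk : IsKernel k)

/-- Uniform `L³` bounds in terms of a weight. -/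
def UnifBd (A : ℝ → ℝ≥0) (X : ℕ → ℝ → SmoothPer) : Prop :=
  ∃ C : ℝ≥0, ∀ n t, eLpNorm (X n t).1 3 vol ≤ (C * A t : ℝ≥0)

namespace UnifBd

variable {X Y : ℕ → ℝ → SmoothPer}

theorem add (hX : UnifBd A X) (hY : UnifBd A Y) : UnifBd A fun n t => X n t + Y n t := by
  obtain ⟨C, hC⟩ := hX
  obtain ⟨D, hD⟩ := hY
  refine ⟨C + D, fun n t => (eLpNorm_add_le (X n t).continuous.aestronglyMeasurable
    (Y n t).continuous.aestronglyMeasurable (by norm_num)).trans ?_⟩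
  rw [add_mul]
  exact_mod_cast add_le_add (hC n t) (hD n t)

theorem neg (hX : UnifBd A X) : UnifBd A fun n t => -X n t := by
  obtain ⟨C, hC⟩ := hX
  exact ⟨C, fun n t => (eLpNorm_neg (X n t).1 3 vol).le.trans (hC n t)⟩

theorem sub (hX : UnifBd A X) (hY : UnifBd A Y) : UnifBd A fun n t => X n t - Y n t := by
  simpa only [sub_eq_add_neg] using hX.add hY.neg

theorem mul (φ : TestFn T) (hX : UnifBd A X) : UnifBd A fun n t => slice φ t * X n t := by
  obtain ⟨C, hC⟩ := hX
  obtain ⟨M, hM⟩ := STInt.exists_eLpNorm_slice_le φ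
  refine ⟨M * C, fun n t => (eLpNorm_smul_le_mul_eLpNorm (p := ⊤) (q := 3) (r := 3)
    (X n t).continuous.aestronglyMeasurable (slice φ t).continuous.aestronglyMeasurable).trans ?_⟩
  rw [mul_assoc]
  exact_mod_cast mul_le_mul' (hM t) (hC n t)

theorem J (hX : UnifBd A X) : UnifBd A fun n t => SmoothPer.J hk (X n t) := by
  obtain ⟨C, hC⟩ := hX
  refine ⟨massOf k * C, fun n t => (eLpNorm_conv_le hk (by norm_num) (X n t).periodic
    (X n t).perInt.meas).trans ?_⟩
  rw [mul_assoc]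
  exact_mod_cast mul_le_mul' le_rfl (hC n t)

theorem D_J (l : Fin 3) (hX : UnifBd A X) : UnifBd A fun n t => D l (SmoothPer.J hk (X n t)) := by
  have := (hX.J (hk.pd l)).neg
  simpa only [J_pd hk, neg_neg] using this

theorem D_D_J (l a : Fin 3) (hX : UnifBd A X) :
    UnifBd A fun n t => D l (D a (SmoothPer.J hk (X n t))) := by
  have := (hX.D_J (hk.pd a) l).neg
  simpa only [J_pd hk, map_neg, neg_neg] using this

protected theorem errorField {v : ℕ → ℝ → Fin 3 → SmoothPer} (hv : ∀ j, UnifBd A fun n t => v n t j)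
    (φ : TestFn T) (l i : Fin 3) :
    UnifBd A fun n t => D l (errorField hk (slice φ t) (v n t) i) := by
  obtain ⟨a, b, c, d, hc⟩ : ∃ a b c d, ∀ w : Fin 3 → SmoothPer, curlS w i = D a (w b) - D c (w d) := by
    fin_cases i
    exacts [⟨1, 2, 2, 1, fun _ => rfl⟩, ⟨2, 0, 0, 2, fun _ => rfl⟩, ⟨0, 1, 1, 0, fun _ => rfl⟩]
  have hT : ∀ a b, UnifBd A fun n t =>
      D l (D a (SmoothPer.J hk (slice φ t * v n t b) + slice φ t * SmoothPer.J hk (v n t b))) +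
        (D l (slice φ t * SmoothPer.J hk (D a (v n t b))) +
          D l (SmoothPer.J hk (slice φ t * D a (v n t b)))) := fun a b => by
    have fv := (hv b).mul φ
    have t1 := ((fv.D_D_J hk l a).add (((hv b).J hk).mul (dx l (dx a φ)))).add
      (((hv b).D_J hk l).mul (dx a φ))
    have t2 := (((hv b).D_J hk a).mul (dx l φ)).add (((hv b).D_D_J hk l a).mul φ)
    have t3 := (fv.D_D_J hk l a).sub (((hv b).mul (dx a φ)).D_J hk l)
    have t4 := ((t1.add t2).add t2).add t3
    refine Eq.mp (congrArg (UnifBd A) (funext fun n => funext fun t => ?_)) t4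
    simp only [slice_dx, D_mul, SmoothPer.D_J, map_add]
    ring
  refine Eq.mp (congrArg (UnifBd A) (funext fun n => funext fun t => ?_)) ((hT a b).sub (hT c d))
  simp only [errorField, hc, map_add, map_sub, mul_sub]
  ring

end UnifBd

end MollificationError

/-! ### Integrated fluxes -/

section IntegratedFlux

open TestFn SmoothPer

variable {A : ℝ → ℝ≥0}

theorem IsWeight.enorm_integral_sub_le (hA : IsWeight T A) {f g : ℝ → ℝ} (hf : IntegrableOn f (Ioo 0 T))
    (hg : IntegrableOn g (Ioo 0 T)) {C r : ℝ≥0} (h : ∀ t, ‖f t - g t‖ₑ ≤ (C * A t ^ 3 * r : ℝ≥0)) :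
    ‖(∫ t in Ioo 0 T, f t) - ∫ t in Ioo 0 T, g t‖ₑ ≤
      (C * (∫⁻ t in Ioo 0 T, (A t : ℝ≥0∞) ^ 3).toNNReal * r : ℝ≥0) := by
  rw [← integral_sub hf hg]
  refine (enorm_integral_le_lintegral_enorm _).trans ((lintegral_mono h).trans (le_of_eq ?_))
  have e : ∀ t, ((C * A t ^ 3 * r : ℝ≥0) : ℝ≥0∞) = (C * r : ℝ≥0) * (A t : ℝ≥0∞) ^ 3 := fun t => by
    push_cast; ring
  simp only [e]
  rw [lintegral_const_mul' _ _ coe_ne_top]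
  push_cast
  rw [coe_toNNReal hA.lintegral_lt.ne]
  ring

theorem integrable_bracket (hA : IsWeight T A) (hs : 1 / 2 < s) {w g : ℝ → E3 → E3}
    (hwm : JMeas w) (hw : ∀ t, Nik 3 s (K * A t) (w t)) (hgm : JMeas g)
    (hg : ∀ t, Nik 𝔮 s (L * A t ^ 2) (g t)) :
    IntegrableOn (fun t => 𝓑 (curlFn (w t)) (g t)) (Ioo 0 T) := by
  obtain ⟨C, hC⟩ := exists_bracket_le (p := 3) (q := 3 / 2) hs hs
  refine hA.integrable (C := C * K * L) (stronglyMeasurable_bracket hs hs hwm hgm hw hg).aestronglyMeasurable fun t =>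
      (hC _ _ _ _ (hw t) (hg t)).trans (le_of_eq ?_)
  push_cast
  ring

theorem stronglyMeasurable_vec {f : Fin 3 → ℝ → E3 → ℝ} (hf : ∀ j, JMeas (f j)) :
    JMeas fun t => vec fun j => f j t :=
  (PiLp.continuous_toLp 2 _).comp_stronglyMeasurable
    (measurable_pi_lambda _ fun j => (hf j).measurable).stronglyMeasurable

theorem stronglyMeasurable_fluxOf {J : (E3 → ℝ) → E3 → ℝ} (hJ : ∀ {F : ℝ → E3 → ℝ}, JMeas F →
      JMeas fun t => J (F t)) {g v : Fin 3 → ℝ → E3 → ℝ} {g' q : ℝ → E3 → ℝ} (hg : ∀ l, JMeas (g l))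
    (hg' : JMeas g') (hv : ∀ l, JMeas (v l)) (hq : JMeas q) (i : Fin 3) : JMeas fun t =>
      fluxOf J (fun l => g l t) (g' t) (fun l => v l t) (q t) i := by
  have mm : ∀ {F G : ℝ → E3 → ℝ}, JMeas F →
      JMeas G →
      JMeas fun t x => F t x * G t x := fun hF hG => hF.mul hG
  have t1 := stronglyMeasurable_fun_sum Finset.univ fun l _ =>
    (((mm (mm (hv i) (hv l)) (hJ (hg l))).sub (mm (hv i) (hJ (mm (hv l) (hg l))))).add
      (hJ (mm (mm (hv i) (hv l)) (hg l)))).add (mm (mm (hJ (hv i)) (hv l)) (hg l))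
  have t2 := (stronglyMeasurable_fun_sum Finset.univ fun l _ =>
    ((mm (mm (hv l) (hv l)) (hJ (hg i))).sub (mm (hg i) (hJ (mm (hv l) (hv l))))).add
      ((mm (mm (hg i) (hJ (hv l))) (hv l)).const_mul 2)).const_mul (1 / 2 : ℝ)
  have t3 := (hJ (mm hq (hg i))).add (mm (hJ hq) (hg i))
  have t4 := (hJ (mm hg' (hv i))).add (mm hg' (hJ (hv i)))
  exact ((t1.sub t2).add t3).add t4

/-- The bracket of the vorticity with the flux field of a test function. -/
def fluxBracket (J : (E3 → ℝ) → E3 → ℝ) (φ : TestFn T) (w : E3 → E3) (q : E3 → ℝ) (t : ℝ) : ℝ :=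
  𝓑 (curlFn w) (vec (fluxOf J (fun l => (D l (slice φ t)).1)
    (slice (ddt φ) t).1 (fun j x => w x j) q))

theorem integrable_fluxBracket (hA : IsWeight T A) (hs : 1 / 2 < s) {J : (E3 → ℝ) → E3 → ℝ}
    (hJ : ∀ {F : ℝ → E3 → ℝ}, JMeas F → JMeas fun t => J (F t)) (φ : TestFn T) {w : ℝ → E3 → E3}
    {q : ℝ → E3 → ℝ} (hwm : JMeas w) (hw : ∀ t, Nik 3 s (K * A t) (w t)) (hqm : JMeas q)
    (hg : ∀ t j, Nik 𝔮 s (L * A t ^ 2) (fluxOf J (fun l => (D l (slice φ t)).1)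
      (slice (ddt φ) t).1 (fun j x => w t x j) (q t) j)) :
    IntegrableOn (fun t => fluxBracket J φ (w t) (q t) t) (Ioo 0 T) := by
  refine integrable_bracket hA hs (L := 3 * L) hwm hw (stronglyMeasurable_vec fun j =>
    stronglyMeasurable_fluxOf hJ (g := fun l t => (D l (slice φ t)).1)
      (g' := fun t => (slice (ddt φ) t).1) (v := fun j t x => w t x j) (q := q) (fun l => ?_)
      (stronglyMeasurable_slice _) (fun l => ?_) hqm j) fun t => ?_
  · simp only [← slice_dx]
    exact stronglyMeasurable_slice _
  · exact (EuclideanSpace.proj l : E3 →L[ℝ] ℝ).continuous.comp_stronglyMeasurable hwm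
  · rw [mul_assoc]
    exact Nik.toLp (hg t) one_le_q

end IntegratedFlux

/-! ### The limit of the mollified defects -/

section DefectLimit

open TestFn SmoothPer

variable {A : ℝ → ℝ≥0}

theorem exists_fluxBracket_grLim (hs : 1 / 2 < s) (hκ : 0 ≤ κ) (c K : ℝ≥0) : ∃ C : ℝ≥0, ∀ {ι : Type}
    {r : ι → ℝ≥0} {A : ℝ≥0} {J : ι → (E3 → ℝ) → E3 → ℝ} {J₀ : (E3 → ℝ) → E3 → ℝ} {φ : TestFn T}
    {t : ℝ} {w : ι → E3 → E3} {w₀ : E3 → E3} {q : ι → E3 → ℝ} {q₀ : E3 → ℝ}, 1 ≤ A →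
    (∀ {d : ℕ} {M : ℝ≥0} {f : ι → E3 → ℝ} {f₀ : E3 → ℝ}, GrLim r (s + κ) A d M f f₀ →
      GrLim r s A d (c * M) (fun i => J i (f i)) (J₀ f₀)) →
    (∀ l, Nik ⊤ (s + κ) K (D l (slice φ t)).1) → Nik ⊤ (s + κ) K (slice (ddt φ) t).1 →
    (∀ l, GrLim r (s + κ) A 1 K (fun i x => w i x l) fun x => w₀ x l) → GrLim r (s + κ) A 2 K q q₀ →
    (∀ i, ‖fluxBracket (J i) φ (w i) (q i) t - fluxBracket J₀ φ w₀ q₀ t‖ₑ ≤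
      (C * A ^ 3 * r i : ℝ≥0)) ∧
    (∀ i j, Nik 𝔮 s (C * A ^ 2) (fluxOf (J i) (fun l => (D l (slice φ t)).1)
      (slice (ddt φ) t).1 (fun j x => w i x j) (q i) j)) ∧
    ∀ j, Nik 𝔮 s (C * A ^ 2) (fluxOf J₀ (fun l => (D l (slice φ t)).1)
      (slice (ddt φ) t).1 (fun j x => w₀ x j) q₀ j) := by
  obtain ⟨L, hL⟩ := exists_grLim_fluxOf (s := s) (by linarith) hκ c K
  obtain ⟨C, hC⟩ := exists_bracket_grLim_le hs
  refine ⟨L + C * (2 * K) * L, fun {ι r A J J₀ φ t w w₀ q q₀} hA hJ hg hg' hw hq => ?_⟩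
  have h1 := hL hA hJ hg hg' hw hq
  have h2 := (hC (fun l => (hw l).lower (s := s) (by linarith) (by linarith)) h1).2.2
  have h3 : L * A ^ 2 ≤ (L + C * (2 * K) * L) * A ^ 2 := mul_le_mul' le_self_add le_rfl
  refine ⟨fun i => (h2 i).trans (ENNReal.coe_le_coe.2 (mul_le_mul' (mul_le_mul' le_add_self le_rfl)
    le_rfl)), fun i j => ((h1 j).fam i).mono h3, fun j => (h1 j).lim.mono h3⟩

theorem GrLim.conv_lower {ι : Type} {r : ι → ℝ≥0} {A K : ℝ≥0} {d : ℕ} {f : ι → E3 → ℝ}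
    {g : E3 → ℝ} (hk : IsKernel k) (hs : 0 ≤ s) (hκ : 0 ≤ κ) (h : GrLim r (s + κ) A d K f g) :
    GrLim r s A d (2 * massOf k * K) (fun i => conv k (f i)) (conv k g) := by
  rw [mul_assoc]
  exact (h.conv hk).lower hs (by linarith)

namespace IsRegular

variable (h : IsRegular T s κ A u) (hM : IsMomentumSolution T A (fun i t x => u t x i) (pres u))

include h

theorem half_lt_sk : 1 / 2 < s + κ := by linarith [h.half_lt, h.kappa_pos]

theorem sk_le_one : s + κ ≤ 1 := by linarith [h.le_one, h.kappa_pos]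

include hM

/-- The deviation of the convolved stress from the stress of the mollified velocity. -/
def stressDefect (hM : IsMomentumSolution T A (fun i t x => u t x i) (pres u)) (n : ℕ) (i l : Fin 3)
    (t : ℝ) : SmoothPer :=
  hM.molVel (isKernel_dyadicKernel n) i t *
    hM.molVel (isKernel_dyadicKernel n) l t -
  mol (isKernel_dyadicKernel n) ((hM.stress i l).perInt t)

/-- The defect of the mollified velocity. -/
theorem defect_molU (hm : IsUnitKernel (dilate ϕ ε)) (φ : TestFn T) (n : ℕ) (t : ℝ) :
    defect ϕ ε (molU u n t) (slice φ t).1 =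
      fluxBracket (conv (dilate ϕ ε)) φ (molU u n t) (conv (dyadicKernel n) (pres u t)) t -
      helForm hm.toIsKernel (slice (ddt φ) t) (fun i => hM.molVel (isKernel_dyadicKernel n) i t)
        (fun i => hM.molVel (isKernel_dyadicKernel n) i t) + (helForm hm.toIsKernel (slice φ t)
          (fun i => hM.molVel (isKernel_dyadicKernel n) i t)
          (fun i => hM.molForce (isKernel_dyadicKernel n) i t) + helForm hm.toIsKernel (slice φ t)
          (fun i => hM.molForce (isKernel_dyadicKernel n) i t)
          fun i => hM.molVel (isKernel_dyadicKernel n) i t) -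
      ∑ i, ∑ l, cInt (D l (errorField hm.toIsKernel (slice φ t)
        (fun i => hM.molVel (isKernel_dyadicKernel n) i t) i) * stressDefect hM n i l t) := by
  set hk := isKernel_dyadicKernel n
  set v := fun i => hM.molVel hk i t with hv
  set Q := mol hk (hM.pres.perInt t) with hQ
  have hdiv : ∑ i, D i (v i) = 0 := sum_D_mol hk (fun i => (hM.vel i).perInt t) (h.div t)
  have hG : ∀ i, ∑ l, D l (v i * v l) = hM.molForce hk i t - D i Q +
      ∑ l, D l (stressDefect hM n i l t) := fun i => by
    simp only [stressDefect, IsMomentumSolution.molForce, map_sub, sum_sub_distrib]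
    ring
  have e1 := (defect_vecOf hm.toIsKernel v (slice φ t)).trans
    (cInt_defect_eq_of_approx hm.toIsKernel hm.even (slice φ t) Q hdiv hG)
  have e2 : fluxBracket (conv (dilate ϕ ε)) φ (molU u n t) (conv (dyadicKernel n) (pres u t)) t =
      ∑ i, cInt (curlS v i * (mollifiedFlux hm.toIsKernel (slice φ t) v i +
        (J hm.toIsKernel (Q * D i (slice φ t)) + J hm.toIsKernel Q * D i (slice φ t)) +
        (J hm.toIsKernel (slice (ddt φ) t * v i) + slice (ddt φ) t * J hm.toIsKernel (v i)))) := by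
    rw [← bracket_vecOf_vecOf]
    refine congrArg (𝓑 _) ?_
    ext x i
    simp only [vecOf, vec, fluxOf, mollifiedFlux, AddMemClass.coe_add, AddSubgroupClass.coe_sub,
      AddSubmonoidClass.coe_finsetSum, MulMemClass.coe_mul, SetLike.val_smul, Pi.add_apply,
      Pi.sub_apply, Pi.mul_apply, Pi.smul_apply, Finset.sum_apply, smul_eq_mul]
    rfl
  have e3 : helForm hm.toIsKernel (slice (ddt φ) t) v v =
      ∑ i, cInt (curlS v i * (J hm.toIsKernel (slice (ddt φ) t * v i) +
        slice (ddt φ) t * J hm.toIsKernel (v i))) := by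
    refine sum_congr rfl fun i _ => ?_
    rw [cInt_mul_J hm.toIsKernel hm.even, mul_add, map_add, mul_comm (curlS v i),
      mul_comm (curlS v i)]
  rw [e2, e3]
  refine e1.trans ?_
  have e4 : ∀ a b : Fin 3 → SmoothPer, ∑ i, cInt (curlS v i * (a i + b i)) =
      ∑ i, cInt (curlS v i * a i) + ∑ i, cInt (curlS v i * b i) := fun a b => by
    simp only [mul_add, map_add, sum_add_distrib]
  rw [e4 (fun i => mollifiedFlux hm.toIsKernel (slice φ t) v i +
    (J hm.toIsKernel (Q * D i (slice φ t)) + J hm.toIsKernel Q * D i (slice φ t)))]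
  ring

theorem exists_error_le (hk : IsKernel k) (φ : TestFn T) : ∃ C : ℝ≥0, ∀ n t,
    ‖∑ i, ∑ l, cInt (D l (errorField hk (slice φ t)
      (fun i => hM.molVel (isKernel_dyadicKernel n) i t) i) *
        stressDefect hM n i l t)‖ₑ ≤ (C * A t ^ 3 * dyadicRate κ n : ℝ≥0) := by
  obtain ⟨K, -, -, -, hv, -⟩ := h.exists_grLim φ
  have hs := h.half_lt
  have hκ := h.kappa_pos
  have hb : ∀ j, UnifBd A fun n t => hM.molVel (isKernel_dyadicKernel n) j t :=
    fun j => ⟨K, fun n t => by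
      have h1 := ((hv t j).fam n).norm_le
      rw [pow_one] at h1
      exact h1⟩
  choose B hB using fun l i => UnifBd.errorField hk hb φ l i
  set c := 2 * (massOf stdKernel + 1)
  have hE : ∀ n t i l, eLpNorm (stressDefect hM n i l t).1 𝔮 vol ≤
      ((4 * K * K + c * 4) * A t ^ 2 * dyadicRate κ n : ℝ≥0) := fun n t i l => by
    have h1 := (hv t i).mul (hv t l) (d'' := 2) rfl
    have h2 : GrLim (dyadicRate κ) (s + κ) (A t) 2 (c * 4)
        (fun n => conv (dyadicKernel n) fun x => u t x i * u t x l) fun x => u t x i * u t x l := by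
      refine GrLim.dyadic (by linarith) hκ.le ?_
      rw [show s + κ + κ = s + 2 * κ by ring]
      refine ((h.nik_stress t i l).lower one_le_q (by linarith)
        (by linarith : s + 2 * κ ≤ s + 3 * κ)).mono (le_of_eq (by ring))
    refine Eq.trans_le (congrArg (eLpNorm · _ _) (funext fun x => ?_)) ((h1.sub h2).rate n).norm_le
    rw [sub_self, sub_zero]
    rfl
  refine ⟨∑ i, ∑ l, B l i * (4 * K * K + c * 4), fun n t => ?_⟩
  refine (enorm_sum_le _ _).trans ((sum_le_sum fun i _ => (enorm_sum_le _ _).trans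
    (sum_le_sum fun l _ => (enorm_integral_mul_le (p := 3) (q := 𝔮)
      (SmoothPer.perInt _).meas (SmoothPer.perInt _).meas).trans
        (mul_le_mul' (hB l i n t) (hE n t i l)))).trans (le_of_eq ?_))
  push_cast
  simp only [sum_mul]
  exact sum_congr rfl fun i _ => sum_congr rfl fun l _ => by ring

end IsRegular

end DefectLimit

/-! ### The limit of vanishing mollification -/

section VanishingMollification

open TestFn SmoothPer

variable {A : ℝ → ℝ≥0}

namespace IsRegular

variable (h : IsRegular T s κ A u) (hM : IsMomentumSolution T A (fun i t x => u t x i) (pres u))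

include h

theorem integrable_defect_sub (hk : IsKernel (dilate ϕ ε)) {w : ℝ → E3 → E3} (hwm : JMeas w)
    (hw : ∀ t, Nik 3 (s + κ) (K * A t) (w t)) (φ : TestFn T) : IntegrableOn (fun t => defect ϕ ε (w t) (slice φ t).1) (Ioo 0 T) := by
  have := integrable_defect h.weight h.half_lt_sk h.sk_le_one hk hwm hw φ
  exact this.1.2.sub (this.2.2.const_mul _)

theorem nik_lower {w : E3 → E3} {t : ℝ} (hw : Nik 3 (s + κ) (K * A t) w) :
    Nik 3 s (2 * K * A t) w := by
  rw [mul_assoc]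
  exact hw.lower (by norm_num) (by linarith [h.half_lt]) (by linarith [h.kappa_pos])

include hM

theorem integral_defect_eq (hm : IsUnitKernel (dilate ϕ ε)) (φ : TestFn T) :
    ∫ t in Ioo 0 T, defect ϕ ε (u t) (slice φ t).1 =
      ∫ t in Ioo 0 T, fluxBracket (conv (dilate ϕ ε)) φ (u t) (pres u t) t := by
  have hk := hm.toIsKernel
  have hA := h.weight
  have hs := h.half_lt
  have hκ := h.kappa_pos
  obtain ⟨K, -, hg, hg', hv, hq⟩ := h.exists_grLim φ
  obtain ⟨L, hL⟩ := h.exists_nik_molU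
  obtain ⟨C₁, hC₁⟩ := h.exists_defect_sub_le hk φ
  obtain ⟨C₂, hC₂⟩ := h.exists_error_le hM hk φ
  obtain ⟨C₃, hC₃⟩ := exists_fluxBracket_grLim hs hκ.le (2 * massOf (dilate ϕ ε)) K
  have hF := fun t => hC₃ (J := fun _ => conv (dilate ϕ ε)) (w := fun n => molU u n t)
    (hA.one_le t) (fun hf => hf.conv_lower hk (by linarith) hκ.le) (hg t) (hg' t) (hv t) (hq t)
  have hJ : ∀ {F : ℝ → E3 → ℝ}, JMeas F →
      JMeas fun t => conv (dilate ϕ ε) (F t) :=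
    stronglyMeasurable_conv_param hk.continuous.measurable
  have i0 := integrable_fluxBracket hA hs hJ φ h.meas (fun t => h.nik_lower (h.nik_vel t))
    h.meas_pres fun t => (hF t).2.2
  have i1 := fun n => integrable_fluxBracket hA hs hJ φ (meas_molU h.meas n)
    (fun t => h.nik_lower (hL n t)) (stronglyMeasurable_conv_param
      (isUnitKernel_dyadicKernel n).continuous.measurable h.meas_pres) fun t => (hF t).2.1 n
  have d0 := h.integrable_defect_sub hk h.meas h.nik_vel φ
  have d1 := fun n => h.integrable_defect_sub hk (meas_molU h.meas n) (hL n) φ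
  set I := (∫⁻ t in Ioo 0 T, (A t : ℝ≥0∞) ^ 3).toNNReal
  refine tendsto_nhds_unique tendsto_const_nhds (tendsto_enorm_sub_zero (C := C₁ * I + C₂ * I + C₃ * I)
    (tendsto_dyadic_rate hκ) (.of_forall fun n => ?_))
  obtain ⟨h0, h1, h2⟩ := hM.integral_helForm (isKernel_dyadicKernel n) hk φ
  have e1 := hA.enorm_integral_sub_le d0 (d1 n) fun t => by
    rw [← enorm_neg, neg_sub]; exact hC₁ n t
  have e2 := hA.enorm_integral_sub_le (d1 n) (((i1 n).sub h0).add h1) fun t => by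
    refine le_trans (le_of_eq ?_) (hC₂ n t)
    rw [h.defect_molU hM hm φ n t, ← enorm_neg]
    congr 1
    simp only [Pi.add_apply, Pi.sub_apply]
    ring
  have e3 := hA.enorm_integral_sub_le (i1 n) i0 fun t => (hF t).1 n
  have e4 := (integral_add' ((i1 n).sub h0) h1).trans (congrArg (· + _) (integral_sub' (i1 n) h0))
  rw [h2, sub_add_cancel] at e4
  rw [e4] at e2
  simp only [← edist_eq_enorm_sub] at e1 e2 e3 ⊢
  refine (edist_triangle4 _ _ _ _).trans ((add_le_add (add_le_add e1 e2) e3).trans (le_of_eq ?_))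
  simp only [dyadicRate]
  push_cast
  ring

/-- The mollified defects converge. -/
theorem tendsto_integral_defect (hϕ : IsMollifier ϕ) (φ : TestFn T) :
    Tendsto (fun ε => ∫ t in Ioo 0 T, defect ϕ ε (u t) (slice φ t).1) (𝓝[>] 0)
      (𝓝 (∫ t in Ioo 0 T, fluxBracket (fun f => f) φ (u t) (pres u t) t)) := by
  have hA := h.weight
  have hs := h.half_lt
  have hκ := h.kappa_pos
  have hk := hϕ.isUnitKernel
  obtain ⟨R, hR⟩ := hk.exists_radius
  obtain ⟨K, -, hg, hg', hv, hq⟩ := h.exists_grLim φ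
  set m := massOf ϕ
  obtain ⟨C, hC⟩ := exists_fluxBracket_grLim hs hκ.le (2 * m + 2 * (m + 1)) K
  set I := (∫⁻ t in Ioo 0 T, (A t : ℝ≥0∞) ^ 3).toNNReal
  have hr : Tendsto (fun ε : ℝ => ε.toNNReal * R) (𝓝[>] 0) (𝓝 0) := by
    have : Tendsto (fun ε : ℝ => ε.toNNReal * R) (𝓝 0) (𝓝 ((0 : ℝ).toNNReal * R)) :=
      ((continuous_real_toNNReal.mul continuous_const).tendsto 0)
    rw [Real.toNNReal_zero, zero_mul] at this
    exact this.mono_left nhdsWithin_le_nhds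
  have hrκ : Tendsto (fun ε : ℝ => (ε.toNNReal * R) ^ κ) (𝓝[>] 0) (𝓝 0) := by
    have := (NNReal.continuousAt_rpow_const (x := 0) (Or.inr hκ.le)).tendsto.comp hr
    rwa [NNReal.zero_rpow hκ.ne'] at this
  refine tendsto_enorm_sub_zero (C := C * I) hrκ ?_
  filter_upwards [self_mem_nhdsWithin, hr.eventually_lt_const one_pos] with ε hε hε1
  have hm := hk.dilate hε
  have hF := fun t => hC (ι := Unit) (r := fun _ => (ε.toNNReal * R) ^ κ)
    (J := fun _ => conv (dilate ϕ ε)) (J₀ := fun f => f) (w := fun _ => u t) (q := fun _ => pres u t)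
    (hA.one_le t) (fun hf => hf.moll_family (fun _ => hm) (fun _ => (massOf_dilate hk.toIsKernel hε).le)
      (fun _ => hε1.le) (fun _ => dilate_ne_zero hR hε) (by linarith) hκ.le) (hg t) (hg' t)
    (fun j => GrLim.const (hv t j).lim) (GrLim.const (hq t).lim)
  have i0 := integrable_fluxBracket hA hs
    (stronglyMeasurable_conv_param hm.continuous.measurable) φ h.meas
    (fun t => h.nik_lower (h.nik_vel t)) h.meas_pres fun t => (hF t).2.1 ()
  have i1 := integrable_fluxBracket hA hs (J := fun f => f) (fun hf => hf) φ h.meas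
    (fun t => h.nik_lower (h.nik_vel t)) h.meas_pres fun t => (hF t).2.2
  rw [h.integral_defect_eq hM hm φ]
  exact hA.enorm_integral_sub_le i0 i1 fun t => (hF t).1 ()

end IsRegular

end VanishingMollification

/-! ### Products with the vorticity as distributions -/

section Products

open TestFn SmoothPer

variable {A : ℝ → ℝ≥0}
  {F : Type*} [NormedAddCommGroup F] [NormedSpace ℝ F]

theorem IsDistribution.comp_fderiv {G : Type*} [NormedAddCommGroup G] [NormedSpace ℝ G]
    {Λ : SpaceTimeTest G T → ℝ} (hΛ : IsDistribution Λ) (L : (ℝ × E3 →L[ℝ] F) →L[ℝ] G)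
    (P : SpaceTimeTest F T → SpaceTimeTest G T) (hP : ∀ φ z, (P φ).1 z = L (fderiv ℝ φ.1 z)) :
    IsDistribution fun φ => Λ (P φ) := by
  have hd : ∀ (φ : SpaceTimeTest F T) z, DifferentiableAt ℝ φ.1 z := fun φ z =>
    φ.2.1.differentiable (by simp) z
  refine ⟨⟨fun φ ψ => ?_, fun c φ => ?_⟩, fun a b ha hb => ?_⟩
  · rw [← hΛ.1.map_add]
    congr 1
    ext z
    change _ = (P φ).1 z + (P ψ).1 z
    rw [hP, hP, hP, ← map_add, ← fderiv_add (hd φ z) (hd ψ z)]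
    rfl
  · rw [← hΛ.1.map_smul]
    congr 1
    ext z
    change _ = c • (P φ).1 z
    rw [hP, hP, ← map_smul, ← fderiv_const_smul (hd φ z)]
    rfl
  · obtain ⟨C, N, h⟩ := hΛ.2 a b ha hb
    refine ⟨C * ‖L‖, N + 1, fun φ hφ M hM => ?_⟩
    have e : (P φ).1 = L ∘ fderiv ℝ φ.1 := funext (hP φ)
    rw [mul_assoc]
    refine h (P φ) (fun t ht x => ?_) _ fun k hk z => ?_
    · have hopen : IsOpen ((Prod.fst : ℝ × E3 → ℝ) ⁻¹' (Icc a b)ᶜ) :=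
        isClosed_Icc.isOpen_compl.preimage continuous_fst
      have hev : φ.1 =ᶠ[𝓝 (t, x)] fun _ => (0 : F) := by
        filter_upwards [hopen.mem_nhds (show (t, x) ∈ _ from ht)] with z hz
        exact hφ z.1 hz z.2
      rw [hP, hev.fderiv_eq]
      simp
    · rw [e]
      refine (L.norm_iteratedFDeriv_comp_left (φ.2.1.fderiv_right (m := k) (by
        exact_mod_cast le_top)).contDiffAt le_rfl).trans ?_
      rw [norm_iteratedFDeriv_fderiv]
      exact mul_le_mul_of_nonneg_left (hM _ (by omega) z) (norm_nonneg L)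

theorem IsDistribution.comp_dt {Λ : SpaceTimeTest F T → ℝ} (hΛ : IsDistribution Λ) :
    IsDistribution fun φ => Λ (dt φ) :=
  hΛ.comp_fderiv (ContinuousLinearMap.apply ℝ F ((1 : ℝ), (0 : E3))) dt fun _ _ => rfl

theorem IsDistribution.comp_grad {Λ : SpaceTimeTest E3 T → ℝ} (hΛ : IsDistribution Λ) :
    IsDistribution fun φ => Λ (grad φ) :=
  hΛ.comp_fderiv (∑ i, (ContinuousLinearMap.apply ℝ ℝ ((0 : ℝ), e i)).smulRight (e i)) grad
    fun φ z => by simp [grad]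

theorem IsDistribution.add {Λ Λ' : SpaceTimeTest F T → ℝ} (h : IsDistribution Λ)
    (h' : IsDistribution Λ') : IsDistribution fun φ => Λ φ + Λ' φ := by
  refine ⟨⟨fun φ ψ => ?_, fun c φ => ?_⟩, fun a b ha hb => ?_⟩
  · rw [h.1.map_add, h'.1.map_add]; ring
  · rw [h.1.map_smul, h'.1.map_smul, smul_add]
  · obtain ⟨C, N, hC⟩ := h.2 a b ha hb
    obtain ⟨C', N', hC'⟩ := h'.2 a b ha hb
    refine ⟨C + C', max N N', fun φ hφ M hM => ?_⟩
    rw [add_mul]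
    exact (abs_add_le _ _).trans (add_le_add
      (hC φ hφ M fun k hk => hM k (hk.trans (le_max_left _ _)))
      (hC' φ hφ M fun k hk => hM k (hk.trans (le_max_right _ _))))

theorem IsDistribution.const_mul {Λ : SpaceTimeTest F T → ℝ} (h : IsDistribution Λ) (c : ℝ) :
    IsDistribution fun φ => c * Λ φ := by
  refine ⟨⟨fun φ ψ => ?_, fun r φ => ?_⟩, fun a b ha hb => ?_⟩
  · rw [h.1.map_add, mul_add]
  · rw [h.1.map_smul, smul_eq_mul, smul_eq_mul, mul_left_comm]
  · obtain ⟨C, N, hC⟩ := h.2 a b ha hb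
    refine ⟨|c| * C, N, fun φ hφ M hM => ?_⟩
    rw [abs_mul, mul_assoc]
    exact mul_le_mul_of_nonneg_left (hC φ hφ M hM) (abs_nonneg c)

/-- Families of fields of degree two that depend linearly on a test function. -/
structure IsTestField (T s : ℝ) (A : ℝ → ℝ≥0) (Φ : SpaceTimeTest F T → ℝ → E3 → E3) : Prop where
  add : ∀ φ ψ t x, Φ (φ + ψ) t x = Φ φ t x + Φ ψ t x
  smul : ∀ (c : ℝ) φ t x, Φ (c • φ) t x = c • Φ φ t x
  meas : ∀ φ, JMeas (Φ φ)
  nik : ∃ C : ℝ≥0, ∀ φ (M : ℝ≥0), (∀ z, ‖φ.1 z‖ ≤ M) → (∀ z, ‖fderiv ℝ φ.1 z‖ ≤ M) → ∀ t,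
    Nik 𝔮 s (C * M * A t ^ 2) (Φ φ t)

/-- The integrated bracket of the vorticity of `u` with a field. -/
def curlPairing (T : ℝ) (u : ℝ → E3 → E3) (G : ℝ → E3 → E3) : ℝ :=
  ∫ t in Ioo 0 T, 𝓑 (curlFn (u t)) (G t)

namespace IsTestField

variable {Φ : SpaceTimeTest F T → ℝ → E3 → E3} (hΦ : IsTestField T s A Φ)
  (h : IsRegular T s κ A u)

include hΦ

theorem exists_nik (φ : SpaceTimeTest F T) : ∃ C : ℝ≥0, ∀ t, Nik 𝔮 s (C * A t ^ 2) (Φ φ t) := by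
  obtain ⟨C, hC⟩ := hΦ.nik
  obtain ⟨M, hM⟩ := exists_bound φ
  obtain ⟨L, hL⟩ := exists_bound_fderiv φ
  exact ⟨C * (M + L), hC φ (M + L) (fun z => (hM z).trans (by exact_mod_cast le_self_add))
    fun z => (hL z).trans (by exact_mod_cast le_add_self)⟩

include h

theorem integrable (φ : SpaceTimeTest F T) : IntegrableOn (fun t =>
    𝓑 (curlFn (u t)) (Φ φ t)) (Ioo 0 T) := by
  obtain ⟨C, hC⟩ := hΦ.exists_nik φ
  exact integrable_bracket h.weight h.half_lt h.meas (fun t => h.nik_lower (h.nik_vel t)) (hΦ.meas φ) hC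

theorem isDistribution : IsDistribution fun φ => curlPairing T u (Φ φ) := by
  have hs := h.half_lt
  have hu := fun t => h.nik_lower (h.nik_vel t)
  refine ⟨⟨fun φ ψ => ?_, fun c φ => ?_⟩, fun a b _ _ => ?_⟩
  · refine Eq.trans (integral_congr_fun fun t => ?_)
      (integral_add (hΦ.integrable h φ) (hΦ.integrable h ψ))
    obtain ⟨C, hC⟩ := hΦ.exists_nik φ
    obtain ⟨C', hC'⟩ := hΦ.exists_nik ψ
    exact (congrArg (bracket _ _ _) (funext (hΦ.add φ ψ t))).trans (bracket_add_right hs hs (hu t) (hC t) (hC' t))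
  · refine Eq.trans (integral_congr_fun fun t => ?_)
      (integral_const_mul c _)
    obtain ⟨C, hC⟩ := hΦ.exists_nik φ
    exact (congrArg (bracket _ _ _) (funext (hΦ.smul c φ t))).trans (bracket_smul_right hs hs (hu t) (hC t) c)
  · obtain ⟨C, hC⟩ := hΦ.nik
    obtain ⟨B, hB⟩ := exists_bracket_le (p := 3) (q := 3 / 2) hs hs
    refine ⟨(B * (2 * 2) * C * (∫⁻ t in Ioo 0 T, (A t : ℝ≥0∞) ^ 3).toNNReal : ℝ≥0), 1,
      fun φ _ M hM => ?_⟩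
    have hM0 : ∀ z, ‖φ.1 z‖ ≤ M := fun z => by simpa using hM 0 zero_le_one z
    lift M to ℝ≥0 using (norm_nonneg _).trans (hM0 0)
    have h1 := hC φ M hM0 fun z => by
      have := hM 1 le_rfl z
      rwa [← zero_add 1, ← norm_iteratedFDeriv_fderiv, norm_iteratedFDeriv_zero] at this
    have h2 := h.weight.enorm_integral_sub_le (g := fun _ => 0) (C := B * (2 * 2) * C) (r := M)
      (hΦ.integrable h φ)
      integrableOn_zero fun t => by
        rw [sub_zero]
        refine (hB _ _ _ _ (hu t) (h1 t)).trans (le_of_eq ?_)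
        push_cast
        ring
    rw [integral_zero, sub_zero, enorm_le_coe] at h2
    exact_mod_cast h2

variable (hω : ∀ᵐ t ∂𝓛 T, ω t = curlFn (u t))
  {Φ' : SpaceTimeTest F T → ℝ → E3 → E3} (hp : ∀ φ, ∀ t ∈ Ioo 0 T, IsPeriodic (Φ' φ t))
  (he : ∀ φ, ∀ᵐ t ∂𝓛 T, Φ' φ t =ᵐ[volume] Φ φ t)

include hω hp he

protected theorem pairing (φ : SpaceTimeTest F T) :
    PairingDefined T ω (Φ' φ) ∧ pairing T ω (Φ' φ) = curlPairing T u (Φ φ) := by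
  have e : (fun t => 𝓑 (ω t) (Φ' φ t)) =ᵐ[𝓛 T]
      fun t => 𝓑 (curlFn (u t)) (Φ φ t) := by
    filter_upwards [hω, he φ] with t h1 h2
    rw [h1, bracket_congr h2]
  refine ⟨⟨?_, (hΦ.integrable h φ).congr e.symm⟩, integral_congr_ae e⟩
  obtain ⟨C, hC⟩ := hΦ.exists_nik φ
  filter_upwards [hω, he φ, ae_restrict_mem measurableSet_Ioo] with t h1 h2 h3
  rw [h1]
  exact ⟨memDual_curlFn (p := 3) h.half_lt (h.nik_lower (h.nik_vel t)),
    memSobolev_congr h2.symm (memSobolev_of_nik (by norm_num) h.half_lt (hC t)) (hp φ t h3)⟩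

theorem isDistribution_pairing : IsDistribution fun φ => pairing T ω (Φ' φ) := by
  simpa only [(hΦ.pairing h hω hp he _).2] using hΦ.isDistribution h

end IsTestField

end Products

/-! ### The fields of the helicity balance -/

section BalanceFields

open TestFn SmoothPer

variable {A : ℝ → ℝ≥0}

theorem grad_apply (φ : TestFn T) (t : ℝ) (x : E3) (i : Fin 3) :
    (grad φ).1 (t, x) i = (D i (slice φ t)).1 x := by
  rw [← slice_dx]
  change (∑ j, fderiv ℝ φ.1 (t, x) (0, e j) • e j : E3) i = _
  simp [e, Pi.single_apply]
  rfl

theorem stronglyMeasurable_test (ψ : SpaceTimeTest F T) : JMeas fun t x => ψ.1 (t, x) :=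
  ψ.2.1.continuous.stronglyMeasurable

namespace IsRegular

variable (h : IsRegular T s κ A u)

include h

theorem isTestField_helicityField : IsTestField T s A (fun φ : TestFn T => helicityField u φ) := by
  refine ⟨fun φ ψ t x => add_smul _ _ _, fun c φ t x => smul_assoc c (φ.1 (t, x)) (u t x),
    fun φ => (stronglyMeasurable_test φ).smul h.meas, 16, fun φ M h0 h1 t => ?_⟩
  have h2 := (nik_slice φ h0 h1 (by linarith [h.half_lt])
    (by linarith [h.sk_le_one, h.kappa_pos]) t).smul (r := 3) (h.nik_lower (h.nik_vel t)) (by norm_num)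
  refine (h2.exponent ofReal_three_half_le).mono ?_
  calc 2 * (2 * M * (2 * 2 * A t)) = 16 * M * A t ^ 1 := by ring
    _ ≤ _ := mul_le_mul' le_rfl (pow_le_pow_right₀ (h.weight.one_le t) (by norm_num))

theorem isTestField_pressureField :
    IsTestField T s A (fun ψ : SpaceTimeTest E3 T => pressureField (pres u) ψ) := by
  obtain ⟨C, hC⟩ := h.exists_nik_pres
  refine ⟨fun φ ψ t x => smul_add _ _ _, fun c ψ t x =>
    smul_comm (pres u t x) c (ψ.1 (t, x)), fun ψ => h.meas_pres.smul (stronglyMeasurable_test ψ), 8 * C, fun ψ M h0 h1 t => ?_⟩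
  have hs := h.half_lt
  have hκ := h.kappa_pos
  exact (((hC t).1.lower one_le_q (by linarith) (by linarith)).smul
    (nik_slice ψ h0 h1 (s := s) (by linarith) (by linarith [h.sk_le_one]) t)
    one_le_q).mono (le_of_eq (by ring))

theorem isTestField_fluxField :
    IsTestField T s A (fun ψ : SpaceTimeTest E3 T => fluxField u ψ) := by
  have hi : ∀ (ψ : SpaceTimeTest E3 T), JMeas fun t x =>
      ⟪u t x, ψ.1 (t, x)⟫_ℝ := fun ψ => h.meas.inner (𝕜 := ℝ) (stronglyMeasurable_test ψ)
  refine ⟨fun φ ψ t x => ?_, fun c φ t x => ?_, fun ψ => ((hi ψ).const_mul 2 |>.smul h.meas).sub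
    ((h.meas.norm.pow 2).smul (stronglyMeasurable_test ψ)), 384, fun ψ M h0 h1 t => ?_⟩
  · change (2 * ⟪u t x, φ.1 (t, x) + ψ.1 (t, x)⟫_ℝ) • u t x -
      (‖u t x‖ ^ 2) • (φ.1 (t, x) + ψ.1 (t, x)) = _
    simp only [fluxField, inner_add_right, mul_add, add_smul, smul_add]
    abel
  · change (2 * ⟪u t x, c • φ.1 (t, x)⟫_ℝ) • u t x - (‖u t x‖ ^ 2) • (c • φ.1 (t, x)) = _
    simp only [fluxField, inner_smul_right, smul_sub, smul_smul]
    ring_nf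
  · have hu := h.nik_lower (h.nik_vel t)
    have hψ := nik_slice ψ h0 h1 (s := s) (by linarith [h.half_lt])
      (by linarith [h.sk_le_one, h.kappa_pos]) t
    have f1 := ((hu.inner (r := 3) hψ (by norm_num)).smul hu one_le_q).const_smul 2
    have f2 := (hu.inner hu one_le_q).smul hψ one_le_q
    have f3 := (f1.sub f2 one_le_q).mono (B := 384 * M * A t ^ 2) (le_of_eq (by
      rw [show ‖(2 : ℝ)‖₊ = 2 by ext; simp]
      ring))
    simp only [real_inner_self_eq_norm_sq, smul_smul] at f3
    exact f3

/-- The limit of the mollified defects is the helicity balance. -/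
theorem integral_fluxBracket_id (φ : TestFn T) :
    ∫ t in Ioo 0 T, fluxBracket (fun f => f) φ (u t) (pres u t) t =
      curlPairing T u (fluxField u (grad φ)) + 2 * curlPairing T u (pressureField (pres u) (grad φ)) +
        2 * curlPairing T u (helicityField u (dt φ)) := by
  have hs := h.half_lt
  have hf := h.isTestField_fluxField
  have hq := h.isTestField_pressureField
  have hh := h.isTestField_helicityField
  have i1 := hf.integrable h (grad φ)
  have i2 := (hq.integrable h (grad φ)).const_mul 2
  have i3 := (hh.integrable h (dt φ)).const_mul 2
  simp only [curlPairing]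
  rw [← integral_const_mul, ← integral_const_mul]
  refine (integral_congr_fun fun t => ?_).trans
    ((integral_add (i1.add i2) i3).trans (congrArg (· + _) (integral_add i1 i2)))
  obtain ⟨C₁, h1⟩ := hf.exists_nik (grad φ)
  obtain ⟨C₂, h2⟩ := hq.exists_nik (grad φ)
  obtain ⟨C₃, h3⟩ := hh.exists_nik (dt φ)
  have hu := h.nik_lower (h.nik_vel t)
  have e2 := (h2 t).const_smul 2
  have e : vec (fluxOf (fun f => f) (fun l => (D l (slice φ t)).1) (slice (ddt φ) t).1
      (fun j x => u t x j) (pres u t)) = fun x => (fluxField u (grad φ) t x +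
        (2 : ℝ) • pressureField (pres u) (grad φ) t x) + (2 : ℝ) • helicityField u (dt φ) t x := by
    ext x i
    simp only [vec, fluxOf, fluxField, pressureField, helicityField, PiLp.add_apply, PiLp.sub_apply,
      PiLp.smul_apply, smul_eq_mul, grad_apply, inner_E3, ← real_inner_self_eq_norm_sq,
      Fin.sum_univ_three, slice]
    ring
  simp only [Pi.add_apply]
  rw [fluxBracket, e, bracket_add_right hs hs hu
    ((h1 t).add e2 one_le_q) ((h3 t).const_smul 2),
    bracket_add_right hs hs hu (h1 t) e2,
    bracket_smul_right hs hs hu (h2 t),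
    bracket_smul_right hs hs hu (h3 t)]

end IsRegular

end BalanceFields

/-! ### The pressure -/

section Pressure

open TestFn SmoothPer

variable {A : ℝ → ℝ≥0} {g : ℝ → E3 → E3} {p : ℝ → E3 → ℝ}

theorem exists_version_of_ae {f : ℝ → E3 → F} (hp : ∀ t ∈ Ioo 0 T, IsPeriodic (f t))
    (hm : AEStronglyMeasurable (uncurry f) ((𝓛 T).prod volume)) {Q : ℝ → Prop}
    (hQ : ∀ᵐ t ∂𝓛 T, Q t) : ∃ (S : Set ℝ) (g : ℝ → E3 → F), MeasurableSet S ∧ (∀ᵐ t ∂𝓛 T, t ∈ S) ∧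
      (∀ t ∈ S, Q t ∧ g t =ᵐ[volume] f t) ∧ (∀ t ∉ S, g t = 0) ∧
      JMeas g ∧ ∀ t, IsPeriodic (g t) := by
  obtain ⟨g, h1, h2, h3⟩ := exists_measurable_version hp hm
  obtain ⟨S, hS, hSm, h⟩ := (hQ.and h3).exists_measurable_mem
  refine ⟨S, S.indicator g, hSm, hS, fun t ht => by rw [indicator_of_mem ht]; exact h t ht,
    fun t ht => indicator_of_notMem ht g, ?_, fun t => ?_⟩
  · convert h1.indicator (hSm.preimage measurable_fst) using 1
    ext z
    by_cases hz : z.1 ∈ S <;> simp [uncurry, hz]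
  · by_cases ht : t ∈ S
    · rw [indicator_of_mem ht]; exact h2 t
    · rw [indicator_of_notMem ht]; exact fun _ _ => rfl

theorem prod_restrict_cell : (𝓛 T).prod vol =
    (volume : Measure (ℝ × E3)).restrict (Ioo 0 T ×ˢ cell) := by
  rw [Measure.prod_restrict, ← Measure.volume_eq_prod]

namespace IsRegular

variable (h : IsRegular T s κ A g)
  (hM : IsMomentumSolution T A (fun i t x => g t x i) (pres g))
  (hu : ∀ᵐ t ∂𝓛 T, g t =ᵐ[volume] u t)

include h

/-- The weak momentum equation in terms of coordinates. -/
theorem integral_momentum (hp : STInt T p) (ζ : SpaceTimeTest E3 T) :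
    ∫ t in Ioo 0 T, ∫ x in cell, (⟪g t x, (dt ζ).1 (t, x)⟫_ℝ +
      (∑ i, ∑ j, g t x i * g t x j * fderiv ℝ ζ.1 (t, x) (0, e i) j) +
        p t x * ∑ i, fderiv ℝ ζ.1 (t, x) (0, e i) i) =
      momForm h.stInt_vel h.stInt_stress (coordST ζ) + ∑ i, stPair T p (dx i (coordST ζ i)) := by
  have iu := fun i => (h.stInt_vel i).integrable_mul (ddt (coordST ζ i))
  have iv := fun i l => (h.stInt_stress i l).integrable_mul (dx i (coordST ζ l))
  have ip := fun i => hp.integrable_mul (dx i (coordST ζ i))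
  rw [momForm_apply]
  simp only [stPair]
  rw [← integral_finsetSum _ fun i _ => iu i,
    ← sum_congr rfl fun i _ => integral_finsetSum _ fun l _ => iv i l,
    ← integral_finsetSum _ fun i _ => integrable_finsetSum _ fun l _ => iv i l,
    ← integral_finsetSum _ fun i _ => ip i]
  refine (integral_congr_fun fun t => ?_).trans
    ((integral_add ((integrable_finsetSum _ fun i _ => iu i).add (integrable_finsetSum _ fun i _ =>
      integrable_finsetSum _ fun l _ => iv i l)) (integrable_finsetSum _ fun i _ => ip i)).trans
      (congrArg (· + _) (integral_add (integrable_finsetSum _ fun i _ => iu i)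
        (integrable_finsetSum _ fun i _ => integrable_finsetSum _ fun l _ => iv i l))))
  have ju := fun i => ((h.stInt_vel i).perInt t).integrable_mul (slice (ddt (coordST ζ i)) t)
  have jv := fun i l => ((h.stInt_stress i l).perInt t).integrable_mul
    (slice (dx i (coordST ζ l)) t)
  have jp := fun i => (hp.perInt t).integrable_mul (slice (dx i (coordST ζ i)) t)
  simp only [Pi.add_apply]
  refine Eq.trans (integral_congr_fun fun x => ?_)
    ((integral_add ((integrable_finsetSum _ fun i _ => ju i).add (integrable_finsetSum _ fun i _ =>
      integrable_finsetSum _ fun l _ => jv i l)) (integrable_finsetSum _ fun i _ => jp i)).trans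
      (congrArg₂ (· + ·) ((integral_add (integrable_finsetSum _ fun i _ => ju i)
        (integrable_finsetSum _ fun i _ => integrable_finsetSum _ fun l _ => jv i l)).trans
          (congrArg₂ (· + ·) (integral_finsetSum _ fun i _ => ju i)
            ((integral_finsetSum _ fun i _ => integrable_finsetSum _ fun l _ => jv i l).trans
              (sum_congr rfl fun i _ => integral_finsetSum _ fun l _ => jv i l))))
        (integral_finsetSum _ fun i _ => jp i)))
  simp only [inner_E3, fderiv_coordST, mul_sum, Pi.add_apply]
  refine congrArg₂ (· + ·) (congrArg₂ (· + ·) (sum_congr rfl fun i _ => ?_) rfl) rfl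
  exact congrArg (g t x i * ·) (fderiv_coordST ζ _ _ i)

include hu

theorem integral_momentum_congr {q : ℝ → E3 → ℝ} (hq : STInt T q)
    (hpq : ∀ᵐ t ∂𝓛 T, q t =ᵐ[volume] p t) (ζ : SpaceTimeTest E3 T) :
    ∫ t in Ioo 0 T, ∫ x in cell, (⟪u t x, (dt ζ).1 (t, x)⟫_ℝ +
      (∑ i, ∑ j, u t x i * u t x j * fderiv ℝ ζ.1 (t, x) (0, e i) j) +
        p t x * ∑ i, fderiv ℝ ζ.1 (t, x) (0, e i) i) =
      momForm h.stInt_vel h.stInt_stress (coordST ζ) + ∑ i, stPair T q (dx i (coordST ζ i)) := by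
  rw [← h.integral_momentum hq ζ]
  refine integral_congr_ae ?_
  filter_upwards [hu, hpq] with t h1 h2
  refine integral_congr_ae ?_
  filter_upwards [ae_restrict_of_ae h1, ae_restrict_of_ae h2] with x h3 h4
  rw [h3, h4]

include hM

theorem isPressure : IsPressure T u (pres g) where
  periodic t _ := (h.exists_nik_pres.choose_spec t).1.periodic
  measurable := h.meas_pres.aestronglyMeasurable
  integrable := by
    have := h.stInt_pres.integrable
    rwa [prod_restrict_cell] at this
  mean_zero := Eventually.of_forall h.integral_pres
  momentum ζ := (h.integral_momentum_congr hu h.stInt_pres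
    (.of_forall fun _ => EventuallyEq.rfl) ζ).trans (hM.momentum _)

/-- The pressure is unique. -/
theorem ae_eq_pres (hp : IsPressure T u p) : ∀ᵐ t ∂𝓛 T, p t =ᵐ[volume] pres g t := by
  have hi := hp.integrable
  rw [IntegrableOn, ← prod_restrict_cell] at hi
  obtain ⟨S, q, hSm, hS, h1, h0, hqm, hqp⟩ := exists_version_of_ae hp.periodic hp.measurable
    (hi.prod_right_ae.and hp.mean_zero)
  have hq : STInt T q := by
    refine ⟨hqm, fun t => ⟨hqp t, hqm.comp_measurable measurable_prodMk_left, ?_⟩, ?_⟩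
    · by_cases ht : t ∈ S
      · exact (h1 t ht).1.1.congr (ae_restrict_of_ae (h1 t ht).2.symm)
      · rw [h0 t ht]; exact integrable_zero _ _ _
    · have h2 := hi.2
      rw [HasFiniteIntegral, lintegral_prod _ hi.1.enorm] at h2
      refine lt_of_le_of_lt (lintegral_mono_ae ?_) h2
      filter_upwards [hS] with t ht
      rw [eLpNorm_one_eq_lintegral_enorm]
      refine (lintegral_congr_ae ?_).le
      filter_upwards [ae_restrict_of_ae (h1 t ht).2] with x hx
      rw [hx]
      rfl
  have hqp : ∀ᵐ t ∂𝓛 T, q t =ᵐ[volume] p t := hS.mono fun t ht => (h1 t ht).2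
  have hr := hq.sub h.stInt_pres
  have h3 := ae_eq_zero_of_stPair_dx hr ?_ fun i φ => ?_
  · filter_upwards [h3, hqp] with t h4 h5
    filter_upwards [h4, h5] with x h6 h7
    rw [← h7]
    linarith
  · filter_upwards [hS] with t ht
    rw [integral_sub (hq.perInt t).integrable (h.stInt_pres.perInt t).integrable, h.integral_pres,
      integral_congr_ae (ae_restrict_of_ae (h1 t ht).2), sub_zero]
    exact (h1 t ht).1.2
  · have e1 := (h.integral_momentum_congr hu hq hqp (vecT (Pi.single i φ))).symm.trans
      (hp.momentum _)
    have e2 := hM.momentum (Pi.single i φ)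
    simp only [coordST_vecT] at e1
    have e3 : ∀ f : ℝ → E3 → ℝ, ∑ j, stPair T f (dx j ((Pi.single i φ : Fin 3 → TestFn T) j)) =
        stPair T f (dx i φ) := fun f => by
      rw [sum_eq_single i, Pi.single_eq_same]
      · intro j _ hj
        rw [Pi.single_eq_of_ne hj]
        have : dx j (0 : TestFn T) = (0 : ℝ) • dx j 0 := by
          rw [zero_smul]; ext z; simp [dx]
        rw [this, stPair_smul, zero_mul]
      · simp
    rw [e3] at e1 e2
    rw [stPair_sub_left hq h.stInt_pres]
    exact sub_eq_zero.2 (add_left_cancel (e1.trans e2.symm))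

end IsRegular

end Pressure

/-! ### Reduction to regular representatives -/

section Reduction

open TestFn SmoothPer

theorem measurable_sobolevNorm {f : ℝ → E3 → F} (s q : ℝ) (hf : JMeas f) : Measurable fun t => sobolevNorm s q (f t) := by
  have h1 : Measurable fun z : ℝ × E3 => ‖f z.1 z.2‖ₑ ^ q := hf.enorm.pow_const q
  have h2 : Measurable fun z : (ℝ × E3) × E3 =>
      ‖increment z.2 (f z.1.1) z.1.2‖ₑ ^ q / ‖z.2‖ₑ ^ (3 + s * q) := by
    have h3 : StronglyMeasurable fun z : (ℝ × E3) × E3 => f z.1.1 (z.1.2 + z.2) :=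
      hf.comp_measurable (g := fun z : (ℝ × E3) × E3 => (z.1.1, z.1.2 + z.2)) (by fun_prop)
    have h4 : StronglyMeasurable fun z : (ℝ × E3) × E3 => f z.1.1 z.1.2 :=
      hf.comp_measurable (g := fun z : (ℝ × E3) × E3 => z.1) (by fun_prop)
    exact ((h3.sub h4).enorm.pow_const q).div (measurable_snd.enorm.pow_const _)
  have h5 : Measurable fun z : ℝ × E3 => ∫⁻ h in centredCell,
      ‖increment h (f z.1) z.2‖ₑ ^ q / ‖h‖ₑ ^ (3 + s * q) :=
    h2.lintegral_prod_right' (ν := volume.restrict centredCell)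
  exact ((h1.lintegral_prod_right' (ν := vol)).add
    (h5.lintegral_prod_right' (ν := vol))).pow_const _

theorem inner_gradient (a : E3) (χ : SmoothPer) (x : E3) :
    ⟪a, gradient χ.1 x⟫_ℝ = ∑ i, a i * (D i χ).1 x := by
  rw [inner_E3]
  exact sum_congr rfl fun i _ => congrArg (a i * ·) (gradient_apply _ _ _)

/-- A solution has a representative that is regular at all times. -/
theorem exists_isRegular (hT : 0 < T) (hsol : IsFunctionalVorticitySolution T u ω)
    (hmean : ∃ c : E3, ∀ᵐ t ∂𝓛 T, ∫ x in cell, u t x = c)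
    (hu : ∃ θ : ℝ, 0 < θ ∧ θ < 1 / 2 ∧ MemBochnerSobolev T 3 (1 / 2 + θ) 3 u) :
    ∃ (s κ : ℝ) (A : ℝ → ℝ≥0) (g : ℝ → E3 → E3), IsRegular T s κ A g ∧
      IsMomentumSolution T A (fun i t x => g t x i) (pres g) ∧ (∀ᵐ t ∂𝓛 T, g t =ᵐ[volume] u t) ∧
      ∀ᵐ t ∂𝓛 T, ω t = curlFn (g t) := by
  obtain ⟨θ, hθ0, hθ1, hper, hmeas, hnorm⟩ := hu
  obtain ⟨C, hC⟩ := exists_nik_of_sobolevNorm_le (F := E3) (s := 1 / 2 + θ) (q := 3) (by linarith)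
    (by linarith) (by norm_num)
  have hn := (eLpNorm_lt_top_iff_lintegral_rpow_enorm_lt_top (by norm_num) (by norm_num)).1 hnorm
  simp only [enorm_eq_self, ENNReal.toReal_ofNat] at hn
  have hN : AEMeasurable (fun t => sobolevNorm (1 / 2 + θ) 3 (u t) ^ (3 : ℝ))
      (𝓛 T) := by
    obtain ⟨g, h1, -, h2⟩ := exists_measurable_version hper hmeas
    exact ⟨_, (measurable_sobolevNorm _ _ h1).pow_const _, h2.mono fun t ht =>
      congrArg (· ^ (3 : ℝ)) (sobolevNorm_congr ht.symm)⟩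
  obtain ⟨S, g, hSm, hS, h1, h0, hgm, hgp⟩ := exists_version_of_ae hper hmeas
    (hsol.div_velocity.and (ae_lt_top' hN hn.ne))
  have hgu : ∀ᵐ t ∂𝓛 T, g t =ᵐ[volume] u t := hS.mono fun t ht => (h1 t ht).2
  have hω : ∀ᵐ t ∂𝓛 T, ω t = curlFn (g t) := by
    filter_upwards [hgu, hsol.vorticity] with t h2 h3
    rw [curlFn_congr h2]
    exact funext h3
  set N : ℝ → ℝ≥0 := fun t => (sobolevNorm (1 / 2 + θ) 3 (g t)).toNNReal
  have hNg : ∀ t ∈ S, (N t : ℝ≥0∞) = sobolevNorm (1 / 2 + θ) 3 (g t) := fun t ht => by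
    refine coe_toNNReal fun h => ?_
    have h2 := (h1 t ht).1.2
    rw [← sobolevNorm_congr (h1 t ht).2, h] at h2
    simp at h2
  have hreg : IsRegular T (1 / 2 + θ / 4) (θ / 4) (fun t => max 1 (C * N t)) g := by
    have hnik : ∀ t, Nik 3 (1 / 2 + θ) (max 1 (C * N t)) (g t) := fun t => by
      by_cases ht : t ∈ S
      · have := hC (g t) (N t) (hgp t) (hgm.comp_measurable measurable_prodMk_left) (hNg t ht).ge
        rw [ENNReal.ofReal_ofNat] at this
        exact this.mono (le_max_right _ _)
      · rw [h0 t ht]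
        exact Nik.zero.mono zero_le
    refine ⟨hT, ⟨?_, fun t => le_max_left _ _, ?_⟩, by linarith, by linarith, by linarith, hgm,
      fun t => ?_, fun t χ => ?_⟩
    · exact measurable_const.max ((measurable_sobolevNorm _ _ hgm).ennreal_toNNReal.const_mul C)
    · refine (lintegral_mono_ae (g := fun t => 1 + (C : ℝ≥0∞) ^ 3 *
        sobolevNorm (1 / 2 + θ) 3 (u t) ^ (3 : ℝ)) ?_).trans_lt ?_
      · filter_upwards [hS] with t ht
        rw [← sobolevNorm_congr (h1 t ht).2, ← hNg t ht, show (3 : ℝ) = (3 : ℕ) by norm_num,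
          ENNReal.rpow_natCast, ← mul_pow]
        rcases max_choice 1 (C * N t) with h2 | h2 <;> rw [h2]
        · simp
        · push_cast
          exact le_add_self
      · rw [lintegral_add_left measurable_const, lintegral_const_mul' _ _ (by simp)]
        exact ENNReal.add_lt_top.2 ⟨by simp, mul_lt_top (by simp) hn⟩
    · rw [show 1 / 2 + θ / 4 + 3 * (θ / 4) = 1 / 2 + θ by ring]
      exact hnik t
    · by_cases ht : t ∈ S
      · have hp := (hnik t).perInt (by norm_num)
        rw [← integral_finsetSum _ fun i _ => (hp.coord i).integrable_mul (D i χ)]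
        refine Eq.trans (integral_congr_ae ?_) ((h1 t ht).1.1 ⟨χ.1, χ.contDiff, χ.periodic⟩)
        filter_upwards [ae_restrict_of_ae (h1 t ht).2] with x hx
        rw [← hx, inner_gradient]
      · simp [h0 t ht]
  refine ⟨_, _, _, g, hreg, hreg.isMomentumSolution (fun i => ?_) fun ψ => ?_, hgu, ?_⟩
  · obtain ⟨c, hc⟩ := hmean
    refine ⟨c i, ?_⟩
    filter_upwards [hgu, hc] with t h2 h3
    rw [← h3, ← integral_congr_ae (ae_restrict_of_ae h2)]
    exact (EuclideanSpace.proj i : E3 →L[ℝ] ℝ).integral_comp_comm (((hreg.nik t).perInt (by norm_num)).integrable)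
  · refine Eq.trans (congrArg₂ (· + ·) (integral_congr_ae ?_) (integral_congr_ae ?_))
      (hsol.equation ψ)
    · filter_upwards [hω] with t h2
      rw [h2]
    · filter_upwards [hω, hgu] with t h2 h3
      rw [h2]
      refine bracket_congr ?_
      filter_upwards [h3] with x h4
      rw [h4]
  · exact hω

end Reduction

/-! ### Mollified defects of a representative -/

section DefectCongr

open TestFn SmoothPer

variable {A : ℝ → ℝ≥0} {g : ℝ → E3 → E3}

theorem increment_congr {f f' : E3 → F} (h : f =ᵐ[volume] f') (ξ : E3) : increment ξ f =ᵐ[volume] increment ξ f' := by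
  filter_upwards [h, (measurePreserving_add_right volume ξ).quasiMeasurePreserving.ae h] with x h1 h2
  rw [increment, increment, h1, h2]

theorem defectField_congr {v v' : E3 → E3} (h : v =ᵐ[volume] v') (f : E3 → ℝ) (ξ : E3) :
    defectField₁ ϕ ε v f ξ =ᵐ[volume] defectField₁ ϕ ε v' f ξ ∧
    defectField₂ ϕ ε v f ξ =ᵐ[volume] defectField₂ ϕ ε v' f ξ := by
  constructor <;>
  · refine increment_congr ?_ _
    filter_upwards [increment_congr h ξ] with x hx
    rw [hx]

theorem isPeriodic_defectField {v : E3 → E3} {f : E3 → ℝ} (hv : IsPeriodic v) (hf : IsPeriodic f)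
    (ξ : E3) : IsPeriodic (defectField₁ ϕ ε v f ξ) ∧ IsPeriodic (defectField₂ ϕ ε v f ξ) :=
  ⟨((hv.increment ξ).comp₂ hf fun a b => (⟪gradient (dilate ϕ ε) ξ, a⟫_ℝ * b) • a).increment _,
    ((hv.increment ξ).comp₂ hf fun a b => (‖a‖ ^ 2 * b) • gradient (dilate ϕ ε) ξ).increment _⟩

namespace IsRegular

variable (h : IsRegular T s κ A g) (hu : ∀ᵐ t ∂𝓛 T, g t =ᵐ[volume] u t)
  (hω : ∀ᵐ t ∂𝓛 T, ω t = curlFn (g t))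

include hu hω

omit h in
theorem ae_defect_eq (φ : TestFn T) : ∀ᵐ t ∂𝓛 T,
    defect₁ ϕ ε (u t) (ω t) (slice φ t).1 = defect₁ ϕ ε (g t) (curlFn (g t)) (slice φ t).1 ∧
    defect₂ ϕ ε (u t) (ω t) (slice φ t).1 = defect₂ ϕ ε (g t) (curlFn (g t)) (slice φ t).1 := by
  filter_upwards [hu, hω] with t h1 h2
  rw [h2]
  exact ⟨integral_congr_ae (.of_forall fun ξ =>
      bracket_congr (defectField_congr h1.symm _ ξ).1),
    integral_congr_ae (.of_forall fun ξ => bracket_congr (defectField_congr h1.symm _ ξ).2)⟩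

omit h in
theorem mollifiedDefect_eq (φ : TestFn T) : mollifiedDefect T ϕ ε u ω φ =
    ∫ t in Ioo 0 T, defect ϕ ε (g t) (slice φ t).1 := by
  refine integral_congr_ae ?_
  filter_upwards [ae_defect_eq (ϕ := ϕ) (ε := ε) hu hω φ] with t h1
  exact congrArg₂ (fun a b => a - 1 / 2 * b) h1.1 h1.2

include h

theorem mollifiedDefectDefined (hp : ∀ t ∈ Ioo 0 T, IsPeriodic (u t)) (hk : IsKernel (dilate ϕ ε))
    (φ : TestFn T) : MollifiedDefectDefined T ϕ ε u ω φ := by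
  have hs := h.half_lt_sk
  have hi := integrable_defect h.weight hs h.sk_le_one hk h.meas h.nik_vel φ
  obtain ⟨K, hK, -⟩ := h.exists_grLim φ
  refine ⟨?_, hi.1.2.congr ((ae_defect_eq hu hω φ).mono fun t ht => ht.1.symm),
    hi.2.2.congr ((ae_defect_eq hu hω φ).mono fun t ht => ht.2.symm)⟩
  filter_upwards [hu, hω, ae_restrict_mem measurableSet_Ioo] with t h1 h2 h3
  have e := fun ξ => defectField_congr (ϕ := ϕ) (ε := ε) h1 (slice φ t).1 ξ
  have hP := fun ξ => isPeriodic_defectField (ϕ := ϕ) (ε := ε) (hp t h3) (slice φ t).periodic ξ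
  have hN := fun ξ => nik_defectField (ϕ := ϕ) (ε := ε) (K := 2 + K)
    ((h.nik_vel t).mono (mul_le_mul' le_self_add le_rfl)) ((hK t).mono le_add_self) ξ
  rw [h2]
  refine ⟨memDual_curlFn (p := 3) hs (h.nik_vel t), fun ξ =>
    ⟨memSobolev_congr (e ξ).1 (memSobolev_of_nik (by norm_num) hs (hN ξ).1) (hP ξ).1,
      memSobolev_congr (e ξ).2 (memSobolev_of_nik (by norm_num) hs (hN ξ).2) (hP ξ).2⟩,
    (hi.1.1 t).congr (.of_forall fun ξ => bracket_congr (e ξ).1),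
    (hi.2.1 t).congr (.of_forall fun ξ => bracket_congr (e ξ).2)⟩

end IsRegular

end DefectCongr

end HelicityBalance

end

open HelicityBalance

theorem mainTheorem1 (T : ℝ) (hT : 0 < T) (u : ℝ → E3 → E3) (ω : ℝ → PeriodicTest E3 → ℝ)
    (hsol : IsFunctionalVorticitySolution T u ω)
    (hmean : ∃ c : E3, ∀ᵐ t ∂volume.restrict (Ioo 0 T), ∫ x in cell, u t x = c)
    (hu : ∃ θ : ℝ, 0 < θ ∧ θ < 1 / 2 ∧ MemBochnerSobolev T 3 (1 / 2 + θ) 3 u) :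
    ∃ D : SpaceTimeTest ℝ T → ℝ,
      IsDistribution D ∧
      -- `D` is the distributional limit of the mollified defects, for every mollifier
      (∀ ϕ : E3 → ℝ, IsMollifier ϕ → ∀ φ : SpaceTimeTest ℝ T,
        (∀ ε : ℝ, 0 < ε → MollifiedDefectDefined T ϕ ε u ω φ) ∧
        Tendsto (fun ε : ℝ => mollifiedDefect T ϕ ε u ω φ) (𝓝[>] 0) (𝓝 (D φ))) ∧
      -- the helicity density and its flux are well-defined distributions
      (∀ φ : SpaceTimeTest ℝ T, PairingDefined T ω (helicityField u φ)) ∧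
      (∀ ψ : SpaceTimeTest E3 T, PairingDefined T ω (fluxField u ψ)) ∧
      IsDistribution (helicityDensity T u ω) ∧
      IsDistribution (helicityFlux T u ω) ∧
      -- the pressure exists, and the local helicity balance holds with it
      (∃ p : ℝ → E3 → ℝ, IsPressure T u p) ∧
      ∀ p : ℝ → E3 → ℝ, IsPressure T u p →
        (∀ ψ : SpaceTimeTest E3 T, PairingDefined T ω (pressureField p ψ)) ∧
        IsDistribution (pressureVorticity T p ω) ∧
        (2 : ℝ) • distDt (helicityDensity T u ω) + (2 : ℝ) • distDiv (pressureVorticity T p ω) +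
          distDiv (helicityFlux T u ω) + D = 0 := by
  obtain ⟨s, κ, A, g, h, hM, hgu, hω⟩ := exists_isRegular hT hsol hmean hu
  obtain ⟨-, -, -, hper, -⟩ := hu
  have hh := h.isTestField_helicityField
  have hf := h.isTestField_fluxField
  have hq := h.isTestField_pressureField
  have ph : ∀ (φ : SpaceTimeTest ℝ T), ∀ t ∈ Ioo 0 T, IsPeriodic (helicityField u φ t) :=
    fun φ t ht => (φ.2.2.1 t).comp₂ (hper t ht) (· • ·)
  have eh : ∀ (φ : SpaceTimeTest ℝ T), ∀ᵐ t ∂volume.restrict (Ioo 0 T),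
      helicityField u φ t =ᵐ[volume] helicityField g φ t := fun φ => by
    filter_upwards [hgu] with t ht
    filter_upwards [ht] with x hx
    rw [helicityField, helicityField, hx]
  have pf : ∀ (ψ : SpaceTimeTest E3 T), ∀ t ∈ Ioo 0 T, IsPeriodic (fluxField u ψ t) :=
    fun ψ t ht => (hper t ht).comp₂ (ψ.2.2.1 t) fun a b => (2 * ⟪a, b⟫_ℝ) • a - (‖a‖ ^ 2) • b
  have ef : ∀ (ψ : SpaceTimeTest E3 T), ∀ᵐ t ∂volume.restrict (Ioo 0 T),
      fluxField u ψ t =ᵐ[volume] fluxField g ψ t := fun ψ => by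
    filter_upwards [hgu] with t ht
    filter_upwards [ht] with x hx
    rw [fluxField, fluxField, hx]
  have pq : ∀ p, IsPressure T u p → ∀ (ψ : SpaceTimeTest E3 T), ∀ t ∈ Ioo 0 T,
      IsPeriodic (pressureField p ψ t) :=
    fun p hp ψ t ht => (hp.periodic t ht).comp₂ (ψ.2.2.1 t) (· • ·)
  have eq : ∀ p, IsPressure T u p → ∀ (ψ : SpaceTimeTest E3 T), ∀ᵐ t ∂volume.restrict (Ioo 0 T),
      pressureField p ψ t =ᵐ[volume] pressureField (pres g) ψ t := fun p hp ψ => by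
    filter_upwards [h.ae_eq_pres hM hgu hp] with t ht
    filter_upwards [ht] with x hx
    rw [pressureField, pressureField, hx]
  have dD := ((hf.isDistribution h).comp_grad.add ((hq.isDistribution h).const_mul 2).comp_grad).add
    ((hh.isDistribution h).const_mul 2).comp_dt
  refine ⟨_, dD, fun ϕ hϕ φ => ⟨fun ε hε => h.mollifiedDefectDefined hgu hω hper
    (hϕ.isUnitKernel.dilate hε).toIsKernel φ, ?_⟩, fun φ => (hh.pairing h hω ph eh φ).1,
    fun ψ => (hf.pairing h hω pf ef ψ).1, hh.isDistribution_pairing h hω ph eh,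
    hf.isDistribution_pairing h hω pf ef, ⟨_, h.isPressure hM hgu⟩, fun p hp =>
      ⟨fun ψ => (hq.pairing h hω (pq p hp) (eq p hp) ψ).1,
        hq.isDistribution_pairing h hω (pq p hp) (eq p hp), ?_⟩⟩
  · rw [← h.integral_fluxBracket_id]
    simp only [IsRegular.mollifiedDefect_eq hgu hω]
    exact h.tendsto_integral_defect hM hϕ φ
  · ext φ
    have e1 := (hh.pairing h hω ph eh (dt φ)).2
    have e2 := (hf.pairing h hω pf ef (grad φ)).2
    have e3 := (hq.pairing h hω (pq p hp) (eq p hp) (grad φ)).2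
    simp only [Pi.add_apply, Pi.smul_apply, smul_eq_mul, distDt, distDiv, helicityDensity,
      helicityFlux, pressureVorticity, e1, e2, e3, Pi.zero_apply]
    ring
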